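/- **Proposition 3.5 (Linear coercivity estimates).** Radial profiles are functions $v:(0,\infty)\to\mathbb C$, and $\|v\|_{L^2}^2=2\pi\int_0^\infty|v|^2\,r\,dr$. Put $\langle x\rangle=(1+x^2)^{1/2}$, $\log_+r=\max\{0,\log r\}$, $\log_-r=\max\{0,-\log r\}$ and $|v|_{-1}=\max\{|\partial_rv|,|r^{-1}v|\}$. Let $$Q(r)=\frac{\sqrt8}{1+r^2},\qquad \Lambda Q=Q+r\partial_rQ,\qquad A_\theta[Q](r)=-\tfrac12\int_0^rQ^2\,r'dr',$$ $$L_Qv=\partial_rv-\tfrac1rA_\theta[Q]v+\tfrac{Q}{r}\int_0^r\mathrm{Re}(Qv)\,r'dr',\qquad A_Qv=\partial_rv-\tfrac1r(1+A_\theta[Q])v,$$ and let $A_Q^*v=-\partial_rv-\tfrac1r(2+A_\theta[Q])v$ be the formal $L^2$-adjoint of $A_Q$. Let $\mathcal S_m$ be the space of profiles $g$ of $m$-equivariant Schwartz functions $g(r)e^{im\theta}$ on $\mathbb R^2$, and define $\dot{\mathcal H}^1_0,\dot{\mathcal H}^1_2,\dot{\mathcal H}^2_1,\dot{\mathcal H}^3_0$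 as the completions of $\mathcal S_0,\mathcal S_2,\mathcal S_1,\mathcal S_0$, respectively, under the norms $$\|v\|_{\dot{\mathcal H}^1_0}=\|\partial_rv\|_{L^2}+\|r^{-1}\langle\log_-r\rangle^{-1}v\|_{L^2},\qquad \|v\|_{\dot{\mathcal H}^1_2}=\|\partial_rv\|_{L^2}+\|r^{-1}\langle\log_+r\rangle^{-1}v\|_{L^2},$$ $$\|v\|_{\dot{\mathcal H}^2_1}=\|\partial_{rr}v\|_{L^2}+\|r^{-1}\langle\log r\rangle^{-1}|v|_{-1}\|_{L^2},$$ $$\|v\|_{\dot{\mathcal H}^3_0}=\|\partial_{rrr}v\|_{L^2}+\|r^{-1}\langle\log r\rangle^{-1}|\partial_rv|_{-1}\|_{L^2}+\|r^{-1}\langle r\rangle^{-2}\langle\log r\rangle^{-1}v\|_{L^2}.$$ All these norms are finite on the respective $\mathcal S_m$. Duals are spaces of continuous real-linear functionals, and $(\psi,v)_r$ is the value of $\psi$ at $v$. The operators below, given on $\mathcal S_m$ by the formulas above, extend to bounded real-linear operators $$L_Q:\dot{\mathcal H}^1_0\to L^2,\qquad L_Q:\dot{\mathcal H}^3_0\to\dot{\mathcal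 H}^2_1,\qquad A_Q:\dot{\mathcal H}^2_1\to\dot{\mathcal H}^1_2,\qquad A_Q^*:\dot{\mathcal H}^1_2\to L^2,$$ the functions $\Lambda Q,iQ$ belong to $\dot{\mathcal H}^1_0$ and $\dot{\mathcal H}^3_0$, the functions $rQ,irQ$ belong to $\dot{\mathcal H}^2_1$, and the following hold. 1. There is $C>0$ with $\|L_Qv\|_{L^2}\le C\|v\|_{\dot{\mathcal H}^1_0}$ for all $v\in\dot{\mathcal H}^1_0$. If $\psi_1,\psi_2\in(\dot{\mathcal H}^1_0)^*$ and the $2\times2$ matrix $(a_{ij})$ with $a_{i1}=(\psi_i,\Lambda Q)_r$, $a_{i2}=(\psi_i,iQ)_r$ has nonzero determinant, then there is $C'=C'(\psi_1,\psi_2)>0$ with $\|v\|_{\dot{\mathcal H}^1_0}\le C'\|L_Qv\|_{L^2}$ for all $v\in\dot{\mathcal H}^1_0$ with $(\psi_1,v)_r=(\psi_2,v)_r=0$. 2. There is $C>0$ with $\|L_Qv\|_{\dot{\mathcal H}^2_1}\le C\|v\|_{\dot{\mathcal H}^3_0}$ for all $v\in\dot{\mathcal H}^3_0$. If $\psi_1,\psi_2\in(\dot{\mathcal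 H}^3_0)^*$ and the matrix with $a_{i1}=(\psi_i,\Lambda Q)_r$, $a_{i2}=(\psi_i,iQ)_r$ has nonzero determinant, then there is $C'=C'(\psi_1,\psi_2)>0$ with $\|v\|_{\dot{\mathcal H}^3_0}\le C'\|L_Qv\|_{\dot{\mathcal H}^2_1}$ for all $v\in\dot{\mathcal H}^3_0$ with $(\psi_1,v)_r=(\psi_2,v)_r=0$. 3. There is $C>0$ with $\|A_Qv\|_{\dot{\mathcal H}^1_2}\le C\|v\|_{\dot{\mathcal H}^2_1}$ for all $v\in\dot{\mathcal H}^2_1$. If $\psi_1,\psi_2\in(\dot{\mathcal H}^2_1)^*$ and the matrix with $a_{i1}=(\psi_i,rQ)_r$, $a_{i2}=(\psi_i,irQ)_r$ has nonzero determinant, then there is $C'=C'(\psi_1,\psi_2)>0$ with $\|v\|_{\dot{\mathcal H}^2_1}\le C'\|A_Qv\|_{\dot{\mathcal H}^1_2}$ for all $v\in\dot{\mathcal H}^2_1$ with $(\psi_1,v)_r=(\psi_2,v)_r=0$. 4. There are $c,C>0$ with $c\|v\|_{\dot{\mathcal H}^1_2}\le\|A_Q^*v\|_{L^2}\le C\|v\|_{\dot{\mathcal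 H}^1_2}$ for all $v\in\dot{\mathcal H}^1_2$. -/

import Mathlib

open MeasureTheory Set Complex
open scoped ENNReal SchwartzMap

noncomputable section

namespace CSS

/-- The measure `2π r dr` on `(0, ∞)`: the planar Lebesgue measure read on radial profiles. -/
def radialMeasure : Measure ℝ :=
  (volume.restrict (Ioi 0)).withDensity (fun r => ENNReal.ofReal (2 * Real.pi * r))

/-- `L²(ℝ²)` read on radial profiles, with values in `E`. -/
abbrev L2 (E : Type) [NormedAddCommGroup E] : Type := Lp E 2 radialMeasure

/-- The bracket `⟨x⟩ = (1 + x²)^{1/2}`. -/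
def bracket (x : ℝ) : ℝ := Real.sqrt (1 + x ^ 2)

/-- `log₊ r = max {0, log r}`. -/
def logPlus (r : ℝ) : ℝ := max 0 (Real.log r)

/-- `log₋ r = max {0, - log r}`. -/
def logMinus (r : ℝ) : ℝ := max 0 (-Real.log r)

/-! ### Equivariant Schwartz functions -/

/-- The `m`-equivariant Schwartz functions on `ℝ² = ℂ`: `f (r e^{iθ}) = e^{imθ} f (r)`. -/
def equivSchwartz (m : ℕ) : Submodule ℝ 𝓢(ℂ, ℂ) where
  carrier := {f | ∀ (θ : ℝ) (z : ℂ), f (exp (θ * I) * z) = exp (m * θ * I) * f z}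
  zero_mem' := by intro θ z; simp
  add_mem' := by
    intro f g hf hg θ z
    change f _ + g _ = _ * (f z + g z)
    rw [hf θ z, hg θ z, mul_add]
  smul_mem' := by
    intro c f hf θ z
    change c • f _ = _ * (c • f z)
    rw [hf θ z, mul_smul_comm]

/-- The radial profile `g` of an `m`-equivariant function `f (r e^{iθ}) = g (r) e^{imθ}`. -/
def profile (f : 𝓢(ℂ, ℂ)) (r : ℝ) : ℂ := f (r : ℂ)

theorem profile_contDiff (f : 𝓢(ℂ, ℂ)) (n : ℕ) : ContDiff ℝ n (profile f) :=
  (f.smooth n).comp Complex.ofRealCLM.contDiff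

theorem iteratedDeriv_profile_add (f g : 𝓢(ℂ, ℂ)) (n : ℕ) (r : ℝ) :
    iteratedDeriv n (profile (f + g)) r =
      iteratedDeriv n (profile f) r + iteratedDeriv n (profile g) r := by
  have h : profile (f + g) = profile f + profile g := rfl
  rw [h, iteratedDeriv_add (profile_contDiff f n).contDiffAt (profile_contDiff g n).contDiffAt]

theorem iteratedDeriv_profile_smul (c : ℝ) (f : 𝓢(ℂ, ℂ)) (n : ℕ) (r : ℝ) :
    iteratedDeriv n (profile (c • f)) r = c • iteratedDeriv n (profile f) r := by
  have h : profile (c • f) = c • profile f := rfl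
  rw [h, iteratedDeriv_const_smul (profile_contDiff f n).contDiffAt]

theorem iteratedDeriv_profile_zero (n : ℕ) (r : ℝ) :
    iteratedDeriv n (profile 0) r = 0 := by
  have h := iteratedDeriv_profile_smul 0 0 n r
  simpa using h

/-! ### The adapted spaces

Each adapted norm of a profile `f` is the norm of the tuple of weighted derivatives of `f` whose
`L²` norms it adds up, in the `ℓ¹` product of `L²` spaces. A pair in `ℂ × ℂ` carries the sup norm,
so that `|f|₋₁ = max {|∂ᵣ f|, |r⁻¹ f|}` is the norm of the pair `(∂ᵣ f, r⁻¹ f)`. The completion of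
the equivariant Schwartz functions is realized as the closure, in this Banach space, of their
tuples. A tuple `x` represents `f` when its entries are the weighted classical derivatives of `f`
almost everywhere on `(0, ∞)`. An operator on a completion is the continuous extension of the
operator on equivariant Schwartz functions; it is unique, as their tuples are dense. -/

/-- The weight `r⁻¹ ⟨log₋ r⟩⁻¹`. -/
def weightMinus (r : ℝ) : ℝ := r⁻¹ * (bracket (logMinus r))⁻¹

/-- The weight `r⁻¹ ⟨log₊ r⟩⁻¹`. -/
def weightPlus (r : ℝ) : ℝ := r⁻¹ * (bracket (logPlus r))⁻¹

/-- The weight `r⁻¹ ⟨log r⟩⁻¹`. -/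
def weightLog (r : ℝ) : ℝ := r⁻¹ * (bracket (Real.log r))⁻¹

/-- The weight `r⁻¹ ⟨r⟩⁻² ⟨log r⟩⁻¹`. -/
def weightThree (r : ℝ) : ℝ := r⁻¹ * (bracket r ^ 2)⁻¹ * (bracket (Real.log r))⁻¹

/-- Ambient space of tuples for the norms with two scalar terms. -/
abbrev Ambient1 : Type := WithLp 1 (L2 ℂ × L2 ℂ)

/-- Ambient space of tuples for the second order norm. -/
abbrev Ambient2 : Type := WithLp 1 (L2 ℂ × L2 (ℂ × ℂ))

/-- Ambient space of tuples for the third order norm. -/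
abbrev Ambient3 : Type := WithLp 1 (L2 ℂ × WithLp 1 (L2 (ℂ × ℂ) × L2 ℂ))

/-- `x = (∂ᵣ f, w f)`, for a weight `w`. -/
def Represents1 (w : ℝ → ℝ) (x : Ambient1) (f : ℝ → ℂ) : Prop :=
  (x.fst =ᵐ[radialMeasure] fun r => iteratedDeriv 1 f r) ∧
  (x.snd =ᵐ[radialMeasure] fun r => w r • f r)

/-- `x = (∂ᵣᵣ f, r⁻¹ ⟨log r⟩⁻¹ (∂ᵣ f, r⁻¹ f))`. -/
def Represents2 (x : Ambient2) (f : ℝ → ℂ) : Prop :=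
  (x.fst =ᵐ[radialMeasure] fun r => iteratedDeriv 2 f r) ∧
  (x.snd =ᵐ[radialMeasure] fun r => weightLog r • (iteratedDeriv 1 f r, r⁻¹ • f r))

/-- `x = (∂ᵣᵣᵣ f, r⁻¹ ⟨log r⟩⁻¹ (∂ᵣᵣ f, r⁻¹ ∂ᵣ f), r⁻¹ ⟨r⟩⁻² ⟨log r⟩⁻¹ f)`. -/
def Represents3 (x : Ambient3) (f : ℝ → ℂ) : Prop :=
  (x.fst =ᵐ[radialMeasure] fun r => iteratedDeriv 3 f r) ∧
  (x.snd.fst =ᵐ[radialMeasure]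
    fun r => weightLog r • (iteratedDeriv 2 f r, r⁻¹ • iteratedDeriv 1 f r)) ∧
  (x.snd.snd =ᵐ[radialMeasure] fun r => weightThree r • f r)

/-- The tuples `(∂ᵣ f, w f)` of the `m`-equivariant Schwartz functions. -/
def schwartzTuples1 (m : ℕ) (w : ℝ → ℝ) : Submodule ℝ Ambient1 where
  carrier := {x | ∃ f ∈ equivSchwartz m, Represents1 w x (profile f)}
  zero_mem' := by
    refine ⟨0, Submodule.zero_mem _, ?_, ?_⟩
    · filter_upwards [Lp.coeFn_zero ℂ 2 radialMeasure] with r h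
      rw [iteratedDeriv_profile_zero]
      exact h
    · filter_upwards [Lp.coeFn_zero ℂ 2 radialMeasure] with r h
      have h0 : profile 0 r = 0 := rfl
      rw [h0, smul_zero]
      exact h
  add_mem' := by
    rintro x y ⟨f, hf, hf1, hf2⟩ ⟨g, hg, hg1, hg2⟩
    refine ⟨f + g, Submodule.add_mem _ hf hg, ?_, ?_⟩
    · filter_upwards [Lp.coeFn_add x.fst y.fst, hf1, hg1] with r h h1 h2
      rw [iteratedDeriv_profile_add, ← h1, ← h2]
      exact h
    · filter_upwards [Lp.coeFn_add x.snd y.snd, hf2, hg2] with r h h1 h2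
      have h0 : profile (f + g) r = profile f r + profile g r := rfl
      rw [h0, smul_add, ← h1, ← h2]
      exact h
  smul_mem' := by
    rintro c x ⟨f, hf, hf1, hf2⟩
    refine ⟨c • f, Submodule.smul_mem _ c hf, ?_, ?_⟩
    · filter_upwards [Lp.coeFn_smul c x.fst, hf1] with r h h1
      rw [iteratedDeriv_profile_smul, ← h1]
      exact h
    · filter_upwards [Lp.coeFn_smul c x.snd, hf2] with r h h1
      have h0 : profile (c • f) r = c • profile f r := rfl
      rw [h0, smul_comm, ← h1]
      exact h

/-- The tuples `(∂ᵣᵣ f, r⁻¹ ⟨log r⟩⁻¹ (∂ᵣ f, r⁻¹ f))` of the `m`-equivariant Schwartz functions. -/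
def schwartzTuples2 (m : ℕ) : Submodule ℝ Ambient2 where
  carrier := {x | ∃ f ∈ equivSchwartz m, Represents2 x (profile f)}
  zero_mem' := by
    refine ⟨0, Submodule.zero_mem _, ?_, ?_⟩
    · filter_upwards [Lp.coeFn_zero ℂ 2 radialMeasure] with r h
      rw [iteratedDeriv_profile_zero]
      exact h
    · filter_upwards [Lp.coeFn_zero (ℂ × ℂ) 2 radialMeasure] with r h
      have h0 : profile 0 r = 0 := rfl
      rw [h0, iteratedDeriv_profile_zero, smul_zero, ← Prod.zero_eq_mk, smul_zero]
      exact h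
  add_mem' := by
    rintro x y ⟨f, hf, hf1, hf2⟩ ⟨g, hg, hg1, hg2⟩
    refine ⟨f + g, Submodule.add_mem _ hf hg, ?_, ?_⟩
    · filter_upwards [Lp.coeFn_add x.fst y.fst, hf1, hg1] with r h h1 h2
      rw [iteratedDeriv_profile_add, ← h1, ← h2]
      exact h
    · filter_upwards [Lp.coeFn_add x.snd y.snd, hf2, hg2] with r h h1 h2
      have h0 : profile (f + g) r = profile f r + profile g r := rfl
      rw [h0, iteratedDeriv_profile_add, smul_add, ← Prod.mk_add_mk, smul_add, ← h1, ← h2]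
      exact h
  smul_mem' := by
    rintro c x ⟨f, hf, hf1, hf2⟩
    refine ⟨c • f, Submodule.smul_mem _ c hf, ?_, ?_⟩
    · filter_upwards [Lp.coeFn_smul c x.fst, hf1] with r h h1
      rw [iteratedDeriv_profile_smul, ← h1]
      exact h
    · filter_upwards [Lp.coeFn_smul c x.snd, hf2] with r h h1
      have h0 : profile (c • f) r = c • profile f r := rfl
      rw [h0, iteratedDeriv_profile_smul, smul_comm _ c, ← Prod.smul_mk, smul_comm _ c, ← h1]
      exact h

/-- The tuples of the third order norm of the `m`-equivariant Schwartz functions. -/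
def schwartzTuples3 (m : ℕ) : Submodule ℝ Ambient3 where
  carrier := {x | ∃ f ∈ equivSchwartz m, Represents3 x (profile f)}
  zero_mem' := by
    refine ⟨0, Submodule.zero_mem _, ?_, ?_, ?_⟩
    · filter_upwards [Lp.coeFn_zero ℂ 2 radialMeasure] with r h
      rw [iteratedDeriv_profile_zero]
      exact h
    · filter_upwards [Lp.coeFn_zero (ℂ × ℂ) 2 radialMeasure] with r h
      rw [iteratedDeriv_profile_zero, iteratedDeriv_profile_zero, smul_zero, ← Prod.zero_eq_mk,
        smul_zero]
      exact h
    · filter_upwards [Lp.coeFn_zero ℂ 2 radialMeasure] with r h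
      have h0 : profile 0 r = 0 := rfl
      rw [h0, smul_zero]
      exact h
  add_mem' := by
    rintro x y ⟨f, hf, hf1, hf2, hf3⟩ ⟨g, hg, hg1, hg2, hg3⟩
    refine ⟨f + g, Submodule.add_mem _ hf hg, ?_, ?_, ?_⟩
    · filter_upwards [Lp.coeFn_add x.fst y.fst, hf1, hg1] with r h h1 h2
      rw [iteratedDeriv_profile_add, ← h1, ← h2]
      exact h
    · filter_upwards [Lp.coeFn_add x.snd.fst y.snd.fst, hf2, hg2] with r h h1 h2
      rw [iteratedDeriv_profile_add, iteratedDeriv_profile_add, smul_add, ← Prod.mk_add_mk,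
        smul_add, ← h1, ← h2]
      exact h
    · filter_upwards [Lp.coeFn_add x.snd.snd y.snd.snd, hf3, hg3] with r h h1 h2
      have h0 : profile (f + g) r = profile f r + profile g r := rfl
      rw [h0, smul_add, ← h1, ← h2]
      exact h
  smul_mem' := by
    rintro c x ⟨f, hf, hf1, hf2, hf3⟩
    refine ⟨c • f, Submodule.smul_mem _ c hf, ?_, ?_, ?_⟩
    · filter_upwards [Lp.coeFn_smul c x.fst, hf1] with r h h1
      rw [iteratedDeriv_profile_smul, ← h1]
      exact h
    · filter_upwards [Lp.coeFn_smul c x.snd.fst, hf2] with r h h1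
      rw [iteratedDeriv_profile_smul, iteratedDeriv_profile_smul, smul_comm _ c, ← Prod.smul_mk,
        smul_comm _ c, ← h1]
      exact h
    · filter_upwards [Lp.coeFn_smul c x.snd.snd, hf3] with r h h1
      have h0 : profile (c • f) r = c • profile f r := rfl
      rw [h0, smul_comm, ← h1]
      exact h

/-- First order, equivariance index `0`: the completion of the `0`-equivariant Schwartz functions
for `‖∂ᵣ v‖ + ‖r⁻¹ ⟨log₋ r⟩⁻¹ v‖` (all norms in `L²`). -/
def adaptedH1_0 : Submodule ℝ Ambient1 := (schwartzTuples1 0 weightMinus).topologicalClosure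

/-- First order, equivariance index `2`: the completion of the `2`-equivariant Schwartz functions
for `‖∂ᵣ v‖ + ‖r⁻¹ ⟨log₊ r⟩⁻¹ v‖`. -/
def adaptedH1_2 : Submodule ℝ Ambient1 := (schwartzTuples1 2 weightPlus).topologicalClosure

/-- Second order, equivariance index `1`: the completion of the `1`-equivariant Schwartz functions
for `‖∂ᵣᵣ v‖ + ‖r⁻¹ ⟨log r⟩⁻¹ |v|₋₁‖`. -/
def adaptedH2_1 : Submodule ℝ Ambient2 := (schwartzTuples2 1).topologicalClosure

/-- Third order, equivariance index `0`: the completion of the `0`-equivariant Schwartz functions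
for `‖∂ᵣᵣᵣ v‖ + ‖r⁻¹ ⟨log r⟩⁻¹ |∂ᵣ v|₋₁‖ + ‖r⁻¹ ⟨r⟩⁻² ⟨log r⟩⁻¹ v‖`. -/
def adaptedH3_0 : Submodule ℝ Ambient3 := (schwartzTuples3 0).topologicalClosure

/-! ### The soliton and the linearized operators on smooth profiles -/

/-- The soliton `Q (r) = √8 / (1 + r²)`. -/
def Q (r : ℝ) : ℂ := ((Real.sqrt 8 / (1 + r ^ 2) : ℝ) : ℂ)

/-- `ΛQ = Q + r ∂ᵣ Q`. -/
def LambdaQ (r : ℝ) : ℂ := Q r + r * deriv Q r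

/-- `A_θ[w] (r) = -½ ∫₀ʳ |w|² r' dr'`. -/
def Atheta (w : ℝ → ℂ) (r : ℝ) : ℝ := -(1 / 2) * ∫ s in (0 : ℝ)..r, ‖w s‖ ^ 2 * s

/-- `L_w v = ∂ᵣ v - r⁻¹ A_θ[w] v + r⁻¹ w ∫₀ʳ Re (w̄ v) r' dr'`. -/
def opL (w v : ℝ → ℂ) (r : ℝ) : ℂ :=
  deriv v r - ((Atheta w r / r : ℝ) : ℂ) * v r
    + w r / r * ((∫ s in (0 : ℝ)..r, ((starRingEnd ℂ) (w s) * v s).re * s : ℝ) : ℂ)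

/-- `A_w v = ∂ᵣ v - r⁻¹ (1 + A_θ[w]) v`. -/
def opA (w v : ℝ → ℂ) (r : ℝ) : ℂ :=
  deriv v r - (((1 + Atheta w r) / r : ℝ) : ℂ) * v r

/-- The formal adjoint of `A_w` for `∫ Re (f̄ g) r dr`. As `∂ᵣ` has the adjoint `-∂ᵣ - r⁻¹`, it is
`A_w^* v = -∂ᵣ v - r⁻¹ (2 + A_θ[w]) v`. -/
def opAstar (w v : ℝ → ℂ) (r : ℝ) : ℂ :=
  -deriv v r - (((2 + Atheta w r) / r : ℝ) : ℂ) * v r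

end CSS

end

/-!
With `a = 2 r / (1 + r²)` and `Y (r) = ∫₀ʳ Re (Q f) s ds` the operators are explicit:
`L_Q f = f' + a f + r⁻¹ Q Y`, `A_Q f = f' - f / r + a f` and `A_Q^* f = -f' - 2 f / (r (1 + r²))`.
Their radial kernels are spanned by `ΛQ, iQ`, by `rQ, irQ` and by no function vanishing at the
origin, respectively. All four estimates are proved for smooth profiles and then extended by
density.

**Coercivity modulo the kernel.** A multiple of each kernel element is added to a profile so that
it is normalized at `r = 1`: `Y 1 = 0` and `Im f 1 = 0` for `L_Q`, `f 1 = 0` for `A_Q`. For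
normalized profiles the estimate needs no orthogonality condition. The tool is an energy inequality
(`massLE_energy_Ioi`, `massLE_energy_Ioc`): from `g' = F - V g`, a weight `φ` that decreases (or
increases) along the drift turns `(φ |g|²)'` into a weighted bound of `|g|²` by `|F|²`. Weights with
a logarithm in them give the logarithmic Hardy inequalities at `0` and `∞`; the normalization at
`r = 1` supplies the boundary values, so that no condition at the degenerate end is needed.

* `massLE_of_astar`: `f` vanishes at `0`, and a single weight works on the whole half line.
* `massLE_of_linL`: `Re (L_Q f) = F` is a second order equation for `Y` with the solution
  `r² / (1 + r²)²` coming from `ΛQ`. The Wronskian `wronskianQ` with this solution has a derivative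
  involving only `F`, which bounds `Y` pointwise. The nonlocal term is then a source term, and
  what is left is the local equation `f' + a f = F - r⁻¹ Q Y`.
* `massLE_of_opA`: the logarithmic Hardy inequality bounds `f`, and the second derivative is
  recovered from the equation of `p = f' - f / r`.
* `massLE_of_linL₃`: the lowest order term `L_Q f / r` of the second order norm bounds `f` as for
  the first order space. The nonlocal term is bounded in the second order space
  (`IsProfile.massLE_nonloc`), and `f'''` is recovered from `(f' + a f)''` through the equation of
  `(f / r)''`, because `a = 2 / r + O(r⁻³)` at infinity (`massLE_of_locL`).

The abstract lemma `coercive_of_mod_span` turns a bound modulo the plane spanned by `e₁, e₂` into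
coercivity on the common kernel of two functionals that separate `e₁` from `e₂`.

**Membership.** The functions `ΛQ, iQ, rQ, irQ` and the images of Schwartz functions only decay
algebraically, because the nonlocal term has an algebraic tail. A smooth equivariant function whose
`k`-th derivative is `O(r^{-k-1})` is a limit of cut-off functions in the adapted norms
(`exists_mem_minus`, `exists_mem_plus`, `exists_mem_two`, `exists_mem_three`). The images are smooth
and equivariant on the plane: `∂₁ + i ∂₂` raises the equivariance index by one and equals
`∂ᵣ - m / r` on profiles, and `r⁻² Y` is a ray average of a smooth function.
-/

noncomputable section

namespace CSS

open Filter Topology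

/-! ### Densities of bounded mass -/

/-- The density `e`, with its negative part cut off, has mass at most `M` on `s`. The lower
Lebesgue integral makes this meaningful without any integrability assumption. -/
def MassLE (s : Set ℝ) (e : ℝ → ℝ) (M : ℝ) : Prop :=
  ∫⁻ r in s, ENNReal.ofReal (e r) ≤ ENNReal.ofReal M

theorem MassLE.mono_set {s t : Set ℝ} {e : ℝ → ℝ} {M : ℝ} (h : MassLE t e M) (hst : s ⊆ t) :
    MassLE s e M :=
  (lintegral_mono_set hst).trans h

theorem MassLE.mono_right {s : Set ℝ} {e : ℝ → ℝ} {M M' : ℝ} (h : MassLE s e M) (hM : M ≤ M') :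
    MassLE s e M' :=
  le_trans h (ENNReal.ofReal_le_ofReal hM)

theorem MassLE.union {s t : Set ℝ} {e : ℝ → ℝ} {M M' : ℝ} (hM : 0 ≤ M) (hM' : 0 ≤ M')
    (h : MassLE s e M) (h' : MassLE t e M') : MassLE (s ∪ t) e (M + M') := by
  unfold MassLE at *
  rw [ENNReal.ofReal_add hM hM']
  exact (lintegral_union_le _ _ _).trans (add_le_add h h')

theorem MassLE.dom1 {s : Set ℝ} (hs : MeasurableSet s) {e e₁ : ℝ → ℝ} {c₁ M₁ : ℝ} (hc₁ : 0 ≤ c₁)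
    (h : ∀ r ∈ s, e r ≤ c₁ * e₁ r) (h₁ : MassLE s e₁ M₁) : MassLE s e (c₁ * M₁) := by
  unfold MassLE at *
  calc ∫⁻ r in s, ENNReal.ofReal (e r)
      ≤ ∫⁻ r in s, ENNReal.ofReal c₁ * ENNReal.ofReal (e₁ r) := by
        refine setLIntegral_mono' hs fun r hr => ?_
        rw [← ENNReal.ofReal_mul hc₁]
        exact ENNReal.ofReal_le_ofReal (h r hr)
    _ = ENNReal.ofReal c₁ * ∫⁻ r in s, ENNReal.ofReal (e₁ r) :=
        lintegral_const_mul' _ _ ENNReal.ofReal_ne_top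
    _ ≤ ENNReal.ofReal c₁ * ENNReal.ofReal M₁ := by gcongr
    _ = _ := by rw [← ENNReal.ofReal_mul hc₁]

theorem MassLE.add {s : Set ℝ} {e₁ e₂ : ℝ → ℝ} {M₁ M₂ : ℝ} (m : Measurable e₁) (hM₁ : 0 ≤ M₁)
    (hM₂ : 0 ≤ M₂) (h₁ : MassLE s e₁ M₁) (h₂ : MassLE s e₂ M₂) :
    MassLE s (fun r => e₁ r + e₂ r) (M₁ + M₂) := by
  unfold MassLE at *
  rw [ENNReal.ofReal_add hM₁ hM₂]
  calc ∫⁻ r in s, ENNReal.ofReal (e₁ r + e₂ r)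
      ≤ ∫⁻ r in s, (ENNReal.ofReal (e₁ r) + ENNReal.ofReal (e₂ r)) :=
        lintegral_mono fun r => ENNReal.ofReal_add_le
    _ = _ := lintegral_add_left (by fun_prop) _
    _ ≤ _ := add_le_add h₁ h₂

theorem MassLE.dom2 {s : Set ℝ} (hs : MeasurableSet s) {e e₁ e₂ : ℝ → ℝ} {c₁ c₂ M₁ M₂ : ℝ}
    (m₁ : Measurable e₁) (hc₁ : 0 ≤ c₁) (hc₂ : 0 ≤ c₂) (hM₁ : 0 ≤ M₁) (hM₂ : 0 ≤ M₂)
    (h : ∀ r ∈ s, e r ≤ c₁ * e₁ r + c₂ * e₂ r) (h₁ : MassLE s e₁ M₁) (h₂ : MassLE s e₂ M₂) :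
    MassLE s e (c₁ * M₁ + c₂ * M₂) := by
  have h3 := MassLE.add (m₁.const_mul c₁) (mul_nonneg hc₁ hM₁) (mul_nonneg hc₂ hM₂)
    (MassLE.dom1 hs hc₁ (fun _ _ => le_rfl) h₁) (MassLE.dom1 hs hc₂ (fun _ _ => le_rfl) h₂)
  simpa using MassLE.dom1 hs zero_le_one (fun r hr => by simpa using h r hr) h3

theorem MassLE.dom3 {s : Set ℝ} (hs : MeasurableSet s) {e e₁ e₂ e₃ : ℝ → ℝ}
    {c₁ c₂ c₃ M₁ M₂ M₃ : ℝ} (m₁ : Measurable e₁) (m₂ : Measurable e₂)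
    (hc₁ : 0 ≤ c₁) (hc₂ : 0 ≤ c₂) (hc₃ : 0 ≤ c₃) (hM₁ : 0 ≤ M₁) (hM₂ : 0 ≤ M₂) (hM₃ : 0 ≤ M₃)
    (h : ∀ r ∈ s, e r ≤ c₁ * e₁ r + c₂ * e₂ r + c₃ * e₃ r)
    (h₁ : MassLE s e₁ M₁) (h₂ : MassLE s e₂ M₂) (h₃ : MassLE s e₃ M₃) :
    MassLE s e (c₁ * M₁ + c₂ * M₂ + c₃ * M₃) := by
  have h4 := MassLE.dom2 hs m₁ hc₁ hc₂ hM₁ hM₂ (fun _ _ => le_rfl) h₁ h₂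
  have h5 := MassLE.dom2 (e := e) (c₁ := 1) hs ((m₁.const_mul c₁).add (m₂.const_mul c₂)) zero_le_one
    hc₃ (by positivity) hM₃ (fun r hr => by simpa using h r hr) h4 h₃
  simpa using h5

/-- Glues mass bounds on `(0, 1]` and `(1, ∞)`. -/
theorem MassLE.glue {e : ℝ → ℝ} {M M' : ℝ} (hM : 0 ≤ M) (hM' : 0 ≤ M')
    (h : MassLE (Ioc 0 1) e M) (h' : MassLE (Ioi 1) e M') : MassLE (Ioi 0) e (M + M') := by
  have := MassLE.union hM hM' h h'
  rwa [Ioc_union_Ioi_eq_Ioi zero_le_one] at this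

theorem MassLE.integral_le {s : Set ℝ} (hs : MeasurableSet s) {e : ℝ → ℝ} {M : ℝ} (hM : 0 ≤ M)
    (he : ∀ r ∈ s, 0 ≤ e r) (h : MassLE s e M) : ∫ r in s, e r ≤ M := by
  by_cases hi : AEStronglyMeasurable e (volume.restrict s)
  · rw [integral_eq_lintegral_of_nonneg_ae ((ae_restrict_mem hs).mono he) hi]
    exact (ENNReal.toReal_mono ENNReal.ofReal_ne_top h).trans (ENNReal.toReal_ofReal hM).le
  · rw [integral_non_aestronglyMeasurable hi]; exact hM

theorem massLE_of_integral_le {s : Set ℝ} (hs : MeasurableSet s) {e : ℝ → ℝ} {M : ℝ}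
    (he : ∀ r ∈ s, 0 ≤ e r) (hi : IntegrableOn e s) (h : ∫ r in s, e r ≤ M) : MassLE s e M := by
  unfold MassLE
  rw [← ofReal_integral_eq_lintegral_ofReal hi ((ae_restrict_mem hs).mono he)]
  exact ENNReal.ofReal_le_ofReal h

/-- An exhaustion of `(α, ∞)` by compact intervals computes masses. -/
theorem massLE_Ioi_of_forall {α : ℝ} {e : ℝ → ℝ} {M : ℝ} {K : ℝ → ℝ}
    (h : ∀ a b, α < a → a < b → MassLE (Ioc a b) e (K a + M))
    (hK : Tendsto K (𝓝[>] α) (𝓝 0)) : MassLE (Ioi α) e M := by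
  have hlim : Tendsto (fun n : ℕ => α + 1 / ((n : ℝ) + 1)) atTop (𝓝 α) := by
    simpa using (tendsto_const_nhds (x := α)).add tendsto_one_div_add_atTop_nhds_zero_nat
  have hpos : ∀ n : ℕ, α < α + 1 / ((n : ℝ) + 1) := fun n => by
    linarith [show (0 : ℝ) < 1 / ((n : ℝ) + 1) by positivity]
  have hc := (aecover_Ioi_of_Ioi (μ := volume) hlim).inter
    (aecover_Iic (μ := volume.restrict (Ioi α)) (b := fun n : ℕ => α + 2 + (n : ℝ))
      (tendsto_atTop_add_const_left _ _ tendsto_natCast_atTop_atTop))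
  -- the lower integral is attained by a measurable minorant, so `e` need not be measurable
  obtain ⟨g, hg, hge, hgi⟩ := exists_measurable_le_lintegral_eq (volume.restrict (Ioi α))
    (fun r => ENNReal.ofReal (e r))
  unfold MassLE
  rw [hgi]
  have ht := hc.lintegral_tendsto_of_nat hg.aemeasurable
  have hK' : Tendsto (fun n : ℕ => ENNReal.ofReal (K (α + 1 / ((n : ℝ) + 1)) + M)) atTop
      (𝓝 (ENNReal.ofReal (0 + M))) := by
    refine (ENNReal.continuous_ofReal.tendsto _).comp ((hK.comp ?_).add_const M)
    exact tendsto_nhdsWithin_iff.2 ⟨hlim, Eventually.of_forall hpos⟩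
  rw [zero_add] at hK'
  refine le_of_tendsto_of_tendsto ht hK' (Eventually.of_forall fun n => ?_)
  have h2 : α + 1 / ((n : ℝ) + 1) < α + 2 + n := by
    have : 1 / ((n : ℝ) + 1) ≤ 1 := by
      rw [div_le_one (by positivity)]; linarith [n.cast_nonneg (α := ℝ)]
    linarith [n.cast_nonneg (α := ℝ)]
  refine le_trans ?_ (h _ _ (hpos n) h2)
  simp only
  rw [Measure.restrict_restrict (measurableSet_Ioi.inter measurableSet_Iic), Ioi_inter_Iic,
    inter_eq_left.2 (show Ioc (α + 1 / ((n : ℝ) + 1)) (α + 2 + n) ⊆ Ioi α from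
      fun x hx => (hpos n).trans hx.1)]
  exact lintegral_mono hge

theorem massLE_Ioc_of_forall {β : ℝ} {e : ℝ → ℝ} {M : ℝ}
    (h : ∀ a, 0 < a → a < β → MassLE (Ioc a β) e M) : MassLE (Ioc 0 β) e M := by
  have h1 : MassLE (Ioi 0) ((Ioc 0 β).indicator e) M := by
    refine massLE_Ioi_of_forall (K := fun _ => 0) (fun a b ha hab => ?_) tendsto_const_nhds
    have h0 : ∀ r, ENNReal.ofReal ((Ioc 0 β).indicator e r)
        = (Ioc 0 β).indicator (fun r => ENNReal.ofReal (e r)) r := fun r => by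
      by_cases hr : r ∈ Ioc 0 β <;> simp [hr]
    unfold MassLE
    simp_rw [h0]
    rw [setLIntegral_indicator measurableSet_Ioc, zero_add]
    rcases lt_or_ge a β with hl | hl
    · refine (lintegral_mono_set ?_).trans (h a ha hl)
      exact fun x hx => ⟨hx.2.1, hx.1.2⟩
    · have : Ioc 0 β ∩ Ioc a b = ∅ := by
        ext x; simp only [mem_inter_iff, mem_Ioc, mem_empty_iff_false, iff_false]
        rintro ⟨⟨_, h1⟩, h2, _⟩; linarith
      simp [this]
  unfold MassLE at *
  refine le_trans (le_of_eq ?_) h1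
  have h0 : ∀ r, ENNReal.ofReal ((Ioc 0 β).indicator e r)
      = (Ioc 0 β).indicator (fun r => ENNReal.ofReal (e r)) r := fun r => by
    by_cases hr : r ∈ Ioc 0 β <;> simp [hr]
  simp_rw [h0]
  rw [setLIntegral_indicator measurableSet_Ioc, inter_eq_left.2 Ioc_subset_Ioi_self]

/-! ### The energy method -/

/-- The fundamental theorem of calculus for the differential inequality `e ≤ -P' + d`. -/
theorem massLE_Ioc_of_deriv_le {P P' e d : ℝ → ℝ} {a b M : ℝ} (hab : a < b) (hM : 0 ≤ M)
    (hP : ∀ r ∈ Icc a b, HasDerivAt P (P' r) r) (he : ContinuousOn e (Icc a b))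
    (hd : ContinuousOn d (Icc a b)) (he0 : ∀ r ∈ Icc a b, 0 ≤ e r) (hd0 : ∀ r ∈ Icc a b, 0 ≤ d r)
    (h : ∀ r ∈ Icc a b, e r ≤ -P' r + d r) (hdM : MassLE (Ioc a b) d M) :
    MassLE (Ioc a b) e (P a - P b + M) := by
  have hei : IntegrableOn e (Icc a b) := he.integrableOn_Icc
  have hdi : IntegrableOn d (Icc a b) := hd.integrableOn_Icc
  have h1 := intervalIntegral.integral_le_sub_of_hasDeriv_right_of_le (g := fun r => -P r)
    (g' := fun r => -P' r) (φ := fun r => e r - d r) hab.le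
    (fun r hr => (hP r hr).continuousAt.continuousWithinAt.neg)
    (fun r hr => (hP r (Ioo_subset_Icc_self hr)).neg.hasDerivWithinAt) (hei.sub hdi)
    (fun r hr => by linarith [h r (Ioo_subset_Icc_self hr)])
  have hei' : IntegrableOn e (Ioc a b) := hei.mono_set Ioc_subset_Icc_self
  have hdi' : IntegrableOn d (Ioc a b) := hdi.mono_set Ioc_subset_Icc_self
  rw [intervalIntegral.integral_of_le hab.le, integral_sub hei' hdi'] at h1
  have h2 := hdM.integral_le measurableSet_Ioc hM (fun r hr => hd0 r (Ioc_subset_Icc_self hr))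
  exact massLE_of_integral_le measurableSet_Ioc (fun r hr => he0 r (Ioc_subset_Icc_self hr)) hei'
    (by linarith)

variable {E : Type} [NormedAddCommGroup E] [InnerProductSpace ℝ E]

/-- The pointwise form of the energy estimate: the derivative of `φ |g|²` along `g' = F - V g`. -/
theorem hasDerivAt_weighted_norm_sq {φ : ℝ → ℝ} {φ' V r : ℝ} {g : ℝ → E} {F : E}
    (hφ : HasDerivAt φ φ' r) (hg : HasDerivAt g (F - V • g r) r) :
    HasDerivAt (fun r => φ r * ‖g r‖ ^ 2)
      ((φ' - 2 * φ r * V) * ‖g r‖ ^ 2 + 2 * φ r * inner ℝ (g r) F) r := by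
  refine (hφ.mul hg.norm_sq).congr_deriv ?_
  rw [inner_sub_right, inner_smul_right, real_inner_self_eq_norm_sq]
  ring

theorem two_mul_inner_le {φ κ ω : ℝ} (x y : E) (hκ : 0 ≤ κ) (hω : 0 ≤ ω) (h : φ ^ 2 ≤ κ * ω) :
    |2 * φ * inner ℝ x y| ≤ κ / 2 * ‖x‖ ^ 2 + 2 * ω * ‖y‖ ^ 2 := by
  refine abs_le_of_sq_le_sq ?_ (by positivity)
  have h1 : (inner ℝ x y) ^ 2 ≤ ‖x‖ ^ 2 * ‖y‖ ^ 2 := by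
    rw [← mul_pow]; exact sq_le_sq' (by linarith [neg_abs_le (inner ℝ x y), abs_real_inner_le_norm x y])
      (real_inner_le_norm x y)
  calc (2 * φ * inner ℝ x y) ^ 2 = 4 * (φ ^ 2 * inner ℝ x y ^ 2) := by ring
    _ ≤ 4 * ((κ * ω) * (‖x‖ ^ 2 * ‖y‖ ^ 2)) := by gcongr
    _ ≤ _ := by nlinarith [sq_nonneg (κ / 2 * ‖x‖ ^ 2 - 2 * ω * ‖y‖ ^ 2)]

/-- The energy estimate from the left end point: if `g' = F - V g` and the weight `φ ≥ 0` decreases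
along the drift, `φ' - 2 φ V ≤ -κ + ε`, then `∫ κ |g|²` is controlled by the boundary value
of `φ |g|²` and by `∫ ω |F|²`, where `φ² ≤ κ ω`. No decay of `g` at infinity is needed. -/
theorem massLE_energy_Ioi {α : ℝ} {φ φ' V κ ω ε : ℝ → ℝ} {g F : ℝ → E} {P₀ M M' : ℝ}
    (hg : ∀ r, α < r → HasDerivAt g (F r - V r • g r) r)
    (hφ : ∀ r, α < r → HasDerivAt φ (φ' r) r)
    (hF : ContinuousOn F (Ioi α)) (hκc : ContinuousOn κ (Ioi α)) (hωc : ContinuousOn ω (Ioi α))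
    (hεc : ContinuousOn ε (Ioi α))
    (hφ0 : ∀ r, α < r → 0 ≤ φ r) (hκ0 : ∀ r, α < r → 0 ≤ κ r) (hω0 : ∀ r, α < r → 0 ≤ ω r)
    (hε0 : ∀ r, α < r → 0 ≤ ε r)
    (hdrift : ∀ r, α < r → φ' r - 2 * φ r * V r ≤ -κ r + ε r)
    (hφω : ∀ r, α < r → φ r ^ 2 ≤ κ r * ω r)
    (hP : Tendsto (fun r => φ r * ‖g r‖ ^ 2) (𝓝[>] α) (𝓝 P₀))
    (hM : 0 ≤ M) (hM' : 0 ≤ M')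
    (h1 : MassLE (Ioi α) (fun r => ω r * ‖F r‖ ^ 2) M)
    (h2 : MassLE (Ioi α) (fun r => ε r * ‖g r‖ ^ 2) M') :
    MassLE (Ioi α) (fun r => κ r * ‖g r‖ ^ 2) (2 * P₀ + 4 * M + 2 * M') := by
  have hgc : ContinuousOn g (Ioi α) := fun r hr => (hg r hr).continuousAt.continuousWithinAt
  refine massLE_Ioi_of_forall (K := fun a => 2 * (φ a * ‖g a‖ ^ 2) - 2 * P₀) (fun a b ha hab => ?_)
    (by simpa using (hP.const_mul 2).sub_const (2 * P₀))
  have hsub : Icc a b ⊆ Ioi α := fun r hr => ha.trans_le hr.1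
  have hcont : ContinuousOn (fun r => κ r / 2 * ‖g r‖ ^ 2) (Icc a b) :=
    ((hκc.div_const 2).mul (hgc.norm.pow 2)).mono hsub
  have hcont' : ContinuousOn (fun r => 2 * (ω r * ‖F r‖ ^ 2) + ε r * ‖g r‖ ^ 2) (Icc a b) :=
    (((hωc.mul (hF.norm.pow 2)).const_smul (2 : ℝ)).add (hεc.mul (hgc.norm.pow 2))).mono hsub
  have hω1 := h1.mono_set (Ioc_subset_Icc_self.trans hsub)
  have hε1 := h2.mono_set (Ioc_subset_Icc_self.trans hsub)
  have hd : MassLE (Ioc a b) (fun r => 2 * (ω r * ‖F r‖ ^ 2) + ε r * ‖g r‖ ^ 2) (2 * M + M') := by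
    refine massLE_of_integral_le measurableSet_Ioc (fun r hr => ?_)
      (hcont'.integrableOn_Icc.mono_set Ioc_subset_Icc_self) ?_
    · have hr' := hsub (Ioc_subset_Icc_self hr)
      have := hω0 r hr'; have := hε0 r hr'; positivity
    · have i1 : IntegrableOn (fun r => ω r * ‖F r‖ ^ 2) (Ioc a b) :=
        ((hωc.mul (hF.norm.pow 2)).mono hsub).integrableOn_Icc.mono_set Ioc_subset_Icc_self
      have i2 : IntegrableOn (fun r => ε r * ‖g r‖ ^ 2) (Ioc a b) :=
        ((hεc.mul (hgc.norm.pow 2)).mono hsub).integrableOn_Icc.mono_set Ioc_subset_Icc_self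
      rw [integral_add (i1.const_mul 2) i2, integral_const_mul]
      have j1 := hω1.integral_le measurableSet_Ioc hM fun r hr => by
        have := hω0 r (hsub (Ioc_subset_Icc_self hr)); positivity
      have j2 := hε1.integral_le measurableSet_Ioc hM' fun r hr => by
        have := hε0 r (hsub (Ioc_subset_Icc_self hr)); positivity
      linarith
  have key := massLE_Ioc_of_deriv_le (P := fun r => φ r * ‖g r‖ ^ 2) hab (by positivity)
    (fun r hr => hasDerivAt_weighted_norm_sq (hφ r (hsub hr)) (hg r (hsub hr))) hcont hcont'
    (fun r hr => by have := hκ0 r (hsub hr); positivity)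
    (fun r hr => by have := hω0 r (hsub hr); have := hε0 r (hsub hr); positivity)
    (fun r hr => by
      have hr' := hsub hr
      have k1 := neg_le_of_abs_le (two_mul_inner_le (g r) (F r) (hκ0 r hr') (hω0 r hr') (hφω r hr'))
      have k1' := le_of_abs_le (two_mul_inner_le (g r) (F r) (hκ0 r hr') (hω0 r hr') (hφω r hr'))
      have k2 := mul_le_mul_of_nonneg_right (hdrift r hr') (sq_nonneg ‖g r‖)
      nlinarith) hd
  refine (MassLE.dom1 measurableSet_Ioc zero_le_two (fun r _ => ?_) key).mono_right ?_
  · exact le_of_eq (by ring)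
  · have := mul_nonneg (hφ0 b (ha.trans hab)) (sq_nonneg ‖g b‖)
    linarith

/-- The energy estimate on `(0, 1]` from the right end point, for a weight `φ ≥ 0` which increases
along the drift. No condition at the origin is needed. -/
theorem massLE_energy_Ioc {φ φ' V κ ω : ℝ → ℝ} {g F : ℝ → E} {M : ℝ}
    (hg : ∀ r, 0 < r → HasDerivAt g (F r - V r • g r) r)
    (hφ : ∀ r, 0 < r → r ≤ 1 → HasDerivAt φ (φ' r) r)
    (hF : ContinuousOn F (Ioc 0 1)) (hκc : ContinuousOn κ (Ioc 0 1)) (hωc : ContinuousOn ω (Ioc 0 1))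
    (hφ0 : ∀ r, 0 < r → r ≤ 1 → 0 ≤ φ r) (hκ0 : ∀ r, 0 < r → r ≤ 1 → 0 ≤ κ r)
    (hω0 : ∀ r, 0 < r → r ≤ 1 → 0 ≤ ω r)
    (hdrift : ∀ r, 0 < r → r ≤ 1 → κ r ≤ φ' r - 2 * φ r * V r)
    (hφω : ∀ r, 0 < r → r ≤ 1 → φ r ^ 2 ≤ κ r * ω r) (hM : 0 ≤ M)
    (h1 : MassLE (Ioc 0 1) (fun r => ω r * ‖F r‖ ^ 2) M) :
    MassLE (Ioc 0 1) (fun r => κ r * ‖g r‖ ^ 2) (2 * (φ 1 * ‖g 1‖ ^ 2) + 4 * M) := by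
  refine massLE_Ioc_of_forall (fun a ha hab => ?_)
  have hgc : ContinuousOn g (Icc a 1) :=
    fun r hr => (hg r (ha.trans_le hr.1)).continuousAt.continuousWithinAt
  have hsub : Icc a 1 ⊆ Ioc 0 1 := fun r hr => ⟨ha.trans_le hr.1, hr.2⟩
  have key := massLE_Ioc_of_deriv_le (P := fun r => -(φ r * ‖g r‖ ^ 2))
    (P' := fun r => -((φ' r - 2 * φ r * V r) * ‖g r‖ ^ 2 + 2 * φ r * inner ℝ (g r) (F r)))
    (e := fun r => κ r / 2 * ‖g r‖ ^ 2) (d := fun r => 2 * (ω r * ‖F r‖ ^ 2)) (M := 2 * M)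
    hab (by positivity)
    (fun r hr => (hasDerivAt_weighted_norm_sq (hφ r (hsub hr).1 (hsub hr).2)
      (hg r (hsub hr).1)).neg)
    (((hκc.mono hsub).div_const 2).mul (hgc.norm.pow 2))
    (((hωc.mul (hF.norm.pow 2)).const_smul (2 : ℝ)).mono hsub)
    (fun r hr => by have := hκ0 r (hsub hr).1 (hsub hr).2; positivity)
    (fun r hr => by have := hω0 r (hsub hr).1 (hsub hr).2; positivity)
    (fun r hr => by
      obtain ⟨hr0, hr1⟩ := hsub hr
      have k1 := neg_le_of_abs_le (two_mul_inner_le (g r) (F r) (hκ0 r hr0 hr1) (hω0 r hr0 hr1)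
        (hφω r hr0 hr1))
      have k2 := mul_le_mul_of_nonneg_right (hdrift r hr0 hr1) (sq_nonneg ‖g r‖)
      nlinarith)
    (MassLE.dom1 measurableSet_Ioc zero_le_two (fun _ _ => le_rfl)
      (h1.mono_set (Ioc_subset_Icc_self.trans hsub)))
  refine (MassLE.dom1 measurableSet_Ioc zero_le_two (fun r _ => ?_) key).mono_right ?_
  · exact le_of_eq (by ring)
  · have := mul_nonneg (hφ0 a ha hab.le) (sq_nonneg ‖g a‖)
    linarith

/-- The Cauchy-Schwarz inequality for increments: `Φ` is a primitive of `m² / r`. -/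
theorem norm_sub_sq_le_of_deriv {u u' : ℝ → E} {m q Φ : ℝ → ℝ} {a b N : ℝ} [CompleteSpace E]
    (ha : 0 < a) (hab : a ≤ b)
    (hu : ∀ r ∈ Icc a b, HasDerivAt u (u' r) r) (hu' : ContinuousOn u' (Icc a b))
    (hq : ContinuousOn q (Icc a b)) (hm : ContinuousOn m (Icc a b))
    (hΦ : ∀ r ∈ Icc a b, HasDerivAt Φ (m r ^ 2 / r) r)
    (hle : ∀ r ∈ Icc a b, ‖u' r‖ ≤ m r * q r) (hN : 0 ≤ N)
    (hmass : MassLE (Ioi 0) (fun r => r * q r ^ 2) N) :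
    ‖u b - u a‖ ^ 2 ≤ (Φ b - Φ a) * N := by
  have hsub : Ioc a b ⊆ Ioi 0 := fun r hr => ha.trans hr.1
  have hpos : ∀ r ∈ Icc a b, 0 < r := fun r hr => ha.trans_le hr.1
  have c1 : ContinuousOn (fun r => m r ^ 2 / r) (Icc a b) :=
    (hm.pow 2).div continuousOn_id fun r hr => (hpos r hr).ne'
  have c2 : ContinuousOn (fun r => r * q r ^ 2) (Icc a b) := continuousOn_id.mul (hq.pow 2)
  have i1 : IntervalIntegrable (fun r => m r ^ 2 / r) volume a b :=
    (c1.mono (uIcc_of_le hab).le).intervalIntegrable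
  have i2 : IntervalIntegrable (fun r => r * q r ^ 2) volume a b :=
    (c2.mono (uIcc_of_le hab).le).intervalIntegrable
  have e1 : ∫ r in a..b, m r ^ 2 / r = Φ b - Φ a :=
    intervalIntegral.integral_eq_sub_of_hasDerivAt (fun r hr => hΦ r (by rwa [uIcc_of_le hab] at hr)) i1
  have e2 : ∫ r in a..b, r * q r ^ 2 ≤ N := by
    rw [intervalIntegral.integral_of_le hab]
    exact (hmass.mono_set hsub).integral_le measurableSet_Ioc hN fun r hr => by
      have : 0 < r := hsub hr
      positivity
  have e3 : u b - u a = ∫ r in a..b, u' r :=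
    (intervalIntegral.integral_eq_sub_of_hasDerivAt
      (fun r hr => hu r (by rwa [uIcc_of_le hab] at hr))
      (hu'.mono (uIcc_of_le hab).le).intervalIntegrable).symm
  -- `2 λ |u'| ≤ λ² m² / r + r q²` for every `λ`
  have key : ∀ l : ℝ, 0 ≤ (Φ b - Φ a) * (l * l) + (-2 * ‖u b - u a‖) * l + N := by
    intro l
    have h1 : ‖u b - u a‖ ≤ ∫ r in a..b, ‖u' r‖ := by
      rw [e3]; exact intervalIntegral.norm_integral_le_integral_norm hab
    have hΦ0 : 0 ≤ Φ b - Φ a := by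
      rw [← e1]; exact intervalIntegral.integral_nonneg hab fun r hr => by
        have := hpos r hr; positivity
    rcases le_or_gt l 0 with hl | hl
    · have := norm_nonneg (u b - u a)
      have := mul_nonneg hΦ0 (mul_self_nonneg l)
      nlinarith [mul_nonneg (neg_nonneg.2 hl) (norm_nonneg (u b - u a))]
    have h2 : ∫ r in a..b, (2 * l) * ‖u' r‖ ≤ ∫ r in a..b, (l ^ 2 * (m r ^ 2 / r) + r * q r ^ 2) := by
      refine intervalIntegral.integral_mono_on hab ?_ ((i1.const_mul _).add i2) fun r hr => ?_
      · exact ((hu'.norm.const_smul (2 * l)).mono (uIcc_of_le hab).le).intervalIntegrable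
      · have hr0 := hpos r hr
        have h3 : l ^ 2 * (m r ^ 2 / r) + r * q r ^ 2 - 2 * l * (m r * q r)
            = (l * m r - r * q r) ^ 2 / r := by field_simp; ring
        have h4 : 0 ≤ (l * m r - r * q r) ^ 2 / r := by positivity
        nlinarith [mul_le_mul_of_nonneg_left (hle r hr) (by positivity : 0 ≤ 2 * l)]
    rw [intervalIntegral.integral_const_mul,
      intervalIntegral.integral_add (i1.const_mul _) i2, intervalIntegral.integral_const_mul, e1] at h2
    nlinarith
  have := discrim_le_zero key
  rw [discrim] at this
  nlinarith

/-! ### Logarithmic weights -/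

/-- The square `1 + log² r` of the bracket `⟨log r⟩`. -/
def logSq (r : ℝ) : ℝ := 1 + Real.log r ^ 2

/-- The square `1 + log₊² r` of the bracket `⟨log₊ r⟩`. -/
def logPlusSq (r : ℝ) : ℝ := 1 + logPlus r ^ 2

/-- The square `1 + log₋² r` of the bracket `⟨log₋ r⟩`. -/
def logMinusSq (r : ℝ) : ℝ := 1 + logMinus r ^ 2

@[fun_prop]
theorem measurable_logSq : Measurable logSq := by unfold logSq; fun_prop

@[fun_prop]
theorem measurable_logPlusSq : Measurable logPlusSq := by
  unfold logPlusSq logPlus; fun_prop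

@[fun_prop]
theorem measurable_logMinusSq : Measurable logMinusSq := by
  unfold logMinusSq logMinus; fun_prop

theorem one_le_logSq (r : ℝ) : 1 ≤ logSq r := by
  unfold logSq; nlinarith [sq_nonneg (Real.log r)]

theorem one_le_logPlusSq (r : ℝ) : 1 ≤ logPlusSq r := by
  unfold logPlusSq; nlinarith [sq_nonneg (logPlus r)]

theorem one_le_logMinusSq (r : ℝ) : 1 ≤ logMinusSq r := by
  unfold logMinusSq; nlinarith [sq_nonneg (logMinus r)]

theorem logSq_pos (r : ℝ) : 0 < logSq r := zero_lt_one.trans_le (one_le_logSq r)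

theorem logPlusSq_pos (r : ℝ) : 0 < logPlusSq r := zero_lt_one.trans_le (one_le_logPlusSq r)

theorem logMinusSq_pos (r : ℝ) : 0 < logMinusSq r := zero_lt_one.trans_le (one_le_logMinusSq r)

theorem logPlusSq_le_logSq (r : ℝ) : logPlusSq r ≤ logSq r := by
  unfold logPlusSq logSq logPlus
  rcases le_total (Real.log r) 0 with h | h
  · rw [max_eq_left h]; nlinarith [sq_nonneg (Real.log r)]
  · rw [max_eq_right h]

theorem logMinusSq_le_logSq (r : ℝ) : logMinusSq r ≤ logSq r := by
  unfold logMinusSq logSq logMinus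
  rcases le_total (-Real.log r) 0 with h | h
  · rw [max_eq_left h]; nlinarith [sq_nonneg (Real.log r)]
  · rw [max_eq_right h]; simp

theorem logPlusSq_of_le_one {r : ℝ} (h0 : 0 < r) (h : r ≤ 1) : logPlusSq r = 1 := by
  unfold logPlusSq logPlus
  rw [max_eq_left (Real.log_nonpos h0.le h)]; simp

theorem logPlusSq_of_one_le {r : ℝ} (h : 1 ≤ r) : logPlusSq r = logSq r := by
  unfold logPlusSq logPlus logSq
  rw [max_eq_right (Real.log_nonneg h)]

theorem logMinusSq_of_le_one {r : ℝ} (h0 : 0 < r) (h : r ≤ 1) : logMinusSq r = logSq r := by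
  unfold logMinusSq logMinus logSq
  rw [max_eq_right (by linarith [Real.log_nonpos h0.le h])]; simp

theorem logMinusSq_of_one_le {r : ℝ} (h : 1 ≤ r) : logMinusSq r = 1 := by
  unfold logMinusSq logMinus
  rw [max_eq_left (by linarith [Real.log_nonneg h])]; simp

/-- `log² r ≤ (√r - 1/√r)²`, from `|x| ≤ |sinh x|` at `x = log √r`. -/
theorem mul_logSq_le {r : ℝ} (hr : 0 < r) : r * logSq r ≤ 1 + r ^ 2 := by
  have hs : 0 < √r := Real.sqrt_pos.2 hr
  have h1 : Real.log r = 2 * Real.log √r := by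
    rw [Real.log_sqrt hr.le]; ring
  have h2 : Real.log √r ^ 2 ≤ Real.sinh (Real.log √r) ^ 2 := by
    rcases le_total 0 (Real.log √r) with h | h
    · exact pow_le_pow_left₀ h (Real.self_le_sinh_iff.2 h) 2
    · nlinarith [Real.sinh_le_self_iff.2 h]
  rw [Real.sinh_log hs] at h2
  have h3 : √r * √r = r := Real.mul_self_sqrt hr.le
  have h4 : √r * (√r)⁻¹ = 1 := mul_inv_cancel₀ hs.ne'
  have h5 : r * ((√r)⁻¹ * (√r)⁻¹) = 1 := by
    calc r * ((√r)⁻¹ * (√r)⁻¹) = √r * √r * ((√r)⁻¹ * (√r)⁻¹) := by rw [h3]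
      _ = (√r * (√r)⁻¹) * (√r * (√r)⁻¹) := by ring
      _ = 1 := by rw [h4]; ring
  have h6 : r * Real.log r ^ 2 ≤ r * (√r - (√r)⁻¹) ^ 2 := by
    rw [h1]; nlinarith
  have h7 : r * (√r - (√r)⁻¹) ^ 2 = r * (√r * √r) - 2 * r * (√r * (√r)⁻¹) + r * ((√r)⁻¹ * (√r)⁻¹) := by
    ring
  rw [h7, h3, h4, h5] at h6
  unfold logSq; nlinarith

theorem continuousOn_logSq : ContinuousOn logSq (Ioi 0) := by
  unfold logSq
  exact continuousOn_const.add ((Real.continuousOn_log.mono fun r hr => ne_of_gt hr).pow 2)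

theorem hasDerivAt_logSq {r : ℝ} (hr : 0 < r) : HasDerivAt logSq (2 * Real.log r / r) r := by
  unfold logSq
  refine (((Real.hasDerivAt_log hr.ne').pow 2).const_add 1).congr_deriv ?_
  field_simp; ring

/-- A density with a primitive of oscillation at most `M` has mass at most `M`. -/
theorem massLE_of_primitive {A e : ℝ → ℝ} {M : ℝ} (hA : ∀ r, 0 < r → HasDerivAt A (e r) r)
    (he : ContinuousOn e (Ioi 0)) (he0 : ∀ r, 0 < r → 0 ≤ e r)
    (hM : ∀ a b, 0 < a → a < b → A b - A a ≤ M) : MassLE (Ioi 0) e M := by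
  refine massLE_Ioi_of_forall (K := fun _ => 0) (fun a b ha hab => ?_) tendsto_const_nhds
  have hsub : Icc a b ⊆ Ioi 0 := fun r hr => ha.trans_le hr.1
  have := massLE_Ioc_of_deriv_le (P := fun r => -A r) (P' := fun r => -e r) (e := e)
    (d := fun _ => 0) hab le_rfl (fun r hr => (hA r (hsub hr)).neg) (he.mono hsub)
    continuousOn_const (fun r hr => he0 r (hsub hr)) (fun _ _ => le_rfl) (fun r _ => by simp)
    (by simp [MassLE])
  exact this.mono_right (by linarith [hM a b ha hab])

theorem massLE_inv_mul_logSq : MassLE (Ioi 0) (fun r => 1 / (r * logSq r)) 4 := by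
  refine massLE_of_primitive (A := fun r => Real.arctan (Real.log r)) (fun r hr => ?_) ?_ ?_ ?_
  · refine ((Real.hasDerivAt_log hr.ne').arctan).congr_deriv ?_
    unfold logSq
    have : 0 < 1 + Real.log r ^ 2 := by positivity
    field_simp
  · exact continuousOn_const.div (continuousOn_id.mul continuousOn_logSq)
      fun r hr => (mul_pos hr (logSq_pos r)).ne'
  · intro r hr; have := logSq_pos r; positivity
  · intro a b _ _
    have h1 := Real.arctan_lt_pi_div_two (Real.log b)
    have h2 := Real.neg_pi_div_two_lt_arctan (Real.log a)
    linarith [Real.pi_lt_four]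

theorem massLE_div_sq : MassLE (Ioi 0) (fun r => r / (1 + r ^ 2) ^ 2) 1 := by
  refine massLE_of_primitive (A := fun r => -(1 / 2) * (1 + r ^ 2)⁻¹) (fun r hr => ?_) ?_ ?_ ?_
  · have h0 : (1 + r ^ 2) ≠ 0 := by positivity
    have h1 : HasDerivAt (fun r : ℝ => 1 + r ^ 2) (2 * r) r := by
      simpa using (hasDerivAt_pow 2 r).const_add 1
    refine ((h1.inv h0).const_mul (-(1 / 2))).congr_deriv ?_
    field_simp
  · exact (continuous_id.div (by fun_prop) fun r => by positivity).continuousOn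
  · intro r hr; positivity
  · intro a b _ _
    have h1 : 0 < (1 + b ^ 2)⁻¹ := by positivity
    have h2 : (1 + a ^ 2)⁻¹ ≤ 1 := inv_le_one_of_one_le₀ (by nlinarith)
    linarith

theorem norm_add_sq_le' (x y : ℂ) : ‖x + y‖ ^ 2 ≤ 2 * ‖x‖ ^ 2 + 2 * ‖y‖ ^ 2 := by
  nlinarith [norm_add_le x y, norm_nonneg (x + y), sq_nonneg (‖x‖ - ‖y‖), norm_nonneg x,
    norm_nonneg y]

theorem norm_sub_sq_le' (x y : ℂ) : ‖x - y‖ ^ 2 ≤ 2 * ‖x‖ ^ 2 + 2 * ‖y‖ ^ 2 := by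
  simpa [sub_eq_add_neg] using norm_add_sq_le' x (-y)

theorem norm_add₃_sq_le (x y z : ℂ) :
    ‖x + y + z‖ ^ 2 ≤ 3 * ‖x‖ ^ 2 + 3 * ‖y‖ ^ 2 + 3 * ‖z‖ ^ 2 := by
  have h := norm_add₃_le (a := x) (b := y) (c := z)
  have h2 := pow_le_pow_left₀ (norm_nonneg _) h 2
  nlinarith [sq_nonneg (‖x‖ - ‖y‖), sq_nonneg (‖x‖ - ‖z‖), sq_nonneg (‖y‖ - ‖z‖)]

theorem norm_smul_sq (c : ℝ) (x : ℂ) : ‖c • x‖ ^ 2 = c ^ 2 * ‖x‖ ^ 2 := by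
  rw [norm_smul, mul_pow, Real.norm_eq_abs, sq_abs]

/-! ### The adjoint operator on the first order space of index two -/

/-- The zeroth order coefficient of `A_Q^*`. -/
def coefAstar (r : ℝ) : ℝ := 2 / (r * (1 + r ^ 2))

/-- The energy weight `(1 + log (1 + r²))⁻¹`: it decreases to `0` at a logarithmic rate, while the
drift of `A_Q^*` makes up for its slow decrease near the origin. -/
def weightAstar (r : ℝ) : ℝ := (1 + Real.log (1 + r ^ 2))⁻¹

theorem log_one_add_sq_nonneg (r : ℝ) : 0 ≤ Real.log (1 + r ^ 2) :=
  Real.log_nonneg (by nlinarith [sq_nonneg r])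

theorem weightAstar_pos (r : ℝ) : 0 < weightAstar r := by
  have := log_one_add_sq_nonneg r
  unfold weightAstar; positivity

theorem hasDerivAt_weightAstar (r : ℝ) :
    HasDerivAt weightAstar (-(2 * r / (1 + r ^ 2)) * weightAstar r ^ 2) r := by
  have h0 : (1 + r ^ 2) ≠ 0 := by positivity
  have h1 : HasDerivAt (fun r : ℝ => 1 + r ^ 2) (2 * r) r := by
    simpa using (hasDerivAt_pow 2 r).const_add 1
  have h2 : 1 + Real.log (1 + r ^ 2) ≠ 0 := by
    have := log_one_add_sq_nonneg r; positivity
  refine (((h1.log h0).const_add 1).inv h2).congr_deriv ?_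
  unfold weightAstar
  field_simp

theorem inv_le_weightAstar (r : ℝ) : (1 + r ^ 2)⁻¹ ≤ weightAstar r := by
  have := log_one_add_sq_nonneg r
  unfold weightAstar
  refine inv_anti₀ (by positivity) ?_
  have := Real.log_le_sub_one_of_pos (show 0 < 1 + r ^ 2 by positivity)
  linarith

theorem weightAstar_le_one (r : ℝ) : weightAstar r ≤ 1 := by
  unfold weightAstar
  exact inv_le_one_of_one_le₀ (by linarith [log_one_add_sq_nonneg r])

theorem inv_logPlusSq_le_weightAstar {r : ℝ} (hr : 0 < r) :
    (logPlusSq r)⁻¹ ≤ 8 * weightAstar r ^ 2 := by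
  have h0 := log_one_add_sq_nonneg r
  unfold weightAstar
  rw [inv_pow, ← div_eq_mul_inv, inv_eq_one_div, div_le_div_iff₀ (logPlusSq_pos r) (by positivity)]
  have h1 : Real.log (1 + r ^ 2) ≤ 1 + 2 * logPlus r := by
    have hp : 0 ≤ logPlus r := le_max_left _ _
    have h2 : 1 + r ^ 2 ≤ 2 * max 1 r ^ 2 := by
      rcases le_total r 1 with h | h
      · rw [max_eq_left h]; nlinarith
      · rw [max_eq_right h]; nlinarith
    have h3 : Real.log (2 * max 1 r ^ 2) = Real.log 2 + 2 * Real.log (max 1 r) := by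
      rw [Real.log_mul (by norm_num) (by positivity), Real.log_pow]; norm_num
    have h4 : Real.log (max 1 r) ≤ logPlus r := by
      rcases le_total r 1 with h | h
      · rw [max_eq_left h]; simpa using hp
      · rw [max_eq_right h]; exact le_max_right _ _
    have h5 := Real.log_le_log (by positivity) h2
    linarith [Real.log_two_lt_d9]
  unfold logPlusSq
  nlinarith [sq_nonneg (logPlus r - 1), mul_self_nonneg (1 + Real.log (1 + r ^ 2))]

/-- Coercivity of `A_Q^*`, in terms of masses. -/
theorem massLE_of_astar {f f₁ : ℝ → ℂ} {N : ℝ} (hN : 0 ≤ N) (hf : Measurable f) (hf₁ : Measurable f₁)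
    (hd : ∀ r, 0 < r → HasDerivAt f (f₁ r) r) (hc : ContinuousOn f₁ (Ioi 0))
    (h0 : Tendsto f (𝓝[>] 0) (𝓝 0))
    (hF : MassLE (Ioi 0) (fun r => r * ‖-f₁ r - coefAstar r • f r‖ ^ 2) N) :
    MassLE (Ioi 0) (fun r => r * ‖f₁ r‖ ^ 2) (10 * N) ∧
      MassLE (Ioi 0) (fun r => ‖f r‖ ^ 2 / (r * logPlusSq r)) (8 * N) := by
  have hfc : ContinuousOn f (Ioi 0) := fun r hr => (hd r hr).continuousAt.continuousWithinAt
  have hVc : ContinuousOn coefAstar (Ioi 0) := by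
    unfold coefAstar
    exact continuousOn_const.div (by fun_prop) fun r (hr : 0 < r) => by positivity
  have hwc : ContinuousOn weightAstar (Ioi 0) :=
    fun r _ => (hasDerivAt_weightAstar r).continuousAt.continuousWithinAt
  have E : MassLE (Ioi 0) (fun r => 2 * weightAstar r ^ 2 / r * ‖f r‖ ^ 2)
      (2 * 0 + 4 * (N / 2) + 2 * 0) := by
    refine massLE_energy_Ioi (φ := weightAstar) (V := coefAstar) (ω := fun r => r / 2)
      (ε := fun _ => 0) (F := fun r => f₁ r + coefAstar r • f r)
      (fun r hr => by simpa using hd r hr) (fun r _ => hasDerivAt_weightAstar r)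
      (hc.add (hVc.smul hfc))
      ((continuousOn_const.mul (hwc.pow 2)).div continuousOn_id fun r hr => ne_of_gt hr)
      (by fun_prop) continuousOn_const (fun r _ => (weightAstar_pos r).le)
      (fun r hr => by have := weightAstar_pos r; positivity) (fun r hr => by positivity)
      (fun _ _ => le_rfl) (fun r hr => ?_) (fun r hr => le_of_eq (by field_simp)) ?_
      (by positivity) le_rfl ?_ (by simp [MassLE])
    · have h1 := weightAstar_pos r
      have h2 : 2 * weightAstar r * coefAstar r ≥ 2 * weightAstar r ^ 2 * coefAstar r := by
        have : 0 ≤ coefAstar r := by unfold coefAstar; positivity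
        have h3 := weightAstar_le_one r
        have h4 : weightAstar r ^ 2 ≤ weightAstar r := by nlinarith
        nlinarith
      have h3 : 2 * weightAstar r ^ 2 / r ≤ (2 * r / (1 + r ^ 2)) * weightAstar r ^ 2
          + 2 * weightAstar r ^ 2 * coefAstar r := by
        unfold coefAstar
        have : (2 * r / (1 + r ^ 2)) * weightAstar r ^ 2
          + 2 * weightAstar r ^ 2 * (2 / (r * (1 + r ^ 2))) - 2 * weightAstar r ^ 2 / r
          = 2 * weightAstar r ^ 2 / (r * (1 + r ^ 2)) := by field_simp; ring
        have h4 : 0 ≤ 2 * weightAstar r ^ 2 / (r * (1 + r ^ 2)) := by positivity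
        linarith
      linarith
    · have hw : Tendsto weightAstar (𝓝[>] 0) (𝓝 (weightAstar 0)) :=
        (hasDerivAt_weightAstar 0).continuousAt.tendsto.mono_left nhdsWithin_le_nhds
      simpa using hw.mul (h0.norm.pow 2)
    · refine (MassLE.dom1 (c₁ := 1 / 2) measurableSet_Ioi (by norm_num) (fun r _ => ?_)
        hF).mono_right (by linarith)
      rw [show -f₁ r - coefAstar r • f r = -(f₁ r + coefAstar r • f r) by ring, norm_neg]
      exact le_of_eq (by ring)
  refine ⟨?_, ?_⟩
  · refine (MassLE.dom2 (c₁ := 2) (c₂ := 4) measurableSet_Ioi ?_ (by norm_num) (by norm_num) hN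
      (by linarith) (fun r hr => ?_) hF E).mono_right (by linarith)
    · unfold coefAstar; fun_prop
    · have hr : 0 < r := hr
      have h1 := norm_add_sq_le' (-(-f₁ r - coefAstar r • f r)) (-(coefAstar r • f r))
      rw [norm_neg, norm_neg, norm_smul_sq] at h1
      rw [show -(-f₁ r - coefAstar r • f r) + -(coefAstar r • f r) = f₁ r by ring] at h1
      have h2 : r * coefAstar r ^ 2 ≤ 4 * weightAstar r ^ 2 / r := by
        have h3 : ((1 + r ^ 2)⁻¹) ^ 2 ≤ weightAstar r ^ 2 :=
          pow_le_pow_left₀ (by positivity) (inv_le_weightAstar r) 2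
        calc r * coefAstar r ^ 2 = 4 * ((1 + r ^ 2)⁻¹) ^ 2 / r := by unfold coefAstar; field_simp; ring
          _ ≤ _ := by gcongr
      have h4 := mul_le_mul_of_nonneg_right h2 (sq_nonneg ‖f r‖)
      have h5 := mul_le_mul_of_nonneg_left h1 hr.le
      calc r * ‖f₁ r‖ ^ 2 ≤ _ := h5
        _ = 2 * (r * ‖-f₁ r - coefAstar r • f r‖ ^ 2) + 2 * (r * coefAstar r ^ 2 * ‖f r‖ ^ 2) := by ring
        _ ≤ 2 * (r * ‖-f₁ r - coefAstar r • f r‖ ^ 2) + 2 * (4 * weightAstar r ^ 2 / r * ‖f r‖ ^ 2) := by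
          linarith
        _ = _ := by ring
  · refine (MassLE.dom1 (c₁ := 4) measurableSet_Ioi (by norm_num) (fun r hr => ?_) E).mono_right
      (by linarith)
    have hr : 0 < r := hr
    have h1 := inv_logPlusSq_le_weightAstar hr
    have h2 := logPlusSq_pos r
    calc ‖f r‖ ^ 2 / (r * logPlusSq r) = (logPlusSq r)⁻¹ * (‖f r‖ ^ 2 / r) := by field_simp
      _ ≤ (8 * weightAstar r ^ 2) * (‖f r‖ ^ 2 / r) := by gcongr
      _ = _ := by ring

/-- Boundedness of `A_Q^*`, in terms of masses. -/
theorem massLE_astar {f f₁ : ℝ → ℂ} {N : ℝ} (hN : 0 ≤ N) (hf₁ : Measurable f₁)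
    (h1 : MassLE (Ioi 0) (fun r => r * ‖f₁ r‖ ^ 2) N)
    (h2 : MassLE (Ioi 0) (fun r => ‖f r‖ ^ 2 / (r * logPlusSq r)) N) :
    MassLE (Ioi 0) (fun r => r * ‖-f₁ r - coefAstar r • f r‖ ^ 2) (10 * N) := by
  refine (MassLE.dom2 (c₁ := 2) (c₂ := 8) measurableSet_Ioi (by fun_prop) (by norm_num)
    (by norm_num) hN hN (fun r hr => ?_) h1 h2).mono_right (by linarith)
  have hr : 0 < r := hr
  have h3 := norm_sub_sq_le' (-f₁ r) (coefAstar r • f r)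
  rw [norm_neg, norm_smul_sq] at h3
  have hL := logPlusSq_pos r
  have h4 : r * coefAstar r ^ 2 ≤ 4 / (r * logPlusSq r) := by
    have h5 : logPlusSq r ≤ (1 + r ^ 2) ^ 2 := by
      rcases le_total r 1 with h | h
      · rw [logPlusSq_of_le_one hr h]; nlinarith [sq_nonneg r]
      · have := mul_logSq_le hr
        have := logPlusSq_le_logSq r
        nlinarith [logSq_pos r, sq_nonneg r]
    unfold coefAstar
    rw [show r * (2 / (r * (1 + r ^ 2))) ^ 2 = 4 / (r * (1 + r ^ 2) ^ 2) by field_simp; ring]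
    gcongr
  have h5 := mul_le_mul_of_nonneg_right h4 (sq_nonneg ‖f r‖)
  have h6 := mul_le_mul_of_nonneg_left h3 hr.le
  calc _ ≤ _ := h6
    _ = 2 * (r * ‖f₁ r‖ ^ 2) + 2 * (r * coefAstar r ^ 2 * ‖f r‖ ^ 2) := by ring
    _ ≤ 2 * (r * ‖f₁ r‖ ^ 2) + 2 * (4 / (r * logPlusSq r) * ‖f r‖ ^ 2) := by linarith
    _ = _ := by ring

/-! ### Hardy inequalities along a drift -/

/-- The Cauchy-Schwarz inequality for a function vanishing at the origin. -/
theorem norm_sq_le_of_deriv_of_tendsto_zero {E : Type} [NormedAddCommGroup E]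
    [InnerProductSpace ℝ E] [CompleteSpace E] {u u' : ℝ → E} {m q Φ : ℝ → ℝ} {N : ℝ}
    (hu : ∀ r, 0 < r → HasDerivAt u (u' r) r) (hu' : ContinuousOn u' (Ioi 0))
    (hq : ContinuousOn q (Ioi 0)) (hm : ContinuousOn m (Ioi 0))
    (hΦ : ∀ r, 0 < r → HasDerivAt Φ (m r ^ 2 / r) r)
    (hle : ∀ r, 0 < r → ‖u' r‖ ≤ m r * q r) (hN : 0 ≤ N)
    (hmass : MassLE (Ioi 0) (fun r => r * q r ^ 2) N)
    (hu0 : Tendsto u (𝓝[>] 0) (𝓝 0)) (hΦ0 : Tendsto Φ (𝓝[>] 0) (𝓝 0)) {r : ℝ} (hr : 0 < r) :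
    ‖u r‖ ^ 2 ≤ Φ r * N := by
  have h1 : Tendsto (fun a => ‖u r - u a‖ ^ 2) (𝓝[>] 0) (𝓝 (‖u r - 0‖ ^ 2)) :=
    ((tendsto_const_nhds.sub hu0).norm).pow 2
  have h2 : Tendsto (fun a => (Φ r - Φ a) * N) (𝓝[>] 0) (𝓝 ((Φ r - 0) * N)) :=
    (tendsto_const_nhds.sub hΦ0).mul_const N
  rw [sub_zero] at h1 h2
  refine le_of_tendsto_of_tendsto h1 h2 ?_
  filter_upwards [Ioo_mem_nhdsGT hr] with a ha
  have hsub : Icc a r ⊆ Ioi 0 := fun x hx => ha.1.trans_le hx.1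
  exact norm_sub_sq_le_of_deriv ha.1 ha.2.le (fun x hx => hu x (hsub hx)) (hu'.mono hsub)
    (hq.mono hsub) (hm.mono hsub) (fun x hx => hΦ x (hsub hx)) (fun x hx => hle x (hsub hx)) hN hmass

/-- The logarithmic Hardy inequality near the origin: `G` is the square of an integrating factor of
`g' + V g = F`. -/
theorem massLE_log_hardy {V G : ℝ → ℝ} {g F : ℝ → ℂ} {M : ℝ}
    (hg : ∀ r, 0 < r → HasDerivAt g (F r - V r • g r) r)
    (hG : ∀ r, 0 < r → HasDerivAt G (2 * V r * G r) r)
    (hG0 : ∀ r, 0 < r → 0 ≤ G r) (hF : ContinuousOn F (Ioi 0)) (hM : 0 ≤ M)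
    (h : MassLE (Ioc 0 1) (fun r => r * G r * ‖F r‖ ^ 2) M) :
    MassLE (Ioc 0 1) (fun r => G r * ‖g r‖ ^ 2 / (r * logSq r)) (4 * (G 1 * ‖g 1‖ ^ 2) + 8 * M) := by
  have hpos : ∀ r : ℝ, 0 < r → r ≤ 1 → 0 < 1 - Real.log r := fun r h0 h1 => by
    linarith [Real.log_nonpos h0.le h1]
  have hlogc : ContinuousOn (fun r => 1 - Real.log r) (Ioc 0 1) :=
    continuousOn_const.sub (Real.continuousOn_log.mono fun r hr => ne_of_gt hr.1)
  have hGc : ContinuousOn G (Ioc 0 1) := fun r hr => (hG r hr.1).continuousAt.continuousWithinAt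
  have E := massLE_energy_Ioc (φ := fun r => (1 - Real.log r)⁻¹ * G r)
    (φ' := fun r => ((1 - Real.log r)⁻¹ ^ 2 / r) * G r + (1 - Real.log r)⁻¹ * (2 * V r * G r))
    (V := V) (κ := fun r => (1 - Real.log r)⁻¹ ^ 2 / r * G r) (ω := fun r => r * G r) hg
    (fun r h0 h1 => by
      have hp := (hpos r h0 h1).ne'
      have h2 := ((Real.hasDerivAt_log h0.ne').const_sub 1).inv hp
      refine (h2.mul (hG r h0)).congr_deriv ?_
      simp only [Pi.inv_apply]
      field_simp)
    (hF.mono Ioc_subset_Ioi_self)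
    ((((hlogc.inv₀ fun r hr => (hpos r hr.1 hr.2).ne').pow 2).div continuousOn_id
      fun r hr => ne_of_gt hr.1).mul hGc)
    (continuousOn_id.mul hGc)
    (fun r h0 h1 => mul_nonneg (inv_nonneg.2 (hpos r h0 h1).le) (hG0 r h0))
    (fun r h0 h1 => by have := hG0 r h0; positivity)
    (fun r h0 h1 => mul_nonneg h0.le (hG0 r h0))
    (fun r h0 h1 => le_of_eq (by ring))
    (fun r h0 h1 => le_of_eq (by field_simp)) hM h
  refine (MassLE.dom1 (c₁ := 2) measurableSet_Ioc zero_le_two (fun r hr => ?_) E).mono_right ?_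
  · have hp := hpos r hr.1 hr.2
    have hr0 : 0 < r := hr.1
    have h1 : (logSq r)⁻¹ ≤ 2 * (1 - Real.log r)⁻¹ ^ 2 := by
      rw [inv_pow, ← div_eq_mul_inv, inv_eq_one_div, div_le_div_iff₀ (logSq_pos r) (by positivity)]
      unfold logSq; nlinarith [sq_nonneg (1 + Real.log r)]
    have := hG0 r hr0
    calc G r * ‖g r‖ ^ 2 / (r * logSq r) = (logSq r)⁻¹ * (G r * ‖g r‖ ^ 2 / r) := by
          field_simp
      _ ≤ (2 * (1 - Real.log r)⁻¹ ^ 2) * (G r * ‖g r‖ ^ 2 / r) := by gcongr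
      _ = _ := by ring
  · simp; linarith

/-- The Hardy inequality near infinity: the weight decreases along the drift at the rate `2 / r`. -/
theorem massLE_hardy_Ioi {V φ φ' : ℝ → ℝ} {g F : ℝ → ℂ} {M : ℝ}
    (hg : ∀ r, 0 < r → HasDerivAt g (F r - V r • g r) r)
    (hφ : ∀ r, 0 < r → HasDerivAt φ (φ' r) r) (hφ0 : ∀ r, 0 < r → 0 ≤ φ r)
    (hdrift : ∀ r, 1 < r → φ' r - 2 * φ r * V r ≤ -(2 * φ r / r))
    (hF : ContinuousOn F (Ioi 0)) (hM : 0 ≤ M)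
    (h : MassLE (Ioi 1) (fun r => r * φ r * ‖F r‖ ^ 2) M) :
    MassLE (Ioi 1) (fun r => φ r * ‖g r‖ ^ 2 / r) (φ 1 * ‖g 1‖ ^ 2 + M) := by
  have hsub : Ioi (1 : ℝ) ⊆ Ioi 0 := Ioi_subset_Ioi zero_le_one
  have hpos : ∀ r : ℝ, 1 < r → 0 < r := fun r hr => zero_lt_one.trans hr
  have hφc : ContinuousOn φ (Ioi 1) :=
    fun r hr => (hφ r (hpos r hr)).continuousAt.continuousWithinAt
  have E := massLE_energy_Ioi (α := 1) (φ := φ) (φ' := φ') (V := V) (κ := fun r => 2 * φ r / r)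
    (ω := fun r => φ r * r / 2) (ε := fun _ => 0) (g := g) (F := F) (P₀ := φ 1 * ‖g 1‖ ^ 2)
    (M := M / 2) (M' := 0)
    (fun r hr => hg r (hpos r hr)) (fun r hr => hφ r (hpos r hr)) (hF.mono hsub)
    ((hφc.const_smul (2 : ℝ)).div continuousOn_id fun r hr => (hpos r hr).ne')
    ((hφc.mul continuousOn_id).div_const 2) continuousOn_const
    (fun r hr => hφ0 r (hpos r hr))
    (fun r hr => by have := hφ0 r (hpos r hr); have := hpos r hr; positivity)
    (fun r hr => by have := hφ0 r (hpos r hr); have := hpos r hr; positivity)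
    (fun _ _ => le_rfl) (fun r hr => by simpa using hdrift r hr)
    (fun r hr => le_of_eq (by have := hpos r hr; field_simp))
    (((hφ 1 one_pos).continuousAt.mul ((hg 1 one_pos).continuousAt.norm.pow 2)).tendsto.mono_left
      nhdsWithin_le_nhds) (by positivity) le_rfl
    ((MassLE.dom1 (c₁ := 1 / 2) measurableSet_Ioi (by norm_num)
      (fun r _ => le_of_eq (by ring)) h).mono_right (by linarith)) (by simp [MassLE])
  refine (MassLE.dom1 (c₁ := 1 / 2) measurableSet_Ioi (by norm_num) (fun r hr => ?_)
    E).mono_right (by linarith)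
  exact le_of_eq (by ring)

/-- Comparison of increments from the base point `1`. -/
theorem abs_le_abs_sub_of_abs_deriv_le {U U' Ψ Ψ' : ℝ → ℝ}
    (hU : ∀ r, 0 < r → HasDerivAt U (U' r) r) (hΨ : ∀ r, 0 < r → HasDerivAt Ψ (Ψ' r) r)
    (hle : ∀ r, 0 < r → |U' r| ≤ Ψ' r) (hU1 : U 1 = 0) {r : ℝ} (hr : 0 < r) :
    |U r| ≤ |Ψ r - Ψ 1| := by
  have hmono : ∀ (W W' : ℝ → ℝ), (∀ r, 0 < r → HasDerivAt W (W' r) r) → (∀ r, 0 < r → 0 ≤ W' r) →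
      MonotoneOn W (Ioi 0) := fun W W' hW hW' => by
    refine monotoneOn_of_deriv_nonneg (convex_Ioi 0)
      (fun r hr => (hW r hr).continuousAt.continuousWithinAt)
      (fun r hr => ?_) (fun r hr => ?_) <;> rw [interior_Ioi] at hr
    · exact (hW r hr).differentiableAt.differentiableWithinAt
    · rw [(hW r hr).deriv]; exact hW' r hr
  have m1 := hmono (fun r => Ψ r - U r) _ (fun r hr => (hΨ r hr).sub (hU r hr))
    fun r hr => by linarith [le_of_abs_le (hle r hr)]
  have m2 := hmono (fun r => Ψ r + U r) _ (fun r hr => (hΨ r hr).add (hU r hr))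
    fun r hr => by linarith [neg_le_of_abs_le (hle r hr)]
  rcases le_total 1 r with h | h
  · have a1 := m1 (mem_Ioi.2 one_pos) (mem_Ioi.2 hr) h
    have a2 := m2 (mem_Ioi.2 one_pos) (mem_Ioi.2 hr) h
    simp only [hU1] at a1 a2
    refine (abs_le.2 ⟨?_, ?_⟩).trans (le_abs_self _) <;> linarith
  · have a1 := m1 (mem_Ioi.2 hr) (mem_Ioi.2 one_pos) h
    have a2 := m2 (mem_Ioi.2 hr) (mem_Ioi.2 one_pos) h
    simp only [hU1] at a1 a2
    refine (abs_le.2 ⟨?_, ?_⟩).trans (neg_le_abs _) <;> linarith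

/-! ### The nonlocal term of `L_Q` -/

/-- The zeroth order coefficient `-r⁻¹ A_θ[Q]` of `L_Q`. -/
def driftQ (r : ℝ) : ℝ := 2 * r / (1 + r ^ 2)

/-- The coefficient `r⁻¹ Q` of the nonlocal term of `L_Q`. -/
def kerQ (r : ℝ) : ℝ := √8 / (r * (1 + r ^ 2))

@[fun_prop]
theorem measurable_driftQ : Measurable driftQ := by unfold driftQ; fun_prop

@[fun_prop]
theorem measurable_kerQ : Measurable kerQ := by unfold kerQ; fun_prop

theorem continuous_driftQ : Continuous driftQ := by
  unfold driftQ
  exact Continuous.div (by fun_prop) (by fun_prop) fun r => by positivity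

theorem continuousOn_kerQ : ContinuousOn kerQ (Ioi 0) := by
  unfold kerQ
  exact continuousOn_const.div (by fun_prop) fun r (hr : 0 < r) => by positivity

theorem hasDerivAt_one_add_sq (r : ℝ) : HasDerivAt (fun r : ℝ => 1 + r ^ 2) (2 * r) r := by
  simpa using (hasDerivAt_pow 2 r).const_add 1

theorem sqrt_eight : √(8 : ℝ) = 2 * √2 := by
  rw [show (8 : ℝ) = 2 ^ 2 * 2 by norm_num, Real.sqrt_mul (by norm_num), Real.sqrt_sq (by norm_num)]

theorem kerQ_sq {r : ℝ} : kerQ r ^ 2 = 8 / (r ^ 2 * (1 + r ^ 2) ^ 2) := by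
  unfold kerQ; rw [div_pow, Real.sq_sqrt (by norm_num), mul_pow]

/-- The right hand side `L_Q g`, where `g₁ = g'` and `Y' = Q Re g · r`. -/
def linL (g g₁ : ℝ → ℂ) (Y : ℝ → ℝ) (r : ℝ) : ℂ :=
  g₁ r + driftQ r • g r + ((kerQ r * Y r : ℝ) : ℂ)

theorem continuousOn_linL {g g₁ : ℝ → ℂ} {Y : ℝ → ℝ} (hg : ContinuousOn g (Ioi 0))
    (hg₁ : ContinuousOn g₁ (Ioi 0)) (hY : ContinuousOn Y (Ioi 0)) :
    ContinuousOn (linL g g₁ Y) (Ioi 0) :=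
  (hg₁.add (continuous_driftQ.continuousOn.smul hg)).add
    (continuous_ofReal.comp_continuousOn (continuousOn_kerQ.mul hY))

/-- A first integral of the real part of `L_Q g = F`: the Wronskian of `(g, Y)` with the scaling
mode `ΛQ`. -/
def wronskianQ (g : ℝ → ℂ) (Y : ℝ → ℝ) (r : ℝ) : ℝ :=
  (r ^ 2 - 1) / (1 + r ^ 2) * Y r + √2 * (r ^ 2 / (1 + r ^ 2)) * (g r).re

/-- `g` with derivative `g₁` and nonlocal integral `Y`, on the half line. The integral enters through
its differential equation and its limit at the origin. -/
structure IsProfile (g g₁ : ℝ → ℂ) (Y : ℝ → ℝ) : Prop where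
  deriv : ∀ r, 0 < r → HasDerivAt g (g₁ r) r
  derivY : ∀ r, 0 < r → HasDerivAt Y (√8 * r / (1 + r ^ 2) * (g r).re) r
  cont : ContinuousOn g₁ (Ioi 0)
  bdd : ∃ c, Tendsto g (𝓝[>] 0) (𝓝 c)
  zeroY : Tendsto Y (𝓝[>] 0) (𝓝 0)

theorem IsProfile.contg {g g₁ : ℝ → ℂ} {Y : ℝ → ℝ} (h : IsProfile g g₁ Y) :
    ContinuousOn g (Ioi 0) := fun r hr => (h.deriv r hr).continuousAt.continuousWithinAt

theorem IsProfile.contY {g g₁ : ℝ → ℂ} {Y : ℝ → ℝ} (h : IsProfile g g₁ Y) :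
    ContinuousOn Y (Ioi 0) := fun r hr => (h.derivY r hr).continuousAt.continuousWithinAt

theorem IsProfile.contF {g g₁ : ℝ → ℂ} {Y : ℝ → ℝ} (h : IsProfile g g₁ Y) :
    ContinuousOn (linL g g₁ Y) (Ioi 0) := continuousOn_linL h.contg h.cont h.contY

theorem hasDerivAt_re {g : ℝ → ℂ} {g' : ℂ} {r : ℝ} (h : HasDerivAt g g' r) :
    HasDerivAt (fun r => (g r).re) g'.re r :=
  (reCLM.hasFDerivAt.comp_hasDerivAt r h)

/-- The first integral is driven by the right hand side alone: `Y` and `g` drop out. -/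
theorem IsProfile.hasDerivAt_wronskianQ {g g₁ : ℝ → ℂ} {Y : ℝ → ℝ} (h : IsProfile g g₁ Y) {r : ℝ}
    (hr : 0 < r) : HasDerivAt (wronskianQ g Y) (√2 * (r ^ 2 / (1 + r ^ 2)) * (linL g g₁ Y r).re) r := by
  have h0 : (1 + r ^ 2) ≠ 0 := by positivity
  have d1 := ((hasDerivAt_pow 2 r).sub_const 1).div (hasDerivAt_one_add_sq r) h0
  have d2 := ((hasDerivAt_pow 2 r).div (hasDerivAt_one_add_sq r) h0).const_mul √2
  refine ((d1.mul (h.derivY r hr)).add (d2.mul (hasDerivAt_re (h.deriv r hr)))).congr_deriv ?_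
  have e : (linL g g₁ Y r).re = (g₁ r).re + driftQ r * (g r).re + kerQ r * Y r := by
    simp [linL]
  have s2 : √2 * √2 = (2 : ℝ) := Real.mul_self_sqrt (by norm_num)
  rw [e, driftQ, kerQ, sqrt_eight]
  simp only [Pi.div_apply]
  push_cast
  field_simp
  ring_nf
  rw [show √2 ^ 2 = (2 : ℝ) from Real.sq_sqrt (by norm_num)]
  ring

theorem IsProfile.tendsto_wronskianQ {g g₁ : ℝ → ℂ} {Y : ℝ → ℝ} (h : IsProfile g g₁ Y) :
    Tendsto (wronskianQ g Y) (𝓝[>] 0) (𝓝 0) := by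
  obtain ⟨c, hc⟩ := h.bdd
  have c1 : Continuous fun r : ℝ => (r ^ 2 - 1) / (1 + r ^ 2) :=
    Continuous.div (by fun_prop) (by fun_prop) fun r => by positivity
  have c2 : Continuous fun r : ℝ => √2 * (r ^ 2 / (1 + r ^ 2)) :=
    continuous_const.mul (Continuous.div (by fun_prop) (by fun_prop) fun r => by positivity)
  have t1 := (c1.tendsto 0).mono_left (nhdsWithin_le_nhds (s := Ioi 0))
  have t2 := (c2.tendsto 0).mono_left (nhdsWithin_le_nhds (s := Ioi 0))
  have t := (t1.mul h.zeroY).add (t2.mul ((continuous_re.tendsto c).comp hc))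
  simp only [mul_zero, zero_mul, ne_eq, OfNat.ofNat_ne_zero, not_false_eq_true, zero_pow, zero_div,
    add_zero] at t
  exact t

theorem wronskianQ_one (g : ℝ → ℂ) (Y : ℝ → ℝ) : (g 1).re = √2 * wronskianQ g Y 1 := by
  have s2 : √2 * √2 = (2 : ℝ) := Real.mul_self_sqrt (by norm_num)
  unfold wronskianQ
  calc (g 1).re = 1 / 2 * (√2 * √2) * (g 1).re := by rw [s2]; ring
    _ = _ := by ring

/-- `Y` is recovered from the first integral by one more quadrature, with the integrating factor
`(1 + r²)² / r²`. -/
theorem IsProfile.hasDerivAt_factor_mul {g g₁ : ℝ → ℂ} {Y : ℝ → ℝ} (h : IsProfile g g₁ Y) {r : ℝ}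
    (hr : 0 < r) : HasDerivAt (fun r => Y r * (1 + r ^ 2) ^ 2 / r ^ 2)
      (2 * wronskianQ g Y r * (1 + r ^ 2) ^ 2 / r ^ 3) r := by
  have h0 : (1 + r ^ 2) ≠ 0 := by positivity
  refine (((h.derivY r hr).mul ((hasDerivAt_one_add_sq r).pow 2)).div (hasDerivAt_pow 2 r)
    (by positivity)).congr_deriv ?_
  have s2 : √2 * √2 = (2 : ℝ) := Real.mul_self_sqrt (by norm_num)
  rw [wronskianQ, sqrt_eight]
  simp only [Pi.pow_apply, Pi.mul_apply]
  field_simp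
  ring

theorem IsProfile.abs_Y_le_of_linear {g g₁ : ℝ → ℂ} {Y : ℝ → ℝ} (h : IsProfile g g₁ Y) {β : ℝ}
    (hY1 : Y 1 = 0) (hβ : 0 ≤ β) (hB : ∀ r, 0 < r → |wronskianQ g Y r| ≤ β * r) {r : ℝ} (hr : 0 < r) :
    |Y r| ≤ 4 * β * r := by
  have key := abs_le_abs_sub_of_abs_deriv_le (Ψ := fun r => 2 * β * (-r⁻¹ + 2 * r + r ^ 3 / 3))
    (Ψ' := fun r => 2 * β * (1 + r ^ 2) ^ 2 / r ^ 2)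
    (fun r hr => h.hasDerivAt_factor_mul hr) (fun r hr => ?_) (fun r hr => ?_) (by simp [hY1]) hr
  · have e : |Y r| = |Y r * (1 + r ^ 2) ^ 2 / r ^ 2| * (r ^ 2 / (1 + r ^ 2) ^ 2) := by
      rw [abs_div, abs_mul, abs_of_pos (show 0 < (1 + r ^ 2) ^ 2 by positivity),
        abs_of_pos (show 0 < r ^ 2 by positivity)]
      field_simp
    rw [e]
    calc _ ≤ |2 * β * (-r⁻¹ + 2 * r + r ^ 3 / 3) - 2 * β * (-1⁻¹ + 2 * 1 + 1 ^ 3 / 3)|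
          * (r ^ 2 / (1 + r ^ 2) ^ 2) := by gcongr
      _ ≤ (2 * β * (r⁻¹ + 2 * r + r ^ 3 / 3 + 4 / 3)) * (r ^ 2 / (1 + r ^ 2) ^ 2) := by
        gcongr
        have hr' : 0 < r⁻¹ := by positivity
        have h3 : 0 < r ^ 3 := by positivity
        rw [← mul_sub, abs_mul, abs_of_nonneg (by positivity : 0 ≤ 2 * β)]
        refine mul_le_mul_of_nonneg_left (abs_le.2 ⟨?_, ?_⟩) (by positivity) <;> norm_num <;> linarith
      _ ≤ 4 * β * r := by
        have e2 : (r⁻¹ + 2 * r + r ^ 3 / 3 + 4 / 3) * r ^ 2 ≤ 2 * r * (1 + r ^ 2) ^ 2 := by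
          have : (r⁻¹ + 2 * r + r ^ 3 / 3 + 4 / 3) * r ^ 2
            = r * (1 + 2 * r ^ 2 + r ^ 4 / 3 + 4 / 3 * r) := by field_simp
          rw [this, show 2 * r * (1 + r ^ 2) ^ 2 = r * (2 * (1 + r ^ 2) ^ 2) by ring]
          refine mul_le_mul_of_nonneg_left ?_ hr.le
          nlinarith [sq_nonneg (r - 1), sq_nonneg (r ^ 2)]
        rw [mul_assoc, ← mul_div_assoc, ← mul_div_assoc, div_le_iff₀ (by positivity)]
        nlinarith
  · have h3 : HasDerivAt (fun r : ℝ => -r⁻¹ + 2 * r + r ^ 3 / 3) ((r ^ 2)⁻¹ + 2 + r ^ 2) r := by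
      have := (((hasDerivAt_inv hr.ne').neg).add ((hasDerivAt_id r).const_mul 2)).add
        ((hasDerivAt_pow 3 r).div_const 3)
      refine this.congr_deriv ?_
      push_cast; ring
    refine (h3.const_mul (2 * β)).congr_deriv ?_
    field_simp; ring
  · rw [abs_div, abs_mul, abs_mul, abs_of_pos (show 0 < (1 + r ^ 2) ^ 2 by positivity),
        abs_of_pos (show 0 < r ^ 3 by positivity), abs_two, div_le_div_iff₀ (by positivity) (by positivity)]
    have := hB r hr
    calc 2 * |wronskianQ g Y r| * (1 + r ^ 2) ^ 2 * r ^ 2 ≤ 2 * (β * r) * (1 + r ^ 2) ^ 2 * r ^ 2 := by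
          gcongr
      _ = _ := by ring

theorem IsProfile.abs_Y_le_of_cubic {g g₁ : ℝ → ℂ} {Y : ℝ → ℝ} (h : IsProfile g g₁ Y) {β : ℝ}
    (hY1 : Y 1 = 0) (hβ : 0 ≤ β) (hB : ∀ r, 0 < r → |wronskianQ g Y r| ≤ β * r ^ 3) {r : ℝ}
    (hr : 0 < r) : |Y r| ≤ 4 * β * (r ^ 2 * (1 + r)) := by
  have key := abs_le_abs_sub_of_abs_deriv_le (Ψ := fun r => 2 * β * (r + 2 * r ^ 3 / 3 + r ^ 5 / 5))
    (Ψ' := fun r => 2 * β * (1 + r ^ 2) ^ 2)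
    (fun r hr => h.hasDerivAt_factor_mul hr) (fun r hr => ?_) (fun r hr => ?_) (by simp [hY1]) hr
  · have e : |Y r| = |Y r * (1 + r ^ 2) ^ 2 / r ^ 2| * (r ^ 2 / (1 + r ^ 2) ^ 2) := by
      rw [abs_div, abs_mul, abs_of_pos (show 0 < (1 + r ^ 2) ^ 2 by positivity),
        abs_of_pos (show 0 < r ^ 2 by positivity)]
      field_simp
    rw [e]
    calc _ ≤ |2 * β * (r + 2 * r ^ 3 / 3 + r ^ 5 / 5) - 2 * β * (1 + 2 * 1 ^ 3 / 3 + 1 ^ 5 / 5)|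
          * (r ^ 2 / (1 + r ^ 2) ^ 2) := by gcongr
      _ ≤ (2 * β * (2 * (1 + r) * (1 + r ^ 2) ^ 2)) * (r ^ 2 / (1 + r ^ 2) ^ 2) := by
        gcongr
        have h2 : 0 < r ^ 2 := by positivity
        have h3 : 0 < r ^ 3 := by positivity
        have h4 : 0 < r ^ 4 := by positivity
        have h5 : 0 < r ^ 5 := by positivity
        rw [← mul_sub, abs_mul, abs_of_nonneg (by positivity : 0 ≤ 2 * β)]
        refine mul_le_mul_of_nonneg_left (abs_le.2 ⟨?_, ?_⟩) (by positivity) <;> ring_nf <;> nlinarith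
      _ = _ := by field_simp; ring
  · have h3 := ((hasDerivAt_id r).add (((hasDerivAt_pow 3 r).const_mul 2).div_const 3)).add
        ((hasDerivAt_pow 5 r).div_const 5)
    refine (h3.const_mul (2 * β)).congr_deriv ?_
    push_cast; ring
  · rw [abs_div, abs_mul, abs_mul, abs_of_pos (show 0 < (1 + r ^ 2) ^ 2 by positivity),
        abs_of_pos (show 0 < r ^ 3 by positivity), abs_two, div_le_iff₀ (by positivity)]
    have := hB r hr
    calc 2 * |wronskianQ g Y r| * (1 + r ^ 2) ^ 2 ≤ 2 * (β * r ^ 3) * (1 + r ^ 2) ^ 2 := by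
          gcongr
      _ = _ := by ring

/-! ### Coercivity of `L_Q` on the first order space of index zero -/

theorem hasDerivAt_driftQ_factor {r : ℝ} :
    HasDerivAt (fun r : ℝ => (1 + r ^ 2) ^ 2) (2 * driftQ r * (1 + r ^ 2) ^ 2) r := by
  have h0 : (1 + r ^ 2) ≠ 0 := by positivity
  refine ((hasDerivAt_one_add_sq r).pow 2).congr_deriv ?_
  unfold driftQ; push_cast; field_simp

theorem inv_le_driftQ {r : ℝ} (hr : 1 ≤ r) : 1 / r ≤ driftQ r := by
  unfold driftQ
  rw [div_le_div_iff₀ (by linarith) (by positivity)]; nlinarith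

theorem driftQ_nonneg {r : ℝ} (hr : 0 < r) : 0 ≤ driftQ r := by
  unfold driftQ; positivity

/-- `a = 2r/(1+r²)` gains two powers of `r` over `1/r` at the origin, which pays for a logarithm. -/
theorem driftQ_sq_mul_le {r : ℝ} (hr : 0 < r) : driftQ r ^ 2 * (r ^ 2 * logMinusSq r) ≤ 4 ∧
    driftQ r ^ 2 * (r ^ 2 * logSq r) ≤ 4 * logPlusSq r := by
  have hq : driftQ r ^ 2 = 4 * r ^ 2 / (1 + r ^ 2) ^ 2 := by unfold driftQ; field_simp; ring
  have hL := mul_logSq_le hr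
  have hLp := logSq_pos r
  rcases le_total r 1 with h | h
  · rw [logMinusSq_of_le_one hr h, logPlusSq_of_le_one hr h]
    have : driftQ r ^ 2 * (r ^ 2 * logSq r) ≤ 4 := by
      rw [hq, div_mul_eq_mul_div, div_le_iff₀ (by positivity)]
      have h1 : r ^ 3 * (r * logSq r) ≤ r ^ 3 * (1 + r ^ 2) := by gcongr
      have h2 : r ^ 3 ≤ 1 := pow_le_one₀ hr.le h
      nlinarith [sq_nonneg r]
    exact ⟨this, by linarith⟩
  · rw [logMinusSq_of_one_le h, logPlusSq_of_one_le h]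
    have : driftQ r ^ 2 * r ^ 2 ≤ 4 := by
      rw [hq, div_mul_eq_mul_div, div_le_iff₀ (by positivity)]; nlinarith [sq_nonneg r]
    exact ⟨by linarith, by nlinarith⟩

theorem norm_ofReal_sq (x : ℝ) : ‖(x : ℂ)‖ ^ 2 = x ^ 2 := by
  rw [Complex.norm_real, Real.norm_eq_abs, sq_abs]

theorem measurable_linL {g g₁ : ℝ → ℂ} {Y : ℝ → ℝ} (mg : Measurable g) (mg₁ : Measurable g₁)
    (mY : Measurable Y) : Measurable (linL g g₁ Y) := by
  unfold linL; fun_prop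

theorem norm_sq_one_le {g : ℝ → ℂ} (him : (g 1).im = 0) : ‖g 1‖ ^ 2 = (g 1).re ^ 2 := by
  rw [Complex.sq_norm, Complex.normSq_apply, him]; ring

/-- Coercivity of `L_Q` for profiles normalized at `r = 1`, in terms of masses: the first integral
bounds the nonlocal term pointwise, and Hardy's inequality treats the remaining local equation. -/
theorem massLE_of_linL {g g₁ : ℝ → ℂ} {Y : ℝ → ℝ} {N : ℝ} (hN : 0 ≤ N) (h : IsProfile g g₁ Y)
    (mg : Measurable g) (mg₁ : Measurable g₁) (mY : Measurable Y)
    (hY1 : Y 1 = 0) (him : (g 1).im = 0)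
    (hF : MassLE (Ioi 0) (fun r => r * ‖linL g g₁ Y r‖ ^ 2) N) :
    MassLE (Ioi 0) (fun r => r * ‖g₁ r‖ ^ 2) (70000 * N) ∧
      MassLE (Ioi 0) (fun r => ‖g r‖ ^ 2 / (r * logMinusSq r)) (70000 * N) := by
  have mF := measurable_linL mg mg₁ mY
  -- the first integral is at most `√N r`, as its derivative is at most `√2 r |L_Q g|`
  have hB : ∀ r, 0 < r → wronskianQ g Y r ^ 2 ≤ r ^ 2 * N := fun r hr => by
    have := norm_sq_le_of_deriv_of_tendsto_zero (u := wronskianQ g Y)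
      (q := fun r => ‖linL g g₁ Y r‖) (m := fun r => √2 * r) (Φ := fun r => r ^ 2)
      (fun r hr => h.hasDerivAt_wronskianQ hr)
      ((continuousOn_const.mul (ContinuousOn.div (by fun_prop) (by fun_prop)
        fun r _ => by positivity)).mul (continuous_re.comp_continuousOn h.contF)) h.contF.norm
      (by fun_prop) (fun r hr => ?_) (fun r hr => ?_) hN hF h.tendsto_wronskianQ ?_ hr
    · rwa [Real.norm_eq_abs, sq_abs] at this
    · refine (hasDerivAt_pow 2 r).congr_deriv ?_
      rw [mul_pow, Real.sq_sqrt (by norm_num)]; field_simp; norm_num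
    · rw [norm_mul, Real.norm_eq_abs, abs_of_nonneg (by positivity), Real.norm_eq_abs]
      have h1 : r ^ 2 / (1 + r ^ 2) ≤ r := by
        rw [div_le_iff₀ (by positivity)]; nlinarith [sq_nonneg (r - 1)]
      gcongr
      exact abs_re_le_norm _
    · have : Tendsto (fun r : ℝ => r ^ 2) (𝓝 0) (𝓝 (0 ^ 2)) := (continuous_pow 2).tendsto 0
      rw [zero_pow two_ne_zero] at this
      exact this.mono_left nhdsWithin_le_nhds
  have hB' : ∀ r, 0 < r → |wronskianQ g Y r| ≤ √N * r := fun r hr => by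
    refine abs_le_of_sq_le_sq ?_ (by positivity)
    rw [mul_pow, Real.sq_sqrt hN]; linarith [hB r hr]
  have hY : ∀ r, 0 < r → Y r ^ 2 ≤ 16 * N * r ^ 2 := fun r hr => by
    have h1 := h.abs_Y_le_of_linear hY1 (Real.sqrt_nonneg N) hB' hr
    have h2 := pow_le_pow_left₀ (abs_nonneg _) h1 2
    rw [sq_abs, mul_pow, mul_pow, Real.sq_sqrt hN] at h2
    linarith
  have hg1 : ‖g 1‖ ^ 2 ≤ 2 * N := by
    rw [norm_sq_one_le him, wronskianQ_one g Y, mul_pow, Real.sq_sqrt (by norm_num)]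
    linarith [hB 1 one_pos]
  -- with the nonlocal term moved to the right, `g' + a g = F` is a local equation
  set F : ℝ → ℂ := fun r => g₁ r + driftQ r • g r with hFdef
  have hFc : ContinuousOn F (Ioi 0) := h.cont.add (continuous_driftQ.continuousOn.smul h.contg)
  have mF' : Measurable F := by rw [hFdef]; fun_prop
  have hFM : MassLE (Ioi 0) (fun r => r * ‖F r‖ ^ 2) (258 * N) := by
    refine (MassLE.dom2 (c₁ := 2) (c₂ := 256 * N) measurableSet_Ioi (by fun_prop) (by norm_num)
      (by positivity) hN zero_le_one (fun r hr => ?_) hF massLE_div_sq).mono_right (by linarith)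
    have hr : 0 < r := hr
    have h1 := norm_sub_sq_le' (linL g g₁ Y r) ((kerQ r * Y r : ℝ) : ℂ)
    rw [show linL g g₁ Y r - ((kerQ r * Y r : ℝ) : ℂ) = F r by simp [linL, hFdef],
      norm_ofReal_sq, mul_pow, kerQ_sq] at h1
    have h2 : 8 / (r ^ 2 * (1 + r ^ 2) ^ 2) * Y r ^ 2 ≤ 8 / (r ^ 2 * (1 + r ^ 2) ^ 2) * (16 * N * r ^ 2) := by
      have := hY r hr
      gcongr
    have h3 : r * (8 / (r ^ 2 * (1 + r ^ 2) ^ 2) * (16 * N * r ^ 2)) = 128 * N * (r / (1 + r ^ 2) ^ 2) := by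
      field_simp; ring
    nlinarith
  have hg : ∀ r, 0 < r → HasDerivAt g (F r - driftQ r • g r) r := fun r hr => by
    simpa [hFdef] using h.deriv r hr
  have near : MassLE (Ioc 0 1) (fun r => ‖g r‖ ^ 2 / (r * logMinusSq r)) (8288 * N) := by
    have E := massLE_log_hardy (M := 1032 * N) hg (fun r _ => hasDerivAt_driftQ_factor)
      (fun r _ => by positivity) hFc (by positivity)
      ((MassLE.dom1 (c₁ := 4) measurableSet_Ioc (by norm_num) (fun r hr => ?_)
        (hFM.mono_set Ioc_subset_Ioi_self)).mono_right (by linarith))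
    · refine (MassLE.dom1 (c₁ := 1) measurableSet_Ioc (by norm_num) (fun r hr => ?_) E).mono_right ?_
      · rw [logMinusSq_of_le_one hr.1 hr.2, one_mul]
        have := logSq_pos r
        have hr0 : 0 < r := hr.1
        gcongr
        exact le_mul_of_one_le_left (by positivity) (by nlinarith [sq_nonneg r])
      · norm_num; linarith
    · have hr0 : 0 < r := hr.1
      have h2 : 1 + r ^ 2 ≤ 2 := by nlinarith [hr.2]
      have : (1 + r ^ 2) ^ 2 ≤ 4 := by nlinarith [sq_nonneg r]
      calc r * (1 + r ^ 2) ^ 2 * ‖F r‖ ^ 2 = (1 + r ^ 2) ^ 2 * (r * ‖F r‖ ^ 2) := by ring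
        _ ≤ _ := by gcongr
  have far : MassLE (Ioi 1) (fun r => ‖g r‖ ^ 2 / (r * logMinusSq r)) (260 * N) := by
    have E := massLE_hardy_Ioi (φ := fun _ => 1) (φ' := fun _ => 0) (M := 258 * N) hg
      (fun r _ => hasDerivAt_const r 1) (fun _ _ => zero_le_one)
      (fun r hr => by have := inv_le_driftQ (le_of_lt hr); ring_nf at this ⊢; linarith) hFc
      (by positivity) (by simpa using hFM.mono_set (Ioi_subset_Ioi zero_le_one))
    refine (MassLE.dom1 (c₁ := 1) measurableSet_Ioi (by norm_num) (fun r hr => ?_) E).mono_right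
      (by linarith)
    rw [logMinusSq_of_one_le (le_of_lt hr)]; simp
  have hgM := (MassLE.glue (by positivity) (by positivity) near far)
  refine ⟨?_, hgM.mono_right (by linarith)⟩
  refine (MassLE.dom2 (c₁ := 2) (c₂ := 8) measurableSet_Ioi (by fun_prop) (by norm_num)
    (by norm_num) (by positivity) (by positivity) (fun r hr => ?_) hFM hgM).mono_right (by linarith)
  have hr : 0 < r := hr
  have h1 := norm_sub_sq_le' (F r) (driftQ r • g r)
  rw [show F r - driftQ r • g r = g₁ r by simp [hFdef], norm_smul_sq] at h1
  have h2 : r * driftQ r ^ 2 ≤ 4 / (r * logMinusSq r) := by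
    rw [le_div_iff₀ (mul_pos hr (logMinusSq_pos r))]
    linarith [(driftQ_sq_mul_le hr).1]
  have h3 := mul_le_mul_of_nonneg_right h2 (sq_nonneg ‖g r‖)
  calc r * ‖g₁ r‖ ^ 2 ≤ r * _ := mul_le_mul_of_nonneg_left h1 hr.le
    _ = 2 * (r * ‖F r‖ ^ 2) + 2 * (r * driftQ r ^ 2 * ‖g r‖ ^ 2) := by ring
    _ ≤ 2 * (r * ‖F r‖ ^ 2) + 2 * (4 / (r * logMinusSq r) * ‖g r‖ ^ 2) := by linarith
    _ = _ := by ring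

theorem continuousOn_logMinusSq : ContinuousOn logMinusSq (Ioi 0) := by
  unfold logMinusSq logMinus
  exact continuousOn_const.add
    ((continuousOn_const.sup ((Real.continuousOn_log.mono fun r hr => ne_of_gt hr).neg)).pow 2)

/-- Boundedness of `L_Q` on the first order space, in terms of masses. -/
theorem massLE_linL {g g₁ : ℝ → ℂ} {Y : ℝ → ℝ} {N : ℝ} (hN : 0 ≤ N) (h : IsProfile g g₁ Y)
    (mg : Measurable g) (mg₁ : Measurable g₁)
    (h1 : MassLE (Ioi 0) (fun r => r * ‖g₁ r‖ ^ 2) N)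
    (h2 : MassLE (Ioi 0) (fun r => ‖g r‖ ^ 2 / (r * logMinusSq r)) N) :
    MassLE (Ioi 0) (fun r => r * ‖linL g g₁ Y r‖ ^ 2) (63 * N) := by
  have hY : ∀ r, 0 < r → Y r ^ 2 ≤ 2 * r ^ 2 * N := fun r hr => by
    have := norm_sq_le_of_deriv_of_tendsto_zero (u := Y)
      (q := fun r => ‖g r‖ / (r * √(logMinusSq r))) (m := fun r => 2 * r) (Φ := fun r => 2 * r ^ 2)
      (fun r hr => h.derivY r hr)
      ((ContinuousOn.div (by fun_prop) (by fun_prop)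
        fun r _ => by positivity).mul (continuous_re.comp_continuousOn h.contg))
      (h.contg.norm.div (continuousOn_id.mul (continuousOn_logMinusSq.sqrt))
        fun r hr => (mul_pos hr (Real.sqrt_pos.2 (logMinusSq_pos r))).ne')
      (by fun_prop) (fun r hr => ?_) (fun r hr => ?_) hN
      ((MassLE.dom1 (c₁ := 1) measurableSet_Ioi zero_le_one (fun r hr => ?_) h2).mono_right
        (one_mul N).le) h.zeroY ?_ hr
    · rwa [Real.norm_eq_abs, sq_abs] at this
    · refine ((hasDerivAt_pow 2 r).const_mul 2).congr_deriv ?_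
      push_cast; field_simp
    · have hL := logMinusSq_pos r
      have hs : 0 < √(logMinusSq r) := Real.sqrt_pos.2 hL
      rw [norm_mul, Real.norm_eq_abs, Real.norm_eq_abs, abs_of_nonneg (by positivity)]
      have k1 : 2 * r ^ 2 * logMinusSq r ≤ (1 + r ^ 2) ^ 2 := by
        have := mul_logSq_le hr
        have h3 : r * logMinusSq r ≤ 1 + r ^ 2 :=
          (mul_le_mul_of_nonneg_left (logMinusSq_le_logSq r) hr.le).trans this
        nlinarith [sq_nonneg (r - 1), sq_nonneg r]
      have k2 : √8 * r * √(logMinusSq r) ≤ 2 * (1 + r ^ 2) := by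
        refine le_of_sq_le_sq ?_ (by positivity)
        rw [mul_pow, mul_pow, Real.sq_sqrt (by norm_num), Real.sq_sqrt hL.le]; nlinarith
      calc √8 * r / (1 + r ^ 2) * |(g r).re| ≤ √8 * r / (1 + r ^ 2) * ‖g r‖ := by
            gcongr; exact abs_re_le_norm _
        _ = (√8 * r * √(logMinusSq r)) / (1 + r ^ 2) * (‖g r‖ / √(logMinusSq r)) := by field_simp
        _ ≤ (2 * (1 + r ^ 2)) / (1 + r ^ 2) * (‖g r‖ / √(logMinusSq r)) := by gcongr
        _ = _ := by field_simp
    · have hL := logMinusSq_pos r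
      have hr : 0 < r := hr
      rw [div_pow, mul_pow, Real.sq_sqrt hL.le]
      refine le_of_eq ?_
      field_simp
    · have : Tendsto (fun r : ℝ => 2 * r ^ 2) (𝓝 0) (𝓝 (2 * 0 ^ 2)) :=
        (by fun_prop : Continuous fun r : ℝ => 2 * r ^ 2).tendsto 0
      rw [zero_pow two_ne_zero, mul_zero] at this
      exact this.mono_left nhdsWithin_le_nhds
  refine (MassLE.dom3 (c₁ := 3) (c₂ := 12) (c₃ := 48 * N) measurableSet_Ioi (by fun_prop)
    (by fun_prop) (by norm_num) (by norm_num) (by positivity) hN hN zero_le_one (fun r hr => ?_)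
    h1 h2 massLE_div_sq).mono_right (by linarith)
  have hr : 0 < r := hr
  have k1 := norm_add₃_sq_le (g₁ r) (driftQ r • g r) ((kerQ r * Y r : ℝ) : ℂ)
  rw [norm_smul_sq, norm_ofReal_sq, mul_pow, kerQ_sq] at k1
  have k2 : r * driftQ r ^ 2 ≤ 4 / (r * logMinusSq r) := by
    rw [le_div_iff₀ (mul_pos hr (logMinusSq_pos r))]
    linarith [(driftQ_sq_mul_le hr).1]
  have k3 := mul_le_mul_of_nonneg_right k2 (sq_nonneg ‖g r‖)
  have k4 : 8 / (r ^ 2 * (1 + r ^ 2) ^ 2) * Y r ^ 2 ≤ 8 / (r ^ 2 * (1 + r ^ 2) ^ 2) * (2 * r ^ 2 * N) := by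
    have := hY r hr
    gcongr
  have k5 : r * (8 / (r ^ 2 * (1 + r ^ 2) ^ 2) * (2 * r ^ 2 * N)) = 16 * N * (r / (1 + r ^ 2) ^ 2) := by
    field_simp; ring
  have k6 := mul_le_mul_of_nonneg_left k4 hr.le
  calc r * ‖linL g g₁ Y r‖ ^ 2 ≤ r * _ := mul_le_mul_of_nonneg_left k1 hr.le
    _ = 3 * (r * ‖g₁ r‖ ^ 2) + 3 * (r * driftQ r ^ 2 * ‖g r‖ ^ 2)
        + 3 * (r * (8 / (r ^ 2 * (1 + r ^ 2) ^ 2) * Y r ^ 2)) := by ring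
    _ ≤ 3 * (r * ‖g₁ r‖ ^ 2) + 3 * (4 / (r * logMinusSq r) * ‖g r‖ ^ 2)
        + 3 * (16 * N * (r / (1 + r ^ 2) ^ 2)) := by linarith
    _ = _ := by ring

/-! ### Coercivity of `A_Q` on the second order space of index one -/

/-- The zeroth order coefficient `r⁻¹ (1 + A_θ[Q])` of `A_Q`. -/
def coefA (r : ℝ) : ℝ := 1 / r - driftQ r

/-- The derivative of `driftQ`. -/
def driftQ' (r : ℝ) : ℝ := 2 * (1 - r ^ 2) / (1 + r ^ 2) ^ 2

@[fun_prop]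
theorem measurable_coefA : Measurable coefA := by unfold coefA; fun_prop

@[fun_prop]
theorem measurable_driftQ' : Measurable driftQ' := by unfold driftQ'; fun_prop

theorem hasDerivAt_driftQ (r : ℝ) : HasDerivAt driftQ (driftQ' r) r := by
  have h0 : (1 + r ^ 2) ≠ 0 := by positivity
  refine (((hasDerivAt_id r).const_mul 2).div (hasDerivAt_one_add_sq r) h0).congr_deriv ?_
  unfold driftQ'; simp only [id]; field_simp; ring

theorem hasDerivAt_one_div {r : ℝ} (hr : r ≠ 0) : HasDerivAt (fun r : ℝ => 1 / r) (-(1 / r ^ 2)) r := by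
  simpa [one_div] using hasDerivAt_inv hr

theorem hasDerivAt_coefA {r : ℝ} (hr : r ≠ 0) :
    HasDerivAt coefA (-(1 / r ^ 2) - driftQ' r) r :=
  (hasDerivAt_one_div hr).sub (hasDerivAt_driftQ r)

theorem continuousOn_coefA : ContinuousOn coefA (Ioi 0) :=
  fun _ hr => (hasDerivAt_coefA (ne_of_gt hr)).continuousAt.continuousWithinAt

theorem coefA_sq_le {r : ℝ} (hr : 0 < r) : coefA r ^ 2 ≤ 1 / r ^ 2 := by
  have h : coefA r = (1 - r ^ 2) / (r * (1 + r ^ 2)) := by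
    unfold coefA driftQ; field_simp; ring
  rw [h, div_pow, div_le_div_iff₀ (by positivity) (by positivity)]
  nlinarith [sq_nonneg r, mul_pos (pow_pos hr 2) (pow_pos hr 2)]

theorem continuous_driftQ' : Continuous driftQ' := by
  unfold driftQ'
  exact Continuous.div (by fun_prop) (by fun_prop) fun r => by positivity

theorem continuous_coef_four : Continuous fun r : ℝ => 4 / (1 + r ^ 2) ^ 2 :=
  Continuous.div (by fun_prop) (by fun_prop) fun r => by positivity

theorem one_le_one_add_sq (r : ℝ) : 1 ≤ 1 + r ^ 2 := by nlinarith [sq_nonneg r]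

theorem sq_mul_logPlusSq_le {r : ℝ} (hr : 0 < r) : r ^ 2 * logPlusSq r ≤ (1 + r ^ 2) ^ 2 ∧
    logPlusSq r ≤ (1 + r ^ 2) ^ 2 := by
  rcases le_total r 1 with h | h
  · rw [logPlusSq_of_le_one hr h]; constructor <;> nlinarith [sq_nonneg r]
  · rw [logPlusSq_of_one_le h]
    have := mul_logSq_le hr
    have h2 := logSq_pos r
    constructor <;> nlinarith [sq_nonneg r]

theorem pow_mul_logSq_le {r : ℝ} (hr : 0 < r) :
    r ^ 4 * logSq r ≤ (1 + r ^ 2) ^ 4 ∧ r ^ 6 * logSq r ≤ (1 + r ^ 2) ^ 4 := by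
  have h := mul_logSq_le hr
  have h1 := one_le_one_add_sq r
  have e1 : r ^ 4 * logSq r ≤ r ^ 3 * (1 + r ^ 2) := by
    calc r ^ 4 * logSq r = r ^ 3 * (r * logSq r) := by ring
      _ ≤ _ := by gcongr
  have e2 : r ^ 6 * logSq r ≤ r ^ 5 * (1 + r ^ 2) := by
    calc r ^ 6 * logSq r = r ^ 5 * (r * logSq r) := by ring
      _ ≤ _ := by gcongr
  have h3 : r ≤ 1 + r ^ 2 := by nlinarith [sq_nonneg (r - 1)]
  have h4 : r ^ 2 ≤ 1 + r ^ 2 := by linarith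
  have h5 : 0 < 1 + r ^ 2 := by positivity
  constructor
  · calc _ ≤ _ := e1
      _ = r * r ^ 2 * (1 + r ^ 2) := by ring
      _ ≤ (1 + r ^ 2) * (1 + r ^ 2) * (1 + r ^ 2) := by gcongr
      _ = (1 + r ^ 2) ^ 3 * 1 := by ring
      _ ≤ (1 + r ^ 2) ^ 3 * (1 + r ^ 2) := by gcongr
      _ = _ := by ring
  · calc _ ≤ _ := e2
      _ = r * r ^ 2 * r ^ 2 * (1 + r ^ 2) := by ring
      _ ≤ (1 + r ^ 2) * (1 + r ^ 2) * (1 + r ^ 2) * (1 + r ^ 2) := by gcongr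
      _ = _ := by ring

/-- Multiplies a pointwise bound of weights by a density. -/
theorem weight_mul_le {c d x : ℝ} (h : c ≤ d) (hx : 0 ≤ x) : c * x ≤ d * x :=
  mul_le_mul_of_nonneg_right h hx

/-- Coercivity of `A_Q` for profiles vanishing at `r = 1`, in terms of masses. The second derivative
is recovered from `p = g' - g / r`, which solves `p' + a p = F' - 4 g / (1 + r²)²`; estimating `g''`
from `F'`, `F / r` and `g / r²` separately would lose a logarithm at infinity. -/
theorem massLE_of_opA {g g₁ g₂ : ℝ → ℂ} {N : ℝ} (hN : 0 ≤ N)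
    (mg : Measurable g) (mg₁ : Measurable g₁) (mg₂ : Measurable g₂)
    (hg : ∀ r, 0 < r → HasDerivAt g (g₁ r) r) (hg₁ : ∀ r, 0 < r → HasDerivAt g₁ (g₂ r) r)
    (hc : ContinuousOn g₂ (Ioi 0)) (hp0 : Tendsto (fun r => g₁ r - (1 / r) • g r) (𝓝[>] 0) (𝓝 0))
    (h1 : g 1 = 0)
    (hF₁ : MassLE (Ioi 0)
      (fun r => r * ‖g₂ r - coefA r • g₁ r - (-(1 / r ^ 2) - driftQ' r) • g r‖ ^ 2) N)
    (hF : MassLE (Ioi 0) (fun r => ‖g₁ r - coefA r • g r‖ ^ 2 / (r * logPlusSq r)) N) :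
    MassLE (Ioi 0) (fun r => r * ‖g₂ r‖ ^ 2) (10000 * N) ∧
      MassLE (Ioi 0) (fun r => ‖g₁ r‖ ^ 2 / (r * logSq r)) (10000 * N) ∧
      MassLE (Ioi 0) (fun r => ‖g r‖ ^ 2 / (r ^ 3 * logSq r)) (10000 * N) := by
  have hgc : ContinuousOn g (Ioi 0) := fun r hr => (hg r hr).continuousAt.continuousWithinAt
  have hgc₁ : ContinuousOn g₁ (Ioi 0) := fun r hr => (hg₁ r hr).continuousAt.continuousWithinAt
  set F : ℝ → ℂ := fun r => g₁ r - coefA r • g r with hFdef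
  set F₁ : ℝ → ℂ := fun r => g₂ r - coefA r • g₁ r - (-(1 / r ^ 2) - driftQ' r) • g r with hF₁def
  have mF : Measurable F := by rw [hFdef]; fun_prop
  have mF₁ : Measurable F₁ := by rw [hF₁def]; fun_prop
  have hFc : ContinuousOn F (Ioi 0) := hgc₁.sub (continuousOn_coefA.smul hgc)
  have hgF : ∀ r, 0 < r → HasDerivAt g (F r - (driftQ r - 1 / r) • g r) r := fun r hr => by
    refine (hg r hr).congr_deriv ?_
    simp only [hFdef, coefA]; module
  -- Hardy inequalities from `r = 1`, where `g` vanishes, towards the origin and towards infinity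
  have near : MassLE (Ioc 0 1) (fun r => ‖g r‖ ^ 2 / (r ^ 3 * logSq r)) (32 * N) := by
    have E := massLE_log_hardy (G := fun r => (1 + r ^ 2) ^ 2 / r ^ 2) (M := 4 * N) hgF
      (fun r hr => ?_) (fun r hr => by positivity) hFc (by positivity)
      (MassLE.dom1 (c₁ := 4) measurableSet_Ioc (by norm_num) (fun r hr => ?_)
        (hF.mono_set Ioc_subset_Ioi_self))
    · refine (MassLE.dom1 (c₁ := 1) measurableSet_Ioc (by norm_num) (fun r hr => ?_) E).mono_right ?_
      · have := logSq_pos r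
        have hr0 : 0 < r := hr.1
        have e1 : (1 + r ^ 2) ^ 2 / r ^ 2 * ‖g r‖ ^ 2 / (r * logSq r)
          = (1 + r ^ 2) ^ 2 * (‖g r‖ ^ 2 / (r ^ 3 * logSq r)) := by field_simp
        rw [e1, one_mul]
        refine le_mul_of_one_le_left (by positivity) (by nlinarith [sq_nonneg r])
      · simp [h1]; linarith
    · refine (hasDerivAt_driftQ_factor.div (hasDerivAt_pow 2 r) (by positivity)).congr_deriv ?_
      unfold driftQ; push_cast; field_simp
    · have hr0 : 0 < r := hr.1
      rw [logPlusSq_of_le_one hr0 hr.2]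
      have h2 : 1 + r ^ 2 ≤ 2 := by nlinarith [hr.2]
      have : (1 + r ^ 2) ^ 2 ≤ 4 := by nlinarith [sq_nonneg r]
      calc r * ((1 + r ^ 2) ^ 2 / r ^ 2) * ‖F r‖ ^ 2 = (1 + r ^ 2) ^ 2 * (‖F r‖ ^ 2 / (r * 1)) := by
            field_simp
        _ ≤ _ := by gcongr
  have far : MassLE (Ioi 1) (fun r => ‖g r‖ ^ 2 / (r ^ 3 * logSq r)) N := by
    have E := massLE_hardy_Ioi (φ := fun r => (r ^ 2 * logSq r)⁻¹)
      (φ' := fun r => -(2 * r * logSq r + r ^ 2 * (2 * Real.log r / r)) / (r ^ 2 * logSq r) ^ 2)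
      (M := N) hgF
      (fun r hr => by
        have hL := logSq_pos r
        have := ((hasDerivAt_pow 2 r).mul (hasDerivAt_logSq hr)).inv
          (by simp only [Pi.mul_apply]; positivity)
        refine this.congr_deriv ?_
        simp)
      (fun r hr => by have hL := logSq_pos r; positivity)
      (fun r hr => ?_) hFc hN
      ((MassLE.dom1 (c₁ := 1) measurableSet_Ioi (by norm_num) (fun r hr => ?_)
        (hF.mono_set (Ioi_subset_Ioi zero_le_one))).mono_right (one_mul N).le)
    · refine (MassLE.dom1 (c₁ := 1) measurableSet_Ioi (by norm_num) (fun r hr => ?_) E).mono_right ?_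
      · have hr0 : (0 : ℝ) < r := zero_lt_one.trans hr
        have hL := logSq_pos r
        refine le_of_eq ?_
        field_simp
      · simp [h1]
    · have hr0 : (0 : ℝ) < r := zero_lt_one.trans hr
      have hL := logSq_pos r
      have hlog := Real.log_nonneg (le_of_lt hr)
      have hV : 0 ≤ driftQ r - 1 / r := by linarith [inv_le_driftQ (le_of_lt hr)]
      have e1 : -(2 * r * logSq r + r ^ 2 * (2 * Real.log r / r)) / (r ^ 2 * logSq r) ^ 2
        = -(2 * (r ^ 2 * logSq r)⁻¹ / r) - 2 * Real.log r * r / (r ^ 2 * logSq r) ^ 2 := by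
        field_simp; ring
      rw [e1]
      have h3 : 0 ≤ 2 * Real.log r * r / (r ^ 2 * logSq r) ^ 2 := by positivity
      have h4 : 0 ≤ 2 * (r ^ 2 * logSq r)⁻¹ * (driftQ r - 1 / r) := by positivity
      linarith
    · have hr0 : (0 : ℝ) < r := zero_lt_one.trans hr
      have hL := logSq_pos r
      rw [logPlusSq_of_one_le (le_of_lt hr)]
      refine le_of_eq ?_
      simp only [hFdef]
      field_simp
  have hgM : MassLE (Ioi 0) (fun r => ‖g r‖ ^ 2 / (r ^ 3 * logSq r)) (33 * N) :=
    (MassLE.glue (by positivity) hN near far).mono_right (by linarith)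
  -- `p' + a p = S`, where the terms of size `g / r²` cancel at the origin and at infinity
  set p : ℝ → ℂ := fun r => g₁ r - (1 / r) • g r with hpdef
  set S : ℝ → ℂ := fun r => F₁ r - (4 / (1 + r ^ 2) ^ 2) • g r with hSdef
  have mp : Measurable p := by rw [hpdef]; fun_prop
  have mS : Measurable S := by rw [hSdef]; fun_prop
  have hpF : ∀ r, p r = F r - driftQ r • g r := fun r => by
    simp only [hpdef, hFdef, coefA]; module
  have hpd : ∀ r, 0 < r → HasDerivAt p (S r - driftQ r • p r) r := fun r hr => by
    refine ((hg₁ r hr).sub ((hasDerivAt_one_div hr.ne').smul (hg r hr))).congr_deriv ?_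
    have hid : driftQ r * (1 / r) + driftQ' r = 4 / (1 + r ^ 2) ^ 2 := by
      unfold driftQ driftQ'; field_simp; ring
    simp only [hSdef, hF₁def, hpdef, coefA, ← hid]
    module
  have hSc : ContinuousOn S (Ioi 0) := by
    have c1 : ContinuousOn (fun r : ℝ => -(1 / r ^ 2) - driftQ' r) (Ioi 0) :=
      ((continuousOn_const.div (by fun_prop) fun r (hr : 0 < r) => by positivity).neg).sub
        continuous_driftQ'.continuousOn
    exact ((hc.sub (continuousOn_coefA.smul hgc₁)).sub (c1.smul hgc)).sub
      (continuous_coef_four.continuousOn.smul hgc)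
  have hSM : MassLE (Ioi 0) (fun r => r * ‖S r‖ ^ 2) (1058 * N) := by
    refine (MassLE.dom2 (c₁ := 2) (c₂ := 32) measurableSet_Ioi (by fun_prop) (by norm_num)
      (by norm_num) hN (by positivity) (fun r hr => ?_) hF₁ hgM).mono_right (by linarith)
    have hr : 0 < r := hr
    have k1 := norm_sub_sq_le' (F₁ r) ((4 / (1 + r ^ 2) ^ 2) • g r)
    rw [norm_smul_sq] at k1
    have k2 : r * (4 / (1 + r ^ 2) ^ 2) ^ 2 ≤ 16 / (r ^ 3 * logSq r) := by
      have hL := logSq_pos r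
      rw [div_pow, ← mul_div_assoc, div_le_div_iff₀ (by positivity) (by positivity)]
      have := (pow_mul_logSq_le hr).1
      nlinarith
    have k3 := weight_mul_le k2 (sq_nonneg ‖g r‖)
    calc r * ‖S r‖ ^ 2 ≤ r * _ := mul_le_mul_of_nonneg_left k1 hr.le
      _ = 2 * (r * ‖F₁ r‖ ^ 2) + 2 * (r * (4 / (1 + r ^ 2) ^ 2) ^ 2 * ‖g r‖ ^ 2) := by ring
      _ ≤ 2 * (r * ‖F₁ r‖ ^ 2) + 2 * (16 / (r ^ 3 * logSq r) * ‖g r‖ ^ 2) := by linarith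
      _ = _ := by ring
  have hp_le : ∀ r, 0 < r → ‖p r‖ ^ 2 ≤ 2 * ‖F r‖ ^ 2 + 2 * (driftQ r ^ 2 * ‖g r‖ ^ 2) := fun r hr => by
    have := norm_sub_sq_le' (F r) (driftQ r • g r)
    rwa [norm_smul_sq, ← hpF] at this
  have hε : MassLE (Ioi 0) (fun r => 2 * r / (1 + r ^ 2) ^ 2 * ‖p r‖ ^ 2) (532 * N) := by
    refine (MassLE.dom2 (c₁ := 4) (c₂ := 16) measurableSet_Ioi (by fun_prop) (by norm_num)
      (by norm_num) hN (by positivity) (fun r hr => ?_) hF hgM).mono_right (by linarith)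
    have hr : 0 < r := hr
    have hL := logSq_pos r
    have hL' := logPlusSq_pos r
    have k1 : 2 * r / (1 + r ^ 2) ^ 2 ≤ 2 / (r * logPlusSq r) := by
      rw [div_le_div_iff₀ (by positivity) (by positivity)]
      nlinarith [(sq_mul_logPlusSq_le hr).1]
    have k2 : 2 * r / (1 + r ^ 2) ^ 2 * driftQ r ^ 2 ≤ 8 / (r ^ 3 * logSq r) := by
      have e : 2 * r / (1 + r ^ 2) ^ 2 * driftQ r ^ 2 = 8 * r ^ 3 / (1 + r ^ 2) ^ 4 := by
        unfold driftQ; field_simp; ring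
      rw [e, div_le_div_iff₀ (by positivity) (by positivity)]
      nlinarith [(pow_mul_logSq_le hr).2]
    have k3 := weight_mul_le k1 (sq_nonneg ‖F r‖)
    have k4 := weight_mul_le k2 (sq_nonneg ‖g r‖)
    calc 2 * r / (1 + r ^ 2) ^ 2 * ‖p r‖ ^ 2
        ≤ 2 * r / (1 + r ^ 2) ^ 2 * (2 * ‖F r‖ ^ 2 + 2 * (driftQ r ^ 2 * ‖g r‖ ^ 2)) := by
          have := hp_le r hr
          gcongr
      _ = 2 * (2 * r / (1 + r ^ 2) ^ 2 * ‖F r‖ ^ 2)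
          + 2 * (2 * r / (1 + r ^ 2) ^ 2 * driftQ r ^ 2 * ‖g r‖ ^ 2) := by ring
      _ ≤ 2 * (2 / (r * logPlusSq r) * ‖F r‖ ^ 2) + 2 * (8 / (r ^ 3 * logSq r) * ‖g r‖ ^ 2) := by
          linarith
      _ = _ := by ring
  have cφ : Continuous fun r : ℝ => r ^ 2 / (1 + r ^ 2) :=
    Continuous.div (by fun_prop) (by fun_prop) fun r => by positivity
  have hpM : MassLE (Ioi 0) (fun r => 4 * r ^ 3 / (1 + r ^ 2) ^ 2 * ‖p r‖ ^ 2) (2124 * N) := by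
    refine (massLE_energy_Ioi (φ := fun r => r ^ 2 / (1 + r ^ 2))
      (φ' := fun r => 2 * r / (1 + r ^ 2) ^ 2) (V := driftQ)
      (κ := fun r => 4 * r ^ 3 / (1 + r ^ 2) ^ 2) (ω := fun r => r / 4)
      (ε := fun r => 2 * r / (1 + r ^ 2) ^ 2) (P₀ := 0) (M := 265 * N) (M' := 532 * N)
      hpd (fun r hr => ?_) hSc
      (Continuous.div (by fun_prop) (by fun_prop) fun r => by positivity).continuousOn
      (by fun_prop)
      (Continuous.div (by fun_prop) (by fun_prop) fun r => by positivity).continuousOn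
      (fun r hr => by positivity) (fun r hr => by positivity) (fun r hr => by positivity)
      (fun r hr => by positivity) (fun r hr => le_of_eq ?_) (fun r hr => le_of_eq ?_) ?_
      (by positivity) (by positivity) ?_ hε).mono_right (by linarith)
    · refine ((hasDerivAt_pow 2 r).div (hasDerivAt_one_add_sq r) (by positivity)).congr_deriv ?_
      push_cast; field_simp; ring
    · unfold driftQ; field_simp; ring
    · field_simp
    · have := ((cφ.tendsto 0).mono_left (nhdsWithin_le_nhds (s := Ioi 0))).mul (hp0.norm.pow 2)
      simpa using this
    · exact (MassLE.dom1 (c₁ := 1 / 4) measurableSet_Ioi (by norm_num)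
        (fun r _ => le_of_eq (by ring)) hSM).mono_right (by linarith)
  refine ⟨?_, ?_, hgM.mono_right (by linarith)⟩
  · have hq : MassLE (Ioi 0) (fun r => 1 / (r * (1 + r ^ 2) ^ 2) * ‖p r‖ ^ 2) (266 * N) := by
      refine (MassLE.dom2 (c₁ := 2) (c₂ := 8) measurableSet_Ioi (by fun_prop) (by norm_num)
        (by norm_num) hN (by positivity) (fun r hr => ?_) hF hgM).mono_right (by linarith)
      have hr : 0 < r := hr
      have hL := logSq_pos r
      have hL' := logPlusSq_pos r
      have k1 : 1 / (r * (1 + r ^ 2) ^ 2) ≤ 1 / (r * logPlusSq r) := by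
        have := (sq_mul_logPlusSq_le hr).2
        gcongr
      have k2 : 1 / (r * (1 + r ^ 2) ^ 2) * driftQ r ^ 2 ≤ 4 / (r ^ 3 * logSq r) := by
        have e : 1 / (r * (1 + r ^ 2) ^ 2) * driftQ r ^ 2 = 4 * r / (1 + r ^ 2) ^ 4 := by
          unfold driftQ; field_simp; ring
        rw [e, div_le_div_iff₀ (by positivity) (by positivity)]
        nlinarith [(pow_mul_logSq_le hr).1]
      have k3 := weight_mul_le k1 (sq_nonneg ‖F r‖)
      have k4 := weight_mul_le k2 (sq_nonneg ‖g r‖)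
      calc 1 / (r * (1 + r ^ 2) ^ 2) * ‖p r‖ ^ 2
          ≤ 1 / (r * (1 + r ^ 2) ^ 2) * (2 * ‖F r‖ ^ 2 + 2 * (driftQ r ^ 2 * ‖g r‖ ^ 2)) := by
            have := hp_le r hr
            gcongr
        _ = 2 * (1 / (r * (1 + r ^ 2) ^ 2) * ‖F r‖ ^ 2)
            + 2 * (1 / (r * (1 + r ^ 2) ^ 2) * driftQ r ^ 2 * ‖g r‖ ^ 2) := by ring
        _ ≤ 2 * (1 / (r * logPlusSq r) * ‖F r‖ ^ 2) + 2 * (4 / (r ^ 3 * logSq r) * ‖g r‖ ^ 2) := by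
            linarith
        _ = _ := by ring
    refine (MassLE.dom3 (c₁ := 2) (c₂ := 2) (c₃ := 1 / 2) measurableSet_Ioi (by fun_prop) (by fun_prop)
      (by norm_num) (by norm_num) (by norm_num) (by positivity) (by positivity) (by positivity)
      (fun r hr => ?_) hSM hq hpM).mono_right (by linarith)
    have hr : 0 < r := hr
    have k1 := norm_add_sq_le' (S r) (coefA r • p r)
    rw [norm_smul_sq] at k1
    have hid : driftQ r * (1 / r) + driftQ' r = 4 / (1 + r ^ 2) ^ 2 := by
      unfold driftQ driftQ'; field_simp; ring
    have e2 : S r + coefA r • p r = g₂ r := by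
      simp only [hSdef, hF₁def, hpdef, coefA, ← hid]
      module
    rw [e2] at k1
    have k2 : r * coefA r ^ 2 ≤ 1 / (r * (1 + r ^ 2) ^ 2) + r ^ 3 / (1 + r ^ 2) ^ 2 := by
      have e : coefA r = (1 - r ^ 2) / (r * (1 + r ^ 2)) := by
        unfold coefA driftQ; field_simp; ring
      have e' : 1 / (r * (1 + r ^ 2) ^ 2) + r ^ 3 / (1 + r ^ 2) ^ 2
        = (1 + r ^ 4) / (r * (1 + r ^ 2) ^ 2) := by field_simp
      have e'' : r * coefA r ^ 2 = (1 - r ^ 2) ^ 2 / (r * (1 + r ^ 2) ^ 2) := by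
        rw [e]; field_simp
      rw [e', e'']
      gcongr
      nlinarith [sq_nonneg r]
    have k3 := weight_mul_le k2 (sq_nonneg ‖p r‖)
    calc r * ‖g₂ r‖ ^ 2 ≤ r * _ := mul_le_mul_of_nonneg_left k1 hr.le
      _ = 2 * (r * ‖S r‖ ^ 2) + 2 * (r * coefA r ^ 2 * ‖p r‖ ^ 2) := by ring
      _ ≤ 2 * (r * ‖S r‖ ^ 2)
          + 2 * ((1 / (r * (1 + r ^ 2) ^ 2) + r ^ 3 / (1 + r ^ 2) ^ 2) * ‖p r‖ ^ 2) := by linarith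
      _ = _ := by ring
  · refine (MassLE.dom2 (c₁ := 2) (c₂ := 2) measurableSet_Ioi (by fun_prop) (by norm_num)
      (by norm_num) hN (by positivity) (fun r hr => ?_) hF hgM).mono_right (by linarith)
    have hr : 0 < r := hr
    have hL := logSq_pos r
    have hL' := logPlusSq_pos r
    have k1 := norm_add_sq_le' (F r) (coefA r • g r)
    rw [norm_smul_sq, show F r + coefA r • g r = g₁ r by simp [hFdef]] at k1
    have k2 := weight_mul_le (coefA_sq_le hr) (sq_nonneg ‖g r‖)
    have k3 : 1 / (r * logSq r) ≤ 1 / (r * logPlusSq r) := by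
      have := logPlusSq_le_logSq r
      gcongr
    have k4 := weight_mul_le k3 (sq_nonneg ‖F r‖)
    calc ‖g₁ r‖ ^ 2 / (r * logSq r) = 1 / (r * logSq r) * ‖g₁ r‖ ^ 2 := by ring
      _ ≤ 1 / (r * logSq r) * (2 * ‖F r‖ ^ 2 + 2 * (1 / r ^ 2 * ‖g r‖ ^ 2)) := by
          gcongr; linarith
      _ = 2 * (1 / (r * logSq r) * ‖F r‖ ^ 2) + 2 * (‖g r‖ ^ 2 / (r ^ 3 * logSq r)) := by
          field_simp
      _ ≤ 2 * (1 / (r * logPlusSq r) * ‖F r‖ ^ 2) + 2 * (‖g r‖ ^ 2 / (r ^ 3 * logSq r)) := by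
          linarith
      _ = _ := by ring

/-- Boundedness of `A_Q`, in terms of masses; the Hardy inequality for `p = f' - f / r` replaces
a bound on `f' / r` and `f / r²`, which the norm controls only up to a logarithm. -/
theorem massLE_opA {g g₁ g₂ : ℝ → ℂ} {N : ℝ} (hN : 0 ≤ N)
    (mg : Measurable g) (mg₁ : Measurable g₁) (mg₂ : Measurable g₂)
    (hg : ∀ r, 0 < r → HasDerivAt g (g₁ r) r) (hg₁ : ∀ r, 0 < r → HasDerivAt g₁ (g₂ r) r)
    (hc : ContinuousOn g₂ (Ioi 0)) (hp0 : Tendsto (fun r => g₁ r - (1 / r) • g r) (𝓝[>] 0) (𝓝 0))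
    (h2 : MassLE (Ioi 0) (fun r => r * ‖g₂ r‖ ^ 2) N)
    (h0 : MassLE (Ioi 0) (fun r => ‖g r‖ ^ 2 / (r ^ 3 * logSq r)) N) :
    MassLE (Ioi 0)
      (fun r => r * ‖g₂ r - coefA r • g₁ r - (-(1 / r ^ 2) - driftQ' r) • g r‖ ^ 2) (54 * N) ∧
    MassLE (Ioi 0) (fun r => ‖g₁ r - coefA r • g r‖ ^ 2 / (r * logPlusSq r)) (10 * N) := by
  set p : ℝ → ℂ := fun r => g₁ r - (1 / r) • g r with hpdef
  have mp : Measurable p := by rw [hpdef]; fun_prop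
  have hpd : ∀ r, 0 < r → HasDerivAt p (g₂ r - (1 / r) • p r) r := fun r hr => by
    refine ((hg₁ r hr).sub ((hasDerivAt_one_div hr.ne').smul (hg r hr))).congr_deriv ?_
    simp only [hpdef, smul_sub, smul_smul]
    rw [show 1 / r * (1 / r) = 1 / r ^ 2 by field_simp]
    module
  have hpM : MassLE (Ioi 0) (fun r => 2 / r * ‖p r‖ ^ 2) (2 * N) := by
    refine (massLE_energy_Ioi (φ := fun _ => 1) (φ' := fun _ => 0) (V := fun r => 1 / r)
      (κ := fun r => 2 / r) (ω := fun r => r / 2) (ε := fun _ => 0) (P₀ := 0) (M := N / 2) (M' := 0)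
      hpd (fun r hr => hasDerivAt_const r 1) hc
      (continuousOn_const.div continuousOn_id fun r hr => ne_of_gt hr) (by fun_prop)
      continuousOn_const (fun r hr => zero_le_one) (fun r hr => by positivity)
      (fun r hr => by positivity) (fun r hr => le_rfl) (fun r hr => le_of_eq (by ring))
      (fun r hr => le_of_eq (by field_simp)) (by simpa using hp0.norm.pow 2) (by positivity) le_rfl
      ?_ (by simp [MassLE])).mono_right (by linarith)
    exact (MassLE.dom1 (c₁ := 1 / 2) measurableSet_Ioi (by norm_num)
        (fun r _ => le_of_eq (by ring)) h2).mono_right (by linarith)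
  refine ⟨?_, ?_⟩
  · refine (MassLE.dom3 (c₁ := 3) (c₂ := 3 / 2) (c₃ := 48) measurableSet_Ioi (by fun_prop) (by fun_prop)
      (by norm_num) (by norm_num) (by norm_num) hN (by positivity) hN
      (fun r hr => ?_) h2 hpM h0).mono_right (by linarith)
    have hr : 0 < r := hr
    have hL := logSq_pos r
    have k1 := norm_add₃_sq_le (g₂ r) (-coefA r • p r) ((4 / (1 + r ^ 2) ^ 2) • g r)
    have hid : driftQ r * (1 / r) + driftQ' r = 4 / (1 + r ^ 2) ^ 2 := by
      unfold driftQ driftQ'; field_simp; ring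
    have e2 : g₂ r + -coefA r • p r + (4 / (1 + r ^ 2) ^ 2) • g r
        = g₂ r - coefA r • g₁ r - (-(1 / r ^ 2) - driftQ' r) • g r := by
      rw [show 1 / r ^ 2 = 1 / r * (1 / r) by field_simp]
      simp only [hpdef, coefA, ← hid]
      module
    rw [e2, norm_smul_sq, norm_smul_sq] at k1
    have k2 : r * (4 / (1 + r ^ 2) ^ 2) ^ 2 ≤ 16 / (r ^ 3 * logSq r) := by
      rw [div_pow, ← mul_div_assoc, div_le_div_iff₀ (by positivity) (by positivity)]
      have := (pow_mul_logSq_le hr).1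
      nlinarith
    have k3 := weight_mul_le k2 (sq_nonneg ‖g r‖)
    have k4 : r * (-coefA r) ^ 2 ≤ 1 / r := by
      rw [neg_sq]
      calc r * coefA r ^ 2 ≤ r * (1 / r ^ 2) := by have := coefA_sq_le hr; gcongr
        _ = _ := by field_simp
    have k5 := weight_mul_le k4 (sq_nonneg ‖p r‖)
    calc r * ‖g₂ r - coefA r • g₁ r - (-(1 / r ^ 2) - driftQ' r) • g r‖ ^ 2
        ≤ r * _ := mul_le_mul_of_nonneg_left k1 hr.le
      _ = 3 * (r * ‖g₂ r‖ ^ 2) + 3 * (r * (-coefA r) ^ 2 * ‖p r‖ ^ 2)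
        + 3 * (r * (4 / (1 + r ^ 2) ^ 2) ^ 2 * ‖g r‖ ^ 2) := by ring
      _ ≤ 3 * (r * ‖g₂ r‖ ^ 2) + 3 * (1 / r * ‖p r‖ ^ 2)
        + 3 * (16 / (r ^ 3 * logSq r) * ‖g r‖ ^ 2) := by linarith
      _ = _ := by ring
  · refine (MassLE.dom2 (c₁ := 1) (c₂ := 8) measurableSet_Ioi (by fun_prop) (by norm_num)
      (by norm_num) (by positivity) hN (fun r hr => ?_) hpM h0).mono_right (by linarith)
    have hr : 0 < r := hr
    have hL := logSq_pos r
    have hL' := logPlusSq_pos r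
    have k1 := norm_add_sq_le' (p r) (driftQ r • g r)
    rw [norm_smul_sq, show p r + driftQ r • g r = g₁ r - coefA r • g r by
      simp only [hpdef, coefA]; module] at k1
    have k2 : 1 / (r * logPlusSq r) * driftQ r ^ 2 ≤ 4 / (r ^ 3 * logSq r) := by
      rw [one_div_mul_eq_div, div_le_div_iff₀ (by positivity) (by positivity)]
      nlinarith [(driftQ_sq_mul_le hr).2]
    have k3 : 1 / (r * logPlusSq r) ≤ 1 / r := by
      have := one_le_logPlusSq r
      refine one_div_le_one_div_of_le hr (le_mul_of_one_le_right hr.le this)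
    have k4 := weight_mul_le k2 (sq_nonneg ‖g r‖)
    have k5 := weight_mul_le k3 (sq_nonneg ‖p r‖)
    calc ‖g₁ r - coefA r • g r‖ ^ 2 / (r * logPlusSq r)
        = 1 / (r * logPlusSq r) * ‖g₁ r - coefA r • g r‖ ^ 2 := by ring
      _ ≤ 1 / (r * logPlusSq r) * (2 * ‖p r‖ ^ 2 + 2 * (driftQ r ^ 2 * ‖g r‖ ^ 2)) := by gcongr
      _ = 2 * (1 / (r * logPlusSq r) * ‖p r‖ ^ 2)
        + 2 * (1 / (r * logPlusSq r) * driftQ r ^ 2 * ‖g r‖ ^ 2) := by ring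
      _ ≤ 2 * (1 / r * ‖p r‖ ^ 2) + 2 * (4 / (r ^ 3 * logSq r) * ‖g r‖ ^ 2) := by linarith
      _ = _ := by ring

/-! ### The nonlocal term in the second order space -/

/-- `1 / (r (1 + r²))`, which is `Q / r` up to the factor `√8`, and also the remainder of
`driftQ = 2 / r - 2 invQ` at infinity. -/
def invQ (r : ℝ) : ℝ := 1 / (r * (1 + r ^ 2))

/-- The derivative of `invQ`. -/
def invQ' (r : ℝ) : ℝ := -((1 + 3 * r ^ 2) / (r ^ 2 * (1 + r ^ 2) ^ 2))

/-- The second derivative of `invQ`. -/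
def invQ'' (r : ℝ) : ℝ := (2 + 6 * r ^ 2 + 12 * r ^ 4) / (r ^ 3 * (1 + r ^ 2) ^ 3)

@[fun_prop]
theorem measurable_invQ : Measurable invQ := by unfold invQ; fun_prop

@[fun_prop]
theorem measurable_invQ' : Measurable invQ' := by unfold invQ'; fun_prop

@[fun_prop]
theorem measurable_invQ'' : Measurable invQ'' := by unfold invQ''; fun_prop

theorem kerQ_eq (r : ℝ) : kerQ r = √8 * invQ r := by unfold kerQ invQ; ring

theorem hasDerivAt_invQ {r : ℝ} (hr : 0 < r) : HasDerivAt invQ (invQ' r) r := by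
  have h := ((hasDerivAt_const r (1 : ℝ)).div ((hasDerivAt_id r).mul (hasDerivAt_one_add_sq r))
    (by simp only [Pi.mul_apply, id]; positivity))
  refine h.congr_deriv ?_
  simp only [invQ', id, Pi.mul_apply]; field_simp; ring

theorem hasDerivAt_invQ' {r : ℝ} (hr : 0 < r) : HasDerivAt invQ' (invQ'' r) r := by
  have h1 : HasDerivAt (fun r : ℝ => 1 + 3 * r ^ 2) (6 * r) r := by
    refine (((hasDerivAt_pow 2 r).const_mul 3).const_add 1).congr_deriv ?_
    push_cast; ring
  have h2 := (h1.div ((hasDerivAt_pow 2 r).mul ((hasDerivAt_one_add_sq r).pow 2))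
    (by simp only [Pi.mul_apply, Pi.pow_apply]; positivity)).neg
  refine h2.congr_deriv ?_
  simp only [invQ'', Pi.mul_apply, Pi.pow_apply]; push_cast; field_simp; ring

/-- The nonlocal term `Q / r · Y` of `L_Q g`. -/
def nonloc (Y : ℝ → ℝ) (r : ℝ) : ℝ := kerQ r * Y r

/-- The first derivative of the nonlocal term. -/
def nonloc' (g : ℝ → ℂ) (Y : ℝ → ℝ) (r : ℝ) : ℝ :=
  √8 * invQ' r * Y r + 8 / (1 + r ^ 2) ^ 2 * (g r).re

/-- The second derivative of the nonlocal term. -/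
def nonloc'' (g g₁ : ℝ → ℂ) (Y : ℝ → ℝ) (r : ℝ) : ℝ :=
  √8 * invQ'' r * Y r - 8 * (1 + 7 * r ^ 2) / (r * (1 + r ^ 2) ^ 3) * (g r).re
    + 8 / (1 + r ^ 2) ^ 2 * (g₁ r).re

theorem sqrt_eight_mul_self : √8 * √8 = (8 : ℝ) := Real.mul_self_sqrt (by norm_num)

theorem sqrt_eight_sq : √8 ^ 2 = (8 : ℝ) := Real.sq_sqrt (by norm_num)

theorem IsProfile.hasDerivAt_nonloc {g g₁ : ℝ → ℂ} {Y : ℝ → ℝ} (h : IsProfile g g₁ Y) {r : ℝ}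
    (hr : 0 < r) : HasDerivAt (nonloc Y) (nonloc' g Y r) r := by
  have h1 : HasDerivAt kerQ (√8 * invQ' r) r := by
    rw [show kerQ = fun r => √8 * invQ r from funext kerQ_eq]
    exact (hasDerivAt_invQ hr).const_mul _
  refine (h1.mul (h.derivY r hr)).congr_deriv ?_
  rw [nonloc', kerQ]
  congr 1
  field_simp
  rw [sqrt_eight_sq]; ring

theorem hasDerivAt_eight_div (r : ℝ) :
    HasDerivAt (fun r : ℝ => 8 / (1 + r ^ 2) ^ 2) (-(32 * r / (1 + r ^ 2) ^ 3)) r := by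
  refine ((hasDerivAt_const r (8 : ℝ)).div ((hasDerivAt_one_add_sq r).pow 2)
    (by simp only [Pi.pow_apply]; positivity)).congr_deriv ?_
  simp only [Pi.pow_apply]; push_cast; field_simp; ring

theorem IsProfile.hasDerivAt_nonloc' {g g₁ : ℝ → ℂ} {Y : ℝ → ℝ} (h : IsProfile g g₁ Y) {r : ℝ}
    (hr : 0 < r) : HasDerivAt (nonloc' g Y) (nonloc'' g g₁ Y r) r := by
  have h1 := (((hasDerivAt_invQ' hr).const_mul √8).mul (h.derivY r hr)).add
    ((hasDerivAt_eight_div r).mul (hasDerivAt_re (h.deriv r hr)))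
  refine h1.congr_deriv ?_
  have e : √8 * invQ' r * (√8 * r / (1 + r ^ 2) * (g r).re)
      = -(8 * (1 + 3 * r ^ 2) / (r * (1 + r ^ 2) ^ 3)) * (g r).re := by
    rw [show √8 * invQ' r * (√8 * r / (1 + r ^ 2) * (g r).re)
      = (√8 * √8) * (invQ' r * (r / (1 + r ^ 2) * (g r).re)) by ring, sqrt_eight_mul_self, invQ']
    field_simp
  rw [e, nonloc'']
  field_simp
  ring

/-- The combination of `Y` and `Q Re g` which vanishes to third order at the origin. -/
def tailY (g : ℝ → ℂ) (Y : ℝ → ℝ) (r : ℝ) : ℝ := √8 * (r ^ 2 / (1 + r ^ 2)) * (g r).re - 2 * Y r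

theorem IsProfile.hasDerivAt_tailY {g g₁ : ℝ → ℂ} {Y : ℝ → ℝ} (h : IsProfile g g₁ Y) {r : ℝ}
    (hr : 0 < r) : HasDerivAt (tailY g Y)
      (√8 * (r ^ 2 / (1 + r ^ 2)) * (g₁ r).re - 2 * √8 * (r ^ 3 / (1 + r ^ 2) ^ 2) * (g r).re) r := by
  have d2 := ((hasDerivAt_pow 2 r).div (hasDerivAt_one_add_sq r) (by positivity)).const_mul √8
  refine ((d2.mul (hasDerivAt_re (h.deriv r hr))).sub ((h.derivY r hr).const_mul 2)).congr_deriv ?_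
  simp only [Pi.div_apply]
  push_cast
  field_simp
  ring

/-- In terms of `tailY`, the second derivative of the nonlocal term has no singular terms which
have to cancel. -/
theorem nonloc''_eq (g g₁ : ℝ → ℂ) (Y : ℝ → ℝ) {r : ℝ} (hr : 0 < r) :
    nonloc'' g g₁ Y r = -(8 * r * (5 + r ^ 2) / (1 + r ^ 2) ^ 4) * (g r).re
      + -(√8 * (1 + 3 * r ^ 2 + 6 * r ^ 4) / (r ^ 3 * (1 + r ^ 2) ^ 3)) * tailY g Y r
      + 8 / (1 + r ^ 2) ^ 2 * (g₁ r).re := by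
  have e : -(√8 * (1 + 3 * r ^ 2 + 6 * r ^ 4) / (r ^ 3 * (1 + r ^ 2) ^ 3)) * tailY g Y r
      = √8 * invQ'' r * Y r
        - 8 * (1 + 3 * r ^ 2 + 6 * r ^ 4) / (r * (1 + r ^ 2) ^ 4) * (g r).re := by
    unfold tailY invQ''
    rw [show -(√8 * (1 + 3 * r ^ 2 + 6 * r ^ 4) / (r ^ 3 * (1 + r ^ 2) ^ 3)) *
      (√8 * (r ^ 2 / (1 + r ^ 2)) * (g r).re - 2 * Y r)
      = -((√8 * √8) * (1 + 3 * r ^ 2 + 6 * r ^ 4) / (r ^ 3 * (1 + r ^ 2) ^ 3) * (r ^ 2 / (1 + r ^ 2))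
        * (g r).re) + 2 * √8 * (1 + 3 * r ^ 2 + 6 * r ^ 4) / (r ^ 3 * (1 + r ^ 2) ^ 3) * Y r by ring,
      sqrt_eight_mul_self]
    field_simp
    ring
  rw [e, nonloc'']
  field_simp
  ring

theorem tendsto_logSq_inv : Tendsto (fun r => (logSq r)⁻¹) (𝓝[>] 0) (𝓝 0) := by
  refine Tendsto.inv_tendsto_atTop ?_
  have h1 : Tendsto (fun r => Real.log r ^ 2) (𝓝[>] 0) atTop :=
    (tendsto_pow_atTop two_ne_zero).comp (tendsto_neg_atBot_atTop.comp Real.tendsto_log_nhdsGT_zero)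
      |>.congr fun r => by simp
  exact tendsto_atTop_add_const_left _ 1 h1

theorem pow_mul_logSq_le_two {r : ℝ} (hr : 0 < r) (h1 : r ≤ 1) : r ^ 4 * logSq r ≤ 2 := by
  have h := mul_logSq_le hr
  have h3 : r ^ 3 ≤ 1 := pow_le_one₀ hr.le h1
  have h2 : 1 + r ^ 2 ≤ 2 := by nlinarith
  calc r ^ 4 * logSq r = r ^ 3 * (r * logSq r) := by ring
    _ ≤ 1 * 2 := by
      have := logSq_pos r
      exact mul_le_mul h3 (h.trans h2) (by positivity) zero_le_one
    _ = 2 := by norm_num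

theorem logSq_le_two_mul {r : ℝ} (h1 : 1 ≤ r) : logSq r ≤ 2 * r := by
  have h := mul_logSq_le (by linarith : 0 < r)
  have h2 : r * logSq r ≤ r * (2 * r) := by nlinarith
  exact le_of_mul_le_mul_left h2 (by linarith)

theorem measurable_nonloc {Y : ℝ → ℝ} (mY : Measurable Y) : Measurable (nonloc Y) := by
  unfold nonloc; fun_prop

theorem measurable_nonloc' {g : ℝ → ℂ} {Y : ℝ → ℝ} (mg : Measurable g) (mY : Measurable Y) :
    Measurable (nonloc' g Y) := by
  unfold nonloc'; fun_prop

theorem measurable_nonloc'' {g g₁ : ℝ → ℂ} {Y : ℝ → ℝ} (mg : Measurable g) (mg₁ : Measurable g₁)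
    (mY : Measurable Y) : Measurable (nonloc'' g g₁ Y) := by
  unfold nonloc''; fun_prop

/-- The Hardy inequality for the nonlocal integral `Y`. -/
theorem IsProfile.massLE_Y {g g₁ : ℝ → ℂ} {Y : ℝ → ℝ} {N : ℝ} (hN : 0 ≤ N) (h : IsProfile g g₁ Y)
    (hY : ∃ c, ∀ r, 0 < r → r ≤ 1 → |Y r| ≤ c * r ^ 2)
    (h0 : MassLE (Ioi 0) (fun r => ‖g r‖ ^ 2 / (r * (1 + r ^ 2) ^ 2 * logSq r)) N) :
    MassLE (Ioi 0) (fun r => Y r ^ 2 / (r ^ 5 * (1 + r ^ 2) ^ 2 * logSq r)) (4 * N) := by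
  have cL := continuousOn_logSq
  have cden : ContinuousOn (fun r : ℝ => r ^ 4 * (1 + r ^ 2) ^ 2 * logSq r) (Ioi 0) :=
    (by fun_prop : Continuous fun r : ℝ => r ^ 4 * (1 + r ^ 2) ^ 2).continuousOn.mul cL
  have hden : ∀ r : ℝ, 0 < r → 0 < r ^ 4 * (1 + r ^ 2) ^ 2 * logSq r := fun r hr => by
    have := logSq_pos r; positivity
  have cφ : ContinuousOn (fun r : ℝ => (r ^ 4 * (1 + r ^ 2) ^ 2 * logSq r)⁻¹) (Ioi 0) :=
    cden.inv₀ fun r hr => (hden r hr).ne'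
  have E := massLE_energy_Ioi (α := 0) (φ := fun r => (r ^ 4 * (1 + r ^ 2) ^ 2 * logSq r)⁻¹)
    (φ' := fun r => -((4 * r ^ 3 * (1 + r ^ 2) ^ 2 + r ^ 4 * (4 * r * (1 + r ^ 2))) * logSq r
      + r ^ 4 * (1 + r ^ 2) ^ 2 * (2 * Real.log r / r)) / (r ^ 4 * (1 + r ^ 2) ^ 2 * logSq r) ^ 2)
    (V := fun _ => 0) (κ := fun r => 3 * (r ^ 4 * (1 + r ^ 2) ^ 2 * logSq r)⁻¹ / r)
    (ω := fun r => (r ^ 4 * (1 + r ^ 2) ^ 2 * logSq r)⁻¹ * r / 3) (ε := fun _ => 0)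
    (g := Y) (F := fun r => √8 * r / (1 + r ^ 2) * (g r).re) (P₀ := 0) (M := 8 / 3 * N) (M' := 0)
    (fun r hr => by simpa using h.derivY r hr)
    (fun r hr => by
      have hL := logSq_pos r
      have := (((hasDerivAt_pow 4 r).mul ((hasDerivAt_one_add_sq r).pow 2)).mul
        (hasDerivAt_logSq hr)).inv (by simpa using (hden r hr).ne')
      refine this.congr_deriv ?_
      simp only [Pi.mul_apply, Pi.pow_apply]
      push_cast
      congr 1
      ring)
    ((ContinuousOn.div (by fun_prop) (by fun_prop) fun r _ => by positivity).mul
      (continuous_re.comp_continuousOn h.contg))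
    ((cφ.const_smul (3 : ℝ)).div continuousOn_id fun r hr => ne_of_gt hr)
    ((cφ.mul continuousOn_id).div_const 3) continuousOn_const
    (fun r hr => (inv_pos.2 (hden r hr)).le)
    (fun r hr => by have := hden r hr; positivity)
    (fun r hr => by have := hden r hr; positivity) (fun _ _ => le_rfl)
    (fun r hr => ?_) (fun r hr => le_of_eq (by field_simp)) ?_ (by positivity) le_rfl ?_
    (by simp [MassLE])
  · refine (MassLE.dom1 (c₁ := 1 / 3) measurableSet_Ioi (by norm_num) (fun r hr => ?_) E).mono_right
      (by linarith)
    have hr : 0 < r := hr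
    have hL := logSq_pos r
    rw [Real.norm_eq_abs, sq_abs]
    refine le_of_eq ?_
    field_simp
  · have hL := logSq_pos r
    have hd := hden r hr
    -- `|2 log r| ≤ 1 + log² r`: the logarithm costs at most one of the four powers
    have e1 : -((4 * r ^ 3 * (1 + r ^ 2) ^ 2 + r ^ 4 * (4 * r * (1 + r ^ 2))) * logSq r
      + r ^ 4 * (1 + r ^ 2) ^ 2 * (2 * Real.log r / r)) / (r ^ 4 * (1 + r ^ 2) ^ 2 * logSq r) ^ 2
      = -(3 * (r ^ 4 * (1 + r ^ 2) ^ 2 * logSq r)⁻¹ / r)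
        - (r ^ 3 * (1 + r ^ 2) ^ 2 * (logSq r + 2 * Real.log r) + 4 * r ^ 5 * (1 + r ^ 2) * logSq r)
          / (r ^ 4 * (1 + r ^ 2) ^ 2 * logSq r) ^ 2 := by
      field_simp; ring
    have e2 : 0 ≤ logSq r + 2 * Real.log r := by unfold logSq; nlinarith [sq_nonneg (Real.log r + 1)]
    rw [e1]
    have e3 : 0 ≤ (r ^ 3 * (1 + r ^ 2) ^ 2 * (logSq r + 2 * Real.log r)
      + 4 * r ^ 5 * (1 + r ^ 2) * logSq r) / (r ^ 4 * (1 + r ^ 2) ^ 2 * logSq r) ^ 2 := by positivity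
    linarith
  · obtain ⟨c, hc⟩ := hY
    have t := tendsto_logSq_inv.const_mul (c ^ 2)
    rw [mul_zero] at t
    refine squeeze_zero' ?_ ?_ t
    · filter_upwards [self_mem_nhdsWithin] with r hr
      have := hden r hr
      positivity
    · filter_upwards [Ioc_mem_nhdsGT one_pos] with r hr
      have hL := logSq_pos r
      have hr0 : 0 < r := hr.1
      have h1 := pow_le_pow_left₀ (abs_nonneg _) (hc r hr.1 hr.2) 2
      rw [Real.norm_eq_abs]
      calc (r ^ 4 * (1 + r ^ 2) ^ 2 * logSq r)⁻¹ * |Y r| ^ 2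
          ≤ (r ^ 4 * 1 ^ 2 * logSq r)⁻¹ * (c * r ^ 2) ^ 2 := by
            have := one_le_one_add_sq r
            gcongr
        _ = c ^ 2 * (logSq r)⁻¹ := by field_simp
  · refine MassLE.dom1 (c₁ := 8 / 3) measurableSet_Ioi (by norm_num) (fun r hr => ?_) h0
    have hr : 0 < r := hr
    have hL := logSq_pos r
    have h1 : ‖√8 * r / (1 + r ^ 2) * (g r).re‖ ^ 2 ≤ 8 * r ^ 2 * ‖g r‖ ^ 2 := by
      rw [Real.norm_eq_abs, sq_abs, mul_pow, div_pow, mul_pow, sqrt_eight_sq]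
      have h2 : (g r).re ^ 2 ≤ ‖g r‖ ^ 2 := by
        rw [← sq_abs]; exact pow_le_pow_left₀ (abs_nonneg _) (abs_re_le_norm _) 2
      have h3 : 8 * r ^ 2 / (1 + r ^ 2) ^ 2 ≤ 8 * r ^ 2 :=
        div_le_self (by positivity) (by nlinarith [sq_nonneg r])
      exact mul_le_mul h3 h2 (sq_nonneg _) (by positivity)
    calc (r ^ 4 * (1 + r ^ 2) ^ 2 * logSq r)⁻¹ * r / 3 * ‖√8 * r / (1 + r ^ 2) * (g r).re‖ ^ 2
        ≤ (r ^ 4 * (1 + r ^ 2) ^ 2 * logSq r)⁻¹ * r / 3 * (8 * r ^ 2 * ‖g r‖ ^ 2) := by gcongr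
      _ = _ := by field_simp

theorem re_sq_le (z : ℂ) : z.re ^ 2 ≤ ‖z‖ ^ 2 := by
  rw [← sq_abs]; exact pow_le_pow_left₀ (abs_nonneg _) (abs_re_le_norm _) 2

/-- The third order vanishing of `tailY` at the origin, by the Cauchy-Schwarz inequality. The
logarithm in the norm is absorbed by `r (1 + log² r) ≤ 1 + r²`. -/
theorem IsProfile.tailY_sq_le {g g₁ : ℝ → ℂ} {Y : ℝ → ℝ} {N : ℝ} (hN : 0 ≤ N) (h : IsProfile g g₁ Y)
    (mg₁ : Measurable g₁)
    (h1 : MassLE (Ioi 0) (fun r => ‖g₁ r‖ ^ 2 / (r ^ 3 * logSq r)) N)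
    (h0 : MassLE (Ioi 0) (fun r => ‖g r‖ ^ 2 / (r * (1 + r ^ 2) ^ 2 * logSq r)) N)
    {r : ℝ} (hr : 0 < r) : tailY g Y r ^ 2 ≤ 11 * N * r ^ 6 := by
  obtain ⟨c, hc⟩ := h.bdd
  have hsL : ∀ r : ℝ, 0 < √(logSq r) := fun r => Real.sqrt_pos.2 (logSq_pos r)
  have csL : ContinuousOn (fun r => √(logSq r)) (Ioi 0) := continuousOn_logSq.sqrt
  have := norm_sq_le_of_deriv_of_tendsto_zero (u := tailY g Y)
    (q := fun r => ‖g₁ r‖ / (r ^ 2 * √(logSq r)) + ‖g r‖ / (r * (1 + r ^ 2) * √(logSq r)))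
    (m := fun r => 4 * r ^ 3) (Φ := fun r => 16 * r ^ 6 / 6) (N := 4 * N)
    (fun r hr => h.hasDerivAt_tailY hr)
    (((continuousOn_const.mul (ContinuousOn.div (by fun_prop) (by fun_prop)
        fun r _ => by positivity)).mul (continuous_re.comp_continuousOn h.cont)).sub
      ((continuousOn_const.mul (ContinuousOn.div (by fun_prop) (by fun_prop)
        fun r _ => by positivity)).mul (continuous_re.comp_continuousOn h.contg)))
    ((h.cont.norm.div ((by fun_prop : Continuous fun r : ℝ => r ^ 2).continuousOn.mul csL)
        fun r hr => (mul_pos (pow_pos hr 2) (hsL r)).ne').add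
      (h.contg.norm.div ((by fun_prop : Continuous fun r : ℝ => r * (1 + r ^ 2)).continuousOn.mul csL)
        fun r hr => (mul_pos (mul_pos hr (by positivity)) (hsL r)).ne'))
    (by fun_prop) (fun r hr => ?_) (fun r hr => ?_) (by positivity)
    ((MassLE.dom2 (c₁ := 2) (c₂ := 2) measurableSet_Ioi (by fun_prop) (by norm_num) (by norm_num)
      hN hN (fun r hr => ?_) h1 h0).mono_right (by linarith)) ?_ ?_ hr
  · rw [Real.norm_eq_abs, sq_abs] at this
    have h6 : 0 ≤ N * r ^ 6 := by positivity
    linarith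
  · refine (((hasDerivAt_pow 6 r).const_mul 16).div_const 6).congr_deriv ?_
    push_cast; field_simp
    norm_num
  · have hs := hsL r
    have k : √8 * r ^ 4 * √(logSq r) / (1 + r ^ 2) ≤ 2 * r ^ 3 := by
      rw [div_le_iff₀ (by positivity)]
      refine le_of_sq_le_sq ?_ (by positivity)
      rw [mul_pow, mul_pow, sqrt_eight_sq, Real.sq_sqrt (logSq_pos r).le]
      have k1 := mul_logSq_le hr
      have k2 : 2 * r ≤ 1 + r ^ 2 := by nlinarith [sq_nonneg (r - 1)]
      calc 8 * (r ^ 4) ^ 2 * logSq r = 4 * r ^ 6 * (2 * r) * (r * logSq r) := by ring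
        _ ≤ 4 * r ^ 6 * (1 + r ^ 2) * (1 + r ^ 2) := by
          have := logSq_pos r
          gcongr
        _ = _ := by ring
    have a1 : |√8 * (r ^ 2 / (1 + r ^ 2)) * (g₁ r).re| ≤ 2 * r ^ 3 * (‖g₁ r‖ / (r ^ 2 * √(logSq r))) := by
      rw [abs_mul, abs_of_nonneg (by positivity)]
      calc √8 * (r ^ 2 / (1 + r ^ 2)) * |(g₁ r).re| ≤ √8 * (r ^ 2 / (1 + r ^ 2)) * ‖g₁ r‖ := by
            gcongr; exact abs_re_le_norm _
        _ = √8 * r ^ 4 * √(logSq r) / (1 + r ^ 2) * (‖g₁ r‖ / (r ^ 2 * √(logSq r))) := by field_simp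
        _ ≤ _ := by gcongr
    have a2 : |2 * √8 * (r ^ 3 / (1 + r ^ 2) ^ 2) * (g r).re|
        ≤ 4 * r ^ 3 * (‖g r‖ / (r * (1 + r ^ 2) * √(logSq r))) := by
      rw [abs_mul, abs_of_nonneg (by positivity)]
      calc 2 * √8 * (r ^ 3 / (1 + r ^ 2) ^ 2) * |(g r).re|
          ≤ 2 * √8 * (r ^ 3 / (1 + r ^ 2) ^ 2) * ‖g r‖ := by
            gcongr; exact abs_re_le_norm _
        _ = 2 * (√8 * r ^ 4 * √(logSq r) / (1 + r ^ 2)) * (‖g r‖ / (r * (1 + r ^ 2) * √(logSq r))) := by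
          field_simp
        _ ≤ 2 * (2 * r ^ 3) * (‖g r‖ / (r * (1 + r ^ 2) * √(logSq r))) := by gcongr
        _ = _ := by ring
    have a3 : 0 ≤ 2 * r ^ 3 * (‖g₁ r‖ / (r ^ 2 * √(logSq r))) := by positivity
    rw [Real.norm_eq_abs]
    refine (abs_sub _ _).trans ?_
    rw [mul_add]
    linarith
  · have hr : 0 < r := hr
    have hL := logSq_pos r
    have e1 : r * (‖g₁ r‖ / (r ^ 2 * √(logSq r))) ^ 2 = ‖g₁ r‖ ^ 2 / (r ^ 3 * logSq r) := by
      rw [div_pow, mul_pow, Real.sq_sqrt hL.le]; field_simp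
    have e2 : r * (‖g r‖ / (r * (1 + r ^ 2) * √(logSq r))) ^ 2
        = ‖g r‖ ^ 2 / (r * (1 + r ^ 2) ^ 2 * logSq r) := by
      rw [div_pow, mul_pow, Real.sq_sqrt hL.le]; field_simp
    rw [← e1, ← e2]
    nlinarith [mul_nonneg hr.le (sq_nonneg (‖g₁ r‖ / (r ^ 2 * √(logSq r))
      - ‖g r‖ / (r * (1 + r ^ 2) * √(logSq r))))]
  · have c2 : Continuous fun r : ℝ => √8 * (r ^ 2 / (1 + r ^ 2)) :=
      continuous_const.mul (Continuous.div (by fun_prop) (by fun_prop) fun r => by positivity)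
    have t2 := (c2.tendsto 0).mono_left (nhdsWithin_le_nhds (s := Ioi 0))
    have t := (t2.mul ((continuous_re.tendsto c).comp hc)).sub (h.zeroY.const_mul 2)
    simp only [mul_zero, zero_mul, ne_eq, OfNat.ofNat_ne_zero, not_false_eq_true, zero_pow, zero_div,
      sub_zero] at t
    exact t
  · have : Tendsto (fun r : ℝ => 16 * r ^ 6 / 6) (𝓝 0) (𝓝 (16 * 0 ^ 6 / 6)) :=
      (by fun_prop : Continuous fun r : ℝ => 16 * r ^ 6 / 6).tendsto 0
    simp only [ne_eq, OfNat.ofNat_ne_zero, not_false_eq_true, zero_pow, mul_zero, zero_div] at this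
    exact this.mono_left nhdsWithin_le_nhds

theorem add_sq_le_two (x y : ℝ) : (x + y) ^ 2 ≤ 2 * x ^ 2 + 2 * y ^ 2 := by
  nlinarith [sq_nonneg (x - y)]

theorem add_sq_le_three (x y z : ℝ) : (x + y + z) ^ 2 ≤ 3 * x ^ 2 + 3 * y ^ 2 + 3 * z ^ 2 := by
  nlinarith [sq_nonneg (x - y), sq_nonneg (x - z), sq_nonneg (y - z)]

/-- The nonlocal term of `L_Q` is bounded in the second order space by the lower order part of the
third order norm. -/
theorem IsProfile.massLE_nonloc {g g₁ : ℝ → ℂ} {Y : ℝ → ℝ} {N : ℝ} (hN : 0 ≤ N)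
    (h : IsProfile g g₁ Y) (mg : Measurable g) (mg₁ : Measurable g₁) (mY : Measurable Y)
    (hY : ∃ c, ∀ r, 0 < r → r ≤ 1 → |Y r| ≤ c * r ^ 2)
    (h1 : MassLE (Ioi 0) (fun r => ‖g₁ r‖ ^ 2 / (r ^ 3 * logSq r)) N)
    (h0 : MassLE (Ioi 0) (fun r => ‖g r‖ ^ 2 / (r * (1 + r ^ 2) ^ 2 * logSq r)) N) :
    MassLE (Ioi 0) (fun r => nonloc Y r ^ 2 / (r ^ 3 * logSq r)) (15000 * N) ∧
    MassLE (Ioi 0) (fun r => nonloc' g Y r ^ 2 / (r * logSq r)) (15000 * N) ∧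
    MassLE (Ioi 0) (fun r => r * nonloc'' g g₁ Y r ^ 2) (15000 * N) := by
  have hYM := h.massLE_Y hN hY h0
  refine ⟨?_, ?_, ?_⟩
  · refine (MassLE.dom1 (c₁ := 8) measurableSet_Ioi (by norm_num) (fun r hr => ?_) hYM).mono_right
      (by linarith)
    have hr : 0 < r := hr
    have hL := logSq_pos r
    rw [nonloc, mul_pow, kerQ_sq]
    refine le_of_eq ?_
    field_simp
  · refine (MassLE.dom2 (c₁ := 144) (c₂ := 128) measurableSet_Ioi (by fun_prop) (by norm_num)
      (by norm_num) (by positivity) hN (fun r hr => ?_) hYM h0).mono_right (by linarith)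
    have hr : 0 < r := hr
    have hL := logSq_pos r
    have k := add_sq_le_two (√8 * invQ' r * Y r) (8 / (1 + r ^ 2) ^ 2 * (g r).re)
    have e1 : (√8 * invQ' r * Y r) ^ 2 ≤ 72 / (r ^ 4 * (1 + r ^ 2) ^ 2) * Y r ^ 2 := by
      rw [mul_pow, mul_pow, sqrt_eight_sq]
      refine mul_le_mul_of_nonneg_right ?_ (sq_nonneg _)
      rw [invQ', neg_sq, div_pow, ← mul_div_assoc, div_le_div_iff₀ (by positivity) (by positivity)]
      have h3 : (1 + 3 * r ^ 2) ^ 2 ≤ (3 * (1 + r ^ 2)) ^ 2 :=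
        pow_le_pow_left₀ (by positivity) (by linarith) 2
      calc 8 * (1 + 3 * r ^ 2) ^ 2 * (r ^ 4 * (1 + r ^ 2) ^ 2)
          ≤ 8 * (3 * (1 + r ^ 2)) ^ 2 * (r ^ 4 * (1 + r ^ 2) ^ 2) := by gcongr
        _ = _ := by ring
    have e2 : (8 / (1 + r ^ 2) ^ 2 * (g r).re) ^ 2 ≤ 64 / (1 + r ^ 2) ^ 2 * ‖g r‖ ^ 2 := by
      rw [mul_pow, div_pow]
      have h3 : (8 : ℝ) ^ 2 / ((1 + r ^ 2) ^ 2) ^ 2 ≤ 64 / (1 + r ^ 2) ^ 2 := by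
        norm_num
        have : (1 + r ^ 2) ^ 2 ≤ ((1 + r ^ 2) ^ 2) ^ 2 := by
          have := one_le_pow₀ (one_le_one_add_sq r) (n := 2)
          nlinarith
        gcongr
      exact mul_le_mul h3 (re_sq_le _) (sq_nonneg _) (by positivity)
    calc nonloc' g Y r ^ 2 / (r * logSq r) ≤ (2 * (72 / (r ^ 4 * (1 + r ^ 2) ^ 2) * Y r ^ 2)
          + 2 * (64 / (1 + r ^ 2) ^ 2 * ‖g r‖ ^ 2)) / (r * logSq r) := by
          unfold nonloc'; gcongr; linarith
      _ = _ := by field_simp; ring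
  · have hW := fun r hr => h.tailY_sq_le hN mg₁ h1 h0 (r := r) hr
    refine (MassLE.dom3 (c₁ := 4800) (c₂ := 9504 * N) (c₃ := 192) measurableSet_Ioi (by fun_prop)
      (by fun_prop) (by norm_num) (by positivity) (by norm_num) hN zero_le_one hN (fun r hr => ?_)
      h0 massLE_div_sq h1).mono_right (by linarith)
    have hr : 0 < r := hr
    have hL := logSq_pos r
    rw [nonloc''_eq g g₁ Y hr]
    have k := add_sq_le_three (-(8 * r * (5 + r ^ 2) / (1 + r ^ 2) ^ 4) * (g r).re)
      (-(√8 * (1 + 3 * r ^ 2 + 6 * r ^ 4) / (r ^ 3 * (1 + r ^ 2) ^ 3)) * tailY g Y r)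
      (8 / (1 + r ^ 2) ^ 2 * (g₁ r).re)
    have hpow := (pow_mul_logSq_le hr).1
    have e1 : r * (-(8 * r * (5 + r ^ 2) / (1 + r ^ 2) ^ 4) * (g r).re) ^ 2
        ≤ 1600 * (‖g r‖ ^ 2 / (r * (1 + r ^ 2) ^ 2 * logSq r)) := by
      have h3 : r * (8 * r * (5 + r ^ 2) / (1 + r ^ 2) ^ 4) ^ 2
          ≤ 1600 / (r * (1 + r ^ 2) ^ 2 * logSq r) := by
        rw [div_pow, ← mul_div_assoc, div_le_div_iff₀ (by positivity) (by positivity)]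
        have h4 : (5 + r ^ 2) ^ 2 ≤ (5 * (1 + r ^ 2)) ^ 2 :=
          pow_le_pow_left₀ (by positivity) (by nlinarith [sq_nonneg r]) 2
        calc r * (8 * r * (5 + r ^ 2)) ^ 2 * (r * (1 + r ^ 2) ^ 2 * logSq r)
            = 64 * (5 + r ^ 2) ^ 2 * (1 + r ^ 2) ^ 2 * (r ^ 4 * logSq r) := by ring
          _ ≤ 64 * (5 * (1 + r ^ 2)) ^ 2 * (1 + r ^ 2) ^ 2 * (1 + r ^ 2) ^ 4 := by gcongr
          _ = _ := by ring
      calc _ = r * (8 * r * (5 + r ^ 2) / (1 + r ^ 2) ^ 4) ^ 2 * (g r).re ^ 2 := by ring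
        _ ≤ 1600 / (r * (1 + r ^ 2) ^ 2 * logSq r) * ‖g r‖ ^ 2 :=
          mul_le_mul h3 (re_sq_le _) (sq_nonneg _) (by positivity)
        _ = _ := by ring
    have e2 : r * (-(√8 * (1 + 3 * r ^ 2 + 6 * r ^ 4) / (r ^ 3 * (1 + r ^ 2) ^ 3)) * tailY g Y r) ^ 2
        ≤ 3168 * N * (r / (1 + r ^ 2) ^ 2) := by
      have h3 : (1 + 3 * r ^ 2 + 6 * r ^ 4) ^ 2 ≤ (6 * (1 + r ^ 2) ^ 2) ^ 2 :=
        pow_le_pow_left₀ (by positivity) (by nlinarith [sq_nonneg r]) 2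
      calc _ = r * (√8 ^ 2 * (1 + 3 * r ^ 2 + 6 * r ^ 4) ^ 2 / (r ^ 3 * (1 + r ^ 2) ^ 3) ^ 2
            * tailY g Y r ^ 2) := by
            rw [mul_pow, neg_sq, div_pow, mul_pow]
        _ ≤ r * (8 * (6 * (1 + r ^ 2) ^ 2) ^ 2 / (r ^ 3 * (1 + r ^ 2) ^ 3) ^ 2
            * (11 * N * r ^ 6)) := by
          rw [sqrt_eight_sq]
          have := hW r hr
          gcongr
        _ = _ := by field_simp; ring
    have e3 : r * (8 / (1 + r ^ 2) ^ 2 * (g₁ r).re) ^ 2 ≤ 64 * (‖g₁ r‖ ^ 2 / (r ^ 3 * logSq r)) := by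
      have h3 : r * (8 / (1 + r ^ 2) ^ 2) ^ 2 ≤ 64 / (r ^ 3 * logSq r) := by
        rw [div_pow, ← mul_div_assoc, div_le_div_iff₀ (by positivity) (by positivity)]
        calc r * 8 ^ 2 * (r ^ 3 * logSq r) = 64 * (r ^ 4 * logSq r) := by ring
          _ ≤ 64 * (1 + r ^ 2) ^ 4 := by gcongr
          _ = _ := by ring
      calc _ = r * (8 / (1 + r ^ 2) ^ 2) ^ 2 * (g₁ r).re ^ 2 := by ring
        _ ≤ 64 / (r ^ 3 * logSq r) * ‖g₁ r‖ ^ 2 :=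
          mul_le_mul h3 (re_sq_le _) (sq_nonneg _) (by positivity)
        _ = _ := by ring
    have := mul_le_mul_of_nonneg_left k hr.le
    linarith

/-! ### The local part of `L_Q` on the third order space -/

/-- The second derivative of `driftQ`. -/
def driftQ'' (r : ℝ) : ℝ := 4 * r * (r ^ 2 - 3) / (1 + r ^ 2) ^ 3

@[fun_prop]
theorem measurable_driftQ'' : Measurable driftQ'' := by unfold driftQ''; fun_prop

theorem hasDerivAt_driftQ' (r : ℝ) : HasDerivAt driftQ' (driftQ'' r) r := by
  have h := (((hasDerivAt_pow 2 r).const_sub 1).const_mul 2).div ((hasDerivAt_one_add_sq r).pow 2)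
    (by simp only [Pi.pow_apply]; positivity)
  refine h.congr_deriv ?_
  simp only [Pi.pow_apply]
  unfold driftQ''; push_cast; field_simp; ring

theorem continuous_driftQ'' : Continuous driftQ'' := by
  unfold driftQ''
  exact Continuous.div (by fun_prop) (by fun_prop) fun r => by positivity

/-- The first derivative of `g' + a g`, with `a = driftQ`. -/
def locL' (g g₁ g₂ : ℝ → ℂ) (r : ℝ) : ℂ := g₂ r + driftQ r • g₁ r + driftQ' r • g r

/-- The second derivative of `g' + a g`, with `a = driftQ`. -/
def locL'' (g g₁ g₂ g₃ : ℝ → ℂ) (r : ℝ) : ℂ :=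
  g₃ r + driftQ r • g₂ r + ((2 * driftQ' r) • g₁ r + driftQ'' r • g r)

/-- The second derivative of `g / r`. -/
def quotDeriv₂ (g g₁ g₂ : ℝ → ℂ) (r : ℝ) : ℂ :=
  (1 / r) • g₂ r - (2 / r ^ 2) • g₁ r + (2 / r ^ 3) • g r

/-- The second derivative of `2 h g`, where `h = 1 / (r (1 + r²))`: the difference between
`2 (g / r)''` and `(a g)''`, with `a = driftQ`. It decays faster at infinity than either of them. -/
def locRem (g g₁ g₂ : ℝ → ℂ) (r : ℝ) : ℂ :=
  (2 * invQ r) • g₂ r + (4 * invQ' r) • g₁ r + (2 * invQ'' r) • g r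

theorem locL''_eq (g g₁ g₂ g₃ : ℝ → ℂ) {r : ℝ} (hr : 0 < r) :
    locL'' g g₁ g₂ g₃ r = g₃ r + (2 : ℝ) • quotDeriv₂ g g₁ g₂ r - locRem g g₁ g₂ r := by
  have e1 : driftQ r = 2 * (1 / r) - 2 * invQ r := by
    unfold driftQ invQ; field_simp; ring
  have e2 : 2 * driftQ' r = -(2 * (2 / r ^ 2)) - 4 * invQ' r := by
    unfold driftQ' invQ'; field_simp; ring
  have e3 : driftQ'' r = 2 * (2 / r ^ 3) - 2 * invQ'' r := by
    unfold driftQ'' invQ''; field_simp; ring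
  unfold locL'' quotDeriv₂ locRem
  rw [e1, e2, e3]
  module

theorem hasDerivAt_quotDeriv₂ {g g₁ g₂ g₃ : ℝ → ℂ} {r : ℝ} (hr : 0 < r)
    (hg : HasDerivAt g (g₁ r) r) (hg₁ : HasDerivAt g₁ (g₂ r) r) (hg₂ : HasDerivAt g₂ (g₃ r) r) :
    HasDerivAt (quotDeriv₂ g g₁ g₂) ((1 / r) • g₃ r - (3 / r) • quotDeriv₂ g g₁ g₂ r) r := by
  have h2 : HasDerivAt (fun r : ℝ => 2 / r ^ 2) (-(4 / r ^ 3)) r := by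
    refine ((hasDerivAt_const r (2 : ℝ)).div (hasDerivAt_pow 2 r) (by positivity)).congr_deriv ?_
    push_cast; field_simp; norm_num
  have h3 : HasDerivAt (fun r : ℝ => 2 / r ^ 3) (-(6 / r ^ 4)) r := by
    refine ((hasDerivAt_const r (2 : ℝ)).div (hasDerivAt_pow 3 r) (by positivity)).congr_deriv ?_
    push_cast; field_simp; norm_num
  refine ((((hasDerivAt_one_div hr.ne').smul hg₂).sub (h2.smul hg₁)).add (h3.smul hg)).congr_deriv ?_
  unfold quotDeriv₂
  rw [smul_add, smul_sub, smul_smul, smul_smul, smul_smul]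
  rw [show 3 / r * (1 / r) = 3 * (1 / r ^ 2) by field_simp,
    show 3 / r * (2 / r ^ 2) = 6 * (1 / r ^ 3) by field_simp; norm_num,
    show 3 / r * (2 / r ^ 3) = 6 * (1 / r ^ 4) by field_simp; norm_num,
    show 2 / r ^ 2 = 2 * (1 / r ^ 2) by ring, show 4 / r ^ 3 = 4 * (1 / r ^ 3) by ring,
    show 2 / r ^ 3 = 2 * (1 / r ^ 3) by ring, show 6 / r ^ 4 = 6 * (1 / r ^ 4) by ring]
  module

/-- Weighted bound of `(g / r)''` away from the origin, through its first order equation: for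
`n = 3` the right hand side is `g'''`, for `n = 5` it is `g''' + 2 (g / r)''`. -/
theorem massLE_quotDeriv₂ {g g₁ g₂ S : ℝ → ℂ} {n M N : ℝ} (hn : 3 ≤ n) (hn' : n ≤ 5) (hM : 0 ≤ M)
    (hN : 0 ≤ N) (mg₁ : Measurable g₁)
    (hK : ∀ r, 0 < r → HasDerivAt (quotDeriv₂ g g₁ g₂)
      ((1 / r) • S r - (n / r) • quotDeriv₂ g g₁ g₂ r) r)
    (hS : ContinuousOn S (Ioi 0))
    (h3 : MassLE (Ioi 1) (fun r => r * ‖S r‖ ^ 2) M)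
    (h2 : MassLE (Ioi 1) (fun r => ‖g₂ r‖ ^ 2 / (r * logSq r)) N)
    (h1 : MassLE (Ioi 1) (fun r => ‖g₁ r‖ ^ 2 / (r ^ 3 * logSq r)) N)
    (h0 : MassLE (Ioi 1) (fun r => ‖g r‖ ^ 2 / (r * (1 + r ^ 2) ^ 2 * logSq r)) N)
    (mg₂ : Measurable g₂) :
    MassLE (Ioi 1) (fun r => 4 * r * ‖quotDeriv₂ g g₁ g₂ r‖ ^ 2) (M + 2520 * N) := by
  have hε : MassLE (Ioi 1) (fun r => 10 / r * ‖quotDeriv₂ g g₁ g₂ r‖ ^ 2) (1260 * N) := by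
    refine (MassLE.dom3 (c₁ := 60) (c₂ := 240) (c₃ := 960) measurableSet_Ioi (by fun_prop)
      (by fun_prop) (by norm_num) (by norm_num) (by norm_num) hN hN hN (fun r hr => ?_)
      h2 h1 h0).mono_right (by linarith)
    have hr1 : 1 < r := hr
    have hr0 : 0 < r := by linarith
    have hL := logSq_pos r
    have hL2 : logSq r ≤ 2 * r ^ 2 := (logSq_le_two_mul hr1.le).trans (by nlinarith)
    have k := norm_add₃_sq_le ((1 / r) • g₂ r) (-(2 / r ^ 2) • g₁ r) ((2 / r ^ 3) • g r)
    rw [norm_smul_sq, norm_smul_sq, norm_smul_sq, show (1 / r) • g₂ r + -(2 / r ^ 2) • g₁ r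
      + (2 / r ^ 3) • g r = quotDeriv₂ g g₁ g₂ r by unfold quotDeriv₂; module] at k
    have k2 : 10 / r * (1 / r) ^ 2 ≤ 20 / (r * logSq r) := by
      rw [show 10 / r * (1 / r) ^ 2 = 10 / r ^ 3 by field_simp,
        div_le_div_iff₀ (by positivity) (by positivity)]
      nlinarith
    have k1 : 10 / r * (-(2 / r ^ 2)) ^ 2 ≤ 80 / (r ^ 3 * logSq r) := by
      rw [show 10 / r * (-(2 / r ^ 2)) ^ 2 = 40 / r ^ 5 by field_simp; norm_num,
        div_le_div_iff₀ (by positivity) (by positivity)]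
      have : 0 < r ^ 3 := by positivity
      nlinarith
    have k0 : 10 / r * (2 / r ^ 3) ^ 2 ≤ 320 / (r * (1 + r ^ 2) ^ 2 * logSq r) := by
      rw [show 10 / r * (2 / r ^ 3) ^ 2 = 40 / r ^ 7 by field_simp; norm_num,
        div_le_div_iff₀ (by positivity) (by positivity)]
      have h4 : 1 + r ^ 2 ≤ 2 * r ^ 2 := by nlinarith
      calc 40 * (r * (1 + r ^ 2) ^ 2 * logSq r) ≤ 40 * (r * (2 * r ^ 2) ^ 2 * (2 * r ^ 2)) := by
            gcongr
        _ = _ := by ring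
    have j2 := weight_mul_le k2 (sq_nonneg ‖g₂ r‖)
    have j1 := weight_mul_le k1 (sq_nonneg ‖g₁ r‖)
    have j0 := weight_mul_le k0 (sq_nonneg ‖g r‖)
    calc 10 / r * ‖quotDeriv₂ g g₁ g₂ r‖ ^ 2 ≤ 10 / r * _ :=
          mul_le_mul_of_nonneg_left k (by positivity)
      _ = 3 * (10 / r * (1 / r) ^ 2 * ‖g₂ r‖ ^ 2) + 3 * (10 / r * (-(2 / r ^ 2)) ^ 2 * ‖g₁ r‖ ^ 2)
          + 3 * (10 / r * (2 / r ^ 3) ^ 2 * ‖g r‖ ^ 2) := by ring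
      _ ≤ 3 * (20 / (r * logSq r) * ‖g₂ r‖ ^ 2) + 3 * (80 / (r ^ 3 * logSq r) * ‖g₁ r‖ ^ 2)
          + 3 * (320 / (r * (1 + r ^ 2) ^ 2 * logSq r) * ‖g r‖ ^ 2) := by linarith
      _ = _ := by ring
  have hsub : Ioi (1 : ℝ) ⊆ Ioi 0 := Ioi_subset_Ioi zero_le_one
  refine (massLE_energy_Ioi (φ := fun r => r ^ 2 - 1) (φ' := fun r => 2 * r) (V := fun r => n / r)
    (κ := fun r => 4 * r) (ω := fun r => r ^ 3 / 4) (ε := fun r => 10 / r) (P₀ := 0) (M := M / 4)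
    (M' := 1260 * N) (F := fun r => (1 / r) • S r)
    (fun r hr => hK r (zero_lt_one.trans hr)) (fun r hr => ?_)
    ((ContinuousOn.div continuousOn_const continuousOn_id
      fun r hr => (zero_lt_one.trans hr).ne').smul (hS.mono hsub))
    (by fun_prop) (by fun_prop)
    (ContinuousOn.div continuousOn_const continuousOn_id fun r hr => (zero_lt_one.trans hr).ne')
    (fun r hr => by nlinarith) (fun r hr => by linarith)
    (fun r hr => by have : 0 < r := zero_lt_one.trans hr; positivity)
    (fun r hr => by have : 0 < r := zero_lt_one.trans hr; positivity)
    (fun r hr => ?_) (fun r hr => ?_) ?_ (by positivity) (by positivity) ?_ hε).mono_right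
    (by linarith)
  · simpa using (hasDerivAt_pow 2 r).sub_const 1
  · have hr0 : 0 < r := zero_lt_one.trans hr
    have e : 2 * r - 2 * (r ^ 2 - 1) * (n / r) = 2 * r - 2 * n * r + 2 * n / r := by
      field_simp; ring
    have h5 : 2 * n / r ≤ 10 / r := by gcongr; linarith
    rw [e]
    nlinarith
  · have hr0 : 0 < r := zero_lt_one.trans hr
    have : 1 ≤ r ^ 2 := by nlinarith
    nlinarith
  · have c1 : ContinuousAt (fun r => (r ^ 2 - 1) * ‖quotDeriv₂ g g₁ g₂ r‖ ^ 2) 1 :=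
      ((by fun_prop : Continuous fun r : ℝ => r ^ 2 - 1).continuousAt).mul
        ((hK 1 one_pos).continuousAt.norm.pow 2)
    have := c1.tendsto.mono_left (nhdsWithin_le_nhds (s := Ioi 1))
    simpa using this
  · refine (MassLE.dom1 (c₁ := 1 / 4) measurableSet_Ioi (by norm_num) (fun r hr => ?_) h3).mono_right
      (by linarith)
    have hr0 : 0 < r := zero_lt_one.trans hr
    rw [norm_smul_sq]
    refine le_of_eq ?_
    field_simp

theorem driftQ_bounds {r : ℝ} (hr : 0 < r) :
    driftQ r ^ 2 ≤ 4 / r ^ 2 ∧ driftQ r ^ 2 ≤ 4 * r ^ 2 ∧ driftQ r ^ 2 = 4 * r ^ 2 / (1 + r ^ 2) ^ 2 := by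
  have e : driftQ r ^ 2 = 4 * r ^ 2 / (1 + r ^ 2) ^ 2 := by unfold driftQ; field_simp; norm_num
  refine ⟨?_, ?_, e⟩
  · rw [e, div_le_div_iff₀ (by positivity) (by positivity)]; nlinarith [sq_nonneg r]
  · rw [e, div_le_iff₀ (by positivity)]
    exact le_mul_of_one_le_right (by positivity) (one_le_pow₀ (one_le_one_add_sq r))

theorem driftQ'_sq_le (r : ℝ) : driftQ' r ^ 2 ≤ 4 / (1 + r ^ 2) ^ 2 := by
  unfold driftQ'
  rw [div_pow, div_le_div_iff₀ (by positivity) (by positivity)]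
  have h : (1 - r ^ 2) ^ 2 ≤ (1 + r ^ 2) ^ 2 := by nlinarith [sq_nonneg r]
  calc (2 * (1 - r ^ 2)) ^ 2 * (1 + r ^ 2) ^ 2 = 4 * (1 - r ^ 2) ^ 2 * (1 + r ^ 2) ^ 2 := by ring
    _ ≤ 4 * (1 + r ^ 2) ^ 2 * (1 + r ^ 2) ^ 2 := by gcongr
    _ = _ := by ring

theorem driftQ''_sq_le (r : ℝ) : driftQ'' r ^ 2 ≤ 144 * r ^ 2 / (1 + r ^ 2) ^ 2 := by
  unfold driftQ''
  have h1 := one_le_one_add_sq r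
  rw [div_pow, div_le_div_iff₀ (by positivity) (by positivity)]
  have h : (r ^ 2 - 3) ^ 2 ≤ 9 * (1 + r ^ 2) ^ 2 := by nlinarith [sq_nonneg r]
  calc (4 * r * (r ^ 2 - 3)) ^ 2 * (1 + r ^ 2) ^ 2 = 16 * r ^ 2 * (r ^ 2 - 3) ^ 2 * (1 + r ^ 2) ^ 2 := by
        ring
    _ ≤ 16 * r ^ 2 * (9 * (1 + r ^ 2) ^ 2) * (1 + r ^ 2) ^ 2 := by gcongr
    _ = 144 * r ^ 2 * (1 + r ^ 2) ^ 4 := by ring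
    _ ≤ 144 * r ^ 2 * (1 + r ^ 2) ^ 6 := by
      gcongr
      norm_num
    _ = _ := by ring

/-- Near the origin, `g'''` and `(g' + a g)''` differ by terms that the weights control. -/
theorem massLE_locRest_near {g g₁ g₂ : ℝ → ℂ} {N : ℝ} (hN : 0 ≤ N)
    (mg₁ : Measurable g₁) (mg₂ : Measurable g₂)
    (h2 : MassLE (Ioi 0) (fun r => ‖g₂ r‖ ^ 2 / (r * logSq r)) N)
    (h1 : MassLE (Ioi 0) (fun r => ‖g₁ r‖ ^ 2 / (r ^ 3 * logSq r)) N)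
    (h0 : MassLE (Ioi 0) (fun r => ‖g r‖ ^ 2 / (r * (1 + r ^ 2) ^ 2 * logSq r)) N) :
    MassLE (Ioc 0 1)
      (fun r => r * ‖driftQ r • g₂ r + (2 * driftQ' r) • g₁ r + driftQ'' r • g r‖ ^ 2) (984 * N) := by
  have hs : Ioc (0 : ℝ) 1 ⊆ Ioi 0 := Ioc_subset_Ioi_self
  refine (MassLE.dom3 (c₁ := 24) (c₂ := 96) (c₃ := 864) measurableSet_Ioc (by fun_prop)
      (by fun_prop) (by norm_num) (by norm_num) (by norm_num) hN hN hN (fun r hr => ?_)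
      (h2.mono_set hs) (h1.mono_set hs) (h0.mono_set hs)).mono_right (by linarith)
  have hr0 : 0 < r := hr.1
  have hL := logSq_pos r
  have hL4 := pow_mul_logSq_le_two hr0 hr.2
  have k := norm_add₃_sq_le (driftQ r • g₂ r) ((2 * driftQ' r) • g₁ r) (driftQ'' r • g r)
  rw [norm_smul_sq, norm_smul_sq, norm_smul_sq] at k
  have k2 : r * driftQ r ^ 2 ≤ 8 / (r * logSq r) := by
    calc r * driftQ r ^ 2 ≤ r * (4 * r ^ 2) := by have := (driftQ_bounds hr0).2.1; gcongr
      _ ≤ _ := by rw [le_div_iff₀ (by positivity)]; nlinarith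
  have k1 : r * (2 * driftQ' r) ^ 2 ≤ 32 / (r ^ 3 * logSq r) := by
    calc r * (2 * driftQ' r) ^ 2 = 4 * r * driftQ' r ^ 2 := by ring
      _ ≤ 4 * r * (4 / (1 + r ^ 2) ^ 2) := by have := driftQ'_sq_le r; gcongr
      _ ≤ 4 * r * 4 := by
        gcongr
        exact div_le_self (by norm_num) (one_le_pow₀ (one_le_one_add_sq r))
      _ ≤ _ := by rw [le_div_iff₀ (by positivity)]; nlinarith
  have k0 : r * driftQ'' r ^ 2 ≤ 288 / (r * (1 + r ^ 2) ^ 2 * logSq r) := by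
    calc r * driftQ'' r ^ 2 ≤ r * (144 * r ^ 2 / (1 + r ^ 2) ^ 2) := by
          have := driftQ''_sq_le r; gcongr
      _ = 144 * r ^ 3 / (1 + r ^ 2) ^ 2 := by ring
      _ ≤ _ := by
        rw [div_le_div_iff₀ (by positivity) (by positivity)]
        have : 0 < (1 + r ^ 2) ^ 2 := by positivity
        nlinarith
  have j2 := weight_mul_le k2 (sq_nonneg ‖g₂ r‖)
  have j1 := weight_mul_le k1 (sq_nonneg ‖g₁ r‖)
  have j0 := weight_mul_le k0 (sq_nonneg ‖g r‖)
  calc _ ≤ r * _ := mul_le_mul_of_nonneg_left k hr0.le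
    _ = 3 * (r * driftQ r ^ 2 * ‖g₂ r‖ ^ 2) + 3 * (r * (2 * driftQ' r) ^ 2 * ‖g₁ r‖ ^ 2)
        + 3 * (r * driftQ'' r ^ 2 * ‖g r‖ ^ 2) := by ring
    _ ≤ 3 * (8 / (r * logSq r) * ‖g₂ r‖ ^ 2) + 3 * (32 / (r ^ 3 * logSq r) * ‖g₁ r‖ ^ 2)
        + 3 * (288 / (r * (1 + r ^ 2) ^ 2 * logSq r) * ‖g r‖ ^ 2) := by linarith
    _ = _ := by ring

/-- Away from the origin, the remainder `locRem` is a lower order term. -/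
theorem massLE_locRem_far {g g₁ g₂ : ℝ → ℂ} {N : ℝ} (hN : 0 ≤ N)
    (mg₁ : Measurable g₁) (mg₂ : Measurable g₂)
    (h2 : MassLE (Ioi 1) (fun r => ‖g₂ r‖ ^ 2 / (r * logSq r)) N)
    (h1 : MassLE (Ioi 1) (fun r => ‖g₁ r‖ ^ 2 / (r ^ 3 * logSq r)) N)
    (h0 : MassLE (Ioi 1) (fun r => ‖g r‖ ^ 2 / (r * (1 + r ^ 2) ^ 2 * logSq r)) N) :
    MassLE (Ioi 1) (fun r => r * ‖locRem g g₁ g₂ r‖ ^ 2) (4000 * N) := by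
  refine (MassLE.dom3 (c₁ := 24) (c₂ := 480) (c₃ := 3456) measurableSet_Ioi (by fun_prop)
      (by fun_prop) (by norm_num) (by norm_num) (by norm_num) hN hN hN (fun r hr => ?_)
      h2 h1 h0).mono_right (by linarith)
  have hr1 : 1 < r := hr
  have hr0 : 0 < r := by linarith
  have hL := logSq_pos r
  have hL2 : logSq r ≤ 2 * r ^ 2 := (logSq_le_two_mul hr1.le).trans (by nlinarith)
  have hL4 : logSq r ≤ 2 * (1 + r ^ 2) ^ 2 := hL2.trans (by nlinarith [sq_nonneg r])
  have k := norm_add₃_sq_le ((2 * invQ r) • g₂ r) ((4 * invQ' r) • g₁ r) ((2 * invQ'' r) • g r)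
  rw [norm_smul_sq, norm_smul_sq, norm_smul_sq] at k
  have k2 : r * (2 * invQ r) ^ 2 ≤ 8 / (r * logSq r) := by
    rw [show r * (2 * invQ r) ^ 2 = 4 / (r * (1 + r ^ 2) ^ 2) by unfold invQ; field_simp; norm_num,
      div_le_div_iff₀ (by positivity) (by positivity)]
    nlinarith
  have k1 : r * (4 * invQ' r) ^ 2 ≤ 160 / (r ^ 3 * logSq r) := by
    have e : r * (4 * invQ' r) ^ 2 = 16 * (1 + 3 * r ^ 2) ^ 2 / (r ^ 3 * (1 + r ^ 2) ^ 4) := by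
      unfold invQ'; field_simp; norm_num
    rw [e, div_le_div_iff₀ (by positivity) (by positivity)]
    have h3 : (1 + 3 * r ^ 2) ^ 2 ≤ 9 * (1 + r ^ 2) ^ 2 := by nlinarith [sq_nonneg r]
    have h4 : logSq r ≤ (1 + r ^ 2) ^ 2 := by nlinarith [sq_nonneg r]
    calc 16 * (1 + 3 * r ^ 2) ^ 2 * (r ^ 3 * logSq r)
        ≤ 16 * (9 * (1 + r ^ 2) ^ 2) * (r ^ 3 * (1 + r ^ 2) ^ 2) := by gcongr
      _ = 144 * (r ^ 3 * (1 + r ^ 2) ^ 4) := by ring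
      _ ≤ _ := by gcongr; norm_num
  have k0 : r * (2 * invQ'' r) ^ 2 ≤ 1152 / (r * (1 + r ^ 2) ^ 2 * logSq r) := by
    have e : r * (2 * invQ'' r) ^ 2
        = 4 * (2 + 6 * r ^ 2 + 12 * r ^ 4) ^ 2 / (r ^ 5 * (1 + r ^ 2) ^ 6) := by
      unfold invQ''; field_simp; norm_num
    rw [e, div_le_div_iff₀ (by positivity) (by positivity)]
    have h3 : (2 + 6 * r ^ 2 + 12 * r ^ 4) ^ 2 ≤ (12 * (1 + r ^ 2) ^ 2) ^ 2 :=
      pow_le_pow_left₀ (by positivity) (by nlinarith [sq_nonneg r]) 2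
    have h5 : logSq r ≤ 2 * r ^ 4 := hL2.trans (by nlinarith [one_le_pow₀ hr1.le (n := 2)])
    calc 4 * (2 + 6 * r ^ 2 + 12 * r ^ 4) ^ 2 * (r * (1 + r ^ 2) ^ 2 * logSq r)
        ≤ 4 * (12 * (1 + r ^ 2) ^ 2) ^ 2 * (r * (1 + r ^ 2) ^ 2 * (2 * r ^ 4)) := by gcongr
      _ = _ := by ring
  have j2 := weight_mul_le k2 (sq_nonneg ‖g₂ r‖)
  have j1 := weight_mul_le k1 (sq_nonneg ‖g₁ r‖)
  have j0 := weight_mul_le k0 (sq_nonneg ‖g r‖)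
  calc _ ≤ r * _ := mul_le_mul_of_nonneg_left k hr0.le
    _ = 3 * (r * (2 * invQ r) ^ 2 * ‖g₂ r‖ ^ 2) + 3 * (r * (4 * invQ' r) ^ 2 * ‖g₁ r‖ ^ 2)
        + 3 * (r * (2 * invQ'' r) ^ 2 * ‖g r‖ ^ 2) := by ring
    _ ≤ 3 * (8 / (r * logSq r) * ‖g₂ r‖ ^ 2) + 3 * (160 / (r ^ 3 * logSq r) * ‖g₁ r‖ ^ 2)
        + 3 * (1152 / (r * (1 + r ^ 2) ^ 2 * logSq r) * ‖g r‖ ^ 2) := by linarith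
    _ = _ := by ring

@[fun_prop]
theorem measurable_quotDeriv₂ {g g₁ g₂ : ℝ → ℂ} (mg : Measurable g) (mg₁ : Measurable g₁)
    (mg₂ : Measurable g₂) : Measurable (quotDeriv₂ g g₁ g₂) := by unfold quotDeriv₂; fun_prop

@[fun_prop]
theorem measurable_locRem {g g₁ g₂ : ℝ → ℂ} (mg : Measurable g) (mg₁ : Measurable g₁)
    (mg₂ : Measurable g₂) : Measurable (locRem g g₁ g₂) := by unfold locRem; fun_prop

@[fun_prop]
theorem measurable_locL' {g g₁ g₂ : ℝ → ℂ} (mg : Measurable g) (mg₁ : Measurable g₁)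
    (mg₂ : Measurable g₂) : Measurable (locL' g g₁ g₂) := by unfold locL'; fun_prop

@[fun_prop]
theorem measurable_locL'' {g g₁ g₂ g₃ : ℝ → ℂ} (mg : Measurable g) (mg₁ : Measurable g₁)
    (mg₂ : Measurable g₂) (mg₃ : Measurable g₃) : Measurable (locL'' g g₁ g₂ g₃) := by
  unfold locL''; fun_prop

theorem continuousOn_locRem {g g₁ g₂ : ℝ → ℂ} (hg : ContinuousOn g (Ioi 0))
    (hg₁ : ContinuousOn g₁ (Ioi 0)) (hg₂ : ContinuousOn g₂ (Ioi 0)) :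
    ContinuousOn (locRem g g₁ g₂) (Ioi 0) := by
  have c0 : ContinuousOn invQ (Ioi 0) := fun r hr =>
    (hasDerivAt_invQ hr).continuousAt.continuousWithinAt
  have c1 : ContinuousOn invQ' (Ioi 0) := fun r hr =>
    (hasDerivAt_invQ' hr).continuousAt.continuousWithinAt
  have c2 : ContinuousOn invQ'' (Ioi 0) := by
    unfold invQ''
    exact ContinuousOn.div (by fun_prop) (by fun_prop) fun r (hr : 0 < r) => by positivity
  exact (((continuousOn_const.mul c0).smul hg₂).add ((continuousOn_const.mul c1).smul hg₁)).add
    ((continuousOn_const.mul c2).smul hg)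

theorem continuousOn_locL'' {g g₁ g₂ g₃ : ℝ → ℂ} (hg : ContinuousOn g (Ioi 0))
    (hg₁ : ContinuousOn g₁ (Ioi 0)) (hg₂ : ContinuousOn g₂ (Ioi 0)) (hg₃ : ContinuousOn g₃ (Ioi 0)) :
    ContinuousOn (locL'' g g₁ g₂ g₃) (Ioi 0) :=
  (hg₃.add (continuous_driftQ.continuousOn.smul hg₂)).add
    (((continuousOn_const.mul continuous_driftQ'.continuousOn).smul hg₁).add
      (continuous_driftQ''.continuousOn.smul hg))

theorem massLE_drift_terms {g g₁ : ℝ → ℂ} {N : ℝ} (hN : 0 ≤ N) (mg₁ : Measurable g₁)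
    (h1 : MassLE (Ioi 0) (fun r => ‖g₁ r‖ ^ 2 / (r ^ 3 * logSq r)) N)
    (h0 : MassLE (Ioi 0) (fun r => ‖g r‖ ^ 2 / (r * (1 + r ^ 2) ^ 2 * logSq r)) N) :
    MassLE (Ioi 0) (fun r => ‖driftQ r • g₁ r + driftQ' r • g r‖ ^ 2 / (r * logSq r)) (16 * N) := by
  refine (MassLE.dom2 (c₁ := 8) (c₂ := 8) measurableSet_Ioi (by fun_prop) (by norm_num)
    (by norm_num) hN hN (fun r hr => ?_) h1 h0).mono_right (by linarith)
  have hr : 0 < r := hr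
  have hL := logSq_pos r
  have k := norm_add_sq_le' (driftQ r • g₁ r) (driftQ' r • g r)
  rw [norm_smul_sq, norm_smul_sq] at k
  have j1 := weight_mul_le (driftQ_bounds hr).1 (sq_nonneg ‖g₁ r‖)
  have j0 := weight_mul_le (driftQ'_sq_le r) (sq_nonneg ‖g r‖)
  calc _ ≤ (2 * (4 / r ^ 2 * ‖g₁ r‖ ^ 2) + 2 * (4 / (1 + r ^ 2) ^ 2 * ‖g r‖ ^ 2)) / (r * logSq r) := by
        gcongr; linarith
    _ = _ := by field_simp; ring

/-- Recovers `g''` and `g'''` from the derivatives of `g' + a g`. At infinity `(a g)''` is `2 (g / r)''`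
up to `locRem`; the equation of `(g / r)''` bounds it without the loss of a logarithm that a bound of
its three terms by the norm would entail. -/
theorem massLE_of_locL {g g₁ g₂ g₃ : ℝ → ℂ} {N : ℝ} (hN : 0 ≤ N)
    (mg : Measurable g) (mg₁ : Measurable g₁) (mg₂ : Measurable g₂) (mg₃ : Measurable g₃)
    (hg : ∀ r, 0 < r → HasDerivAt g (g₁ r) r) (hg₁ : ∀ r, 0 < r → HasDerivAt g₁ (g₂ r) r)
    (hg₂ : ∀ r, 0 < r → HasDerivAt g₂ (g₃ r) r) (hc : ContinuousOn g₃ (Ioi 0))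
    (h1 : MassLE (Ioi 0) (fun r => ‖g₁ r‖ ^ 2 / (r ^ 3 * logSq r)) N)
    (h0 : MassLE (Ioi 0) (fun r => ‖g r‖ ^ 2 / (r * (1 + r ^ 2) ^ 2 * logSq r)) N)
    (hF₁ : MassLE (Ioi 0) (fun r => ‖locL' g g₁ g₂ r‖ ^ 2 / (r * logSq r)) N)
    (hF₂ : MassLE (Ioi 0) (fun r => r * ‖locL'' g g₁ g₂ g₃ r‖ ^ 2) N) :
    MassLE (Ioi 0) (fun r => ‖g₂ r‖ ^ 2 / (r * logSq r)) (34 * N) ∧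
      MassLE (Ioi 0) (fun r => r * ‖g₃ r‖ ^ 2) (2000000 * N) := by
  have hgc : ContinuousOn g (Ioi 0) := fun r hr => (hg r hr).continuousAt.continuousWithinAt
  have hgc₁ : ContinuousOn g₁ (Ioi 0) := fun r hr => (hg₁ r hr).continuousAt.continuousWithinAt
  have hgc₂ : ContinuousOn g₂ (Ioi 0) := fun r hr => (hg₂ r hr).continuousAt.continuousWithinAt
  have hsub : Ioi (1 : ℝ) ⊆ Ioi 0 := Ioi_subset_Ioi zero_le_one
  have h2 : MassLE (Ioi 0) (fun r => ‖g₂ r‖ ^ 2 / (r * logSq r)) (34 * N) := by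
    refine (MassLE.dom2 (c₁ := 2) (c₂ := 2) measurableSet_Ioi (by fun_prop) (by norm_num)
      (by norm_num) hN (by positivity) (fun r hr => ?_) hF₁
      (massLE_drift_terms hN mg₁ h1 h0)).mono_right (by linarith)
    have hr : 0 < r := hr
    have hL := logSq_pos r
    have k := norm_sub_sq_le' (locL' g g₁ g₂ r) (driftQ r • g₁ r + driftQ' r • g r)
    rw [show locL' g g₁ g₂ r - (driftQ r • g₁ r + driftQ' r • g r) = g₂ r by
      unfold locL'; abel] at k
    calc _ ≤ _ := div_le_div_of_nonneg_right k (by positivity)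
      _ = _ := by ring
  refine ⟨h2, ?_⟩
  have h1' := h1.mono_right (show N ≤ 34 * N by linarith)
  have h0' := h0.mono_right (show N ≤ 34 * N by linarith)
  have near : MassLE (Ioc 0 1) (fun r => r * ‖g₃ r‖ ^ 2) (70000 * N) := by
    refine (MassLE.dom2 (c₁ := 2) (c₂ := 2) measurableSet_Ioc (by fun_prop) (by norm_num)
      (by norm_num) hN (by positivity) (fun r hr => ?_) (hF₂.mono_set Ioc_subset_Ioi_self)
      (massLE_locRest_near (by positivity) mg₁ mg₂ h2 h1' h0')).mono_right (by linarith)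
    have hr : 0 < r := hr.1
    have k := norm_sub_sq_le' (locL'' g g₁ g₂ g₃ r)
      (driftQ r • g₂ r + (2 * driftQ' r) • g₁ r + driftQ'' r • g r)
    rw [show locL'' g g₁ g₂ g₃ r - (driftQ r • g₂ r + (2 * driftQ' r) • g₁ r + driftQ'' r • g r)
      = g₃ r by unfold locL''; abel] at k
    calc _ ≤ r * _ := mul_le_mul_of_nonneg_left k hr.le
      _ = _ := by ring
  have hSM : MassLE (Ioi 1) (fun r => r * ‖locL'' g g₁ g₂ g₃ r + locRem g g₁ g₂ r‖ ^ 2)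
      (272002 * N) := by
    refine (MassLE.dom2 (c₁ := 2) (c₂ := 2) measurableSet_Ioi (by fun_prop) (by norm_num)
      (by norm_num) hN (by positivity) (fun r hr => ?_) (hF₂.mono_set hsub)
      (massLE_locRem_far (by positivity) mg₁ mg₂ (h2.mono_set hsub) (h1'.mono_set hsub)
        (h0'.mono_set hsub))).mono_right (by linarith)
    have hr : 0 < r := zero_lt_one.trans hr
    calc _ ≤ r * _ := mul_le_mul_of_nonneg_left (norm_add_sq_le' _ _) hr.le
      _ = _ := by ring
  have hKM := massLE_quotDeriv₂ (n := 5) (by norm_num) le_rfl (by positivity) (by positivity) mg₁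
    (fun r hr => (hasDerivAt_quotDeriv₂ hr (hg r hr) (hg₁ r hr) (hg₂ r hr)).congr_deriv (by
      rw [Pi.add_apply, locL''_eq g g₁ g₂ g₃ hr, show 5 / r = 2 * (1 / r) + 3 / r by ring]
      module)) ((continuousOn_locL'' hgc hgc₁ hgc₂ hc).add (continuousOn_locRem hgc hgc₁ hgc₂))
    hSM (h2.mono_set hsub) (h1'.mono_set hsub) (h0'.mono_set hsub) mg₂
  have far : MassLE (Ioi 1) (fun r => r * ‖g₃ r‖ ^ 2) (1900000 * N) := by
    refine (MassLE.dom2 (c₁ := 2) (c₂ := 2) measurableSet_Ioi (by fun_prop) (by norm_num)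
      (by norm_num) (by positivity) (by positivity) (fun r hr => ?_) hSM hKM).mono_right (by linarith)
    have hr : 0 < r := zero_lt_one.trans hr
    have k := norm_sub_sq_le' (locL'' g g₁ g₂ g₃ r + locRem g g₁ g₂ r)
      ((2 : ℝ) • quotDeriv₂ g g₁ g₂ r)
    rw [norm_smul_sq, show locL'' g g₁ g₂ g₃ r + locRem g g₁ g₂ r - (2 : ℝ) • quotDeriv₂ g g₁ g₂ r
      = g₃ r by rw [locL''_eq g g₁ g₂ g₃ hr]; abel] at k
    calc _ ≤ r * _ := mul_le_mul_of_nonneg_left k hr.le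
      _ = _ := by ring
  exact (MassLE.glue (by positivity) (by positivity) near far).mono_right (by linarith)

/-- Bounds the derivatives of `g' + a g`. -/
theorem massLE_locL {g g₁ g₂ g₃ : ℝ → ℂ} {N : ℝ} (hN : 0 ≤ N)
    (mg : Measurable g) (mg₁ : Measurable g₁) (mg₂ : Measurable g₂) (mg₃ : Measurable g₃)
    (hg : ∀ r, 0 < r → HasDerivAt g (g₁ r) r) (hg₁ : ∀ r, 0 < r → HasDerivAt g₁ (g₂ r) r)
    (hg₂ : ∀ r, 0 < r → HasDerivAt g₂ (g₃ r) r) (hc : ContinuousOn g₃ (Ioi 0))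
    (h3 : MassLE (Ioi 0) (fun r => r * ‖g₃ r‖ ^ 2) N)
    (h2 : MassLE (Ioi 0) (fun r => ‖g₂ r‖ ^ 2 / (r * logSq r)) N)
    (h1 : MassLE (Ioi 0) (fun r => ‖g₁ r‖ ^ 2 / (r ^ 3 * logSq r)) N)
    (h0 : MassLE (Ioi 0) (fun r => ‖g r‖ ^ 2 / (r * (1 + r ^ 2) ^ 2 * logSq r)) N) :
    MassLE (Ioi 0) (fun r => ‖locL' g g₁ g₂ r‖ ^ 2 / (r * logSq r)) (34 * N) ∧
      MassLE (Ioi 0) (fun r => r * ‖locL'' g g₁ g₂ g₃ r‖ ^ 2) (30000 * N) := by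
  have hsub : Ioi (1 : ℝ) ⊆ Ioi 0 := Ioi_subset_Ioi zero_le_one
  refine ⟨?_, ?_⟩
  · refine (MassLE.dom2 (c₁ := 2) (c₂ := 2) measurableSet_Ioi (by fun_prop) (by norm_num)
      (by norm_num) hN (by positivity) (fun r hr => ?_) h2
      (massLE_drift_terms hN mg₁ h1 h0)).mono_right (by linarith)
    have hr : 0 < r := hr
    have hL := logSq_pos r
    have k := norm_add_sq_le' (g₂ r) (driftQ r • g₁ r + driftQ' r • g r)
    rw [show g₂ r + (driftQ r • g₁ r + driftQ' r • g r) = locL' g g₁ g₂ r by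
      unfold locL'; abel] at k
    calc _ ≤ _ := div_le_div_of_nonneg_right k (by positivity)
      _ = _ := by ring
  have near : MassLE (Ioc 0 1) (fun r => r * ‖locL'' g g₁ g₂ g₃ r‖ ^ 2) (1970 * N) := by
    refine (MassLE.dom2 (c₁ := 2) (c₂ := 2) measurableSet_Ioc (by fun_prop) (by norm_num)
      (by norm_num) hN (by positivity) (fun r hr => ?_) (h3.mono_set Ioc_subset_Ioi_self)
      (massLE_locRest_near hN mg₁ mg₂ h2 h1 h0)).mono_right (by linarith)
    have hr : 0 < r := hr.1
    have k := norm_add_sq_le' (g₃ r)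
      (driftQ r • g₂ r + (2 * driftQ' r) • g₁ r + driftQ'' r • g r)
    rw [show g₃ r + (driftQ r • g₂ r + (2 * driftQ' r) • g₁ r + driftQ'' r • g r)
      = locL'' g g₁ g₂ g₃ r by unfold locL''; abel] at k
    calc _ ≤ r * _ := mul_le_mul_of_nonneg_left k hr.le
      _ = _ := by ring
  have hKM := massLE_quotDeriv₂ (n := 3) le_rfl (by norm_num) hN hN mg₁
    (fun r hr => hasDerivAt_quotDeriv₂ hr (hg r hr) (hg₁ r hr) (hg₂ r hr)) hc
    (h3.mono_set hsub) (h2.mono_set hsub) (h1.mono_set hsub) (h0.mono_set hsub) mg₂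
  have far : MassLE (Ioi 1) (fun r => r * ‖locL'' g g₁ g₂ g₃ r‖ ^ 2) (20000 * N) := by
    refine (MassLE.dom3 (c₁ := 3) (c₂ := 3) (c₃ := 3) measurableSet_Ioi (by fun_prop) (by fun_prop)
      (by norm_num) (by norm_num) (by norm_num) hN (by positivity) (by positivity)
      (fun r hr => ?_) (h3.mono_set hsub) hKM (massLE_locRem_far hN mg₁ mg₂ (h2.mono_set hsub)
        (h1.mono_set hsub) (h0.mono_set hsub))).mono_right (by linarith)
    have hr : 0 < r := zero_lt_one.trans hr
    have k := norm_add₃_sq_le (g₃ r) ((2 : ℝ) • quotDeriv₂ g g₁ g₂ r) (-locRem g g₁ g₂ r)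
    rw [norm_smul_sq, norm_neg, ← sub_eq_add_neg, ← locL''_eq g g₁ g₂ g₃ hr] at k
    calc _ ≤ r * _ := mul_le_mul_of_nonneg_left k hr.le
      _ = _ := by ring
  exact (MassLE.glue (by positivity) (by positivity) near far).mono_right (by linarith)

/-! ### Coercivity of `L_Q` on the third order space -/

/-- The first derivative of `L_Q g`. -/
def linL' (g g₁ g₂ : ℝ → ℂ) (Y : ℝ → ℝ) (r : ℝ) : ℂ := locL' g g₁ g₂ r + (nonloc' g Y r : ℂ)

/-- The second derivative of `L_Q g`. -/
def linL'' (g g₁ g₂ g₃ : ℝ → ℂ) (Y : ℝ → ℝ) (r : ℝ) : ℂ :=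
  locL'' g g₁ g₂ g₃ r + (nonloc'' g g₁ Y r : ℂ)

theorem IsProfile.hasDerivAt_linL {g g₁ g₂ : ℝ → ℂ} {Y : ℝ → ℝ} (h : IsProfile g g₁ Y) {r : ℝ}
    (hr : 0 < r) (hg₁ : HasDerivAt g₁ (g₂ r) r) :
    HasDerivAt (linL g g₁ Y) (linL' g g₁ g₂ Y r) r := by
  refine ((hg₁.add ((hasDerivAt_driftQ r).smul (h.deriv r hr))).add
    (h.hasDerivAt_nonloc hr).ofReal_comp).congr_deriv ?_
  unfold linL' locL'
  abel

theorem IsProfile.hasDerivAt_linL' {g g₁ g₂ g₃ : ℝ → ℂ} {Y : ℝ → ℝ} (h : IsProfile g g₁ Y) {r : ℝ}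
    (hr : 0 < r) (hg₁ : HasDerivAt g₁ (g₂ r) r) (hg₂ : HasDerivAt g₂ (g₃ r) r) :
    HasDerivAt (linL' g g₁ g₂ Y) (linL'' g g₁ g₂ g₃ Y r) r := by
  refine (((hg₂.add ((hasDerivAt_driftQ r).smul hg₁)).add
    ((hasDerivAt_driftQ' r).smul (h.deriv r hr))).add
    (h.hasDerivAt_nonloc' hr).ofReal_comp).congr_deriv ?_
  unfold linL'' locL''
  module

/-- Bounds `g` and `g'` by the lowest order term of the second order norm of `L_Q g`. The first integral
gains two powers of `r` compared with the first order space. -/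
theorem IsProfile.massLE_zeroth {g g₁ : ℝ → ℂ} {Y : ℝ → ℝ} {N : ℝ} (hN : 0 ≤ N)
    (h : IsProfile g g₁ Y) (mg : Measurable g) (mg₁ : Measurable g₁) (mY : Measurable Y)
    (hY1 : Y 1 = 0) (him : (g 1).im = 0)
    (hF : MassLE (Ioi 0) (fun r => ‖linL g g₁ Y r‖ ^ 2 / (r ^ 3 * logSq r)) N) :
    MassLE (Ioi 0) (fun r => ‖g₁ r‖ ^ 2 / (r ^ 3 * logSq r)) (1130000 * N) ∧
      MassLE (Ioi 0) (fun r => ‖g r‖ ^ 2 / (r * (1 + r ^ 2) ^ 2 * logSq r)) (140000 * N) := by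
  have mF := measurable_linL mg mg₁ mY
  have hsL : ∀ r : ℝ, 0 < √(logSq r) := fun r => Real.sqrt_pos.2 (logSq_pos r)
  have csL : ContinuousOn (fun r => √(logSq r)) (Ioi 0) := continuousOn_logSq.sqrt
  have hB : ∀ r, 0 < r → wronskianQ g Y r ^ 2 ≤ r ^ 6 / 6 * N := fun r hr => by
    have := norm_sq_le_of_deriv_of_tendsto_zero (u := wronskianQ g Y)
      (q := fun r => ‖linL g g₁ Y r‖ / (r ^ 2 * √(logSq r))) (m := fun r => r ^ 3)
      (Φ := fun r => r ^ 6 / 6)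
      (fun r hr => h.hasDerivAt_wronskianQ hr)
      ((continuousOn_const.mul (ContinuousOn.div (by fun_prop) (by fun_prop)
        fun r _ => by positivity)).mul (continuous_re.comp_continuousOn h.contF))
      (h.contF.norm.div ((by fun_prop : Continuous fun r : ℝ => r ^ 2).continuousOn.mul csL)
        fun r hr => (mul_pos (pow_pos hr 2) (hsL r)).ne')
      (by fun_prop) (fun r hr => ?_) (fun r hr => ?_) hN
      ((MassLE.dom1 (c₁ := 1) measurableSet_Ioi zero_le_one (fun r hr => ?_) hF).mono_right
        (one_mul N).le) h.tendsto_wronskianQ ?_ hr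
    · rwa [Real.norm_eq_abs, sq_abs] at this
    · refine ((hasDerivAt_pow 6 r).div_const 6).congr_deriv ?_
      push_cast; field_simp
    · have hs := hsL r
      rw [norm_mul, Real.norm_eq_abs, abs_of_nonneg (by positivity), Real.norm_eq_abs]
      have k : √2 * r * √(logSq r) ≤ 1 + r ^ 2 := by
        refine le_of_sq_le_sq ?_ (by positivity)
        rw [mul_pow, mul_pow, Real.sq_sqrt (by norm_num), Real.sq_sqrt (logSq_pos r).le]
        have k1 := mul_logSq_le hr
        have k2 : 2 * r ≤ 1 + r ^ 2 := by nlinarith [sq_nonneg (r - 1)]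
        calc 2 * r ^ 2 * logSq r = (2 * r) * (r * logSq r) := by ring
          _ ≤ (1 + r ^ 2) * (1 + r ^ 2) := by
            have := logSq_pos r
            gcongr
          _ = _ := by ring
      calc √2 * (r ^ 2 / (1 + r ^ 2)) * |(linL g g₁ Y r).re|
          ≤ √2 * (r ^ 2 / (1 + r ^ 2)) * ‖linL g g₁ Y r‖ := by gcongr; exact abs_re_le_norm _
        _ = (√2 * r * √(logSq r)) / (1 + r ^ 2)
            * (r ^ 3 * (‖linL g g₁ Y r‖ / (r ^ 2 * √(logSq r)))) := by field_simp
        _ ≤ 1 * (r ^ 3 * (‖linL g g₁ Y r‖ / (r ^ 2 * √(logSq r)))) := by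
          gcongr
          rw [div_le_one (by positivity)]; exact k
        _ = _ := one_mul _
    · have hr : 0 < r := hr
      have hL := logSq_pos r
      rw [div_pow, mul_pow, Real.sq_sqrt hL.le]
      refine le_of_eq ?_
      field_simp
    · have : Tendsto (fun r : ℝ => r ^ 6 / 6) (𝓝 0) (𝓝 (0 ^ 6 / 6)) :=
        (by fun_prop : Continuous fun r : ℝ => r ^ 6 / 6).tendsto 0
      rw [zero_pow (by norm_num), zero_div] at this
      exact this.mono_left nhdsWithin_le_nhds
  have hB' : ∀ r, 0 < r → |wronskianQ g Y r| ≤ √N * r ^ 3 := fun r hr => by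
    refine abs_le_of_sq_le_sq ?_ (by positivity)
    rw [mul_pow, Real.sq_sqrt hN]
    have h6 : 0 ≤ r ^ 6 * N := by positivity
    linarith [hB r hr]
  have hY : ∀ r, 0 < r → Y r ^ 2 ≤ 16 * N * (r ^ 4 * (1 + r) ^ 2) := fun r hr => by
    have h1 := h.abs_Y_le_of_cubic hY1 (Real.sqrt_nonneg N) hB' hr
    have h2 := pow_le_pow_left₀ (abs_nonneg _) h1 2
    rw [sq_abs, mul_pow, mul_pow, Real.sq_sqrt hN] at h2
    linarith
  have hg1 : ‖g 1‖ ^ 2 ≤ 2 * N := by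
    rw [norm_sq_one_le him, wronskianQ_one g Y, mul_pow, Real.sq_sqrt (by norm_num)]
    linarith [hB 1 one_pos]
  set F : ℝ → ℂ := fun r => g₁ r + driftQ r • g r with hFdef
  have hFc : ContinuousOn F (Ioi 0) := h.cont.add (continuous_driftQ.continuousOn.smul h.contg)
  have mF' : Measurable F := by rw [hFdef]; fun_prop
  have mL : Measurable fun r => 1 / (r * logSq r) := by fun_prop
  have hFM : MassLE (Ioi 0) (fun r => ‖F r‖ ^ 2 / (r ^ 3 * logSq r)) (2050 * N) := by
    refine (MassLE.dom2 (c₁ := 2) (c₂ := 512 * N) measurableSet_Ioi (by fun_prop) (by norm_num)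
      (by positivity) hN (by norm_num) (fun r hr => ?_) hF massLE_inv_mul_logSq).mono_right
      (by linarith)
    have hr : 0 < r := hr
    have hL := logSq_pos r
    have h1 := norm_sub_sq_le' (linL g g₁ Y r) ((kerQ r * Y r : ℝ) : ℂ)
    rw [show linL g g₁ Y r - ((kerQ r * Y r : ℝ) : ℂ) = F r by simp [linL, hFdef],
      norm_ofReal_sq, mul_pow, kerQ_sq] at h1
    have h2 : 8 / (r ^ 2 * (1 + r ^ 2) ^ 2) * Y r ^ 2 ≤ 256 * N * r ^ 2 := by
      have h3 : (1 + r) ^ 2 ≤ 2 * (1 + r ^ 2) ^ 2 := by nlinarith [sq_nonneg (r - 1), sq_nonneg r]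
      calc 8 / (r ^ 2 * (1 + r ^ 2) ^ 2) * Y r ^ 2
          ≤ 8 / (r ^ 2 * (1 + r ^ 2) ^ 2) * (16 * N * (r ^ 4 * (2 * (1 + r ^ 2) ^ 2))) := by
            have := (hY r hr).trans (by gcongr :
              16 * N * (r ^ 4 * (1 + r) ^ 2) ≤ 16 * N * (r ^ 4 * (2 * (1 + r ^ 2) ^ 2)))
            gcongr
        _ = _ := by field_simp; ring
    calc ‖F r‖ ^ 2 / (r ^ 3 * logSq r)
        ≤ (2 * ‖linL g g₁ Y r‖ ^ 2 + 2 * (256 * N * r ^ 2)) / (r ^ 3 * logSq r) := by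
          gcongr; linarith
      _ = _ := by field_simp; ring
  have hg : ∀ r, 0 < r → HasDerivAt g (F r - driftQ r • g r) r := fun r hr => by
    simpa [hFdef] using h.deriv r hr
  have near : MassLE (Ioc 0 1) (fun r => ‖g r‖ ^ 2 / (r * (1 + r ^ 2) ^ 2 * logSq r))
      (131232 * N) := by
    have E := massLE_log_hardy (M := 16400 * N) hg (fun r _ => hasDerivAt_driftQ_factor)
      (fun r _ => by positivity) hFc (by positivity)
      ((MassLE.dom1 (c₁ := 8) measurableSet_Ioc (by norm_num) (fun r hr => ?_)
        (hFM.mono_set Ioc_subset_Ioi_self)).mono_right (by linarith))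
    · refine (MassLE.dom1 (c₁ := 1) measurableSet_Ioc (by norm_num) (fun r hr => ?_) E).mono_right ?_
      · have hr0 : 0 < r := hr.1
        have hL := logSq_pos r
        rw [one_mul, div_le_div_iff₀ (by positivity) (by positivity)]
        have h1 : 1 ≤ (1 + r ^ 2) ^ 4 := one_le_pow₀ (one_le_one_add_sq r)
        calc ‖g r‖ ^ 2 * (r * logSq r) ≤ (1 + r ^ 2) ^ 4 * (‖g r‖ ^ 2 * (r * logSq r)) :=
              le_mul_of_one_le_left (by positivity) h1
          _ = _ := by ring
      · norm_num; linarith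
    · have hr0 : 0 < r := hr.1
      have hL := logSq_pos r
      have h2 : 1 + r ^ 2 ≤ 2 := by nlinarith [hr.2]
      have h4 : (1 + r ^ 2) ^ 2 ≤ 4 := by nlinarith [sq_nonneg r]
      have h5 := pow_mul_logSq_le_two hr0 hr.2
      have h6 : r * (1 + r ^ 2) ^ 2 ≤ 8 / (r ^ 3 * logSq r) := by
        rw [le_div_iff₀ (by positivity)]
        calc r * (1 + r ^ 2) ^ 2 * (r ^ 3 * logSq r) = (1 + r ^ 2) ^ 2 * (r ^ 4 * logSq r) := by ring
          _ ≤ 4 * 2 := by gcongr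
          _ = 8 := by norm_num
      calc r * (1 + r ^ 2) ^ 2 * ‖F r‖ ^ 2 ≤ 8 / (r ^ 3 * logSq r) * ‖F r‖ ^ 2 :=
            weight_mul_le h6 (sq_nonneg _)
        _ = _ := by ring
  have far : MassLE (Ioi 1) (fun r => ‖g r‖ ^ 2 / (r * (1 + r ^ 2) ^ 2 * logSq r)) (2052 * N) := by
    have E := massLE_hardy_Ioi (φ := fun r => (r ^ 4 * logSq r)⁻¹)
      (φ' := fun r => -(4 * r ^ 3 * logSq r + r ^ 4 * (2 * Real.log r / r)) / (r ^ 4 * logSq r) ^ 2)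
      (M := 2050 * N) hg
      (fun r hr => by
        have hL := logSq_pos r
        have := ((hasDerivAt_pow 4 r).mul (hasDerivAt_logSq hr)).inv
          (by simp only [Pi.mul_apply]; positivity)
        refine this.congr_deriv ?_
        simp)
      (fun r hr => by have hL := logSq_pos r; positivity)
      (fun r hr => ?_) hFc (by positivity)
      ((MassLE.dom1 (c₁ := 1) measurableSet_Ioi (by norm_num) (fun r hr => ?_)
        (hFM.mono_set (Ioi_subset_Ioi zero_le_one))).mono_right (one_mul _).le)
    · refine (MassLE.dom1 (c₁ := 1) measurableSet_Ioi (by norm_num) (fun r hr => ?_) E).mono_right ?_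
      · have hr0 : (0 : ℝ) < r := zero_lt_one.trans hr
        have hL := logSq_pos r
        rw [one_mul, show (r ^ 4 * logSq r)⁻¹ * ‖g r‖ ^ 2 / r = ‖g r‖ ^ 2 / (r ^ 5 * logSq r) by
          field_simp]
        gcongr
        nlinarith [pow_pos hr0 3, pow_pos hr0 5]
      · simp [logSq]; linarith
    · have hr0 : (0 : ℝ) < r := zero_lt_one.trans hr
      have hL := logSq_pos r
      have hlog := Real.log_nonneg (le_of_lt hr)
      have hV : 0 ≤ driftQ r := driftQ_nonneg hr0
      have e1 : -(4 * r ^ 3 * logSq r + r ^ 4 * (2 * Real.log r / r)) / (r ^ 4 * logSq r) ^ 2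
        = -(2 * (r ^ 4 * logSq r)⁻¹ / r) - 2 * (r ^ 4 * logSq r)⁻¹ / r
          - 2 * Real.log r * r ^ 3 / (r ^ 4 * logSq r) ^ 2 := by
        field_simp; ring
      rw [e1]
      have h3 : 0 ≤ 2 * Real.log r * r ^ 3 / (r ^ 4 * logSq r) ^ 2 := by positivity
      have h4 : 0 ≤ 2 * (r ^ 4 * logSq r)⁻¹ * driftQ r := by positivity
      have h5 : 0 ≤ 2 * (r ^ 4 * logSq r)⁻¹ / r := by positivity
      linarith
    · have hr0 : (0 : ℝ) < r := zero_lt_one.trans hr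
      have hL := logSq_pos r
      refine le_of_eq ?_
      field_simp
  have hgM : MassLE (Ioi 0) (fun r => ‖g r‖ ^ 2 / (r * (1 + r ^ 2) ^ 2 * logSq r)) (140000 * N) :=
    (MassLE.glue (by positivity) (by positivity) near far).mono_right (by linarith)
  refine ⟨?_, hgM⟩
  refine (MassLE.dom2 (c₁ := 2) (c₂ := 8) measurableSet_Ioi (by fun_prop) (by norm_num)
    (by norm_num) (by positivity) (by positivity) (fun r hr => ?_) hFM hgM).mono_right (by linarith)
  have hr : 0 < r := hr
  have hL := logSq_pos r
  have h1 := norm_sub_sq_le' (F r) (driftQ r • g r)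
  rw [show F r - driftQ r • g r = g₁ r by simp [hFdef], norm_smul_sq, (driftQ_bounds hr).2.2] at h1
  calc _ ≤ _ := div_le_div_of_nonneg_right h1 (by positivity)
    _ = _ := by field_simp; ring

/-- Coercivity of `L_Q` from the third to the second order space, for profiles with `Y 1 = 0` and
`Im g 1 = 0`, in terms of masses. -/
theorem massLE_of_linL₃ {g g₁ g₂ g₃ : ℝ → ℂ} {Y : ℝ → ℝ} {N : ℝ} (hN : 0 ≤ N)
    (h : IsProfile g g₁ Y) (mg : Measurable g) (mg₁ : Measurable g₁) (mg₂ : Measurable g₂)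
    (mg₃ : Measurable g₃) (mY : Measurable Y)
    (hY : ∃ c, ∀ r, 0 < r → r ≤ 1 → |Y r| ≤ c * r ^ 2)
    (hg₁ : ∀ r, 0 < r → HasDerivAt g₁ (g₂ r) r) (hg₂ : ∀ r, 0 < r → HasDerivAt g₂ (g₃ r) r)
    (hc : ContinuousOn g₃ (Ioi 0)) (hY1 : Y 1 = 0) (him : (g 1).im = 0)
    (hF₂ : MassLE (Ioi 0) (fun r => r * ‖linL'' g g₁ g₂ g₃ Y r‖ ^ 2) N)
    (hF₁ : MassLE (Ioi 0) (fun r => ‖linL' g g₁ g₂ Y r‖ ^ 2 / (r * logSq r)) N)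
    (hF : MassLE (Ioi 0) (fun r => ‖linL g g₁ Y r‖ ^ 2 / (r ^ 3 * logSq r)) N) :
    MassLE (Ioi 0) (fun r => r * ‖g₃ r‖ ^ 2) (10 ^ 18 * N) ∧
      MassLE (Ioi 0) (fun r => ‖g₂ r‖ ^ 2 / (r * logSq r)) (10 ^ 18 * N) ∧
      MassLE (Ioi 0) (fun r => ‖g₁ r‖ ^ 2 / (r ^ 3 * logSq r)) (10 ^ 18 * N) ∧
      MassLE (Ioi 0) (fun r => ‖g r‖ ^ 2 / (r * (1 + r ^ 2) ^ 2 * logSq r)) (10 ^ 18 * N) := by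
  obtain ⟨h1, h0⟩ := h.massLE_zeroth hN mg mg₁ mY hY1 him hF
  have h0' := h0.mono_right (show 140000 * N ≤ 1130000 * N by linarith)
  obtain ⟨-, hn1, hn2⟩ := h.massLE_nonloc (by positivity) mg mg₁ mY hY h1 h0'
  have mn1 := measurable_nonloc' mg mY
  have mn2 := measurable_nonloc'' mg mg₁ mY
  have mL' : Measurable (linL' g g₁ g₂ Y) := by unfold linL'; fun_prop
  have mL'' : Measurable (linL'' g g₁ g₂ g₃ Y) := by unfold linL''; fun_prop
  have hL1 : MassLE (Ioi 0) (fun r => ‖locL' g g₁ g₂ r‖ ^ 2 / (r * logSq r)) (10 ^ 11 * N) := by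
    refine (MassLE.dom2 (c₁ := 2) (c₂ := 2) measurableSet_Ioi (by fun_prop) (by norm_num)
      (by norm_num) hN (by positivity) (fun r hr => ?_) hF₁ hn1).mono_right (by norm_num; linarith)
    have hr : 0 < r := hr
    have hL := logSq_pos r
    have k := norm_sub_sq_le' (linL' g g₁ g₂ Y r) (nonloc' g Y r : ℂ)
    rw [show linL' g g₁ g₂ Y r - (nonloc' g Y r : ℂ) = locL' g g₁ g₂ r by simp [linL'],
      norm_ofReal_sq] at k
    calc _ ≤ _ := div_le_div_of_nonneg_right k (by positivity)
      _ = _ := by ring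
  have hL2 : MassLE (Ioi 0) (fun r => r * ‖locL'' g g₁ g₂ g₃ r‖ ^ 2) (10 ^ 11 * N) := by
    refine (MassLE.dom2 (c₁ := 2) (c₂ := 2) measurableSet_Ioi (by fun_prop) (by norm_num)
      (by norm_num) hN (by positivity) (fun r hr => ?_) hF₂ hn2).mono_right (by norm_num; linarith)
    have hr : 0 < r := hr
    have k := norm_sub_sq_le' (linL'' g g₁ g₂ g₃ Y r) (nonloc'' g g₁ Y r : ℂ)
    rw [show linL'' g g₁ g₂ g₃ Y r - (nonloc'' g g₁ Y r : ℂ) = locL'' g g₁ g₂ g₃ r by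
      simp [linL''], norm_ofReal_sq] at k
    calc _ ≤ _ := mul_le_mul_of_nonneg_left k hr.le
      _ = _ := by ring
  have big : 1130000 * N ≤ 10 ^ 11 * N := by norm_num; linarith
  obtain ⟨h2, h3⟩ := massLE_of_locL (by positivity) mg mg₁ mg₂ mg₃ h.deriv hg₁ hg₂ hc
    (h1.mono_right big) (h0'.mono_right big) hL1 hL2
  exact ⟨h3.mono_right (by norm_num; linarith), h2.mono_right (by norm_num; linarith),
    h1.mono_right (by norm_num; linarith), h0.mono_right (by norm_num; linarith)⟩

/-- Boundedness of `L_Q` from the third to the second order space, in terms of masses. -/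
theorem massLE_linL₃ {g g₁ g₂ g₃ : ℝ → ℂ} {Y : ℝ → ℝ} {N : ℝ} (hN : 0 ≤ N)
    (h : IsProfile g g₁ Y) (mg : Measurable g) (mg₁ : Measurable g₁) (mg₂ : Measurable g₂)
    (mg₃ : Measurable g₃) (mY : Measurable Y)
    (hY : ∃ c, ∀ r, 0 < r → r ≤ 1 → |Y r| ≤ c * r ^ 2)
    (hg₁ : ∀ r, 0 < r → HasDerivAt g₁ (g₂ r) r) (hg₂ : ∀ r, 0 < r → HasDerivAt g₂ (g₃ r) r)
    (hc : ContinuousOn g₃ (Ioi 0))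
    (h3 : MassLE (Ioi 0) (fun r => r * ‖g₃ r‖ ^ 2) N)
    (h2 : MassLE (Ioi 0) (fun r => ‖g₂ r‖ ^ 2 / (r * logSq r)) N)
    (h1 : MassLE (Ioi 0) (fun r => ‖g₁ r‖ ^ 2 / (r ^ 3 * logSq r)) N)
    (h0 : MassLE (Ioi 0) (fun r => ‖g r‖ ^ 2 / (r * (1 + r ^ 2) ^ 2 * logSq r)) N) :
    MassLE (Ioi 0) (fun r => r * ‖linL'' g g₁ g₂ g₃ Y r‖ ^ 2) (90000 * N) ∧
    MassLE (Ioi 0) (fun r => ‖linL' g g₁ g₂ Y r‖ ^ 2 / (r * logSq r)) (90000 * N) ∧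
    MassLE (Ioi 0) (fun r => ‖linL g g₁ Y r‖ ^ 2 / (r ^ 3 * logSq r)) (90000 * N) := by
  obtain ⟨hn0, hn1, hn2⟩ := h.massLE_nonloc hN mg mg₁ mY hY h1 h0
  obtain ⟨hL1, hL2⟩ := massLE_locL hN mg mg₁ mg₂ mg₃ h.deriv hg₁ hg₂ hc h3 h2 h1 h0
  have mn0 := measurable_nonloc mY
  have mn1 := measurable_nonloc' mg mY
  have mn2 := measurable_nonloc'' mg mg₁ mY
  refine ⟨?_, ?_, ?_⟩
  · refine (MassLE.dom2 (c₁ := 2) (c₂ := 2) measurableSet_Ioi (by fun_prop) (by norm_num)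
      (by norm_num) (by positivity) (by positivity) (fun r hr => ?_) hL2 hn2).mono_right (by linarith)
    have hr : 0 < r := hr
    have k := norm_add_sq_le' (locL'' g g₁ g₂ g₃ r) (nonloc'' g g₁ Y r : ℂ)
    rw [norm_ofReal_sq] at k
    calc _ ≤ _ := mul_le_mul_of_nonneg_left k hr.le
      _ = _ := by ring
  · refine (MassLE.dom2 (c₁ := 2) (c₂ := 2) measurableSet_Ioi (by fun_prop) (by norm_num)
      (by norm_num) (by positivity) (by positivity) (fun r hr => ?_) hL1 hn1).mono_right (by linarith)
    have hr : 0 < r := hr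
    have hL := logSq_pos r
    have k := norm_add_sq_le' (locL' g g₁ g₂ r) (nonloc' g Y r : ℂ)
    rw [norm_ofReal_sq] at k
    calc _ ≤ _ := div_le_div_of_nonneg_right k (by positivity)
      _ = _ := by ring
  · refine (MassLE.dom3 (c₁ := 3) (c₂ := 12) (c₃ := 3) measurableSet_Ioi (by fun_prop)
      (by fun_prop) (by norm_num) (by norm_num) (by norm_num) hN hN (by positivity)
      (fun r hr => ?_) h1 h0 hn0).mono_right (by linarith)
    have hr : 0 < r := hr
    have hL := logSq_pos r
    have k := norm_add₃_sq_le (g₁ r) (driftQ r • g r) ((kerQ r * Y r : ℝ) : ℂ)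
    rw [norm_ofReal_sq, norm_smul_sq, (driftQ_bounds hr).2.2] at k
    calc _ ≤ _ := div_le_div_of_nonneg_right k (by positivity)
      _ = _ := by unfold nonloc; field_simp; ring

/-! ### Norms of tuples and masses -/

theorem ae_radialMeasure_iff {p : ℝ → Prop} :
    (∀ᵐ r ∂radialMeasure, p r) ↔ ∀ᵐ r ∂(volume.restrict (Ioi (0 : ℝ))), p r := by
  unfold radialMeasure
  rw [ae_withDensity_iff (by fun_prop)]
  refine eventually_congr ?_
  filter_upwards [ae_restrict_mem measurableSet_Ioi] with r hr
  have hr : 0 < r := hr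
  have : ENNReal.ofReal (2 * Real.pi * r) ≠ 0 := by
    rw [Ne, ENNReal.ofReal_eq_zero, not_le]; positivity
  simp [this]

theorem ae_radialMeasure_of_forall {p : ℝ → Prop} (h : ∀ r, 0 < r → p r) :
    ∀ᵐ r ∂radialMeasure, p r := by
  rw [ae_radialMeasure_iff]
  filter_upwards [ae_restrict_mem measurableSet_Ioi] with r hr using h r hr

theorem lintegral_radialMeasure_enorm_sq {E : Type} [NormedAddCommGroup E] (u : ℝ → E) :
    ∫⁻ r, ‖u r‖ₑ ^ 2 ∂radialMeasure
      = ∫⁻ r in Ioi 0, ENNReal.ofReal (2 * Real.pi * (r * ‖u r‖ ^ 2)) := by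
  unfold radialMeasure
  rw [lintegral_withDensity_eq_lintegral_mul_non_measurable _ (by fun_prop)
    (by filter_upwards with r using ENNReal.ofReal_lt_top)]
  refine setLIntegral_congr_fun measurableSet_Ioi fun r hr => ?_
  have hr : 0 < r := hr
  rw [Pi.mul_apply, ← ofReal_norm, ← ENNReal.ofReal_pow (norm_nonneg _),
    ← ENNReal.ofReal_mul (by positivity), mul_assoc]

theorem eLpNorm_radialMeasure_sq {E : Type} [NormedAddCommGroup E] (u : ℝ → E) :
    eLpNorm u 2 radialMeasure ^ 2
      = ∫⁻ r in Ioi 0, ENNReal.ofReal (2 * Real.pi * (r * ‖u r‖ ^ 2)) := by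
  rw [← lintegral_radialMeasure_enorm_sq]
  have := eLpNorm_nnreal_pow_eq_lintegral (p := 2) two_ne_zero (f := u) (μ := radialMeasure)
  simpa using this

theorem ofReal_norm_sq_eq {E : Type} [NormedAddCommGroup E] {x : L2 E} {u : ℝ → E}
    (h : x =ᵐ[radialMeasure] u) :
    ENNReal.ofReal (‖x‖ ^ 2)
      = ∫⁻ r in Ioi 0, ENNReal.ofReal (2 * Real.pi * (r * ‖u r‖ ^ 2)) := by
  rw [ENNReal.ofReal_pow (norm_nonneg _), ofReal_norm, Lp.enorm_def, eLpNorm_congr_ae h,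
    eLpNorm_radialMeasure_sq]

theorem massLE_norm_sq {E : Type} [NormedAddCommGroup E] {x : L2 E} {u : ℝ → E}
    (h : x =ᵐ[radialMeasure] u) : MassLE (Ioi 0) (fun r => r * ‖u r‖ ^ 2) (‖x‖ ^ 2) := by
  unfold MassLE
  rw [ofReal_norm_sq_eq h]
  refine setLIntegral_mono' measurableSet_Ioi fun r hr => ENNReal.ofReal_le_ofReal ?_
  have hr : 0 < r := hr
  refine le_mul_of_one_le_left (by positivity) ?_
  linarith [Real.pi_gt_three]

theorem lintegral_two_pi_le {e : ℝ → ℝ} {M : ℝ} (h : MassLE (Ioi 0) e M) :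
    ∫⁻ r in Ioi 0, ENNReal.ofReal (2 * Real.pi * e r) ≤ ENNReal.ofReal (2 * Real.pi * M) :=
  MassLE.dom1 measurableSet_Ioi (by positivity) (fun _ _ => le_rfl) h

theorem norm_le_of_massLE {E : Type} [NormedAddCommGroup E] {x : L2 E} {u : ℝ → E} {M : ℝ}
    (hM : 0 ≤ M) (h : x =ᵐ[radialMeasure] u) (hu : MassLE (Ioi 0) (fun r => r * ‖u r‖ ^ 2) M) :
    ‖x‖ ≤ 3 * √M := by
  have h1 := (ofReal_norm_sq_eq h).le.trans (lintegral_two_pi_le hu)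
  rw [ENNReal.ofReal_le_ofReal_iff (by positivity)] at h1
  refine le_of_sq_le_sq (h1.trans ?_) (by positivity)
  rw [mul_pow, Real.sq_sqrt hM]
  have := Real.pi_lt_four
  nlinarith

theorem exists_L2 {E : Type} [NormedAddCommGroup E] {u : ℝ → E} {M : ℝ}
    (mu : StronglyMeasurable u) (hu : MassLE (Ioi 0) (fun r => r * ‖u r‖ ^ 2) M) :
    ∃ x : L2 E, x =ᵐ[radialMeasure] u := by
  have h : MemLp u 2 radialMeasure := by
    refine ⟨mu.aestronglyMeasurable, ?_⟩
    have h1 : eLpNorm u 2 radialMeasure ^ 2 < ⊤ := by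
      rw [eLpNorm_radialMeasure_sq]
      exact (lintegral_two_pi_le hu).trans_lt ENNReal.ofReal_lt_top
    exact (ENNReal.pow_lt_top_iff.1 h1).resolve_right two_ne_zero
  exact ⟨h.toLp u, h.coeFn_toLp⟩

/-- The squared weight is `1 / (r² L)`. -/
def IsWeight (w L : ℝ → ℝ) : Prop :=
  Measurable w ∧ (∀ r, 0 < L r) ∧ ∀ r, 0 < r → w r ^ 2 = 1 / (r ^ 2 * L r)

theorem bracket_sq (x : ℝ) : bracket x ^ 2 = 1 + x ^ 2 := Real.sq_sqrt (by positivity)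

@[fun_prop]
theorem continuous_bracket : Continuous bracket := by unfold bracket; fun_prop

@[fun_prop]
theorem measurable_weightLog : Measurable weightLog := by
  have := continuous_bracket.measurable
  unfold weightLog; fun_prop

@[fun_prop]
theorem measurable_weightThree : Measurable weightThree := by
  have := continuous_bracket.measurable
  unfold weightThree; fun_prop

theorem isWeight_minus : IsWeight weightMinus logMinusSq := by
  have := continuous_bracket.measurable
  refine ⟨by unfold weightMinus logMinus; fun_prop, logMinusSq_pos, fun r _ => ?_⟩
  rw [weightMinus, mul_pow, inv_pow, inv_pow, bracket_sq, ← mul_inv, one_div]; rfl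

theorem isWeight_plus : IsWeight weightPlus logPlusSq := by
  have := continuous_bracket.measurable
  refine ⟨by unfold weightPlus logPlus; fun_prop, logPlusSq_pos, fun r _ => ?_⟩
  rw [weightPlus, mul_pow, inv_pow, inv_pow, bracket_sq, ← mul_inv, one_div]; rfl

theorem weightLog_sq (r : ℝ) : weightLog r ^ 2 = 1 / (r ^ 2 * logSq r) := by
  rw [weightLog, mul_pow, inv_pow, inv_pow, bracket_sq, ← mul_inv, one_div]; rfl

theorem weightThree_sq (r : ℝ) :
    weightThree r ^ 2 = 1 / (r ^ 2 * (1 + r ^ 2) ^ 2 * logSq r) := by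
  rw [weightThree, mul_pow, mul_pow, inv_pow, inv_pow, inv_pow, bracket_sq, bracket_sq, ← mul_inv,
    ← mul_inv, one_div]; rfl

/-- The squared first order norm, without the factor `2π`, is at most `M`. -/
def Mass1 (L : ℝ → ℝ) (f : ℝ → ℂ) (M : ℝ) : Prop :=
  MassLE (Ioi 0) (fun r => r * ‖iteratedDeriv 1 f r‖ ^ 2) M ∧
  MassLE (Ioi 0) (fun r => ‖f r‖ ^ 2 / (r * L r)) M

/-- The squares of the terms of the second order norm, without the factor `2π`, are at most `M`. -/
def Mass2 (f : ℝ → ℂ) (M : ℝ) : Prop :=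
  MassLE (Ioi 0) (fun r => r * ‖iteratedDeriv 2 f r‖ ^ 2) M ∧
  MassLE (Ioi 0) (fun r => ‖iteratedDeriv 1 f r‖ ^ 2 / (r * logSq r)) M ∧
  MassLE (Ioi 0) (fun r => ‖f r‖ ^ 2 / (r ^ 3 * logSq r)) M

/-- The squares of the terms of the third order norm, without the factor `2π`, are at most `M`. -/
def Mass3 (f : ℝ → ℂ) (M : ℝ) : Prop :=
  MassLE (Ioi 0) (fun r => r * ‖iteratedDeriv 3 f r‖ ^ 2) M ∧
  MassLE (Ioi 0) (fun r => ‖iteratedDeriv 2 f r‖ ^ 2 / (r * logSq r)) M ∧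
  MassLE (Ioi 0) (fun r => ‖iteratedDeriv 1 f r‖ ^ 2 / (r ^ 3 * logSq r)) M ∧
  MassLE (Ioi 0) (fun r => ‖f r‖ ^ 2 / (r * (1 + r ^ 2) ^ 2 * logSq r)) M

theorem IsWeight.density {w L : ℝ → ℝ} (hw : IsWeight w L) (f : ℝ → ℂ) {r : ℝ} (hr : 0 < r) :
    r * ‖w r • f r‖ ^ 2 = ‖f r‖ ^ 2 / (r * L r) := by
  have := hw.2.1 r
  rw [norm_smul_sq, hw.2.2 r hr]; field_simp

theorem density_weightThree (f : ℝ → ℂ) {r : ℝ} (hr : 0 < r) :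
    r * ‖weightThree r • f r‖ ^ 2 = ‖f r‖ ^ 2 / (r * (1 + r ^ 2) ^ 2 * logSq r) := by
  have := logSq_pos r
  rw [norm_smul_sq, weightThree_sq]; field_simp

theorem norm_smul_pair_sq (c : ℝ) (p : ℂ × ℂ) : ‖c • p‖ ^ 2 = c ^ 2 * ‖p‖ ^ 2 := by
  rw [norm_smul, mul_pow, Real.norm_eq_abs, sq_abs]

/-- The sup norm of a weighted pair against its two entries. -/
theorem density_pair (a b : ℂ) {r : ℝ} (hr : 0 < r) :
    ‖a‖ ^ 2 / (r * logSq r) ≤ r * ‖weightLog r • (a, r⁻¹ • b)‖ ^ 2 ∧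
    ‖b‖ ^ 2 / (r ^ 3 * logSq r) ≤ r * ‖weightLog r • (a, r⁻¹ • b)‖ ^ 2 ∧
    r * ‖weightLog r • (a, r⁻¹ • b)‖ ^ 2
      ≤ 1 * (‖a‖ ^ 2 / (r * logSq r)) + 1 * (‖b‖ ^ 2 / (r ^ 3 * logSq r)) := by
  have hL := logSq_pos r
  rw [norm_smul_pair_sq, weightLog_sq, Prod.norm_def]
  have e : r * (1 / (r ^ 2 * logSq r) * max ‖a‖ ‖r⁻¹ • b‖ ^ 2)
      = max ‖a‖ ‖r⁻¹ • b‖ ^ 2 / (r * logSq r) := by field_simp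
  have eb : ‖b‖ ^ 2 / (r ^ 3 * logSq r) = ‖r⁻¹ • b‖ ^ 2 / (r * logSq r) := by
    rw [norm_smul_sq]; field_simp
  simp only
  rw [e, eb, one_mul, one_mul, ← add_div]
  refine ⟨?_, ?_, ?_⟩
  · gcongr; exact le_max_left _ _
  · gcongr; exact le_max_right _ _
  · gcongr
    rcases max_choice ‖a‖ ‖r⁻¹ • b‖ with h | h <;> rw [h] <;>
      nlinarith [sq_nonneg ‖a‖, sq_nonneg ‖r⁻¹ • b‖]

theorem MassLE.congr {e e' : ℝ → ℝ} {M : ℝ} (h : MassLE (Ioi 0) e M)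
    (he : ∀ r, 0 < r → e' r = e r) : MassLE (Ioi 0) e' M :=
  (MassLE.dom1 (c₁ := 1) measurableSet_Ioi zero_le_one
    (fun r hr => (he r hr).le.trans (one_mul _).ge) h).mono_right (one_mul M).le

theorem sq_norm_fst_le {α β : Type} [NormedAddCommGroup α] [NormedAddCommGroup β]
    (x : WithLp 1 (α × β)) : ‖x.fst‖ ^ 2 ≤ ‖x‖ ^ 2 ∧ ‖x.snd‖ ^ 2 ≤ ‖x‖ ^ 2 := by
  rw [WithLp.prod_norm_eq_of_L1]
  constructor <;> nlinarith [norm_nonneg x.fst, norm_nonneg x.snd]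

theorem Represents1.mass {w L : ℝ → ℝ} (hw : IsWeight w L) {x : Ambient1} {f : ℝ → ℂ}
    (h : Represents1 w x f) : Mass1 L f (‖x‖ ^ 2) :=
  ⟨(massLE_norm_sq h.1).mono_right (sq_norm_fst_le x).1,
    ((massLE_norm_sq h.2).mono_right (sq_norm_fst_le x).2).congr fun _ hr => (hw.density f hr).symm⟩

theorem Represents2.mass {x : Ambient2} {f : ℝ → ℂ} (h : Represents2 x f) : Mass2 f (‖x‖ ^ 2) := by
  have h2 := (massLE_norm_sq h.2).mono_right (sq_norm_fst_le x).2
  refine ⟨(massLE_norm_sq h.1).mono_right (sq_norm_fst_le x).1, ?_, ?_⟩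
  · exact (MassLE.dom1 (c₁ := 1) measurableSet_Ioi zero_le_one (fun r hr =>
      (density_pair _ _ hr).1.trans (one_mul _).ge) h2).mono_right (one_mul _).le
  · exact (MassLE.dom1 (c₁ := 1) measurableSet_Ioi zero_le_one (fun r hr =>
      (density_pair _ _ hr).2.1.trans (one_mul _).ge) h2).mono_right (one_mul _).le

theorem Represents3.mass {x : Ambient3} {f : ℝ → ℂ} (h : Represents3 x f) : Mass3 f (‖x‖ ^ 2) := by
  have hs := (sq_norm_fst_le x).2
  have h2 := (massLE_norm_sq h.2.1).mono_right ((sq_norm_fst_le x.snd).1.trans hs)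
  refine ⟨(massLE_norm_sq h.1).mono_right (sq_norm_fst_le x).1, ?_, ?_, ?_⟩
  · exact (MassLE.dom1 (c₁ := 1) measurableSet_Ioi zero_le_one (fun r hr =>
      (density_pair _ _ hr).1.trans (one_mul _).ge) h2).mono_right (one_mul _).le
  · exact (MassLE.dom1 (c₁ := 1) measurableSet_Ioi zero_le_one (fun r hr =>
      (density_pair _ _ hr).2.1.trans (one_mul _).ge) h2).mono_right (one_mul _).le
  · exact ((massLE_norm_sq h.2.2).mono_right ((sq_norm_fst_le x.snd).2.trans hs)).congr
      fun _ hr => (density_weightThree f hr).symm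

@[fun_prop]
theorem measurable_iteratedDeriv_succ (n : ℕ) (f : ℝ → ℂ) :
    Measurable (iteratedDeriv (n + 1) f) := by
  rw [iteratedDeriv_succ]; exact measurable_deriv _

theorem massLE_pair {a b : ℝ → ℂ} {M : ℝ} (hM : 0 ≤ M) (ma : Measurable a)
    (h1 : MassLE (Ioi 0) (fun r => ‖a r‖ ^ 2 / (r * logSq r)) M)
    (h0 : MassLE (Ioi 0) (fun r => ‖b r‖ ^ 2 / (r ^ 3 * logSq r)) M) :
    MassLE (Ioi 0) (fun r => r * ‖weightLog r • (a r, r⁻¹ • b r)‖ ^ 2) (4 * M) :=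
  (MassLE.dom2 (c₁ := 1) (c₂ := 1) measurableSet_Ioi (by fun_prop) zero_le_one zero_le_one hM hM
    (fun _ hr => (density_pair _ _ hr).2.2) h1 h0).mono_right (by linarith)

theorem sqrt_four_mul {M : ℝ} : √(4 * M) = 2 * √M := by
  rw [Real.sqrt_mul (by norm_num), show √(4 : ℝ) = 2 by
    rw [show (4 : ℝ) = 2 ^ 2 by norm_num]; exact Real.sqrt_sq (by norm_num)]

theorem Represents1.norm_le {w L : ℝ → ℝ} (hw : IsWeight w L) {x : Ambient1} {f : ℝ → ℂ} {M : ℝ}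
    (hM : 0 ≤ M) (h : Represents1 w x f) (hf : Mass1 L f M) : ‖x‖ ≤ 12 * √M := by
  rw [WithLp.prod_norm_eq_of_L1]
  have h1 := norm_le_of_massLE hM h.1 hf.1
  have h2 := norm_le_of_massLE hM h.2 (hf.2.congr fun _ hr => hw.density f hr)
  linarith [Real.sqrt_nonneg M]

theorem Represents2.norm_le {x : Ambient2} {f : ℝ → ℂ} {M : ℝ} (hM : 0 ≤ M) (h : Represents2 x f)
    (hf : Mass2 f M) : ‖x‖ ≤ 12 * √M := by
  rw [WithLp.prod_norm_eq_of_L1]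
  have h1 := norm_le_of_massLE hM h.1 hf.1
  have h2 := norm_le_of_massLE (by positivity) h.2 (massLE_pair hM (by fun_prop) hf.2.1 hf.2.2)
  rw [sqrt_four_mul] at h2
  linarith [Real.sqrt_nonneg M]

theorem Represents3.norm_le {x : Ambient3} {f : ℝ → ℂ} {M : ℝ} (hM : 0 ≤ M) (h : Represents3 x f)
    (hf : Mass3 f M) : ‖x‖ ≤ 12 * √M := by
  rw [WithLp.prod_norm_eq_of_L1, WithLp.prod_norm_eq_of_L1]
  have h1 := norm_le_of_massLE hM h.1 hf.1
  have h2 := norm_le_of_massLE (by positivity) h.2.1 (massLE_pair hM (by fun_prop) hf.2.1 hf.2.2.1)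
  have h3 := norm_le_of_massLE hM h.2.2 (hf.2.2.2.congr fun _ hr => density_weightThree f hr)
  rw [sqrt_four_mul] at h2
  linarith [Real.sqrt_nonneg M]

theorem exists_represents1 {w L : ℝ → ℝ} (hw : IsWeight w L) {f : ℝ → ℂ} {M : ℝ}
    (mf : Measurable f) (hf : Mass1 L f M) : ∃ x : Ambient1, Represents1 w x f := by
  obtain ⟨a, ha⟩ := exists_L2 (by fun_prop : Measurable fun r => iteratedDeriv 1 f r).stronglyMeasurable
    hf.1
  obtain ⟨b, hb⟩ := exists_L2 (hw.1.smul mf).stronglyMeasurable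
    (hf.2.congr fun _ hr => hw.density f hr)
  exact ⟨WithLp.toLp 1 (a, b), ha, hb⟩

theorem exists_represents2 {f : ℝ → ℂ} {M : ℝ} (hM : 0 ≤ M)
    (mf : Measurable f) (hf : Mass2 f M) : ∃ x : Ambient2, Represents2 x f := by
  obtain ⟨a, ha⟩ := exists_L2 (by fun_prop : Measurable fun r => iteratedDeriv 2 f r).stronglyMeasurable
    hf.1
  obtain ⟨b, hb⟩ := exists_L2
    (by fun_prop : Measurable fun r => weightLog r • (iteratedDeriv 1 f r, r⁻¹ • f r)).stronglyMeasurable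
    (massLE_pair hM (by fun_prop) hf.2.1 hf.2.2)
  exact ⟨WithLp.toLp 1 (a, b), ha, hb⟩

theorem exists_represents3 {f : ℝ → ℂ} {M : ℝ} (hM : 0 ≤ M)
    (mf : Measurable f) (hf : Mass3 f M) : ∃ x : Ambient3, Represents3 x f := by
  obtain ⟨a, ha⟩ := exists_L2 (by fun_prop : Measurable fun r => iteratedDeriv 3 f r).stronglyMeasurable
    hf.1
  obtain ⟨b, hb⟩ := exists_L2 (by fun_prop : Measurable fun r =>
      weightLog r • (iteratedDeriv 2 f r, r⁻¹ • iteratedDeriv 1 f r)).stronglyMeasurable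
    (massLE_pair hM (by fun_prop) hf.2.1 hf.2.2.1)
  obtain ⟨c, hc⟩ := exists_L2 (by fun_prop : Measurable fun r => weightThree r • f r).stronglyMeasurable
    (hf.2.2.2.congr fun _ hr => density_weightThree f hr)
  exact ⟨WithLp.toLp 1 (a, WithLp.toLp 1 (b, c)), ha, hb, hc⟩

/-! ### Linearity of the representation -/

theorem iteratedDeriv_congr_pos {f g : ℝ → ℂ} (h : ∀ r, 0 < r → f r = g r) (n : ℕ) {r : ℝ}
    (hr : 0 < r) : iteratedDeriv n f r = iteratedDeriv n g r :=
  Filter.EventuallyEq.iteratedDeriv_eq n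
    (by filter_upwards [lt_mem_nhds hr] with s hs using h s hs)

theorem Represents1.congr {w : ℝ → ℝ} {x : Ambient1} {f g : ℝ → ℂ} (hx : Represents1 w x f)
    (h : ∀ r, 0 < r → f r = g r) : Represents1 w x g :=
  ⟨hx.1.trans (ae_radialMeasure_of_forall fun _ hr => iteratedDeriv_congr_pos h 1 hr),
    hx.2.trans (ae_radialMeasure_of_forall fun r hr => by simp only [h r hr])⟩

theorem Represents2.congr {x : Ambient2} {f g : ℝ → ℂ} (hx : Represents2 x f)
    (h : ∀ r, 0 < r → f r = g r) : Represents2 x g :=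
  ⟨hx.1.trans (ae_radialMeasure_of_forall fun _ hr => iteratedDeriv_congr_pos h 2 hr),
    hx.2.trans (ae_radialMeasure_of_forall fun r hr => by
      simp only [h r hr, iteratedDeriv_congr_pos h 1 hr])⟩

theorem Represents3.congr {x : Ambient3} {f g : ℝ → ℂ} (hx : Represents3 x f)
    (h : ∀ r, 0 < r → f r = g r) : Represents3 x g :=
  ⟨hx.1.trans (ae_radialMeasure_of_forall fun _ hr => iteratedDeriv_congr_pos h 3 hr),
    hx.2.1.trans (ae_radialMeasure_of_forall fun r hr => by
      simp only [iteratedDeriv_congr_pos h 2 hr, iteratedDeriv_congr_pos h 1 hr]),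
    hx.2.2.trans (ae_radialMeasure_of_forall fun r hr => by simp only [h r hr])⟩

/-- Three times continuously differentiable on `(0, ∞)`. -/
def SmoothPos (f : ℝ → ℂ) : Prop := ∀ r, 0 < r → ContDiffAt ℝ 3 f r

theorem _root_.ContDiff.smoothPos {f : ℝ → ℂ} (h : ContDiff ℝ (⊤ : ℕ∞) f) : SmoothPos f :=
  fun _ _ => (contDiff_infty.1 h 3).contDiffAt

theorem SmoothPos.iteratedDeriv_add {f g : ℝ → ℂ} (hf : SmoothPos f) (hg : SmoothPos g) {n : ℕ}
    (hn : n ≤ 3) {r : ℝ} (hr : 0 < r) :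
    iteratedDeriv n (f + g) r = iteratedDeriv n f r + iteratedDeriv n g r :=
  _root_.iteratedDeriv_add ((hf r hr).of_le (by exact_mod_cast hn))
    ((hg r hr).of_le (by exact_mod_cast hn))

theorem Represents1.add {w : ℝ → ℝ} {x y : Ambient1} {f g : ℝ → ℂ} (hx : Represents1 w x f)
    (hy : Represents1 w y g) (hf : SmoothPos f) (hg : SmoothPos g) :
    Represents1 w (x + y) (f + g) := by
  refine ⟨?_, ?_⟩
  · filter_upwards [Lp.coeFn_add x.fst y.fst, hx.1, hy.1, ae_radialMeasure_of_forall
      (fun _ hr => hf.iteratedDeriv_add hg (by norm_num : 1 ≤ 3) hr)] with r h h1 h2 h3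
    rw [h3, ← h1, ← h2]; exact h
  · filter_upwards [Lp.coeFn_add x.snd y.snd, hx.2, hy.2] with r h h1 h2
    rw [Pi.add_apply, smul_add, ← h1, ← h2]; exact h

theorem Represents2.add {x y : Ambient2} {f g : ℝ → ℂ} (hx : Represents2 x f)
    (hy : Represents2 y g) (hf : SmoothPos f) (hg : SmoothPos g) :
    Represents2 (x + y) (f + g) := by
  refine ⟨?_, ?_⟩
  · filter_upwards [Lp.coeFn_add x.fst y.fst, hx.1, hy.1, ae_radialMeasure_of_forall
      (fun _ hr => hf.iteratedDeriv_add hg (by norm_num : 2 ≤ 3) hr)] with r h h1 h2 h3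
    rw [h3, ← h1, ← h2]; exact h
  · filter_upwards [Lp.coeFn_add x.snd y.snd, hx.2, hy.2, ae_radialMeasure_of_forall
      (fun _ hr => hf.iteratedDeriv_add hg (by norm_num : 1 ≤ 3) hr)] with r h h1 h2 h3
    rw [h3, Pi.add_apply, smul_add, ← Prod.mk_add_mk, smul_add, ← h1, ← h2]; exact h

theorem Represents3.add {x y : Ambient3} {f g : ℝ → ℂ} (hx : Represents3 x f)
    (hy : Represents3 y g) (hf : SmoothPos f) (hg : SmoothPos g) :
    Represents3 (x + y) (f + g) := by
  refine ⟨?_, ?_, ?_⟩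
  · filter_upwards [Lp.coeFn_add x.fst y.fst, hx.1, hy.1, ae_radialMeasure_of_forall
      (fun _ hr => hf.iteratedDeriv_add hg (by norm_num : 3 ≤ 3) hr)] with r h h1 h2 h3
    rw [h3, ← h1, ← h2]; exact h
  · filter_upwards [Lp.coeFn_add x.snd.fst y.snd.fst, hx.2.1, hy.2.1, ae_radialMeasure_of_forall
      (fun _ hr => hf.iteratedDeriv_add hg (by norm_num : 1 ≤ 3) hr), ae_radialMeasure_of_forall
      (fun _ hr => hf.iteratedDeriv_add hg (by norm_num : 2 ≤ 3) hr)] with r h h1 h2 h3 h4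
    rw [h3, h4, smul_add, ← Prod.mk_add_mk, smul_add, ← h1, ← h2]; exact h
  · filter_upwards [Lp.coeFn_add x.snd.snd y.snd.snd, hx.2.2, hy.2.2] with r h h1 h2
    rw [Pi.add_apply, smul_add, ← h1, ← h2]; exact h

theorem Represents1.smul {w : ℝ → ℝ} {x : Ambient1} {f : ℝ → ℂ} (hx : Represents1 w x f) (c : ℝ) :
    Represents1 w (c • x) (c • f) := by
  refine ⟨?_, ?_⟩
  · filter_upwards [Lp.coeFn_smul c x.fst, hx.1] with r h h1
    rw [iteratedDeriv_const_smul_field, ← h1]; exact h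
  · filter_upwards [Lp.coeFn_smul c x.snd, hx.2] with r h h1
    rw [Pi.smul_apply, smul_comm, ← h1]; exact h

theorem Represents2.smul {x : Ambient2} {f : ℝ → ℂ} (hx : Represents2 x f) (c : ℝ) :
    Represents2 (c • x) (c • f) := by
  refine ⟨?_, ?_⟩
  · filter_upwards [Lp.coeFn_smul c x.fst, hx.1] with r h h1
    rw [iteratedDeriv_const_smul_field, ← h1]; exact h
  · filter_upwards [Lp.coeFn_smul c x.snd, hx.2] with r h h1
    rw [Pi.smul_apply, iteratedDeriv_const_smul_field, smul_comm _ c, ← Prod.smul_mk, smul_comm _ c,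
      ← h1]; exact h

theorem Represents3.smul {x : Ambient3} {f : ℝ → ℂ} (hx : Represents3 x f) (c : ℝ) :
    Represents3 (c • x) (c • f) := by
  refine ⟨?_, ?_, ?_⟩
  · filter_upwards [Lp.coeFn_smul c x.fst, hx.1] with r h h1
    rw [iteratedDeriv_const_smul_field, ← h1]; exact h
  · filter_upwards [Lp.coeFn_smul c x.snd.fst, hx.2.1] with r h h1
    rw [iteratedDeriv_const_smul_field, iteratedDeriv_const_smul_field, smul_comm _ c,
      ← Prod.smul_mk, smul_comm _ c, ← h1]; exact h
  · filter_upwards [Lp.coeFn_smul c x.snd.snd, hx.2.2] with r h h1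
    rw [Pi.smul_apply, smul_comm, ← h1]; exact h

/-! ### Extension by density, and coercivity modulo a plane -/

/-- A linear relation with bounded fibres extends to a bounded operator on the closure of its
domain. -/
theorem exists_extension {X Y : Type} [NormedAddCommGroup X] [NormedSpace ℝ X]
    [NormedAddCommGroup Y] [NormedSpace ℝ Y] [CompleteSpace Y] (S : Submodule ℝ X)
    (G : X → Y → Prop) (C : ℝ) (hbound : ∀ x y, G x y → ‖y‖ ≤ C * ‖x‖)
    (hadd : ∀ x y x' y', G x y → G x' y' → G (x + x') (y + y'))
    (hsmul : ∀ (c : ℝ) x y, G x y → G (c • x) (c • y))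
    (hdom : ∀ x ∈ S, ∃ y, G x y) :
    ∃ T : S.topologicalClosure →L[ℝ] Y,
      (∀ (x : S.topologicalClosure) (y : Y), (x : X) ∈ S → G x y → T x = y) ∧
      ∀ v, ‖T v‖ ≤ C * ‖v‖ := by
  have huniq : ∀ x y y', G x y → G x y' → y = y' := fun x y y' h h' => by
    have := hbound _ _ (hadd _ _ _ _ h (hsmul (-1) _ _ h'))
    rw [neg_one_smul, neg_one_smul, add_neg_cancel, norm_zero, mul_zero, ← sub_eq_add_neg] at this
    exact sub_eq_zero.1 (norm_le_zero_iff.1 this)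
  choose y hy using fun x : S => hdom x x.2
  let f : S →ₗ[ℝ] Y :=
    { toFun := y
      map_add' := fun a b => huniq _ _ _ (hy (a + b)) (hadd _ _ _ _ (hy a) (hy b))
      map_smul' := fun c a => huniq _ _ _ (hy (c • a)) (hsmul c _ _ (hy a)) }
  let e : S →ₗ[ℝ] S.topologicalClosure := Submodule.inclusion S.le_topologicalClosure
  have hdense : DenseRange e := by
    intro v
    rw [closure_subtype]
    have hv : (v : X) ∈ closure (S : Set X) := v.2
    refine closure_mono ?_ hv
    intro x hx
    exact ⟨⟨x, S.le_topologicalClosure hx⟩, ⟨⟨x, hx⟩, rfl⟩, rfl⟩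
  have hnorm : ∀ x, ‖f x‖ ≤ C * ‖e x‖ := fun x => hbound _ _ (hy x)
  refine ⟨f.extendOfNorm e, fun x z hx hz => ?_, LinearMap.norm_extendOfNorm_apply_le hdense C hnorm⟩
  have h1 := LinearMap.extendOfNorm_eq hdense ⟨C, hnorm⟩ (⟨x, hx⟩ : S)
  have h2 : e ⟨x, hx⟩ = x := rfl
  rw [h2] at h1
  rw [h1]
  exact huniq _ _ _ (hy ⟨x, hx⟩) hz

/-- If `T` controls, on a dense set, the distance to the span of `e₁` and `e₂`, then it controls
the norm on the common kernel of two functionals that separate this span. -/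
theorem coercive_of_mod_span {X Y : Type} [NormedAddCommGroup X] [NormedSpace ℝ X]
    [NormedAddCommGroup Y] [NormedSpace ℝ Y] (S : Submodule ℝ X)
    (T : S.topologicalClosure →L[ℝ] Y) (e₁ e₂ : S.topologicalClosure) {K : ℝ} (hK : 0 ≤ K)
    (h : ∀ x : S.topologicalClosure, (x : X) ∈ S →
      ∃ c₁ c₂ : ℝ, ‖x + c₁ • e₁ + c₂ • e₂‖ ≤ K * ‖T x‖)
    (ψ₁ ψ₂ : S.topologicalClosure →L[ℝ] ℝ)
    (hdet : Matrix.det !![ψ₁ e₁, ψ₁ e₂; ψ₂ e₁, ψ₂ e₂] ≠ 0) :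
    ∃ C : ℝ, 0 < C ∧ ∀ v : S.topologicalClosure, ψ₁ v = 0 → ψ₂ v = 0 → ‖v‖ ≤ C * ‖T v‖ := by
  rw [Matrix.det_fin_two_of] at hdet
  set d := ψ₁ e₁ * ψ₂ e₂ - ψ₁ e₂ * ψ₂ e₁ with hd
  -- the vector `w + b₁ e₁ + b₂ e₂` recovered from `w` by Cramer's rule
  set B : ℝ := 1 + ((‖ψ₁‖ * |ψ₂ e₂| + ‖ψ₂‖ * |ψ₁ e₂|) * ‖e₁‖
    + (‖ψ₂‖ * |ψ₁ e₁| + ‖ψ₁‖ * |ψ₂ e₁|) * ‖e₂‖) / |d| with hB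
  have hB1 : 1 ≤ B := by
    have : 0 ≤ ((‖ψ₁‖ * |ψ₂ e₂| + ‖ψ₂‖ * |ψ₁ e₂|) * ‖e₁‖
      + (‖ψ₂‖ * |ψ₁ e₁| + ‖ψ₁‖ * |ψ₂ e₁|) * ‖e₂‖) / |d| := by positivity
    linarith
  have key : ∀ v : S.topologicalClosure, ψ₁ v = 0 → ψ₂ v = 0 → ∀ c₁ c₂ : ℝ,
      ‖v‖ ≤ B * ‖v + c₁ • e₁ + c₂ • e₂‖ := by
    intro v h1 h2 c₁ c₂
    set w := v + c₁ • e₁ + c₂ • e₂ with hw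
    have w1 : ψ₁ w = c₁ * ψ₁ e₁ + c₂ * ψ₁ e₂ := by simp [hw, h1]
    have w2 : ψ₂ w = c₁ * ψ₂ e₁ + c₂ * ψ₂ e₂ := by simp [hw, h2]
    have hc₁ : c₁ = (ψ₁ w * ψ₂ e₂ - ψ₂ w * ψ₁ e₂) / d := by
      rw [eq_div_iff hdet, w1, w2, hd]; ring
    have hc₂ : c₂ = (ψ₂ w * ψ₁ e₁ - ψ₁ w * ψ₂ e₁) / d := by
      rw [eq_div_iff hdet, w1, w2, hd]; ring
    have n1 := ψ₁.le_opNorm w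
    have n2 := ψ₂.le_opNorm w
    rw [Real.norm_eq_abs] at n1 n2
    have b1 : |c₁| ≤ (‖ψ₁‖ * |ψ₂ e₂| + ‖ψ₂‖ * |ψ₁ e₂|) / |d| * ‖w‖ := by
      rw [hc₁, abs_div, div_mul_eq_mul_div]
      gcongr
      calc |ψ₁ w * ψ₂ e₂ - ψ₂ w * ψ₁ e₂| ≤ |ψ₁ w * ψ₂ e₂| + |ψ₂ w * ψ₁ e₂| := abs_sub _ _
        _ = |ψ₁ w| * |ψ₂ e₂| + |ψ₂ w| * |ψ₁ e₂| := by rw [abs_mul, abs_mul]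
        _ ≤ ‖ψ₁‖ * ‖w‖ * |ψ₂ e₂| + ‖ψ₂‖ * ‖w‖ * |ψ₁ e₂| := by gcongr
        _ = _ := by ring
    have b2 : |c₂| ≤ (‖ψ₂‖ * |ψ₁ e₁| + ‖ψ₁‖ * |ψ₂ e₁|) / |d| * ‖w‖ := by
      rw [hc₂, abs_div, div_mul_eq_mul_div]
      gcongr
      calc |ψ₂ w * ψ₁ e₁ - ψ₁ w * ψ₂ e₁| ≤ |ψ₂ w * ψ₁ e₁| + |ψ₁ w * ψ₂ e₁| := abs_sub _ _
        _ = |ψ₂ w| * |ψ₁ e₁| + |ψ₁ w| * |ψ₂ e₁| := by rw [abs_mul, abs_mul]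
        _ ≤ ‖ψ₂‖ * ‖w‖ * |ψ₁ e₁| + ‖ψ₁‖ * ‖w‖ * |ψ₂ e₁| := by gcongr
        _ = _ := by ring
    calc ‖v‖ = ‖w + (-(c₁ • e₁) + -(c₂ • e₂))‖ := by congr 1; rw [hw]; abel
      _ ≤ ‖w‖ + (‖c₁ • e₁‖ + ‖c₂ • e₂‖) := by
        refine (norm_add_le _ _).trans (by gcongr; refine (norm_add_le _ _).trans ?_; simp)
      _ = ‖w‖ + (|c₁| * ‖e₁‖ + |c₂| * ‖e₂‖) := by
        rw [norm_smul, norm_smul, Real.norm_eq_abs, Real.norm_eq_abs]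
      _ ≤ ‖w‖ + ((‖ψ₁‖ * |ψ₂ e₂| + ‖ψ₂‖ * |ψ₁ e₂|) / |d| * ‖w‖ * ‖e₁‖
          + (‖ψ₂‖ * |ψ₁ e₁| + ‖ψ₁‖ * |ψ₂ e₁|) / |d| * ‖w‖ * ‖e₂‖) := by gcongr
      _ = B * ‖w‖ := by rw [hB]; ring
  refine ⟨B * K + 1, by positivity, fun v h1 h2 => ?_⟩
  have hv : ‖v‖ ≤ B * K * ‖T v‖ := by
    refine le_of_forall_pos_le_add fun ε hε => ?_
    have hcl : (v : X) ∈ closure (S : Set X) := v.2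
    set q := B * (1 + K * ‖T‖) with hq
    have hq0 : 0 < q := by positivity
    obtain ⟨x, hx, hxv⟩ := Metric.mem_closure_iff.1 hcl (ε / q) (by positivity)
    set x' : S.topologicalClosure := ⟨x, S.le_topologicalClosure hx⟩ with hx'
    have hdist : ‖v - x'‖ ≤ ε / q := by
      rw [dist_eq_norm] at hxv; exact hxv.le
    obtain ⟨c₁, c₂, hc⟩ := h x' hx
    have hT : ‖T x'‖ ≤ ‖T v‖ + ‖T‖ * ‖v - x'‖ := by
      have e : T x' = T v - T (v - x') := by rw [map_sub]; abel
      rw [e]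
      exact (norm_sub_le _ _).trans (by gcongr; exact T.le_opNorm _)
    calc ‖v‖ ≤ B * ‖v + c₁ • e₁ + c₂ • e₂‖ := key v h1 h2 c₁ c₂
      _ = B * ‖(v - x') + (x' + c₁ • e₁ + c₂ • e₂)‖ := by congr 2; abel
      _ ≤ B * (‖v - x'‖ + K * (‖T v‖ + ‖T‖ * ‖v - x'‖)) := by
        gcongr
        refine (norm_add_le _ _).trans ?_
        gcongr
        exact hc.trans (by gcongr)
      _ = B * K * ‖T v‖ + q * ‖v - x'‖ := by rw [hq]; ring
      _ ≤ B * K * ‖T v‖ + q * (ε / q) := by gcongr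
      _ = _ := by field_simp
  linarith [norm_nonneg (T v)]

/-! ### Approximation of decaying equivariant functions by Schwartz functions -/

/-- A smooth `m`-equivariant function on the plane. -/
structure EquivSmooth (m : ℕ) (Φ : ℂ → ℂ) : Prop where
  smooth : ContDiff ℝ (⊤ : ℕ∞) Φ
  equiv : ∀ (θ : ℝ) (z : ℂ), Φ (exp (θ * I) * z) = exp (m * θ * I) * Φ z

/-- Decay of order `r⁻¹` at infinity, with a gain of `r⁻¹` per derivative up to order `N`. -/
def Decay (N : ℕ) (f : ℝ → ℂ) : Prop :=
  ∃ C, ∀ k ≤ N, ∀ r : ℝ, 1 ≤ r → ‖iteratedDeriv k f r‖ ≤ C / r ^ (k + 1)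

/-- A smooth function of the radius that vanishes for `r ≤ 1` and equals `1` for `2 ≤ r`. -/
def outer (r : ℝ) : ℝ := 1 - Real.smoothTransition (2 - r ^ 2)

theorem contDiff_outer : ContDiff ℝ (⊤ : ℕ∞) outer :=
  contDiff_const.sub (Real.smoothTransition.contDiff.comp (by fun_prop))

theorem outer_of_lt {r : ℝ} (h0 : 0 ≤ r) (h : r ≤ 1) : outer r = 0 := by
  unfold outer
  rw [Real.smoothTransition.one_of_one_le (by nlinarith), sub_self]

theorem outer_of_two_le {r : ℝ} (h : 2 ≤ r) : outer r = 1 := by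
  unfold outer
  rw [Real.smoothTransition.zero_of_nonpos (by nlinarith), sub_zero]

theorem exists_bound_le_three {p : ℕ → ℝ → Prop} (hp : ∀ k C C', C ≤ C' → p k C → p k C')
    (h : ∀ k ≤ 3, ∃ C, p k C) : ∃ C, 0 ≤ C ∧ ∀ k ≤ 3, p k C := by
  choose! C hC using h
  refine ⟨∑ k ∈ Finset.range 4, |C k|, Finset.sum_nonneg fun _ _ => abs_nonneg _, fun k hk => ?_⟩
  refine hp k (C k) _ ((le_abs_self _).trans ?_) (hC k hk)
  exact Finset.single_le_sum (f := fun k => |C k|) (fun _ _ => abs_nonneg _)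
    (Finset.mem_range.2 (by omega))

theorem continuous_iteratedDeriv_of_smooth {F : Type} [NormedAddCommGroup F] [NormedSpace ℝ F]
    {f : ℝ → F} (hf : ContDiff ℝ (⊤ : ℕ∞) f) (k : ℕ) : Continuous (iteratedDeriv k f) :=
  hf.continuous_iteratedDeriv k (mod_cast le_top)

theorem exists_bound_outer : ∃ C, 0 ≤ C ∧ ∀ i ≤ 3, ∀ ρ : ℝ, 0 ≤ ρ →
    ρ ^ i * ‖iteratedDeriv i outer ρ‖ ≤ C := by
  refine exists_bound_le_three (p := fun i C => ∀ ρ : ℝ, 0 ≤ ρ → ρ ^ i * ‖iteratedDeriv i outer ρ‖ ≤ C)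
    (fun _ _ _ h hp ρ hρ => (hp ρ hρ).trans h) fun i _ => ?_
  obtain ⟨C, hC⟩ := (isCompact_Icc (a := (0 : ℝ)) (b := 3)).exists_bound_of_continuousOn
    (f := fun ρ => ρ ^ i * ‖iteratedDeriv i outer ρ‖)
    ((continuous_pow i).mul (continuous_iteratedDeriv_of_smooth contDiff_outer i).norm).continuousOn
  refine ⟨max C 1, fun ρ hρ => ?_⟩
  rcases le_or_gt ρ 3 with h | h
  · exact (le_abs_self _).trans ((hC ρ ⟨hρ, h⟩).trans (le_max_left _ _))
  · have e : iteratedDeriv i outer ρ = iteratedDeriv i (fun _ => (1 : ℝ)) ρ :=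
      Filter.EventuallyEq.iteratedDeriv_eq i (by
        filter_upwards [lt_mem_nhds h] with s hs using outer_of_two_le (by linarith))
    rw [e, iteratedDeriv_const]
    refine le_trans ?_ (le_max_right _ _)
    split_ifs with h0
    · simp [h0]
    · simp

/-- The part of `f` outside the disk of radius `n`. -/
def tail (n : ℝ) (f : ℝ → ℂ) (r : ℝ) : ℂ := outer (n⁻¹ * r) • f r

theorem contDiff_outer_scaled (n : ℝ) : ContDiff ℝ (⊤ : ℕ∞) fun r => outer (n⁻¹ * r) :=
  contDiff_outer.comp (by fun_prop)

theorem contDiff_tail {f : ℝ → ℂ} (hf : ContDiff ℝ (⊤ : ℕ∞) f) (n : ℝ) :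
    ContDiff ℝ (⊤ : ℕ∞) (tail n f) := (contDiff_outer_scaled n).smul hf

theorem iteratedDeriv_tail_eq_zero (f : ℝ → ℂ) {n r : ℝ} (hr : 0 < r) (h : r < n) (k : ℕ) :
    iteratedDeriv k (tail n f) r = 0 := by
  have hn : 0 < n := hr.trans h
  have e : iteratedDeriv k (tail n f) r = iteratedDeriv k (fun _ => (0 : ℂ)) r :=
    Filter.EventuallyEq.iteratedDeriv_eq k (by
      filter_upwards [lt_mem_nhds hr, gt_mem_nhds h] with s hs hs'
      rw [tail, outer_of_lt (by positivity) (by rw [inv_mul_le_iff₀ hn]; linarith), zero_smul])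
  rw [e, iteratedDeriv_const]; simp

theorem exists_bound_tail {N : ℕ} (hN : N ≤ 3) {f : ℝ → ℂ} (hf : ContDiff ℝ (⊤ : ℕ∞) f)
    (hd : Decay N f) : ∃ C, 0 ≤ C ∧ ∀ k ≤ N, ∀ n r : ℝ, 1 ≤ n → 1 ≤ r →
      ‖iteratedDeriv k (tail n f) r‖ ≤ C / r ^ (k + 1) := by
  obtain ⟨C₁, h0, hC₁⟩ := exists_bound_outer
  obtain ⟨C₂, hC₂⟩ := hd
  have hC₂0 : 0 ≤ C₂ := by simpa using (norm_nonneg _).trans (hC₂ 0 N.zero_le 1 le_rfl)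
  refine ⟨8 * (C₁ * C₂), by positivity, fun k hk n r hn hr => ?_⟩
  have hr0 : 0 < r := by linarith
  have hn0 : 0 < n := by linarith
  have hθ : ∀ i ≤ 3, ‖iteratedDeriv i (fun r => outer (n⁻¹ * r)) r‖ ≤ C₁ / r ^ i := fun i hi => by
    rw [iteratedDeriv_comp_const_mul (contDiff_outer.of_le (mod_cast le_top)), norm_mul, norm_pow,
      norm_inv, Real.norm_of_nonneg hn0.le, le_div_iff₀ (by positivity)]
    calc n⁻¹ ^ i * ‖iteratedDeriv i outer (n⁻¹ * r)‖ * r ^ i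
        = (n⁻¹ * r) ^ i * ‖iteratedDeriv i outer (n⁻¹ * r)‖ := by rw [mul_pow]; ring
      _ ≤ C₁ := hC₁ i hi _ (by positivity)
  have hl := norm_iteratedFDeriv_smul_le (𝕜 := ℝ) (n := k) (N := ((⊤ : ℕ∞) : WithTop ℕ∞))
    (contDiff_outer_scaled n) hf r (mod_cast le_top)
  simp only [norm_iteratedFDeriv_eq_norm_iteratedDeriv] at hl
  refine hl.trans ?_
  calc _ ≤ ∑ i ∈ Finset.range (k + 1), (k.choose i : ℝ) * (C₁ * C₂ / r ^ (k + 1)) := by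
        refine Finset.sum_le_sum fun i hi => ?_
        have hi' : i ≤ k := Nat.lt_succ_iff.1 (Finset.mem_range.1 hi)
        rw [mul_assoc]
        gcongr
        calc _ ≤ C₁ / r ^ i * (C₂ / r ^ (k - i + 1)) := by
              gcongr
              · exact hθ i (hi'.trans (hk.trans hN))
              · exact hC₂ (k - i) ((Nat.sub_le _ _).trans hk) r hr
          _ = _ := by
              rw [div_mul_div_comm, ← pow_add]
              congr 2; omega
    _ = 2 ^ k * (C₁ * C₂ / r ^ (k + 1)) := by
        rw [← Finset.sum_mul]
        congr 1
        exact_mod_cast Nat.sum_range_choose k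
    _ ≤ 2 ^ 3 * (C₁ * C₂ / r ^ (k + 1)) := by
        gcongr
        · norm_num
        · exact hk.trans hN
    _ = _ := by ring

theorem equivSmooth_truncate {m : ℕ} {Φ : ℂ → ℂ} (h : EquivSmooth m Φ) {n : ℝ} (hn : 1 ≤ n) :
    ∃ F ∈ equivSchwartz m, ∀ r : ℝ, profile F r = Φ r + (-1 : ℝ) • tail n (fun r => Φ r) r := by
  set η : ℂ → ℝ := fun z => Real.smoothTransition (2 - (n⁻¹ * ‖z‖) ^ 2) with hη
  have hη' : η = fun z => Real.smoothTransition (2 - n⁻¹ ^ 2 * ‖z‖ ^ 2) := by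
    funext z; rw [hη]; simp only [mul_pow]
  have hηs : ContDiff ℝ (⊤ : ℕ∞) η := by
    rw [hη']
    exact Real.smoothTransition.contDiff.comp
      (contDiff_const.sub (contDiff_const.mul (contDiff_norm_sq ℝ)))
  have hn0 : 0 < n := by linarith
  have hsupp : HasCompactSupport fun z => η z • Φ z := by
    refine HasCompactSupport.intro (isCompact_closedBall (0 : ℂ) (2 * n)) fun z hz => ?_
    rw [mem_closedBall_zero_iff, not_le] at hz
    have h2 : 2 < n⁻¹ * ‖z‖ := by rw [lt_inv_mul_iff₀ hn0]; linarith
    simp only [hη]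
    rw [Real.smoothTransition.zero_of_nonpos (by nlinarith), zero_smul]
  refine ⟨hsupp.toSchwartzMap (hηs.smul h.smooth), fun θ z => ?_, fun r => ?_⟩
  · change η _ • Φ _ = _ * (η z • Φ z)
    rw [h.equiv, mul_smul_comm]
    simp only [hη, norm_mul, norm_exp_ofReal_mul_I, one_mul]
  · change η _ • Φ _ = _
    simp only [hη, tail, outer, norm_real, Real.norm_eq_abs, mul_pow, sq_abs]
    module

theorem massLE_of_le_majorant {e : ℝ → ℝ} {c : ℝ} (hc : 0 ≤ c)
    (h : ∀ r, 0 < r → e r ≤ c / (r * logSq r)) : MassLE (Ioi 0) e (4 * c) :=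
  (MassLE.dom1 measurableSet_Ioi hc (fun r hr => (h r hr).trans (by rw [mul_one_div]))
    massLE_inv_mul_logSq).mono_right (by linarith)

theorem far_density_le {q x C n r : ℝ} {k : ℕ} (hn : 1 ≤ n) (hr : n ≤ r) (hq : q ≤ r ^ (2 * k) / r)
    (hx0 : 0 ≤ x) (hx : x ≤ C / r ^ (k + 1)) : q * x ^ 2 ≤ 2 * C ^ 2 / n / (r * logSq r) := by
  have hr1 : 1 ≤ r := hn.trans hr
  have hr0 : 0 < r := by linarith
  have hn0 : 0 < n := by linarith
  have hL := logSq_pos r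
  have hL2 := logSq_le_two_mul hr1
  calc q * x ^ 2 ≤ r ^ (2 * k) / r * (C / r ^ (k + 1)) ^ 2 := by gcongr
    _ = C ^ 2 / r ^ 3 := by
      rw [div_pow, ← pow_mul, show (k + 1) * 2 = 2 * k + 2 by ring, pow_add]; field_simp
    _ ≤ _ := by
      rw [div_div, div_le_div_iff₀ (by positivity) (by positivity)]
      have : n * (r * logSq r) ≤ 2 * r ^ 3 := by
        calc n * (r * logSq r) ≤ r * (r * (2 * r)) := by gcongr
          _ = _ := by ring
      calc C ^ 2 * (n * (r * logSq r)) ≤ C ^ 2 * (2 * r ^ 3) := by gcongr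
        _ = _ := by ring

theorem exists_bound_near {f : ℝ → ℂ} (hf : ContDiff ℝ (⊤ : ℕ∞) f) :
    ∃ B, 0 ≤ B ∧ ∀ k ≤ 3, ∀ r : ℝ, 0 ≤ r → r ≤ 1 → ‖iteratedDeriv k f r‖ ≤ B := by
  refine exists_bound_le_three
    (p := fun k B => ∀ r : ℝ, 0 ≤ r → r ≤ 1 → ‖iteratedDeriv k f r‖ ≤ B)
    (fun _ _ _ h hp r h0 h1 => (hp r h0 h1).trans h) fun k _ => ?_
  obtain ⟨C, hC⟩ := (isCompact_Icc (a := (0 : ℝ)) (b := 1)).exists_bound_of_continuousOn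
    (continuous_iteratedDeriv_of_smooth hf k).continuousOn
  exact ⟨C, fun r h0 h1 => hC r ⟨h0, h1⟩⟩

theorem hasDerivAt_iteratedDeriv {f : ℝ → ℂ} (hf : ContDiff ℝ (⊤ : ℕ∞) f) (k : ℕ) (r : ℝ) :
    HasDerivAt (iteratedDeriv k f) (iteratedDeriv (k + 1) f r) r := by
  rw [iteratedDeriv_succ]
  exact (hf.differentiable_iteratedDeriv k (mod_cast ENat.natCast_lt_top k) r).hasDerivAt

theorem norm_le_mul_of_vanish {f : ℝ → ℂ} (hf : ContDiff ℝ (⊤ : ℕ∞) f) {B : ℝ} {k : ℕ}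
    (hB : ∀ r : ℝ, 0 ≤ r → r ≤ 1 → ‖iteratedDeriv (k + 1) f r‖ ≤ B) (h0 : iteratedDeriv k f 0 = 0)
    {r : ℝ} (hr : 0 ≤ r) (hr1 : r ≤ 1) : ‖iteratedDeriv k f r‖ ≤ B * r := by
  have := (convex_Icc (0 : ℝ) 1).norm_image_sub_le_of_norm_hasDerivWithin_le
    (f := iteratedDeriv k f) (f' := iteratedDeriv (k + 1) f) (C := B) (x := 0) (y := r)
    (fun s _ => (hasDerivAt_iteratedDeriv hf k s).hasDerivWithinAt) (fun s hs => hB s hs.1 hs.2)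
    ⟨le_rfl, zero_le_one⟩ ⟨hr, hr1⟩
  rwa [h0, sub_zero, sub_zero, Real.norm_of_nonneg hr] at this

theorem near_le {q x B r : ℝ} (hr : 0 < r) (hq : q ≤ 2 / (r * logSq r)) (hx0 : 0 ≤ x)
    (hx : x ≤ B) : q * x ^ 2 ≤ 2 * B ^ 2 / (r * logSq r) := by
  have hL := logSq_pos r
  calc q * x ^ 2 ≤ 2 / (r * logSq r) * B ^ 2 := by gcongr
    _ = _ := by ring

theorem near_le_of_vanish {q x B r : ℝ} (hq : q * r ^ 2 ≤ 2 / (r * logSq r))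
    (hq0 : 0 ≤ q) (hx0 : 0 ≤ x) (hx : x ≤ B * r) : q * x ^ 2 ≤ 2 * B ^ 2 / (r * logSq r) := by
  calc q * x ^ 2 ≤ q * (B * r) ^ 2 := by gcongr
    _ = q * r ^ 2 * B ^ 2 := by ring
    _ ≤ 2 / (r * logSq r) * B ^ 2 := by gcongr
    _ = _ := by ring

theorem self_le_two_div {r : ℝ} (hr : 0 < r) (h1 : r ≤ 1) : r ≤ 2 / (r * logSq r) := by
  have hL := logSq_pos r
  rw [le_div_iff₀ (by positivity)]
  have := mul_logSq_le hr
  nlinarith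

/-- A finite mass criterion: near the origin the density is bounded by hypothesis, and far away
the decay of the derivative is enough. -/
theorem massLE_of_near_of_decay {f : ℝ → ℂ} {q : ℝ → ℝ} {k : ℕ} {B C : ℝ}
    (hfar : ∀ r : ℝ, 1 ≤ r → ‖iteratedDeriv k f r‖ ≤ C / r ^ (k + 1))
    (hq : ∀ r : ℝ, 1 ≤ r → q r ≤ r ^ (2 * k) / r)
    (hnear : ∀ r : ℝ, 0 < r → r ≤ 1 →
      q r * ‖iteratedDeriv k f r‖ ^ 2 ≤ 2 * B ^ 2 / (r * logSq r)) :
    MassLE (Ioi 0) (fun r => q r * ‖iteratedDeriv k f r‖ ^ 2) (8 * (B ^ 2 + C ^ 2)) := by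
  refine (massLE_of_le_majorant (c := 2 * (B ^ 2 + C ^ 2)) (by positivity) fun r hr => ?_).mono_right
    (by linarith)
  have hL := logSq_pos r
  rcases le_total r 1 with h | h
  · refine (hnear r hr h).trans ?_
    gcongr
    nlinarith [sq_nonneg C]
  · refine (far_density_le le_rfl h (hq r h) (norm_nonneg _) (hfar r h)).trans ?_
    rw [div_one]
    gcongr
    nlinarith [sq_nonneg B]

theorem massLE_tail {f : ℝ → ℂ} {q : ℝ → ℝ} {k : ℕ} {C n : ℝ} (hn : 1 ≤ n)
    (hfar : ∀ r : ℝ, 1 ≤ r → ‖iteratedDeriv k (tail n f) r‖ ≤ C / r ^ (k + 1))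
    (hq : ∀ r : ℝ, 1 ≤ r → q r ≤ r ^ (2 * k) / r) :
    MassLE (Ioi 0) (fun r => q r * ‖iteratedDeriv k (tail n f) r‖ ^ 2) (8 * C ^ 2 / n) := by
  have hn0 : 0 < n := by linarith
  refine (massLE_of_le_majorant (c := 2 * C ^ 2 / n) (by positivity) fun r hr => ?_).mono_right
    (by rw [← mul_div_assoc]; exact (by ring : _ = _).le)
  have hL := logSq_pos r
  rcases lt_or_ge r n with h | h
  · rw [iteratedDeriv_tail_eq_zero f hr h]
    simp only [norm_zero, ne_eq, OfNat.ofNat_ne_zero, not_false_eq_true, zero_pow, mul_zero]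
    positivity
  · exact far_density_le hn h (hq r (hn.trans h)) (norm_nonneg _) (hfar r (hn.trans h))

theorem self_le_pow_div {r : ℝ} {k : ℕ} (hr : 1 ≤ r) (hk : 1 ≤ k) : r ≤ r ^ (2 * k) / r := by
  rw [le_div_iff₀ (by linarith)]
  calc r * r = r ^ 2 := by ring
    _ ≤ _ := pow_le_pow_right₀ hr (by omega)

theorem one_div_le_pow_div {r y : ℝ} (k : ℕ) (hr : 1 ≤ r) (hy : r ≤ y) :
    1 / y ≤ r ^ (2 * k) / r := by
  have hr0 : 0 < r := by linarith
  calc 1 / y ≤ 1 / r := by gcongr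
    _ ≤ _ := by gcongr; exact one_le_pow₀ hr

theorem EquivSmooth.trace {m : ℕ} {Φ : ℂ → ℂ} (h : EquivSmooth m Φ) :
    ContDiff ℝ (⊤ : ℕ∞) fun r : ℝ => Φ r := h.smooth.comp ofRealCLM.contDiff

theorem EquivSmooth.zero {m : ℕ} {Φ : ℂ → ℂ} (h : EquivSmooth m Φ) (hm : m ≠ 0) :
    iteratedDeriv 0 (fun r : ℝ => Φ r) 0 = 0 := by
  have h1 := h.equiv (Real.pi / m) 0
  rw [mul_zero] at h1
  have e : (m : ℂ) * ((Real.pi / m : ℝ) : ℂ) * I = Real.pi * I := by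
    push_cast
    field_simp
  rw [e, exp_pi_mul_I] at h1
  have h2 : Φ 0 = 0 := by linear_combination h1 / 2
  simpa using h2

/-- A radial function is even along the real line, so its derivative vanishes at the origin. -/
theorem EquivSmooth.deriv_zero {Φ : ℂ → ℂ} (h : EquivSmooth 0 Φ) :
    iteratedDeriv 1 (fun r : ℝ => Φ r) 0 = 0 := by
  have he : (fun r : ℝ => Φ ((-r : ℝ) : ℂ)) = fun r : ℝ => Φ r := by
    funext r
    have := h.equiv Real.pi r
    rw [exp_pi_mul_I] at this
    simpa using this
  have hd := deriv_comp_neg (fun r : ℝ => Φ r) 0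
  rw [iteratedDeriv_one]
  simp only [he, neg_zero] at hd
  linear_combination hd / 2

/-! ### Membership in the adapted spaces -/

theorem exists_nat_sqrt_lt (C : ℝ) {ε : ℝ} (hε : 0 < ε) :
    ∃ n : ℝ, 1 ≤ n ∧ 12 * √(8 * C ^ 2 / n) < ε := by
  refine ⟨1 + 144 * (8 * C ^ 2) / ε ^ 2, by have : 0 ≤ 144 * (8 * C ^ 2) / ε ^ 2 := by positivity
                                            linarith, ?_⟩
  refine lt_of_pow_lt_pow_left₀ 2 hε.le ?_
  have h0 : 0 ≤ 144 * (8 * C ^ 2) / ε ^ 2 := by positivity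
  rw [mul_pow, Real.sq_sqrt (by positivity), ← mul_div_assoc, div_lt_iff₀ (by positivity)]
  rw [mul_add, mul_one, mul_div_cancel₀ _ (by positivity : ε ^ 2 ≠ 0)]
  nlinarith [pow_pos hε 2]

theorem SmoothPos.smul {f : ℝ → ℂ} (hf : SmoothPos f) (c : ℝ) : SmoothPos (c • f) :=
  fun r hr => (contDiffAt_const (c := c)).smul (hf r hr)

theorem Represents1.add_neg {w : ℝ → ℝ} {x y : Ambient1} {f g : ℝ → ℂ} (hx : Represents1 w x f)
    (hy : Represents1 w y g) (hf : SmoothPos f) (hg : SmoothPos g) :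
    Represents1 w (x + (-1 : ℝ) • y) (f + (-1 : ℝ) • g) :=
  hx.add (hy.smul _) hf (hg.smul _)

theorem Represents2.add_neg {x y : Ambient2} {f g : ℝ → ℂ} (hx : Represents2 x f)
    (hy : Represents2 y g) (hf : SmoothPos f) (hg : SmoothPos g) :
    Represents2 (x + (-1 : ℝ) • y) (f + (-1 : ℝ) • g) :=
  hx.add (hy.smul _) hf (hg.smul _)

theorem Represents3.add_neg {x y : Ambient3} {f g : ℝ → ℂ} (hx : Represents3 x f)
    (hy : Represents3 y g) (hf : SmoothPos f) (hg : SmoothPos g) :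
    Represents3 (x + (-1 : ℝ) • y) (f + (-1 : ℝ) • g) :=
  hx.add (hy.smul _) hf (hg.smul _)

theorem le_mul_of_one_le {r x : ℝ} (hr : 1 ≤ r) (hx : 1 ≤ x) : r ≤ r * x :=
  le_mul_of_one_le_right (by linarith) hx

/-- Cutting off at radius `n` changes a decaying function by an amount of size `O(n^{-1/2})` in the
adapted norm. -/
theorem mem_closure1 {m : ℕ} {w L : ℝ → ℝ} (hw : IsWeight w L) (hL : ∀ r, 1 ≤ L r) {Φ : ℂ → ℂ}
    (h : EquivSmooth m Φ) (hd : Decay 1 fun r => Φ r) {x : Ambient1}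
    (hx : Represents1 w x fun r => Φ r) : x ∈ (schwartzTuples1 m w).topologicalClosure := by
  obtain ⟨C, -, hC⟩ := exists_bound_tail (by norm_num) h.trace hd
  refine Metric.mem_closure_iff.2 fun ε hε => ?_
  obtain ⟨n, hn, hnε⟩ := exists_nat_sqrt_lt C hε
  have ht := contDiff_tail h.trace n
  have hM : Mass1 L (tail n fun r => Φ r) (8 * C ^ 2 / n) := by
    refine ⟨massLE_tail (q := fun r => r) (k := 1) hn (fun r => hC 1 (by norm_num) n r hn)
      fun r hr => self_le_pow_div hr le_rfl, ?_⟩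
    refine (massLE_tail (q := fun r => 1 / (r * L r)) (k := 0) hn
      (fun r => hC 0 (by norm_num) n r hn) fun r hr => one_div_le_pow_div 0 hr
        (le_mul_of_one_le hr (hL r))).congr fun r hr => ?_
    rw [iteratedDeriv_zero]; ring
  obtain ⟨y, hy⟩ := exists_represents1 hw ht.continuous.measurable hM
  obtain ⟨F, hF, hFp⟩ := equivSmooth_truncate h hn
  refine ⟨x + (-1 : ℝ) • y, ⟨F, hF, (hx.add_neg hy h.trace.smoothPos ht.smoothPos).congr
    fun r _ => (hFp r).symm⟩, ?_⟩
  have e : x - (x + (-1 : ℝ) • y) = y := by rw [neg_one_smul]; abel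
  rw [dist_eq_norm, e]
  exact (hy.norm_le hw (by positivity) hM).trans_lt hnε

theorem mem_closure2 {m : ℕ} {Φ : ℂ → ℂ} (h : EquivSmooth m Φ) (hd : Decay 2 fun r => Φ r)
    {x : Ambient2} (hx : Represents2 x fun r => Φ r) :
    x ∈ (schwartzTuples2 m).topologicalClosure := by
  obtain ⟨C, -, hC⟩ := exists_bound_tail (by norm_num) h.trace hd
  refine Metric.mem_closure_iff.2 fun ε hε => ?_
  obtain ⟨n, hn, hnε⟩ := exists_nat_sqrt_lt C hε
  have ht := contDiff_tail h.trace n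
  have hM : Mass2 (tail n fun r => Φ r) (8 * C ^ 2 / n) := by
    refine ⟨massLE_tail (q := fun r => r) (k := 2) hn (fun r => hC 2 (by norm_num) n r hn)
      fun r hr => self_le_pow_div hr (by norm_num), ?_, ?_⟩
    · refine (massLE_tail (q := fun r => 1 / (r * logSq r)) (k := 1) hn
        (fun r => hC 1 (by norm_num) n r hn) fun r hr => one_div_le_pow_div 1 hr
          (le_mul_of_one_le hr (one_le_logSq r))).congr fun r hr => ?_
      ring
    · refine (massLE_tail (q := fun r => 1 / (r ^ 3 * logSq r)) (k := 0) hn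
        (fun r => hC 0 (by norm_num) n r hn) fun r hr => one_div_le_pow_div 0 hr
          ((le_self_pow₀ hr three_ne_zero).trans
            (le_mul_of_one_le (one_le_pow₀ hr) (one_le_logSq r)))).congr fun r hr => ?_
      rw [iteratedDeriv_zero]; ring
  obtain ⟨y, hy⟩ := exists_represents2 (by positivity) ht.continuous.measurable hM
  obtain ⟨F, hF, hFp⟩ := equivSmooth_truncate h hn
  refine ⟨x + (-1 : ℝ) • y, ⟨F, hF, (hx.add_neg hy h.trace.smoothPos ht.smoothPos).congr
    fun r _ => (hFp r).symm⟩, ?_⟩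
  have e : x - (x + (-1 : ℝ) • y) = y := by rw [neg_one_smul]; abel
  rw [dist_eq_norm, e]
  exact (hy.norm_le (by positivity) hM).trans_lt hnε

theorem mem_closure3 {m : ℕ} {Φ : ℂ → ℂ} (h : EquivSmooth m Φ) (hd : Decay 3 fun r => Φ r)
    {x : Ambient3} (hx : Represents3 x fun r => Φ r) :
    x ∈ (schwartzTuples3 m).topologicalClosure := by
  obtain ⟨C, -, hC⟩ := exists_bound_tail (by norm_num) h.trace hd
  refine Metric.mem_closure_iff.2 fun ε hε => ?_
  obtain ⟨n, hn, hnε⟩ := exists_nat_sqrt_lt C hε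
  have ht := contDiff_tail h.trace n
  have hM : Mass3 (tail n fun r => Φ r) (8 * C ^ 2 / n) := by
    refine ⟨massLE_tail (q := fun r => r) (k := 3) hn (fun r => hC 3 (by norm_num) n r hn)
      fun r hr => self_le_pow_div hr (by norm_num), ?_, ?_, ?_⟩
    · refine (massLE_tail (q := fun r => 1 / (r * logSq r)) (k := 2) hn
        (fun r => hC 2 (by norm_num) n r hn) fun r hr => one_div_le_pow_div 2 hr
          (le_mul_of_one_le hr (one_le_logSq r))).congr fun r hr => ?_
      ring
    · refine (massLE_tail (q := fun r => 1 / (r ^ 3 * logSq r)) (k := 1) hn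
        (fun r => hC 1 (by norm_num) n r hn) fun r hr => one_div_le_pow_div 1 hr
          ((le_self_pow₀ hr three_ne_zero).trans
            (le_mul_of_one_le (one_le_pow₀ hr) (one_le_logSq r)))).congr fun r hr => ?_
      ring
    · refine (massLE_tail (q := fun r => 1 / (r * (1 + r ^ 2) ^ 2 * logSq r)) (k := 0) hn
        (fun r => hC 0 (by norm_num) n r hn) fun r hr => one_div_le_pow_div 0 hr
          ?_).congr fun r hr => ?_
      · have h1 : 1 ≤ (1 + r ^ 2) ^ 2 := one_le_pow₀ (one_le_one_add_sq r)
        exact (le_mul_of_one_le hr h1).trans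
          (le_mul_of_one_le (hr.trans (le_mul_of_one_le hr h1)) (one_le_logSq r))
      · rw [iteratedDeriv_zero]; ring
  obtain ⟨y, hy⟩ := exists_represents3 (by positivity) ht.continuous.measurable hM
  obtain ⟨F, hF, hFp⟩ := equivSmooth_truncate h hn
  refine ⟨x + (-1 : ℝ) • y, ⟨F, hF, (hx.add_neg hy h.trace.smoothPos ht.smoothPos).congr
    fun r _ => (hFp r).symm⟩, ?_⟩
  have e : x - (x + (-1 : ℝ) • y) = y := by rw [neg_one_smul]; abel
  rw [dist_eq_norm, e]
  exact (hy.norm_le (by positivity) hM).trans_lt hnε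

theorem exists_mem_minus {Φ : ℂ → ℂ} (h : EquivSmooth 0 Φ) (hd : Decay 1 fun r => Φ r) :
    ∃ x : adaptedH1_0, Represents1 weightMinus x fun r => Φ r := by
  obtain ⟨C, hC⟩ := id hd
  obtain ⟨B, -, hB⟩ := exists_bound_near h.trace
  have hM : Mass1 logMinusSq (fun r => Φ r) (8 * (B ^ 2 + C ^ 2)) := by
    refine ⟨massLE_of_near_of_decay (q := fun r => r) (k := 1) (hC 1 (by norm_num))
      (fun r hr => self_le_pow_div hr le_rfl) fun r hr h1 => near_le hr (self_le_two_div hr h1)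
        (norm_nonneg _) (hB 1 (by norm_num) r hr.le h1), ?_⟩
    refine (massLE_of_near_of_decay (q := fun r => 1 / (r * logMinusSq r)) (k := 0)
      (hC 0 (by norm_num)) (fun r hr => one_div_le_pow_div 0 hr
        (le_mul_of_one_le hr (one_le_logMinusSq r))) fun r hr h1 => near_le hr ?_
        (norm_nonneg _) (hB 0 (by norm_num) r hr.le h1)).congr fun r _ => ?_
    · have hL := logSq_pos r
      rw [logMinusSq_of_le_one hr h1]
      gcongr; norm_num
    · rw [iteratedDeriv_zero]; ring
  obtain ⟨x, hx⟩ := exists_represents1 isWeight_minus h.trace.continuous.measurable hM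
  exact ⟨⟨x, mem_closure1 isWeight_minus one_le_logMinusSq h hd hx⟩, hx⟩

theorem exists_mem_plus {Φ : ℂ → ℂ} (h : EquivSmooth 2 Φ) (hd : Decay 1 fun r => Φ r) :
    ∃ x : adaptedH1_2, Represents1 weightPlus x fun r => Φ r := by
  obtain ⟨C, hC⟩ := id hd
  obtain ⟨B, -, hB⟩ := exists_bound_near h.trace
  have hM : Mass1 logPlusSq (fun r => Φ r) (8 * (B ^ 2 + C ^ 2)) := by
    refine ⟨massLE_of_near_of_decay (q := fun r => r) (k := 1) (hC 1 (by norm_num))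
      (fun r hr => self_le_pow_div hr le_rfl) fun r hr h1 => near_le hr (self_le_two_div hr h1)
        (norm_nonneg _) (hB 1 (by norm_num) r hr.le h1), ?_⟩
    refine (massLE_of_near_of_decay (q := fun r => 1 / (r * logPlusSq r)) (k := 0)
      (hC 0 (by norm_num)) (fun r hr => one_div_le_pow_div 0 hr
        (le_mul_of_one_le hr (one_le_logPlusSq r))) fun r hr h1 => near_le_of_vanish ?_
        (by have := logPlusSq_pos r; positivity) (norm_nonneg _)
        (norm_le_mul_of_vanish h.trace (hB 1 (by norm_num)) (h.zero two_ne_zero) hr.le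
          h1)).congr fun r _ => ?_
    · rw [logPlusSq_of_le_one hr h1, show 1 / (r * 1) * r ^ 2 = r by field_simp]
      exact self_le_two_div hr h1
    · rw [iteratedDeriv_zero]; ring
  obtain ⟨x, hx⟩ := exists_represents1 isWeight_plus h.trace.continuous.measurable hM
  exact ⟨⟨x, mem_closure1 isWeight_plus one_le_logPlusSq h hd hx⟩, hx⟩

theorem inv_le_two_div (r : ℝ) {y : ℝ} (hr : 0 < r) (hy : y = 1 / (r * logSq r)) :
    y ≤ 2 / (r * logSq r) := by
  have hL := logSq_pos r
  rw [hy]; gcongr; norm_num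

theorem exists_mem_two {Φ : ℂ → ℂ} (h : EquivSmooth 1 Φ) (hd : Decay 2 fun r => Φ r) :
    ∃ x : adaptedH2_1, Represents2 x fun r => Φ r := by
  obtain ⟨C, hC⟩ := id hd
  obtain ⟨B, -, hB⟩ := exists_bound_near h.trace
  have hM : Mass2 (fun r => Φ r) (8 * (B ^ 2 + C ^ 2)) := by
    refine ⟨massLE_of_near_of_decay (q := fun r => r) (k := 2) (hC 2 (by norm_num))
      (fun r hr => self_le_pow_div hr (by norm_num)) fun r hr h1 => near_le hr
        (self_le_two_div hr h1) (norm_nonneg _) (hB 2 (by norm_num) r hr.le h1), ?_, ?_⟩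
    · refine (massLE_of_near_of_decay (q := fun r => 1 / (r * logSq r)) (k := 1)
        (hC 1 (by norm_num)) (fun r hr => one_div_le_pow_div 1 hr
          (le_mul_of_one_le hr (one_le_logSq r))) fun r hr h1 => near_le hr
          (inv_le_two_div r hr rfl) (norm_nonneg _) (hB 1 (by norm_num) r hr.le h1)).congr
        fun r _ => by ring
    · refine (massLE_of_near_of_decay (q := fun r => 1 / (r ^ 3 * logSq r)) (k := 0)
        (hC 0 (by norm_num)) (fun r hr => one_div_le_pow_div 0 hr
          ((le_self_pow₀ hr three_ne_zero).trans
            (le_mul_of_one_le (one_le_pow₀ hr) (one_le_logSq r)))) fun r hr h1 =>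
          near_le_of_vanish (inv_le_two_div r hr (by field_simp))
          (by have := logSq_pos r; positivity) (norm_nonneg _)
          (norm_le_mul_of_vanish h.trace (hB 1 (by norm_num)) (h.zero one_ne_zero) hr.le
            h1)).congr fun r _ => ?_
      rw [iteratedDeriv_zero]; ring
  obtain ⟨x, hx⟩ := exists_represents2 (by positivity) h.trace.continuous.measurable hM
  exact ⟨⟨x, mem_closure2 h hd hx⟩, hx⟩

theorem exists_mem_three {Φ : ℂ → ℂ} (h : EquivSmooth 0 Φ) (hd : Decay 3 fun r => Φ r) :
    ∃ x : adaptedH3_0, Represents3 x fun r => Φ r := by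
  obtain ⟨C, hC⟩ := id hd
  obtain ⟨B, -, hB⟩ := exists_bound_near h.trace
  have hM : Mass3 (fun r => Φ r) (8 * (B ^ 2 + C ^ 2)) := by
    refine ⟨massLE_of_near_of_decay (q := fun r => r) (k := 3) (hC 3 (by norm_num))
      (fun r hr => self_le_pow_div hr (by norm_num)) fun r hr h1 => near_le hr
        (self_le_two_div hr h1) (norm_nonneg _) (hB 3 (by norm_num) r hr.le h1), ?_, ?_, ?_⟩
    · refine (massLE_of_near_of_decay (q := fun r => 1 / (r * logSq r)) (k := 2)
        (hC 2 (by norm_num)) (fun r hr => one_div_le_pow_div 2 hr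
          (le_mul_of_one_le hr (one_le_logSq r))) fun r hr h1 => near_le hr
          (inv_le_two_div r hr rfl) (norm_nonneg _) (hB 2 (by norm_num) r hr.le h1)).congr
        fun r _ => by ring
    · refine (massLE_of_near_of_decay (q := fun r => 1 / (r ^ 3 * logSq r)) (k := 1)
        (hC 1 (by norm_num)) (fun r hr => one_div_le_pow_div 1 hr
          ((le_self_pow₀ hr three_ne_zero).trans
            (le_mul_of_one_le (one_le_pow₀ hr) (one_le_logSq r)))) fun r hr h1 =>
          near_le_of_vanish (inv_le_two_div r hr (by field_simp))
          (by have := logSq_pos r; positivity) (norm_nonneg _)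
          (norm_le_mul_of_vanish h.trace (hB 2 (by norm_num)) h.deriv_zero hr.le
            h1)).congr fun r _ => by ring
    · refine (massLE_of_near_of_decay (q := fun r => 1 / (r * (1 + r ^ 2) ^ 2 * logSq r)) (k := 0)
        (hC 0 (by norm_num)) (fun r hr => one_div_le_pow_div 0 hr ?_) fun r hr h1 => near_le hr ?_
        (norm_nonneg _) (hB 0 (by norm_num) r hr.le h1)).congr fun r _ => ?_
      · have h1 : 1 ≤ (1 + r ^ 2) ^ 2 := one_le_pow₀ (one_le_one_add_sq r)
        exact (le_mul_of_one_le hr h1).trans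
          (le_mul_of_one_le (hr.trans (le_mul_of_one_le hr h1)) (one_le_logSq r))
      · have hL := logSq_pos r
        have h2 : 1 ≤ (1 + r ^ 2) ^ 2 := one_le_pow₀ (one_le_one_add_sq r)
        refine (one_div_le_one_div_of_le (by positivity) ?_).trans (inv_le_two_div r hr rfl)
        gcongr
        exact le_mul_of_one_le_right hr.le h2
      · rw [iteratedDeriv_zero]; ring
  obtain ⟨x, hx⟩ := exists_represents3 (by positivity) h.trace.continuous.measurable hM
  exact ⟨⟨x, mem_closure3 h hd hx⟩, hx⟩

/-! ### Schwartz profiles -/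

theorem equivSmooth_of_mem {m : ℕ} {f : 𝓢(ℂ, ℂ)} (hf : f ∈ equivSchwartz m) : EquivSmooth m f :=
  ⟨f.smooth _, hf⟩

theorem norm_iteratedDeriv_profile_le (f : 𝓢(ℂ, ℂ)) (k : ℕ) (r : ℝ) :
    ‖iteratedDeriv k (profile f) r‖ ≤ ‖iteratedFDeriv ℝ k f r‖ := by
  rw [← norm_iteratedFDeriv_eq_norm_iteratedDeriv]
  have e : iteratedFDeriv ℝ k (profile f) r
      = (iteratedFDeriv ℝ k f (ofRealCLM r)).compContinuousLinearMap fun _ => ofRealCLM :=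
    ofRealCLM.iteratedFDeriv_comp_right (f.smooth k) r le_rfl
  rw [e]
  refine (ContinuousMultilinearMap.norm_compContinuousLinearMap_le _ _).trans ?_
  simp

theorem exists_bound_profile (f : 𝓢(ℂ, ℂ)) (p : ℕ) : ∃ C, 0 ≤ C ∧ ∀ k ≤ 3, ∀ r : ℝ, 1 ≤ r →
    ‖iteratedDeriv k (profile f) r‖ ≤ C / r ^ p := by
  refine exists_bound_le_three (p := fun k C => ∀ r : ℝ, 1 ≤ r →
    ‖iteratedDeriv k (profile f) r‖ ≤ C / r ^ p) (fun _ _ _ h hp r hr => (hp r hr).trans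
      (by have : 0 < r := by linarith
          gcongr)) fun k _ => ?_
  obtain ⟨C, -, hC⟩ := f.decay p k
  refine ⟨C, fun r hr => ?_⟩
  have hr0 : 0 < r := by linarith
  rw [le_div_iff₀ (by positivity)]
  have := hC (r : ℂ)
  rw [norm_real, Real.norm_of_nonneg hr0.le] at this
  calc _ ≤ ‖iteratedFDeriv ℝ k f r‖ * r ^ p := by gcongr; exact norm_iteratedDeriv_profile_le f k r
    _ ≤ C := by linarith

theorem decay_profile (f : 𝓢(ℂ, ℂ)) {N : ℕ} (hN : N ≤ 3) : Decay N (profile f) := by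
  obtain ⟨C, h0, hC⟩ := exists_bound_profile f 4
  refine ⟨C, fun k hk r hr => (hC k (hk.trans hN) r hr).trans ?_⟩
  have hr0 : 0 < r := by linarith
  gcongr
  omega

/-! ### The soliton and the kernels of the linearized operators -/

/-- The rational function `1 / (1 + r²)`. -/
def ratS (r : ℝ) : ℝ := 1 / (1 + r ^ 2)

theorem ratS_pos (r : ℝ) : 0 < ratS r := by unfold ratS; positivity

theorem ratS_mul (r : ℝ) : (1 + r ^ 2) * ratS r = 1 := by
  unfold ratS; field_simp

theorem sq_mul_ratS (r : ℝ) : r ^ 2 * ratS r = 1 - ratS r := by linarith [ratS_mul r]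

theorem Q_eq (r : ℝ) : Q r = ((√8 * ratS r : ℝ) : ℂ) := by
  unfold Q ratS; congr 1; ring

theorem contDiff_ratS : ContDiff ℝ (⊤ : ℕ∞) ratS :=
  contDiff_const.div (by fun_prop) fun r => by positivity

theorem hasDerivAt_ratS (r : ℝ) : HasDerivAt ratS (-(2 * r * ratS r ^ 2)) r := by
  refine ((hasDerivAt_const r (1 : ℝ)).div (hasDerivAt_one_add_sq r) (by positivity)).congr_deriv ?_
  unfold ratS; field_simp; ring

theorem hasDerivAt_ratS' (r : ℝ) :
    HasDerivAt (fun r => -(2 * r * ratS r ^ 2)) (6 * ratS r ^ 2 - 8 * ratS r ^ 3) r := by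
  refine (((hasDerivAt_id r).const_mul 2).mul ((hasDerivAt_ratS r).pow 2)).neg.congr_deriv ?_
  simp only [Pi.pow_apply, id]
  push_cast
  linear_combination 8 * ratS r ^ 2 * sq_mul_ratS r

theorem hasDerivAt_ratS'' (r : ℝ) : HasDerivAt (fun r => 6 * ratS r ^ 2 - 8 * ratS r ^ 3)
    (-(24 * r * ratS r ^ 3) + 48 * r * ratS r ^ 4) r := by
  refine ((((hasDerivAt_ratS r).pow 2).const_mul 6).sub
    (((hasDerivAt_ratS r).pow 3).const_mul 8)).congr_deriv ?_
  push_cast; ring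

/-- `ΛQ / √8` as a function of the radius. -/
def ratL (r : ℝ) : ℝ := 2 * ratS r ^ 2 - ratS r

theorem contDiff_ratL : ContDiff ℝ (⊤ : ℕ∞) ratL :=
  (contDiff_const.mul (contDiff_ratS.pow 2)).sub contDiff_ratS

theorem hasDerivAt_ratL (r : ℝ) :
    HasDerivAt ratL (2 * r * ratS r ^ 2 - 8 * r * ratS r ^ 3) r := by
  refine ((((hasDerivAt_ratS r).pow 2).const_mul 2).sub (hasDerivAt_ratS r)).congr_deriv ?_
  push_cast; ring

theorem hasDerivAt_ratL' (r : ℝ) : HasDerivAt (fun r => 2 * r * ratS r ^ 2 - 8 * r * ratS r ^ 3)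
    (-(6 * ratS r ^ 2) + 48 * ratS r ^ 3 - 48 * ratS r ^ 4) r := by
  refine ((((hasDerivAt_id r).const_mul 2).mul ((hasDerivAt_ratS r).pow 2)).sub
    (((hasDerivAt_id r).const_mul 8).mul ((hasDerivAt_ratS r).pow 3))).congr_deriv ?_
  simp only [Pi.pow_apply, id]
  push_cast
  linear_combination (-8 * ratS r ^ 2 + 48 * ratS r ^ 3) * sq_mul_ratS r

theorem hasDerivAt_ratL'' (r : ℝ) :
    HasDerivAt (fun r => -(6 * ratS r ^ 2) + 48 * ratS r ^ 3 - 48 * ratS r ^ 4)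
      ((-(12 * ratS r) + 144 * ratS r ^ 2 - 192 * ratS r ^ 3) * -(2 * r * ratS r ^ 2)) r := by
  refine (((((hasDerivAt_ratS r).pow 2).const_mul 6).neg.add
    (((hasDerivAt_ratS r).pow 3).const_mul 48)).sub
    (((hasDerivAt_ratS r).pow 4).const_mul 48)).congr_deriv ?_
  push_cast; ring

theorem hasDerivAt_mul_ratS (r : ℝ) : HasDerivAt (fun r => r * ratS r) (ratL r) r := by
  refine ((hasDerivAt_id r).mul (hasDerivAt_ratS r)).congr_deriv ?_
  unfold ratL
  simp only [id]
  linear_combination (-2 * ratS r) * sq_mul_ratS r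

theorem LambdaQ_eq (r : ℝ) : LambdaQ r = ((√8 * ratL r : ℝ) : ℂ) := by
  have h : HasDerivAt Q ((√8 * -(2 * r * ratS r ^ 2) : ℝ) : ℂ) r := by
    have := ((hasDerivAt_ratS r).const_mul √8).ofReal_comp
    exact this.congr_of_eventuallyEq (Eventually.of_forall Q_eq)
  rw [LambdaQ, h.deriv, Q_eq, ← ofReal_mul, ← ofReal_add]
  congr 1
  unfold ratL
  linear_combination (-2 * √8 * ratS r) * sq_mul_ratS r

theorem iteratedDeriv_of_chain {F : Type} [NormedAddCommGroup F] [NormedSpace ℝ F]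
    {f f₁ f₂ f₃ : ℝ → F} (h1 : ∀ r, HasDerivAt f (f₁ r) r) (h2 : ∀ r, HasDerivAt f₁ (f₂ r) r)
    (h3 : ∀ r, HasDerivAt f₂ (f₃ r) r) :
    iteratedDeriv 1 f = f₁ ∧ iteratedDeriv 2 f = f₂ ∧ iteratedDeriv 3 f = f₃ := by
  have e1 : iteratedDeriv 1 f = f₁ := by rw [iteratedDeriv_one]; exact funext fun r => (h1 r).deriv
  have e2 : iteratedDeriv 2 f = f₂ := by
    rw [iteratedDeriv_succ, e1]; exact funext fun r => (h2 r).deriv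
  have e3 : iteratedDeriv 3 f = f₃ := by
    rw [iteratedDeriv_succ, e2]; exact funext fun r => (h3 r).deriv
  exact ⟨e1, e2, e3⟩

theorem decay_of_chain {c : ℂ} {h h₁ h₂ h₃ : ℝ → ℝ} {C : ℝ} {N : ℕ} (hN : N ≤ 3)
    (d1 : ∀ r, HasDerivAt h (h₁ r) r) (d2 : ∀ r, HasDerivAt h₁ (h₂ r) r)
    (d3 : ∀ r, HasDerivAt h₂ (h₃ r) r)
    (hb : ∀ r : ℝ, 1 ≤ r → |h r| ≤ C * (1 / r) ∧ |h₁ r| ≤ C * (1 / r) ^ 2 ∧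
      |h₂ r| ≤ C * (1 / r) ^ 3 ∧ |h₃ r| ≤ C * (1 / r) ^ 4) :
    Decay N fun r => c * (h r : ℂ) := by
  have d1' := fun r => ((d1 r).ofReal_comp).const_mul c
  have d2' := fun r => ((d2 r).ofReal_comp).const_mul c
  have d3' := fun r => ((d3 r).ofReal_comp).const_mul c
  obtain ⟨e1, e2, e3⟩ := iteratedDeriv_of_chain d1' d2' d3'
  refine ⟨‖c‖ * C, fun k hk r hr => ?_⟩
  obtain ⟨b0, b1, b2, b3⟩ := hb r hr
  have key : ∀ x : ℝ, |x| ≤ C * (1 / r) ^ (k + 1) → ‖c * (x : ℂ)‖ ≤ ‖c‖ * C / r ^ (k + 1) :=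
    fun x hx => by
      rw [norm_mul, norm_real, Real.norm_eq_abs, mul_div_assoc, div_eq_mul_one_div C, ← one_div_pow]
      gcongr
  have hk3 : k ≤ 3 := hk.trans hN
  interval_cases k
  · rw [iteratedDeriv_zero]; exact key _ (by simpa using b0)
  · rw [e1]; exact key _ b1
  · rw [e2]; exact key _ b2
  · rw [e3]; exact key _ b3

theorem ratS_bounds {r : ℝ} (hr : 1 ≤ r) : 0 < 1 / r ∧ 1 / r ≤ 1 ∧ 0 < ratS r ∧ ratS r ≤ 1 ∧
    ratS r ≤ (1 / r) ^ 2 ∧ 0 < r * ratS r ∧ r * ratS r ≤ 1 / r := by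
  have hr0 : 0 < r := by linarith
  have h2 : ratS r ≤ (1 / r) ^ 2 := by
    unfold ratS; rw [one_div_pow]; gcongr; linarith
  have h1 : 1 / r ≤ 1 := by rw [div_le_one hr0]; exact hr
  refine ⟨by positivity, h1, ratS_pos r, h2.trans (pow_le_one₀ (by positivity) h1), h2,
    mul_pos hr0 (ratS_pos r), ?_⟩
  calc r * ratS r ≤ r * (1 / r) ^ 2 := by gcongr
    _ = 1 / r := by field_simp

theorem bounds_ratL {r : ℝ} (hr : 1 ≤ r) : |ratL r| ≤ 700 * (1 / r) ^ 2 ∧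
    |2 * r * ratS r ^ 2 - 8 * r * ratS r ^ 3| ≤ 700 * (1 / r) ^ 3 ∧
    |-(6 * ratS r ^ 2) + 48 * ratS r ^ 3 - 48 * ratS r ^ 4| ≤ 700 * (1 / r) ^ 4 ∧
    |(-(12 * ratS r) + 144 * ratS r ^ 2 - 192 * ratS r ^ 3) * -(2 * r * ratS r ^ 2)|
      ≤ 700 * (1 / r) ^ 5 := by
  obtain ⟨t0, t1, s0, s1, hs, u0, hu⟩ := ratS_bounds hr
  set t := 1 / r
  set s := ratS r
  set u := r * s with hudef
  have us : u * s ≤ t ^ 3 := by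
    calc u * s ≤ t * t ^ 2 := by gcongr
      _ = _ := by ring
  have ss : s ^ 2 ≤ t ^ 4 := by
    calc s ^ 2 ≤ (t ^ 2) ^ 2 := by gcongr
      _ = _ := by ring
  have uss : u * s ^ 2 ≤ t ^ 5 := by
    calc u * s ^ 2 ≤ t * t ^ 4 := by gcongr
      _ = _ := by ring
  have p2 : s ^ 2 ≤ 1 := pow_le_one₀ s0.le s1
  have us0 : 0 < u * s := by positivity
  have uss0 : 0 < u * s ^ 2 := by positivity
  have ss0 : 0 < s ^ 2 := by positivity
  refine ⟨?_, ?_, ?_, ?_⟩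
  · have e : ratL r = s * (2 * s - 1) := by unfold ratL; ring
    rw [e, abs_mul, abs_of_pos s0]
    have : |2 * s - 1| ≤ 3 := abs_le.2 ⟨by linarith, by linarith⟩
    calc s * |2 * s - 1| ≤ t ^ 2 * 3 := by gcongr
      _ ≤ _ := by nlinarith [pow_pos t0 2]
  · have e : 2 * r * s ^ 2 - 8 * r * s ^ 3 = (u * s) * (2 - 8 * s) := by rw [hudef]; ring
    rw [e, abs_mul, abs_of_pos us0]
    have : |2 - 8 * s| ≤ 10 := abs_le.2 ⟨by linarith, by linarith⟩
    calc u * s * |2 - 8 * s| ≤ t ^ 3 * 10 := by gcongr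
      _ ≤ _ := by nlinarith [pow_pos t0 3]
  · have e : -(6 * s ^ 2) + 48 * s ^ 3 - 48 * s ^ 4 = s ^ 2 * (-6 + 48 * s - 48 * s ^ 2) := by ring
    rw [e, abs_mul, abs_of_pos ss0]
    have : |-6 + 48 * s - 48 * s ^ 2| ≤ 100 := abs_le.2 ⟨by linarith, by linarith⟩
    calc s ^ 2 * |-6 + 48 * s - 48 * s ^ 2| ≤ t ^ 4 * 100 := by gcongr
      _ ≤ _ := by nlinarith [pow_pos t0 4]
  · have e : (-(12 * s) + 144 * s ^ 2 - 192 * s ^ 3) * -(2 * r * s ^ 2)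
        = (u * s ^ 2) * (24 - 288 * s + 384 * s ^ 2) := by rw [hudef]; ring
    rw [e, abs_mul, abs_of_pos uss0]
    have : |24 - 288 * s + 384 * s ^ 2| ≤ 700 := abs_le.2 ⟨by linarith, by linarith⟩
    calc u * s ^ 2 * |24 - 288 * s + 384 * s ^ 2| ≤ t ^ 5 * 700 := by gcongr
      _ = _ := by ring

theorem decay_ratL (c : ℂ) {N : ℕ} (hN : N ≤ 3) : Decay N fun r => c * (ratL r : ℂ) := by
  refine decay_of_chain (C := 700) hN hasDerivAt_ratL hasDerivAt_ratL' hasDerivAt_ratL''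
    fun r hr => ?_
  obtain ⟨b0, b1, b2, b3⟩ := bounds_ratL hr
  obtain ⟨t0, t1, -⟩ := ratS_bounds hr
  have mono : ∀ k : ℕ, 700 * (1 / r) ^ (k + 1) ≤ 700 * (1 / r) ^ k := fun k => by
    gcongr ?_ * ?_
    exact pow_le_pow_of_le_one t0.le t1 (Nat.le_succ k)
  refine ⟨b0.trans ((mono 1).trans (by rw [pow_one])), b1.trans (mono 2), b2.trans (mono 3),
    b3.trans (mono 4)⟩

theorem decay_mul_ratS (c : ℂ) {N : ℕ} (hN : N ≤ 3) :
    Decay N fun r => c * ((r * ratS r : ℝ) : ℂ) := by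
  refine decay_of_chain (C := 700) hN hasDerivAt_mul_ratS hasDerivAt_ratL hasDerivAt_ratL'
    fun r hr => ?_
  obtain ⟨b0, b1, b2, -⟩ := bounds_ratL hr
  obtain ⟨t0, t1, -, -, -, u0, hu⟩ := ratS_bounds hr
  exact ⟨by rw [abs_of_pos u0]; linarith, b0, b1, b2⟩

theorem decay_ratS (c : ℂ) {N : ℕ} (hN : N ≤ 3) : Decay N fun r => c * (ratS r : ℂ) := by
  refine decay_of_chain (C := 700) hN hasDerivAt_ratS hasDerivAt_ratS' hasDerivAt_ratS''
    fun r hr => ?_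
  obtain ⟨t0, t1, s0, s1, hs, u0, hu⟩ := ratS_bounds hr
  have tt : (1 / r) ^ 2 ≤ 1 / r := by nlinarith
  set t := 1 / r
  set s := ratS r
  set u := r * s with hudef
  have h3 : (0 : ℝ) < t ^ 3 := by positivity
  have h4 : (0 : ℝ) < t ^ 4 := by positivity
  have us : u * s ≤ t ^ 2 := by
    calc u * s ≤ t * t ^ 2 := by gcongr
      _ ≤ t * t := by gcongr
      _ = _ := by ring
  have ss : s ^ 2 ≤ t ^ 3 := by
    calc s ^ 2 ≤ (t ^ 2) ^ 2 := by gcongr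
      _ = t ^ 2 * t ^ 2 := by ring
      _ ≤ t ^ 2 * t := by gcongr
      _ = _ := by ring
  have uss : u * s ^ 2 ≤ t ^ 4 := by
    calc u * s ^ 2 ≤ t * t ^ 3 := by gcongr
      _ = _ := by ring
  refine ⟨?_, ?_, ?_, ?_⟩
  · rw [abs_of_pos s0]; linarith
  · rw [abs_neg, show 2 * r * s ^ 2 = 2 * (u * s) by rw [hudef]; ring, abs_of_pos (by positivity)]
    nlinarith [sq_nonneg t]
  · rw [show 6 * s ^ 2 - 8 * s ^ 3 = s ^ 2 * (6 - 8 * s) by ring, abs_mul,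
      abs_of_pos (by positivity : 0 < s ^ 2)]
    have : |6 - 8 * s| ≤ 14 := abs_le.2 ⟨by linarith, by linarith⟩
    calc s ^ 2 * |6 - 8 * s| ≤ t ^ 3 * 14 := by gcongr
      _ ≤ _ := by linarith
  · rw [show -(24 * r * s ^ 3) + 48 * r * s ^ 4 = (u * s ^ 2) * (-24 + 48 * s) by rw [hudef]; ring,
      abs_mul, abs_of_pos (by positivity : 0 < u * s ^ 2)]
    have : |-24 + 48 * s| ≤ 72 := abs_le.2 ⟨by linarith, by linarith⟩
    calc u * s ^ 2 * |-24 + 48 * s| ≤ t ^ 4 * 72 := by gcongr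
      _ ≤ _ := by linarith

/-- `1 / (1 + |z|²)` on the plane. -/
def planeS (z : ℂ) : ℝ := (1 + ‖z‖ ^ 2)⁻¹

theorem contDiff_planeS : ContDiff ℝ (⊤ : ℕ∞) planeS :=
  (contDiff_const.add (contDiff_norm_sq ℝ)).inv fun z => by positivity

theorem planeS_ofReal (r : ℝ) : planeS r = ratS r := by
  unfold planeS ratS; rw [norm_real, Real.norm_eq_abs, sq_abs, one_div]

theorem planeS_rotate (θ : ℝ) (z : ℂ) : planeS (exp (θ * I) * z) = planeS z := by
  unfold planeS; rw [norm_mul, norm_exp_ofReal_mul_I, one_mul]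

theorem contDiff_planeS_ofReal : ContDiff ℝ (⊤ : ℕ∞) fun z => (planeS z : ℂ) :=
  ofRealCLM.contDiff.comp contDiff_planeS

theorem equivSmooth_ratL (c : ℂ) :
    EquivSmooth 0 fun z => c * ((2 * planeS z ^ 2 - planeS z : ℝ) : ℂ) := by
  refine ⟨contDiff_const.mul (ofRealCLM.contDiff.comp
    ((contDiff_const.mul (contDiff_planeS.pow 2)).sub contDiff_planeS)), fun θ z => ?_⟩
  simp only [planeS_rotate]; simp

theorem equivSmooth_ratS (c : ℂ) : EquivSmooth 0 fun z => c * (planeS z : ℂ) := by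
  refine ⟨contDiff_const.mul contDiff_planeS_ofReal, fun θ z => ?_⟩
  simp only [planeS_rotate]; simp

theorem equivSmooth_mul_ratS (c : ℂ) : EquivSmooth 1 fun z => c * (z * (planeS z : ℂ)) := by
  refine ⟨contDiff_const.mul (contDiff_id.mul contDiff_planeS_ofReal), fun θ z => ?_⟩
  simp only [planeS_rotate]; push_cast; ring_nf

theorem exists_ratL_minus : ∃ e : adaptedH1_0, Represents1 weightMinus e LambdaQ := by
  obtain ⟨e, he⟩ := exists_mem_minus (equivSmooth_ratL (√8 : ℝ))
    (by simp only [planeS_ofReal]; exact decay_ratL (√8 : ℝ) (by norm_num))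
  exact ⟨e, he.congr fun r _ => by rw [LambdaQ_eq, planeS_ofReal, ofReal_mul, ratL]⟩

theorem exists_ratL_three : ∃ e : adaptedH3_0, Represents3 e LambdaQ := by
  obtain ⟨e, he⟩ := exists_mem_three (equivSmooth_ratL (√8 : ℝ))
    (by simp only [planeS_ofReal]; exact decay_ratL (√8 : ℝ) (by norm_num))
  exact ⟨e, he.congr fun r _ => by rw [LambdaQ_eq, planeS_ofReal, ofReal_mul, ratL]⟩

theorem exists_ratS_minus : ∃ e : adaptedH1_0, Represents1 weightMinus e fun r => I * Q r := by
  obtain ⟨e, he⟩ := exists_mem_minus (equivSmooth_ratS (I * (√8 : ℝ)))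
    (by simpa only [planeS_ofReal] using decay_ratS (I * (√8 : ℝ)) (by norm_num))
  exact ⟨e, he.congr fun r _ => by rw [Q_eq, planeS_ofReal, ofReal_mul, mul_assoc]⟩

theorem exists_ratS_three : ∃ e : adaptedH3_0, Represents3 e fun r => I * Q r := by
  obtain ⟨e, he⟩ := exists_mem_three (equivSmooth_ratS (I * (√8 : ℝ)))
    (by simpa only [planeS_ofReal] using decay_ratS (I * (√8 : ℝ)) (by norm_num))
  exact ⟨e, he.congr fun r _ => by rw [Q_eq, planeS_ofReal, ofReal_mul, mul_assoc]⟩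

theorem exists_mul_ratS_two (c : ℂ) : ∃ e : adaptedH2_1, Represents2 e fun r => c * (r * Q r) := by
  obtain ⟨e, he⟩ := exists_mem_two (equivSmooth_mul_ratS (c * (√8 : ℝ)))
    (by simpa only [planeS_ofReal, ofReal_mul] using decay_mul_ratS (c * (√8 : ℝ)) (by norm_num))
  exact ⟨e, he.congr fun r _ => by rw [Q_eq, planeS_ofReal, ofReal_mul]; ring⟩

theorem Atheta_Q (r : ℝ) : Atheta Q r = -(2 * r ^ 2 * ratS r) := by
  have h : ∫ s in (0 : ℝ)..r, ‖Q s‖ ^ 2 * s = -4 * ratS r - -4 * ratS 0 := by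
    refine intervalIntegral.integral_eq_sub_of_hasDerivAt (f := fun r => -4 * ratS r)
      (fun s _ => ?_) ?_
    · refine ((hasDerivAt_ratS s).const_mul (-4)).congr_deriv ?_
      rw [Q_eq, norm_ofReal_sq, mul_pow, sqrt_eight_sq]; ring
    · have : Continuous fun s => ‖Q s‖ ^ 2 * s := by
        simp only [Q_eq, norm_ofReal_sq]
        exact ((continuous_const.mul contDiff_ratS.continuous).pow 2).mul continuous_id
      exact this.intervalIntegrable _ _
  rw [Atheta, h]
  have h0 : ratS 0 = 1 := by simp [ratS]
  rw [h0]
  linear_combination 2 * sq_mul_ratS r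

/-! ### Profiles with their nonlocal integral -/

/-- A smooth profile `f` together with its nonlocal integral `Y = ∫₀ʳ Re (Q f) s ds`. Carrying `Y`
along as data makes the notion linear in the pair, and lets the kernel elements have an explicit `Y`. -/
structure ProfileData (f : ℝ → ℂ) (Y : ℝ → ℝ) : Prop where
  smooth : ContDiff ℝ (⊤ : ℕ∞) f
  smoothY : ContDiff ℝ (⊤ : ℕ∞) Y
  isProfile : IsProfile f (iteratedDeriv 1 f) Y
  small : ∃ c, ∀ r, 0 < r → r ≤ 1 → |Y r| ≤ c * r ^ 2

/-- `L_Q f`, with the nonlocal integral as a separate argument. -/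
def lin (f : ℝ → ℂ) (Y : ℝ → ℝ) : ℝ → ℂ := linL f (iteratedDeriv 1 f) Y

theorem iteratedDeriv_add_smooth {f g : ℝ → ℂ} (hf : ContDiff ℝ (⊤ : ℕ∞) f)
    (hg : ContDiff ℝ (⊤ : ℕ∞) g) (n : ℕ) (r : ℝ) :
    iteratedDeriv n (f + g) r = iteratedDeriv n f r + iteratedDeriv n g r :=
  iteratedDeriv_add (contDiff_infty.1 hf n).contDiffAt (contDiff_infty.1 hg n).contDiffAt

theorem contDiff_iteratedDeriv {f : ℝ → ℂ} (hf : ContDiff ℝ (⊤ : ℕ∞) f) (n : ℕ) :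
    ContDiff ℝ (⊤ : ℕ∞) (iteratedDeriv n f) := by
  induction n with
  | zero => simpa using hf
  | succ n ih => rw [iteratedDeriv_succ]; exact (contDiff_infty_iff_deriv.1 ih).2

/-- A smooth profile and a primitive of `Re (Q f) r` that vanishes at the origin. -/
theorem ProfileData.mk' {f : ℝ → ℂ} {Y : ℝ → ℝ} (hf : ContDiff ℝ (⊤ : ℕ∞) f)
    (hY : ∀ r, HasDerivAt Y (√8 * r / (1 + r ^ 2) * (f r).re) r) (h0 : Y 0 = 0) :
    ProfileData f Y := by
  have hd : deriv Y = fun r => √8 * r / (1 + r ^ 2) * (f r).re := funext fun r => (hY r).deriv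
  have hs : ContDiff ℝ (⊤ : ℕ∞) fun r : ℝ => √8 * r / (1 + r ^ 2) * (f r).re :=
    (ContDiff.div (by fun_prop) (by fun_prop) fun r => by positivity).mul (reCLM.contDiff.comp hf)
  have hYs : ContDiff ℝ (⊤ : ℕ∞) Y := by
    rw [contDiff_infty_iff_deriv, hd]
    exact ⟨fun r => (hY r).differentiableAt, hs⟩
  refine ⟨hf, hYs, ⟨fun r _ => ?_, fun r _ => hY r, ?_, ?_, ?_⟩, ?_⟩
  · simpa using hasDerivAt_iteratedDeriv hf 0 r
  · exact (continuous_iteratedDeriv_of_smooth hf 1).continuousOn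
  · exact ⟨f 0, (hf.continuous.tendsto 0).mono_left nhdsWithin_le_nhds⟩
  · have := (hYs.continuous.tendsto 0).mono_left (nhdsWithin_le_nhds (s := Ioi 0))
    rwa [h0] at this
  · obtain ⟨B, hB0, hB⟩ := exists_bound_near hf
    refine ⟨√8 * B, fun r hr hr1 => ?_⟩
    have := (convex_Icc (0 : ℝ) r).norm_image_sub_le_of_norm_hasDerivWithin_le (f := Y)
      (C := √8 * B * r) (x := 0) (y := r) (fun s _ => (hY s).hasDerivWithinAt) (fun s hs => ?_)
      ⟨le_rfl, hr.le⟩ ⟨hr.le, le_rfl⟩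
    · rw [h0, sub_zero, sub_zero, Real.norm_eq_abs, Real.norm_of_nonneg hr.le] at this
      linarith
    · have hs0 : 0 ≤ s := hs.1
      have h1 := hB 0 (by norm_num) s hs0 (hs.2.trans hr1)
      rw [iteratedDeriv_zero] at h1
      rw [norm_mul, Real.norm_of_nonneg (by positivity), Real.norm_eq_abs]
      calc √8 * s / (1 + s ^ 2) * |(f s).re| ≤ √8 * s * B := by
            gcongr
            · exact div_le_self (by positivity) (one_le_one_add_sq s)
            · exact (abs_re_le_norm _).trans h1
        _ ≤ √8 * r * B := by gcongr; exact hs.2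
        _ = _ := by ring

theorem ProfileData.hasDerivAt_Y {f : ℝ → ℂ} {Y : ℝ → ℝ} (h : ProfileData f Y) {r : ℝ} (hr : 0 < r) :
    HasDerivAt Y (√8 * r / (1 + r ^ 2) * (f r).re) r := h.isProfile.derivY r hr

theorem ProfileData.add {f g : ℝ → ℂ} {Y Z : ℝ → ℝ} (h : ProfileData f Y) (k : ProfileData g Z) :
    ProfileData (f + g) (Y + Z) := by
  refine ⟨h.smooth.add k.smooth, h.smoothY.add k.smoothY,
    ⟨fun r hr => ?_, fun r hr => ?_, ?_, ?_, ?_⟩, ?_⟩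
  · have := hasDerivAt_iteratedDeriv (h.smooth.add k.smooth) 0 r
    rwa [iteratedDeriv_zero] at this
  · refine ((h.hasDerivAt_Y hr).add (k.hasDerivAt_Y hr)).congr_deriv ?_
    rw [Pi.add_apply, add_re]; ring
  · exact (continuous_iteratedDeriv_of_smooth (h.smooth.add k.smooth) 1).continuousOn
  · obtain ⟨c, hc⟩ := h.isProfile.bdd
    obtain ⟨d, hd⟩ := k.isProfile.bdd
    exact ⟨c + d, hc.add hd⟩
  · have := h.isProfile.zeroY.add k.isProfile.zeroY
    rwa [add_zero] at this
  · obtain ⟨c, hc⟩ := h.small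
    obtain ⟨d, hd⟩ := k.small
    refine ⟨c + d, fun r hr hr1 => (abs_add_le _ _).trans ?_⟩
    linarith [hc r hr hr1, hd r hr hr1]

theorem ProfileData.smul {f : ℝ → ℂ} {Y : ℝ → ℝ} (h : ProfileData f Y) (a : ℝ) :
    ProfileData (a • f) (a • Y) := by
  have hs : ContDiff ℝ (⊤ : ℕ∞) (a • f) := contDiff_const.smul h.smooth
  refine ⟨hs, contDiff_const.smul h.smoothY, ⟨fun r hr => ?_, fun r hr => ?_, ?_, ?_, ?_⟩, ?_⟩
  · simpa using hasDerivAt_iteratedDeriv hs 0 r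
  · refine ((h.hasDerivAt_Y hr).const_smul a).congr_deriv ?_
    simp only [Pi.smul_apply, smul_eq_mul, real_smul, re_ofReal_mul]; ring
  · exact (continuous_iteratedDeriv_of_smooth hs 1).continuousOn
  · obtain ⟨c, hc⟩ := h.isProfile.bdd
    exact ⟨a • c, hc.const_smul a⟩
  · have := h.isProfile.zeroY.const_smul a
    rwa [smul_zero] at this
  · obtain ⟨c, hc⟩ := h.small
    refine ⟨|a| * c, fun r hr hr1 => ?_⟩
    rw [Pi.smul_apply, smul_eq_mul, abs_mul, mul_assoc]
    gcongr
    exact hc r hr hr1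

theorem lin_add {f g : ℝ → ℂ} {Y Z : ℝ → ℝ} (h : ProfileData f Y) (k : ProfileData g Z) :
    lin (f + g) (Y + Z) = lin f Y + lin g Z := by
  funext r
  simp only [lin, linL, Pi.add_apply, iteratedDeriv_add_smooth h.smooth k.smooth, mul_add, ofReal_add,
    smul_add]
  abel

theorem lin_smul (f : ℝ → ℂ) (Y : ℝ → ℝ) (a : ℝ) : lin (a • f) (a • Y) = a • lin f Y := by
  funext r
  simp only [lin, linL, Pi.smul_apply, iteratedDeriv_const_smul_field, smul_eq_mul, real_smul]
  push_cast
  ring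

theorem ProfileData.smoothPos_lin {f : ℝ → ℂ} {Y : ℝ → ℝ} (h : ProfileData f Y) :
    SmoothPos (lin f Y) := by
  intro r hr
  have h1 : ContDiff ℝ (⊤ : ℕ∞) driftQ :=
    ContDiff.div (by fun_prop) (by fun_prop) fun r => by positivity
  have h2 : ContDiffAt ℝ 3 kerQ r := by
    refine ContDiffAt.div contDiffAt_const (by fun_prop) ?_
    positivity
  have h3 : ContDiffAt ℝ 3 (fun r => (iteratedDeriv 1 f r + driftQ r • f r)) r :=
    (contDiff_infty.1 ((contDiff_iteratedDeriv h.smooth 1).add (h1.smul h.smooth)) 3).contDiffAt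
  exact h3.add (ofRealCLM.contDiff.contDiffAt.comp r
    (h2.mul (contDiff_infty.1 h.smoothY 3).contDiffAt))

theorem profileData_LambdaQ : ProfileData LambdaQ fun r => 4 * (r * ratS r) ^ 2 := by
  have e : LambdaQ = fun r => ((√8 * ratL r : ℝ) : ℂ) := funext LambdaQ_eq
  rw [e]
  refine ProfileData.mk' (ofRealCLM.contDiff.comp (contDiff_const.mul contDiff_ratL))
    (fun r => ?_) (by simp)
  refine (((hasDerivAt_mul_ratS r).pow 2).const_mul 4).congr_deriv ?_
  rw [ofReal_re, show √8 * r / (1 + r ^ 2) * (√8 * ratL r) = √8 ^ 2 * (r * ratS r * ratL r) by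
    unfold ratS; ring, sqrt_eight_sq]
  push_cast; ring

theorem profileData_IQ : ProfileData (fun r => I * Q r) fun _ => 0 := by
  have e : (fun r => I * Q r) = fun r => I * ((√8 * ratS r : ℝ) : ℂ) :=
    funext fun r => by rw [Q_eq]
  rw [e]
  refine ProfileData.mk' (contDiff_const.mul (ofRealCLM.contDiff.comp
    (contDiff_const.mul contDiff_ratS))) (fun r => ?_) rfl
  simpa using hasDerivAt_const r (0 : ℝ)

theorem driftQ_eq (r : ℝ) : driftQ r = 2 * (r * ratS r) := by unfold driftQ ratS; ring

theorem lin_LambdaQ {r : ℝ} (hr : 0 < r) : lin LambdaQ (fun r => 4 * (r * ratS r) ^ 2) r = 0 := by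
  have e : LambdaQ = fun r => ((√8 * ratL r : ℝ) : ℂ) := funext LambdaQ_eq
  have hd : iteratedDeriv 1 LambdaQ r
      = ((√8 * (2 * r * ratS r ^ 2 - 8 * r * ratS r ^ 3) : ℝ) : ℂ) := by
    rw [iteratedDeriv_one, e]
    exact (((hasDerivAt_ratL r).const_mul √8).ofReal_comp).deriv
  have hk : kerQ r = √8 * ratS r / r := by unfold kerQ ratS; field_simp
  rw [lin, linL, hd, LambdaQ_eq, driftQ_eq, hk, real_smul, ← ofReal_mul, ← ofReal_add, ← ofReal_add,
    ofReal_eq_zero, ratL]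
  field_simp
  ring

theorem lin_IQ (r : ℝ) : lin (fun r => I * Q r) (fun _ => 0) r = 0 := by
  have e : (fun r => I * Q r) = fun r => I * ((√8 * ratS r : ℝ) : ℂ) :=
    funext fun r => by rw [Q_eq]
  have hd : iteratedDeriv 1 (fun r => I * Q r) r = I * ((√8 * -(2 * r * ratS r ^ 2) : ℝ) : ℂ) := by
    rw [iteratedDeriv_one, e]
    exact ((((hasDerivAt_ratS r).const_mul √8).ofReal_comp).const_mul I).deriv
  rw [lin, linL, hd, Q_eq, driftQ_eq, real_smul]
  push_cast
  ring

/-- The nonlocal integral `∫₀ʳ Re (Q f) s ds`. -/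
def nonlocInt (f : ℝ → ℂ) (r : ℝ) : ℝ := ∫ s in (0 : ℝ)..r, √8 * s / (1 + s ^ 2) * (f s).re

theorem profileData_nonlocInt {f : ℝ → ℂ} (hf : ContDiff ℝ (⊤ : ℕ∞) f) :
    ProfileData f (nonlocInt f) := by
  have hc : Continuous fun s : ℝ => √8 * s / (1 + s ^ 2) * (f s).re :=
    (Continuous.div (by fun_prop) (by fun_prop) fun r => by positivity).mul
      (continuous_re.comp hf.continuous)
  exact ProfileData.mk' hf (fun r => (hc.integral_hasStrictDerivAt 0 r).hasDerivAt)
    intervalIntegral.integral_same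

theorem opL_eq (f : ℝ → ℂ) {r : ℝ} (hr : 0 < r) : opL Q f r = lin f (nonlocInt f) r := by
  have e1 : Atheta Q r / r = -driftQ r := by rw [Atheta_Q, driftQ_eq]; field_simp
  have e2 : ∀ s : ℝ, ((starRingEnd ℂ) (Q s) * f s).re * s = √8 * s / (1 + s ^ 2) * (f s).re := by
    intro s
    rw [Q_eq, conj_ofReal, re_ofReal_mul, ratS]; ring
  rw [opL, e1, lin, linL, iteratedDeriv_one, Q_eq]
  simp only [e2]
  rw [show kerQ r = √8 * ratS r / r by unfold kerQ ratS; field_simp, nonlocInt, real_smul]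
  push_cast
  ring

theorem opA_eq (f : ℝ → ℂ) {r : ℝ} (hr : 0 < r) :
    opA Q f r = iteratedDeriv 1 f r - coefA r • f r := by
  have e1 : (1 + Atheta Q r) / r = coefA r := by
    rw [Atheta_Q, coefA, driftQ_eq]; field_simp; ring
  rw [opA, e1, iteratedDeriv_one, real_smul]

theorem opAstar_eq (f : ℝ → ℂ) {r : ℝ} (hr : 0 < r) :
    opAstar Q f r = -iteratedDeriv 1 f r - coefAstar r • f r := by
  have e1 : (2 + Atheta Q r) / r = coefAstar r := by
    rw [Atheta_Q, coefAstar, ratS]; field_simp; ring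
  rw [opAstar, e1, iteratedDeriv_one, real_smul]

/-! ### The operators map equivariant functions to equivariant functions -/

/-- The Cauchy-Riemann derivative `(∂₁ + i ∂₂) F`. It raises the equivariance index by one. -/
def raise (F : ℂ → ℂ) (z : ℂ) : ℂ := fderiv ℝ F z 1 + I * fderiv ℝ F z I

theorem EquivSmooth.differentiable {m : ℕ} {F : ℂ → ℂ} (h : EquivSmooth m F) :
    Differentiable ℝ F := h.smooth.differentiable (by simp)

theorem EquivSmooth.fderiv_rotate {m : ℕ} {F : ℂ → ℂ} (h : EquivSmooth m F) (θ : ℝ) (z v : ℂ) :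
    fderiv ℝ F (exp (θ * I) * z) (exp (θ * I) * v) = exp (m * θ * I) * fderiv ℝ F z v := by
  have h1 : HasFDerivAt (fun w => F (exp (θ * I) * w)) _ z :=
    (h.differentiable (exp (θ * I) * z)).hasFDerivAt.comp z
      ((ContinuousLinearMap.mul ℝ ℂ (exp (θ * I))).hasFDerivAt)
  have h2 := ((h.differentiable z).hasFDerivAt).const_mul (exp (m * θ * I))
  simp only [h.equiv θ] at h1
  have := congrArg (fun L : ℂ →L[ℝ] ℂ => L v) (h1.unique h2)
  simpa using this

theorem EquivSmooth.raise {m : ℕ} {F : ℂ → ℂ} (h : EquivSmooth m F) :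
    EquivSmooth (m + 1) (raise F) := by
  have hs : ContDiff ℝ (⊤ : ℕ∞) (fderiv ℝ F) := h.smooth.fderiv_right (mod_cast le_top)
  refine ⟨(hs.clm_apply contDiff_const).add (contDiff_const.mul (hs.clm_apply contDiff_const)),
    fun θ z => ?_⟩
  have e1 : (1 : ℂ) = exp (θ * I) * (Real.cos θ • (1 : ℂ) - Real.sin θ • I) := by
    rw [exp_mul_I, ← ofReal_cos, ← ofReal_sin, real_smul, real_smul]
    have : (Real.cos θ : ℂ) ^ 2 + (Real.sin θ : ℂ) ^ 2 = 1 := by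
      exact_mod_cast congrArg ofReal (Real.cos_sq_add_sin_sq θ)
    linear_combination -this + (Real.sin θ : ℂ) ^ 2 * I_sq
  have e2 : I = exp (θ * I) * (Real.sin θ • (1 : ℂ) + Real.cos θ • I) := by
    rw [exp_mul_I, ← ofReal_cos, ← ofReal_sin, real_smul, real_smul]
    have : (Real.cos θ : ℂ) ^ 2 + (Real.sin θ : ℂ) ^ 2 = 1 := by
      exact_mod_cast congrArg ofReal (Real.cos_sq_add_sin_sq θ)
    linear_combination -I * this - (Real.sin θ : ℂ) * (Real.cos θ : ℂ) * I_sq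
  have f1 : fderiv ℝ F (exp (θ * I) * z) 1
      = exp (m * θ * I) * (Real.cos θ * fderiv ℝ F z 1 - Real.sin θ * fderiv ℝ F z I) := by
    have := h.fderiv_rotate θ z (Real.cos θ • (1 : ℂ) - Real.sin θ • I)
    rwa [← e1, map_sub, map_smul, map_smul, real_smul, real_smul] at this
  have f2 : fderiv ℝ F (exp (θ * I) * z) I
      = exp (m * θ * I) * (Real.sin θ * fderiv ℝ F z 1 + Real.cos θ * fderiv ℝ F z I) := by
    have := h.fderiv_rotate θ z (Real.sin θ • (1 : ℂ) + Real.cos θ • I)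
    rwa [← e2, map_add, map_smul, map_smul, real_smul, real_smul] at this
  have e3 : exp (((m + 1 : ℕ) : ℂ) * θ * I)
      = exp (m * θ * I) * (Real.cos θ + Real.sin θ * I) := by
    rw [ofReal_cos, ofReal_sin, ← exp_mul_I, ← exp_add]
    push_cast
    ring_nf
  rw [CSS.raise, f1, f2, e3, CSS.raise]
  linear_combination -(exp (m * θ * I) * Real.sin θ * fderiv ℝ F z I) * I_sq

theorem EquivSmooth.raise_ofReal {m : ℕ} {F : ℂ → ℂ} (h : EquivSmooth m F) {r : ℝ} (hr : 0 < r) :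
    CSS.raise F r = iteratedDeriv 1 (fun r : ℝ => F r) r - ((m / r : ℝ) : ℂ) * F r := by
  have hF := (h.differentiable r).hasFDerivAt
  have h1 : iteratedDeriv 1 (fun r : ℝ => F r) r = fderiv ℝ F r 1 := by
    rw [iteratedDeriv_one]
    exact (hF.comp_hasDerivAt r (ofRealCLM.hasDerivAt)).deriv.trans (by simp)
  -- the derivative along the circle of radius `r`
  have hc : ∀ k : ℂ, HasDerivAt (fun θ : ℝ => exp (k * θ * I)) (k * I) 0 := fun k => by
    have h2 : HasDerivAt (fun θ : ℝ => k * θ * I) (k * I) 0 := by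
      simpa using ((ofRealCLM.hasDerivAt (x := 0)).const_mul k).mul_const I
    simpa using h2.cexp
  have h3 : HasDerivAt (fun θ : ℝ => exp (θ * I) * (r : ℂ)) (I * r) 0 := by
    simpa using (hc 1).mul_const (r : ℂ)
  have h4 : HasDerivAt (fun θ : ℝ => F (exp (θ * I) * r)) (fderiv ℝ F r (I * r)) 0 := by
    have e : (r : ℂ) = exp (((0 : ℝ) : ℂ) * I) * r := by simp
    have hF' : HasFDerivAt F (fderiv ℝ F r) (exp (((0 : ℝ) : ℂ) * I) * r) := by rwa [← e]
    exact hF'.comp_hasDerivAt (0 : ℝ) h3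
  have h5 : HasDerivAt (fun θ : ℝ => F (exp (θ * I) * r)) (m * I * F r) 0 := by
    simp only [h.equiv]
    exact (hc m).mul_const _
  have h6 := h4.unique h5
  rw [show I * (r : ℂ) = r • I by rw [real_smul, mul_comm], map_smul, real_smul] at h6
  have hr' : (r : ℂ) ≠ 0 := by exact_mod_cast hr.ne'
  have h7 : fderiv ℝ F r I = m * I * F r / r := by field_simp; linear_combination h6
  rw [CSS.raise, h1, h7]
  push_cast
  field_simp
  linear_combination (m : ℂ) * F r * I_sq

theorem EquivSmooth.add {m : ℕ} {F G : ℂ → ℂ} (h : EquivSmooth m F) (k : EquivSmooth m G) :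
    EquivSmooth m fun z => F z + G z :=
  ⟨h.smooth.add k.smooth, fun θ z => by rw [h.equiv, k.equiv, mul_add]⟩

/-- The product with `c z ρ(z)`, for a radial function `ρ`, raises the equivariance index by one. -/
theorem EquivSmooth.mul_radial {m : ℕ} {F : ℂ → ℂ} (h : EquivSmooth m F) (c : ℂ) :
    EquivSmooth (m + 1) fun z => c * (z * (planeS z : ℂ)) * F z := by
  refine ⟨(equivSmooth_mul_ratS c).smooth.mul h.smooth, fun θ z => ?_⟩
  rw [h.equiv, (equivSmooth_mul_ratS c).equiv, show ((m + 1 : ℕ) : ℂ) * θ * I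
    = (1 : ℕ) * θ * I + m * θ * I by push_cast; ring, exp_add]
  ring

/-- The average `∫₀¹ σ H(σ z) dσ` over a segment from the origin. -/
def rayMean (H : ℂ → ℝ) (z : ℂ) : ℝ := ∫ σ in (0 : ℝ)..1, σ * H (σ * z)

theorem contDiff_rayMean {H : ℂ → ℝ} (hH : ContDiff ℝ (⊤ : ℕ∞) H) :
    ContDiff ℝ (⊤ : ℕ∞) (rayMean H) := by
  -- a convolution in `σ` at the point `0`, with a cutoff that is `1` on `[-1, 0]`
  let b : ContDiffBump (0 : ℝ) := ⟨1, 2, one_pos, one_lt_two⟩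
  set φ : ℝ → ℝ := (Ioc (0 : ℝ) 1).indicator fun σ => σ
  set g : ℂ → ℝ → ℝ := fun p t => b t * H (((-t : ℝ) : ℂ) * p)
  have hφ : LocallyIntegrable φ volume :=
    ((integrable_indicator_iff measurableSet_Ioc).2
      (continuous_id.continuousOn.integrableOn_Icc.mono_set Ioc_subset_Icc_self)).locallyIntegrable
  have hg : ContDiffOn ℝ (⊤ : ℕ∞) ↿g (univ ×ˢ univ) := by
    refine ContDiff.contDiffOn ?_
    have h1 : ContDiff ℝ (⊤ : ℕ∞) fun q : ℂ × ℝ => b q.2 := b.contDiff.comp contDiff_snd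
    have h2 : ContDiff ℝ (⊤ : ℕ∞) fun q : ℂ × ℝ => ((-q.2 : ℝ) : ℂ) * q.1 :=
      (ofRealCLM.contDiff.comp contDiff_snd.neg).mul contDiff_fst
    exact h1.mul (hH.comp h2)
  have := contDiffOn_convolution_right_with_param_comp (μ := volume) (ContinuousLinearMap.mul ℝ ℝ)
    (v := fun _ : ℂ => (0 : ℝ)) (s := univ) (k := Metric.closedBall 0 2) contDiffOn_const
    isOpen_univ (isCompact_closedBall 0 2) (fun p x _ hx => ?_) hφ hg
  · rw [contDiffOn_univ] at this
    refine (congrArg (ContDiff ℝ (⊤ : ℕ∞)) (funext fun z => ?_)).mpr this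
    rw [rayMean, intervalIntegral.integral_of_le zero_le_one, ← integral_indicator measurableSet_Ioc,
      convolution]
    refine integral_congr_ae (ae_of_all _ fun σ => ?_)
    by_cases hσ : σ ∈ Ioc (0 : ℝ) 1
    · have hb : b (0 - σ) = 1 := b.one_of_mem_closedBall (by
        rw [Metric.mem_closedBall, dist_zero_right, zero_sub, norm_neg, Real.norm_of_nonneg hσ.1.le]
        exact hσ.2)
      simp only [φ, g, indicator_of_mem hσ, hb, ContinuousLinearMap.mul_apply', one_mul]
      rw [zero_sub, neg_neg]
    · simp [φ, hσ]
  · have : b x = 0 := b.zero_of_le_dist (by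
      rw [Metric.mem_closedBall, not_le] at hx
      exact hx.le)
    simp only [g, this, zero_mul]

/-- The density `Q Re F` on the plane. -/
def density (F : ℂ → ℂ) (z : ℂ) : ℝ := √8 * planeS z * (F z).re

theorem EquivSmooth.rayMean {F : ℂ → ℂ} (h : EquivSmooth 0 F) :
    EquivSmooth 0 fun z => (rayMean (density F) z : ℂ) := by
  have h1 : ContDiff ℝ (⊤ : ℕ∞) (density F) :=
    (contDiff_const.mul contDiff_planeS).mul (reCLM.contDiff.comp h.smooth)
  refine ⟨ofRealCLM.contDiff.comp (contDiff_rayMean h1), fun θ z => ?_⟩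
  have : ∀ σ : ℝ, density F (σ * (exp (θ * I) * z)) = density F (σ * z) := fun σ => by
    rw [mul_left_comm, density, planeS_rotate, h.equiv, density]
    simp
  simp only [CSS.rayMean, this]
  simp

theorem nonlocInt_eq (F : ℂ → ℂ) {r : ℝ} (hr : 0 < r) :
    nonlocInt (fun r : ℝ => F r) r = r ^ 2 * rayMean (density F) r := by
  have h := intervalIntegral.integral_comp_mul_right (a := 0) (b := 1) (c := r)
    (fun s : ℝ => √8 * s / (1 + s ^ 2) * (F s).re) hr.ne'
  rw [zero_mul, one_mul, smul_eq_mul, eq_comm, inv_mul_eq_iff_eq_mul₀ hr.ne'] at h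
  have h2 : ∫ σ in (0 : ℝ)..1, √8 * (σ * r) / (1 + (σ * r) ^ 2) * (F ((σ * r : ℝ) : ℂ)).re
      = ∫ σ in (0 : ℝ)..1, r * (σ * density F (σ * r)) := by
    congr 1
    funext σ
    simp only [density, ← ofReal_mul, planeS_ofReal, ratS]
    ring
  rw [nonlocInt, h, h2, intervalIntegral.integral_const_mul, rayMean]
  ring

/-- `L_Q f` as an equivariant function on the plane. -/
theorem exists_equivSmooth_lin {F : ℂ → ℂ} (h : EquivSmooth 0 F) :
    ∃ Φ, EquivSmooth 1 Φ ∧ ∀ r : ℝ, 0 < r →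
      Φ r = lin (fun r : ℝ => F r) (nonlocInt fun r : ℝ => F r) r := by
  refine ⟨_, (h.raise.add (h.mul_radial 2)).add (h.rayMean.mul_radial (√8 : ℝ)), fun r hr => ?_⟩
  have hk : kerQ r = √8 * ratS r / r := by unfold kerQ ratS; field_simp
  have hr' : (r : ℂ) ≠ 0 := by exact_mod_cast hr.ne'
  rw [h.raise_ofReal hr, lin, linL, nonlocInt_eq F hr, hk, driftQ_eq, planeS_ofReal, real_smul]
  push_cast
  field_simp
  ring

/-- `A_Q f` as an equivariant function on the plane. -/
theorem exists_equivSmooth_opA {F : ℂ → ℂ} (h : EquivSmooth 1 F) :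
    ∃ Φ, EquivSmooth 2 Φ ∧ ∀ r : ℝ, 0 < r →
      Φ r = iteratedDeriv 1 (fun r : ℝ => F r) r - coefA r • F r := by
  refine ⟨_, h.raise.add (h.mul_radial 2), fun r hr => ?_⟩
  have hr' : (r : ℂ) ≠ 0 := by exact_mod_cast hr.ne'
  rw [h.raise_ofReal hr, coefA, driftQ_eq, planeS_ofReal, real_smul]
  push_cast
  ring

/-! ### Derivatives and decay of the images of Schwartz functions -/

theorem iteratedDeriv_one_of_pos {u u₁ : ℝ → ℂ} (h : ∀ r, 0 < r → HasDerivAt u (u₁ r) r) {r : ℝ}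
    (hr : 0 < r) : iteratedDeriv 1 u r = u₁ r := by
  rw [iteratedDeriv_one]; exact (h r hr).deriv

theorem iteratedDeriv_two_of_pos {u u₁ u₂ : ℝ → ℂ} (h : ∀ r, 0 < r → HasDerivAt u (u₁ r) r)
    (h₁ : ∀ r, 0 < r → HasDerivAt u₁ (u₂ r) r) {r : ℝ} (hr : 0 < r) :
    iteratedDeriv 2 u r = u₂ r := by
  rw [iteratedDeriv_succ]
  have : iteratedDeriv 1 u =ᶠ[𝓝 r] u₁ := by
    filter_upwards [lt_mem_nhds hr] with s hs using iteratedDeriv_one_of_pos h hs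
  rw [this.deriv_eq]
  exact (h₁ r hr).deriv

theorem iteratedDeriv_one_lin {f : ℝ → ℂ} {Y : ℝ → ℝ} (h : ProfileData f Y) {r : ℝ} (hr : 0 < r) :
    iteratedDeriv 1 (lin f Y) r = linL' f (iteratedDeriv 1 f) (iteratedDeriv 2 f) Y r :=
  iteratedDeriv_one_of_pos (fun _ hs => h.isProfile.hasDerivAt_linL hs
    (hasDerivAt_iteratedDeriv h.smooth 1 _)) hr

theorem iteratedDeriv_two_lin {f : ℝ → ℂ} {Y : ℝ → ℝ} (h : ProfileData f Y) {r : ℝ} (hr : 0 < r) :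
    iteratedDeriv 2 (lin f Y) r
      = linL'' f (iteratedDeriv 1 f) (iteratedDeriv 2 f) (iteratedDeriv 3 f) Y r :=
  iteratedDeriv_two_of_pos (fun _ hs => h.isProfile.hasDerivAt_linL hs
    (hasDerivAt_iteratedDeriv h.smooth 1 _)) (fun _ hs => h.isProfile.hasDerivAt_linL' hs
    (hasDerivAt_iteratedDeriv h.smooth 1 _) (hasDerivAt_iteratedDeriv h.smooth 2 _)) hr

/-- `A_Q f` on smooth profiles. -/
def linA (f : ℝ → ℂ) (r : ℝ) : ℂ := iteratedDeriv 1 f r - coefA r • f r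

/-- `A_Q^* f` on smooth profiles. -/
def linAstar (f : ℝ → ℂ) (r : ℝ) : ℂ := -iteratedDeriv 1 f r - coefAstar r • f r

theorem iteratedDeriv_one_linA {f : ℝ → ℂ} (h : ContDiff ℝ (⊤ : ℕ∞) f) {r : ℝ} (hr : 0 < r) :
    iteratedDeriv 1 (linA f) r = iteratedDeriv 2 f r - coefA r • iteratedDeriv 1 f r
      - (-(1 / r ^ 2) - driftQ' r) • f r := by
  rw [iteratedDeriv_one]
  refine HasDerivAt.deriv ?_
  have h0 := hasDerivAt_iteratedDeriv h 0 r
  rw [iteratedDeriv_zero] at h0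
  refine ((hasDerivAt_iteratedDeriv h 1 r).sub ((hasDerivAt_coefA hr.ne').smul h0)).congr_deriv ?_
  abel

theorem smoothPos_linA {f : ℝ → ℂ} (h : ContDiff ℝ (⊤ : ℕ∞) f) : SmoothPos (linA f) := by
  intro r hr
  have h1 : ContDiffAt ℝ 3 coefA r := by
    refine ContDiffAt.sub (ContDiffAt.div contDiffAt_const contDiffAt_id hr.ne') ?_
    exact ContDiffAt.div (by fun_prop) (by fun_prop) (by positivity)
  exact (contDiff_infty.1 (contDiff_iteratedDeriv h 1) 3).contDiffAt.sub
    (h1.smul (contDiff_infty.1 h 3).contDiffAt)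

theorem abs_driftQ_le {r : ℝ} : |driftQ r| ≤ 1 := by
  unfold driftQ
  rw [abs_div, abs_of_pos (by positivity : 0 < 1 + r ^ 2), div_le_one (by positivity)]
  exact abs_le.2 ⟨by nlinarith [sq_nonneg (r + 1)], by nlinarith [sq_nonneg (r - 1)]⟩

theorem abs_driftQ'_le (r : ℝ) : |driftQ' r| ≤ 2 := by
  refine abs_le_of_sq_le_sq ((driftQ'_sq_le r).trans ?_) (by norm_num)
  rw [div_le_iff₀ (by positivity)]
  nlinarith [one_le_pow₀ (one_le_one_add_sq r) (n := 2)]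

theorem abs_driftQ''_le (r : ℝ) : |driftQ'' r| ≤ 12 := by
  refine abs_le_of_sq_le_sq ((driftQ''_sq_le r).trans ?_) (by norm_num)
  rw [div_le_iff₀ (by positivity)]
  nlinarith [sq_nonneg r, sq_nonneg (r ^ 2)]

theorem abs_nonlocInt_le {f : ℝ → ℂ} {B : ℝ} (hB : ∀ r, 0 ≤ r → ‖f r‖ * r ≤ B) {r : ℝ} (hr : 0 < r) :
    |nonlocInt f r| ≤ 6 * B := by
  have hB0 : 0 ≤ B := by simpa using hB 0 le_rfl
  have h1 : ‖nonlocInt f r‖ ≤ ∫ s in (0 : ℝ)..r, √8 * B * (1 + s ^ 2)⁻¹ := by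
    refine intervalIntegral.norm_integral_le_of_norm_le hr.le (ae_of_all _ fun s hs => ?_) ?_
    · have hs0 : 0 < s := hs.1
      rw [norm_mul, Real.norm_of_nonneg (by positivity), Real.norm_eq_abs]
      calc √8 * s / (1 + s ^ 2) * |(f s).re| ≤ √8 * s / (1 + s ^ 2) * ‖f s‖ := by
            gcongr; exact abs_re_le_norm _
        _ = √8 * (‖f s‖ * s) * (1 + s ^ 2)⁻¹ := by field_simp
        _ ≤ _ := by gcongr; exact hB s hs0.le
    · exact (continuous_const.mul ((by fun_prop : Continuous fun s : ℝ => 1 + s ^ 2).inv₀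
        fun s => by positivity)).intervalIntegrable _ _
  rw [intervalIntegral.integral_const_mul, integral_inv_one_add_sq, Real.arctan_zero, sub_zero,
    Real.norm_eq_abs] at h1
  have h2 : Real.arctan r ≤ 2 := (Real.arctan_lt_pi_div_two r).le.trans (by
    linarith [Real.pi_le_four])
  have h3 : √8 ≤ 3 := Real.sqrt_le_iff.2 ⟨by norm_num, by norm_num⟩
  calc |nonlocInt f r| ≤ √8 * B * Real.arctan r := h1
    _ ≤ 3 * B * 2 := by gcongr
    _ = _ := by ring

theorem exists_abs_nonlocInt_profile_le (f : 𝓢(ℂ, ℂ)) :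
    ∃ C, 0 ≤ C ∧ ∀ r, 0 < r → |nonlocInt (profile f) r| ≤ C := by
  have hf : ContDiff ℝ (⊤ : ℕ∞) (profile f) := contDiff_infty.2 (profile_contDiff f)
  obtain ⟨C, h0, hC⟩ := exists_bound_profile f 1
  obtain ⟨D, hD0, hD⟩ := exists_bound_near hf
  refine ⟨6 * (C + D), by positivity, fun r hr => abs_nonlocInt_le (fun s hs => ?_) hr⟩
  rcases le_or_gt s 1 with h | h
  · have := hD 0 (by norm_num) s hs h
    rw [iteratedDeriv_zero] at this
    calc ‖profile f s‖ * s ≤ D * 1 := by gcongr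
      _ ≤ _ := by linarith
  · have := hC 0 (by norm_num) s h.le
    rw [iteratedDeriv_zero, pow_one, le_div_iff₀ (by linarith)] at this
    linarith

theorem norm_add_smul_le {a b : ℂ} {c x y M : ℝ} (ha : ‖a‖ ≤ x) (hb : ‖b‖ ≤ y) (hc : |c| ≤ M) :
    ‖a + c • b‖ ≤ x + M * y := by
  refine (norm_add_le _ _).trans (add_le_add ha ?_)
  rw [norm_smul, Real.norm_eq_abs]
  gcongr
  exact (abs_nonneg _).trans hc

theorem decay_linA_profile (f : 𝓢(ℂ, ℂ)) : Decay 1 (linA (profile f)) := by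
  obtain ⟨C, h0, hC⟩ := exists_bound_profile f 4
  have hf : ContDiff ℝ (⊤ : ℕ∞) (profile f) := contDiff_infty.2 (profile_contDiff f)
  refine ⟨6 * C, fun k hk r hr => ?_⟩
  have hr0 : 0 < r := by linarith
  have hr1 : 1 / r ≤ 1 := by rw [div_le_one hr0]; exact hr
  have b0 : 0 < 1 / r := by positivity
  have f0 := hC 0 (by norm_num) r hr
  have f1 := hC 1 (by norm_num) r hr
  have f2 := hC 2 (by norm_num) r hr
  rw [iteratedDeriv_zero] at f0
  have d0 := abs_le.1 (abs_driftQ_le (r := r))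
  have d1 := abs_le.1 (abs_driftQ'_le r)
  have c0 : |-coefA r| ≤ 2 := abs_le.2 ⟨by unfold coefA; linarith, by unfold coefA; linarith⟩
  have c1 : |1 / r ^ 2 + driftQ' r| ≤ 3 := by
    have e1 : 1 / r ^ 2 ≤ 1 := by
      rw [div_le_one (by positivity)]; exact one_le_pow₀ hr
    have e2 : 0 < 1 / r ^ 2 := by positivity
    exact abs_le.2 ⟨by linarith, by linarith⟩
  have key : ‖iteratedDeriv k (linA (profile f)) r‖ ≤ 6 * C / r ^ 4 := by
    interval_cases k
    · rw [iteratedDeriv_zero, show linA (profile f) r = iteratedDeriv 1 (profile f) r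
        + (-coefA r) • profile f r by unfold linA; module]
      refine (norm_add_smul_le f1 f0 c0).trans ?_
      rw [mul_div_assoc]
      have : 0 ≤ C / r ^ 4 := by positivity
      linarith
    · rw [iteratedDeriv_one_linA hf hr0, show iteratedDeriv 2 (profile f) r
        - coefA r • iteratedDeriv 1 (profile f) r - (-(1 / r ^ 2) - driftQ' r) • profile f r
        = iteratedDeriv 2 (profile f) r + (-coefA r) • iteratedDeriv 1 (profile f) r
          + (1 / r ^ 2 + driftQ' r) • profile f r by module]
      refine (norm_add_smul_le (norm_add_smul_le f2 f1 c0) f0 c1).trans (le_of_eq ?_)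
      ring
  refine key.trans ?_
  gcongr
  omega

theorem decay_lin_profile (f : 𝓢(ℂ, ℂ)) : Decay 2 (lin (profile f) (nonlocInt (profile f))) := by
  obtain ⟨C, h0, hC⟩ := exists_bound_profile f 4
  obtain ⟨D, hD0, hD⟩ := exists_abs_nonlocInt_profile_le f
  have hf : ContDiff ℝ (⊤ : ℕ∞) (profile f) := contDiff_infty.2 (profile_contDiff f)
  have hp := profileData_nonlocInt hf
  refine ⟨100 * C + 60 * D, fun k hk r hr => ?_⟩
  have hr0 : 0 < r := by linarith
  have f0 := hC 0 (by norm_num) r hr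
  have f1 := hC 1 (by norm_num) r hr
  have f2 := hC 2 (by norm_num) r hr
  have f3 := hC 3 (by norm_num) r hr
  rw [iteratedDeriv_zero] at f0
  have hY := hD r hr0
  set Y := nonlocInt (profile f)
  have d0 := abs_driftQ_le (r := r)
  have d1 := abs_driftQ'_le r
  have d2 := abs_driftQ''_le r
  have h8 : √8 ≤ 3 := Real.sqrt_le_iff.2 ⟨by norm_num, by norm_num⟩
  have hr2 : 1 ≤ r ^ 2 := one_le_pow₀ hr
  have hr4 : r ^ 2 ≤ r ^ 4 := by gcongr; norm_num
  have pos : ∀ n : ℕ, 0 < r ^ n := fun n => pow_pos hr0 n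
  have hX : 0 ≤ C / r ^ 4 := by positivity
  have i0 : ∀ x : ℂ, ‖x‖ ≤ C / r ^ 4 → |8 / (1 + r ^ 2) ^ 2 * x.re| ≤ 8 * (C / r ^ 4) := by
    intro x hx
    rw [abs_mul, abs_of_pos (by positivity)]
    gcongr
    · rw [div_le_iff₀ (by positivity)]
      nlinarith [one_le_pow₀ (one_le_one_add_sq r) (n := 2)]
    · exact (abs_re_le_norm x).trans hx
  have key : ‖iteratedDeriv k (lin (profile f) Y) r‖ ≤ 100 * (C / r ^ 4) + 60 * D / r ^ (k + 1) := by
    interval_cases k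
    · rw [iteratedDeriv_zero, lin, linL]
      have n0 : |kerQ r * Y r| ≤ 3 * (1 / r) * D := by
        rw [kerQ_eq, abs_mul, abs_mul, abs_of_nonneg (Real.sqrt_nonneg 8)]
        gcongr
        rw [invQ, abs_of_pos (by positivity)]
        gcongr
        nlinarith
      refine (norm_add_le _ _).trans (add_le_add ((norm_add_smul_le f1 f0 d0).trans (by linarith))
        ?_)
      rw [norm_real, Real.norm_eq_abs]
      refine n0.trans ?_
      rw [zero_add, pow_one, show 3 * (1 / r) * D = 3 * D / r by ring]
      gcongr
      linarith
    · rw [iteratedDeriv_one_lin hp hr0, linL', locL']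
      have n0 : |√8 * invQ' r * Y r| ≤ 3 * (3 / r ^ 2) * D := by
        rw [abs_mul, abs_mul, abs_of_nonneg (Real.sqrt_nonneg 8)]
        gcongr
        rw [invQ', abs_neg, abs_of_pos (by positivity), div_le_div_iff₀ (by positivity) (pos 2)]
        nlinarith [pos 2, pos 4, pos 6]
      refine (norm_add_le _ _).trans ((add_le_add (norm_add_smul_le (norm_add_smul_le f2 f1 d0)
        f0 d1) (c := ‖(nonloc' (profile f) Y r : ℂ)‖) (d := 8 * (C / r ^ 4) + 9 * D / r ^ 2) ?_).trans ?_)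
      · rw [norm_real, Real.norm_eq_abs, nonloc']
        refine (abs_add_le _ _).trans ?_
        have := i0 _ f0
        rw [show 3 * (3 / r ^ 2) * D = 9 * D / r ^ 2 by ring] at n0
        linarith
      · have e : 9 * D / r ^ 2 ≤ 60 * D / r ^ (1 + 1) := by
          gcongr; norm_num
        linarith
    · rw [iteratedDeriv_two_lin hp hr0, linL'', locL'']
      have n0 : |√8 * invQ'' r * Y r| ≤ 3 * (20 / r ^ 3) * D := by
        rw [abs_mul, abs_mul, abs_of_nonneg (Real.sqrt_nonneg 8)]
        gcongr
        rw [invQ'', abs_of_pos (by positivity), div_le_div_iff₀ (by positivity) (pos 3)]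
        have : 2 + 6 * r ^ 2 + 12 * r ^ 4 ≤ 20 * (1 + r ^ 2) ^ 3 := by
          nlinarith [pos 2, pos 4, pos 6]
        nlinarith [pos 3]
      have n1 : |8 * (1 + 7 * r ^ 2) / (r * (1 + r ^ 2) ^ 3) * (profile f r).re|
          ≤ 56 * (C / r ^ 4) := by
        rw [abs_mul, abs_of_pos (by positivity)]
        gcongr
        · rw [div_le_iff₀ (by positivity)]
          have : (1 + 7 * r ^ 2) ≤ 7 * (1 + r ^ 2) ^ 3 := by nlinarith [pos 2, pos 4, pos 6]
          have k2 : (1 + r ^ 2) ^ 3 ≤ r * (1 + r ^ 2) ^ 3 := le_mul_of_one_le_left (by positivity) hr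
          linarith
        · exact (abs_re_le_norm _).trans f0
      have d1' : |2 * driftQ' r| ≤ 4 := by rw [abs_mul, abs_two]; linarith
      rw [← add_assoc (iteratedDeriv 3 (profile f) r + driftQ r • iteratedDeriv 2 (profile f) r)]
      refine (norm_add_le _ _).trans ((add_le_add (norm_add_smul_le (norm_add_smul_le
        (norm_add_smul_le f3 f2 d0) f1 d1') f0 d2)
        (c := ‖(nonloc'' (profile f) (iteratedDeriv 1 (profile f)) Y r : ℂ)‖)
        (d := 64 * (C / r ^ 4) + 60 * D / r ^ 3) ?_).trans ?_)
      · rw [norm_real, Real.norm_eq_abs, nonloc'']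
        refine (abs_add_le _ _).trans ?_
        have h1 := i0 _ f1
        have h2 := abs_sub (√8 * invQ'' r * Y r)
          (8 * (1 + 7 * r ^ 2) / (r * (1 + r ^ 2) ^ 3) * (profile f r).re)
        rw [show 3 * (20 / r ^ 3) * D = 60 * D / r ^ 3 by ring] at n0
        linarith
      · linarith
  refine key.trans ?_
  rw [add_div]
  gcongr
  rw [mul_div_assoc]
  gcongr
  omega

theorem exists_lin_profile {f : 𝓢(ℂ, ℂ)} (hf : f ∈ equivSchwartz 0) :
    ∃ y : adaptedH2_1, Represents2 y (lin (profile f) (nonlocInt (profile f))) := by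
  obtain ⟨Φ, hΦ, he⟩ := exists_equivSmooth_lin (equivSmooth_of_mem hf)
  obtain ⟨C, hC⟩ := decay_lin_profile f
  obtain ⟨y, hy⟩ := exists_mem_two hΦ ⟨C, fun k hk r hr => by
    rw [iteratedDeriv_congr_pos he k (by linarith)]; exact hC k hk r hr⟩
  exact ⟨y, hy.congr he⟩

theorem exists_linA_profile {f : 𝓢(ℂ, ℂ)} (hf : f ∈ equivSchwartz 1) :
    ∃ y : adaptedH1_2, Represents1 weightPlus y (linA (profile f)) := by
  obtain ⟨Φ, hΦ, he⟩ := exists_equivSmooth_opA (equivSmooth_of_mem hf)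
  obtain ⟨C, hC⟩ := decay_linA_profile f
  have he' : ∀ r : ℝ, 0 < r → Φ r = linA (profile f) r := he
  obtain ⟨y, hy⟩ := exists_mem_plus hΦ ⟨C, fun k hk r hr => by
    rw [iteratedDeriv_congr_pos he' k (by linarith)]; exact hC k hk r hr⟩
  exact ⟨y, hy.congr he'⟩

/-! ### Norm estimates on smooth profiles -/

theorem sqrt_mul_sq {c a : ℝ} (ha : 0 ≤ a) : √(c * a ^ 2) = √c * a := by
  rw [Real.sqrt_mul' _ (sq_nonneg a), Real.sqrt_sq ha]

theorem ContDiff.measurable_iteratedDeriv {f : ℝ → ℂ} (hf : ContDiff ℝ (⊤ : ℕ∞) f) (n : ℕ) :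
    Measurable (iteratedDeriv n f) := (continuous_iteratedDeriv_of_smooth hf n).measurable

theorem ProfileData.measurable_lin {f : ℝ → ℂ} {Y : ℝ → ℝ} (h : ProfileData f Y) :
    Measurable (lin f Y) :=
  measurable_linL h.smooth.continuous.measurable (ContDiff.measurable_iteratedDeriv h.smooth 1)
    h.smoothY.continuous.measurable

theorem ProfileData.massLE_lin {f : ℝ → ℂ} {Y : ℝ → ℝ} (h : ProfileData f Y) {x : Ambient1}
    (hx : Represents1 weightMinus x f) :
    MassLE (Ioi 0) (fun r => r * ‖lin f Y r‖ ^ 2) (63 * ‖x‖ ^ 2) :=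
  massLE_linL (sq_nonneg _) h.isProfile h.smooth.continuous.measurable
    (ContDiff.measurable_iteratedDeriv h.smooth 1) (hx.mass isWeight_minus).1
    (hx.mass isWeight_minus).2

theorem ProfileData.norm_lin_le {f : ℝ → ℂ} {Y : ℝ → ℝ} (h : ProfileData f Y) {x : Ambient1}
    {y : L2 ℂ} (hx : Represents1 weightMinus x f) (hy : y =ᵐ[radialMeasure] lin f Y) :
    ‖y‖ ≤ 3 * √63 * ‖x‖ := by
  have := norm_le_of_massLE (by positivity) hy (h.massLE_lin hx)
  rwa [sqrt_mul_sq (norm_nonneg _), ← mul_assoc] at this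

/-- Coercivity of `L_Q` for normalized profiles. -/
theorem ProfileData.norm_le_lin {f : ℝ → ℂ} {Y : ℝ → ℝ} (h : ProfileData f Y) (hY : Y 1 = 0)
    (him : (f 1).im = 0) {x : Ambient1} {y : L2 ℂ} (hx : Represents1 weightMinus x f)
    (hy : y =ᵐ[radialMeasure] lin f Y) : ‖x‖ ≤ 12 * √70000 * ‖y‖ := by
  have := hx.norm_le isWeight_minus (by positivity) (massLE_of_linL (sq_nonneg ‖y‖) h.isProfile
    h.smooth.continuous.measurable (ContDiff.measurable_iteratedDeriv h.smooth 1)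
    h.smoothY.continuous.measurable hY him (massLE_norm_sq hy))
  rwa [sqrt_mul_sq (norm_nonneg _), ← mul_assoc] at this

theorem ProfileData.norm_lin_le₃ {f : ℝ → ℂ} {Y : ℝ → ℝ} (h : ProfileData f Y) {x : Ambient3}
    {y : Ambient2} (hx : Represents3 x f) (hy : Represents2 y (lin f Y)) :
    ‖y‖ ≤ 12 * √90000 * ‖x‖ := by
  obtain ⟨m3, m2, m1, m0⟩ := hx.mass
  have hf := h.smooth
  obtain ⟨n2, n1, n0⟩ := massLE_linL₃ (sq_nonneg ‖x‖) h.isProfile hf.continuous.measurable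
    (ContDiff.measurable_iteratedDeriv hf 1) (ContDiff.measurable_iteratedDeriv hf 2)
    (ContDiff.measurable_iteratedDeriv hf 3) h.smoothY.continuous.measurable h.small
    (fun r _ => hasDerivAt_iteratedDeriv hf 1 r) (fun r _ => hasDerivAt_iteratedDeriv hf 2 r)
    (continuous_iteratedDeriv_of_smooth hf 3).continuousOn m3 m2 m1 m0
  have := hy.norm_le (by positivity) ⟨n2.congr fun r hr => by rw [iteratedDeriv_two_lin h hr],
    n1.congr fun r hr => by rw [iteratedDeriv_one_lin h hr], n0⟩
  rwa [sqrt_mul_sq (norm_nonneg _), ← mul_assoc] at this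

theorem ProfileData.norm_le_lin₃ {f : ℝ → ℂ} {Y : ℝ → ℝ} (h : ProfileData f Y) (hY : Y 1 = 0)
    (him : (f 1).im = 0) {x : Ambient3} {y : Ambient2} (hx : Represents3 x f)
    (hy : Represents2 y (lin f Y)) : ‖x‖ ≤ 12 * √(10 ^ 18) * ‖y‖ := by
  obtain ⟨m2, m1, m0⟩ := hy.mass
  have hf := h.smooth
  have := hx.norm_le (by positivity) (massLE_of_linL₃ (sq_nonneg ‖y‖) h.isProfile
    hf.continuous.measurable
    (ContDiff.measurable_iteratedDeriv hf 1) (ContDiff.measurable_iteratedDeriv hf 2)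
    (ContDiff.measurable_iteratedDeriv hf 3) h.smoothY.continuous.measurable h.small
    (fun r _ => hasDerivAt_iteratedDeriv hf 1 r) (fun r _ => hasDerivAt_iteratedDeriv hf 2 r)
    (continuous_iteratedDeriv_of_smooth hf 3).continuousOn hY him
    (m2.congr fun r hr => by rw [iteratedDeriv_two_lin h hr])
    (m1.congr fun r hr => by rw [iteratedDeriv_one_lin h hr]) m0)
  rwa [sqrt_mul_sq (norm_nonneg _), ← mul_assoc] at this

/-- For a profile that vanishes at the origin, `f' - f / r` vanishes there as well. -/
theorem tendsto_iteratedDeriv_one_sub {f : ℝ → ℂ} (hf : ContDiff ℝ (⊤ : ℕ∞) f) (h0 : f 0 = 0) :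
    Tendsto (fun r => iteratedDeriv 1 f r - (1 / r) • f r) (𝓝[>] 0) (𝓝 0) := by
  have h1 := ((continuous_iteratedDeriv_of_smooth hf 1).tendsto 0).mono_left
    (nhdsWithin_le_nhds (s := Ioi 0))
  have h2 := hasDerivAt_iteratedDeriv hf 0 0
  rw [iteratedDeriv_zero] at h2
  have h3 := h2.tendsto_slope.mono_left (nhdsWithin_mono (0 : ℝ) fun r (hr : 0 < r) => hr.ne')
  have := h1.sub h3
  rw [sub_self] at this
  refine this.congr fun r => ?_
  rw [slope_def_module, h0, sub_zero, sub_zero, one_div]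

theorem norm_linA_le {f : ℝ → ℂ} (hf : ContDiff ℝ (⊤ : ℕ∞) f) (h0 : f 0 = 0) {x : Ambient2}
    {y : Ambient1} (hx : Represents2 x f) (hy : Represents1 weightPlus y (linA f)) :
    ‖y‖ ≤ 12 * √54 * ‖x‖ := by
  obtain ⟨m2, -, m0⟩ := hx.mass
  obtain ⟨n1, n0⟩ := massLE_opA (sq_nonneg ‖x‖) hf.continuous.measurable
    (ContDiff.measurable_iteratedDeriv hf 1) (ContDiff.measurable_iteratedDeriv hf 2)
    (fun r _ => by simpa using hasDerivAt_iteratedDeriv hf 0 r)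
    (fun r _ => hasDerivAt_iteratedDeriv hf 1 r)
    (continuous_iteratedDeriv_of_smooth hf 2).continuousOn (tendsto_iteratedDeriv_one_sub hf h0)
    m2 m0
  have := hy.norm_le isWeight_plus (by positivity) ⟨n1.congr fun r hr => by
    rw [iteratedDeriv_one_linA hf hr], n0.mono_right (by linarith [sq_nonneg ‖x‖])⟩
  rwa [sqrt_mul_sq (norm_nonneg _), ← mul_assoc] at this

theorem norm_le_linA {f : ℝ → ℂ} (hf : ContDiff ℝ (⊤ : ℕ∞) f) (h0 : f 0 = 0) (hf1 : f 1 = 0)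
    {x : Ambient2} {y : Ambient1} (hx : Represents2 x f)
    (hy : Represents1 weightPlus y (linA f)) : ‖x‖ ≤ 12 * √10000 * ‖y‖ := by
  obtain ⟨m1, m0⟩ := hy.mass isWeight_plus
  have := hx.norm_le (by positivity) (massLE_of_opA (sq_nonneg ‖y‖) hf.continuous.measurable
    (ContDiff.measurable_iteratedDeriv hf 1) (ContDiff.measurable_iteratedDeriv hf 2)
    (fun r _ => by simpa using hasDerivAt_iteratedDeriv hf 0 r)
    (fun r _ => hasDerivAt_iteratedDeriv hf 1 r)
    (continuous_iteratedDeriv_of_smooth hf 2).continuousOn (tendsto_iteratedDeriv_one_sub hf h0)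
    hf1 (m1.congr fun r hr => by rw [iteratedDeriv_one_linA hf hr]) m0)
  rwa [sqrt_mul_sq (norm_nonneg _), ← mul_assoc] at this

theorem massLE_linAstar {f : ℝ → ℂ} (hf : ContDiff ℝ (⊤ : ℕ∞) f) {x : Ambient1}
    (hx : Represents1 weightPlus x f) :
    MassLE (Ioi 0) (fun r => r * ‖linAstar f r‖ ^ 2) (10 * ‖x‖ ^ 2) :=
  massLE_astar (sq_nonneg _) (ContDiff.measurable_iteratedDeriv hf 1) (hx.mass isWeight_plus).1
    (hx.mass isWeight_plus).2

theorem norm_linAstar_le {f : ℝ → ℂ} (hf : ContDiff ℝ (⊤ : ℕ∞) f) {x : Ambient1} {y : L2 ℂ}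
    (hx : Represents1 weightPlus x f) (hy : y =ᵐ[radialMeasure] linAstar f) :
    ‖y‖ ≤ 3 * √10 * ‖x‖ := by
  have := norm_le_of_massLE (by positivity) hy (massLE_linAstar hf hx)
  rwa [sqrt_mul_sq (norm_nonneg _), ← mul_assoc] at this

theorem norm_le_linAstar {f : ℝ → ℂ} (hf : ContDiff ℝ (⊤ : ℕ∞) f) (h0 : f 0 = 0) {x : Ambient1}
    {y : L2 ℂ} (hx : Represents1 weightPlus x f) (hy : y =ᵐ[radialMeasure] linAstar f) :
    ‖x‖ ≤ 12 * √10 * ‖y‖ := by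
  obtain ⟨n1, n0⟩ := massLE_of_astar (sq_nonneg ‖y‖) hf.continuous.measurable
    (ContDiff.measurable_iteratedDeriv hf 1)
    (fun r _ => by simpa using hasDerivAt_iteratedDeriv hf 0 r)
    (continuous_iteratedDeriv_of_smooth hf 1).continuousOn
    (by have := (hf.continuous.tendsto 0).mono_left (nhdsWithin_le_nhds (s := Ioi 0))
        rwa [h0] at this) (massLE_norm_sq hy)
  have := hx.norm_le isWeight_plus (by positivity) ⟨n1, n0.mono_right (by linarith [sq_nonneg ‖y‖])⟩
  rwa [sqrt_mul_sq (norm_nonneg _), ← mul_assoc] at this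

/-! ### Normalization modulo the kernels -/

theorem ratS_one : ratS 1 = 1 / 2 := by norm_num [ratS]

/-- Modulo the kernel of `L_Q`, a profile has vanishing nonlocal integral and imaginary part at
`r = 1`. -/
theorem ProfileData.exists_normalized {f : ℝ → ℂ} {Y : ℝ → ℝ} (h : ProfileData f Y) :
    ∃ (c₁ c₂ : ℝ) (Z : ℝ → ℝ), ProfileData (f + c₁ • LambdaQ + c₂ • fun r => I * Q r) Z ∧ Z 1 = 0 ∧
      ((f + c₁ • LambdaQ + c₂ • fun r => I * Q r : ℝ → ℂ) 1).im = 0 ∧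
      ∀ r, 0 < r → lin (f + c₁ • LambdaQ + c₂ • fun r => I * Q r) Z r = lin f Y r := by
  refine ⟨-Y 1, -(f 1).im / (√8 / 2), _, (h.add (profileData_LambdaQ.smul _)).add
    (profileData_IQ.smul _), ?_, ?_, fun r hr => ?_⟩
  · simp only [Pi.add_apply, Pi.smul_apply, smul_eq_mul, ratS_one]
    norm_num
  · simp only [Pi.add_apply, Pi.smul_apply, LambdaQ_eq, Q_eq, ratS_one, real_smul]
    simp only [add_im, mul_im, mul_re, ofReal_im, ofReal_re, I_im, I_re]
    field_simp
    ring
  · rw [lin_add (h.add (profileData_LambdaQ.smul _)) (profileData_IQ.smul _),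
      lin_add h (profileData_LambdaQ.smul _), lin_smul, lin_smul]
    simp only [Pi.add_apply, Pi.smul_apply, lin_LambdaQ hr, lin_IQ, smul_zero, add_zero]

/-- The profile `c r Q`. The choices `c = 1` and `c = i` span the kernel of `A_Q` over the reals. -/
def kerA (c : ℂ) (r : ℝ) : ℂ := c * (r * Q r)

theorem kerA_eq (c : ℂ) : kerA c = fun r => c * ((√8 * (r * ratS r) : ℝ) : ℂ) := by
  funext r
  rw [kerA, Q_eq]
  push_cast
  ring

theorem contDiff_kerA (c : ℂ) : ContDiff ℝ (⊤ : ℕ∞) (kerA c) := by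
  rw [kerA_eq]
  exact contDiff_const.mul (ofRealCLM.contDiff.comp
    (contDiff_const.mul (contDiff_id.mul contDiff_ratS)))

theorem linA_kerA (c : ℂ) {r : ℝ} (hr : 0 < r) : linA (kerA c) r = 0 := by
  have hd : iteratedDeriv 1 (kerA c) r = c * ((√8 * ratL r : ℝ) : ℂ) := by
    rw [iteratedDeriv_one, kerA_eq]
    exact ((((hasDerivAt_mul_ratS r).const_mul √8).ofReal_comp).const_mul c).deriv
  have e : (1 / r - 2 * (r * ratS r)) * (√8 * (r * ratS r)) = √8 * ratL r := by
    rw [ratL]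
    field_simp
    linear_combination (-2 * ratS r) * sq_mul_ratS r
  rw [linA, hd, kerA_eq, real_smul, coefA, driftQ_eq, ← e]
  push_cast
  ring

theorem linA_add {f g : ℝ → ℂ} (hf : ContDiff ℝ (⊤ : ℕ∞) f) (hg : ContDiff ℝ (⊤ : ℕ∞) g) (r : ℝ) :
    linA (f + g) r = linA f r + linA g r := by
  simp only [linA, iteratedDeriv_add_smooth hf hg, Pi.add_apply, smul_add]
  abel

theorem linA_smul (c : ℝ) (f : ℝ → ℂ) (r : ℝ) : linA (c • f) r = c • linA f r := by
  simp only [linA, iteratedDeriv_const_smul_field, Pi.smul_apply, smul_sub]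
  rw [smul_comm]

theorem linAstar_add {f g : ℝ → ℂ} (hf : ContDiff ℝ (⊤ : ℕ∞) f) (hg : ContDiff ℝ (⊤ : ℕ∞) g)
    (r : ℝ) : linAstar (f + g) r = linAstar f r + linAstar g r := by
  simp only [linAstar, iteratedDeriv_add_smooth hf hg, Pi.add_apply, smul_add]
  abel

theorem linAstar_smul (c : ℝ) (f : ℝ → ℂ) (r : ℝ) : linAstar (c • f) r = c • linAstar f r := by
  simp only [linAstar, iteratedDeriv_const_smul_field, Pi.smul_apply, smul_sub, smul_neg]
  rw [smul_comm]

/-! ### The bounded extensions and their coercivity -/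

theorem contDiff_profile (f : 𝓢(ℂ, ℂ)) : ContDiff ℝ (⊤ : ℕ∞) (profile f) :=
  contDiff_infty.2 (profile_contDiff f)

theorem profile_zero_of_mem {m : ℕ} (hm : m ≠ 0) {f : 𝓢(ℂ, ℂ)} (hf : f ∈ equivSchwartz m) :
    profile f 0 = 0 := by
  have := (equivSmooth_of_mem hf).zero hm
  rwa [iteratedDeriv_zero] at this

/-- `L_Q` from the first order space of index `0` to `L²`. -/
theorem exists_linL_extension :
    ∃ T : adaptedH1_0 →L[ℝ] L2 ℂ,
      (∀ f ∈ equivSchwartz 0, ∃ v : adaptedH1_0, Represents1 weightMinus v (profile f) ∧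
        T v =ᵐ[radialMeasure] opL Q (profile f)) ∧
      (∃ C : ℝ, 0 < C ∧ ∀ v : adaptedH1_0, ‖T v‖ ≤ C * ‖v‖) ∧
      ∃ e₁ e₂ : adaptedH1_0, Represents1 weightMinus e₁ LambdaQ ∧
        Represents1 weightMinus e₂ (fun r => I * Q r) ∧
        ∀ ψ₁ ψ₂ : adaptedH1_0 →L[ℝ] ℝ, Matrix.det !![ψ₁ e₁, ψ₁ e₂; ψ₂ e₁, ψ₂ e₂] ≠ 0 →
          ∃ C : ℝ, 0 < C ∧ ∀ v : adaptedH1_0, ψ₁ v = 0 → ψ₂ v = 0 → ‖v‖ ≤ C * ‖T v‖ := by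
  have hdom : ∀ f : 𝓢(ℂ, ℂ), ∀ x : Ambient1, Represents1 weightMinus x (profile f) →
      ∃ y : L2 ℂ, y =ᵐ[radialMeasure] lin (profile f) (nonlocInt (profile f)) := fun f x hx =>
    have h := profileData_nonlocInt (contDiff_profile f)
    exists_L2 h.measurable_lin.stronglyMeasurable (h.massLE_lin hx)
  obtain ⟨T, hT, hb⟩ := exists_extension (schwartzTuples1 0 weightMinus)
    (fun (x : Ambient1) (y : L2 ℂ) => ∃ f Y, ProfileData f Y ∧ Represents1 weightMinus x f ∧
      y =ᵐ[radialMeasure] lin f Y) (3 * √63)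
    (by rintro x y ⟨f, Y, h, hx, hy⟩; exact h.norm_lin_le hx hy)
    (by
      rintro x y x' y' ⟨f, Y, h, hx, hy⟩ ⟨f', Y', h', hx', hy'⟩
      refine ⟨f + f', Y + Y', h.add h', hx.add hx' h.smooth.smoothPos h'.smooth.smoothPos, ?_⟩
      rw [lin_add h h']
      exact (Lp.coeFn_add y y').trans (hy.add hy'))
    (by
      rintro c x y ⟨f, Y, h, hx, hy⟩
      refine ⟨c • f, c • Y, h.smul c, hx.smul c, ?_⟩
      rw [lin_smul]
      exact (Lp.coeFn_smul c y).trans (hy.const_smul c))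
    (by
      rintro x ⟨f, hf, hx⟩
      obtain ⟨y, hy⟩ := hdom f x hx
      exact ⟨y, _, _, profileData_nonlocInt (contDiff_profile f), hx, hy⟩)
  refine ⟨T, fun f hf => ?_, ⟨3 * √63, by positivity, hb⟩, ?_⟩
  · obtain ⟨v, hv⟩ := exists_mem_minus (equivSmooth_of_mem hf) (decay_profile f (by norm_num))
    obtain ⟨y, hy⟩ := hdom f v hv
    refine ⟨v, hv, (congrArg (fun z : L2 ℂ => z =ᵐ[radialMeasure] opL Q (profile f))
      (hT v y ⟨f, hf, hv⟩ ⟨_, _, profileData_nonlocInt (contDiff_profile f), hv, hy⟩)).mpr ?_⟩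
    exact hy.trans (ae_radialMeasure_of_forall fun r hr => (opL_eq _ hr).symm)
  · obtain ⟨e₁, he₁⟩ := exists_ratL_minus
    obtain ⟨e₂, he₂⟩ := exists_ratS_minus
    refine ⟨e₁, e₂, he₁, he₂, coercive_of_mod_span (schwartzTuples1 0 weightMinus) T e₁ e₂
      (K := 12 * √70000) (by positivity) ?_⟩
    rintro v ⟨f, hf, hv⟩
    have hp := profileData_nonlocInt (contDiff_profile f)
    obtain ⟨y, hy⟩ := hdom f v hv
    rw [hT v y ⟨f, hf, hv⟩ ⟨_, _, hp, hv, hy⟩]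
    obtain ⟨c₁, c₂, Z, hZ, hZ1, him, he⟩ := hp.exists_normalized
    refine ⟨c₁, c₂, hZ.norm_le_lin hZ1 him ((hv.add (he₁.smul c₁) hp.smooth.smoothPos
      (profileData_LambdaQ.smooth.smoothPos.smul c₁)).add (he₂.smul c₂)
      (hp.add (profileData_LambdaQ.smul c₁)).smooth.smoothPos
      (profileData_IQ.smooth.smoothPos.smul c₂)) ?_⟩
    exact hy.trans (ae_radialMeasure_of_forall fun r hr => (he r hr).symm)

instance completeSpace_adaptedH2_1 : CompleteSpace adaptedH2_1 :=
  (Submodule.isClosed_topologicalClosure (schwartzTuples2 1)).completeSpace_coe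

instance completeSpace_adaptedH1_2 : CompleteSpace adaptedH1_2 :=
  (Submodule.isClosed_topologicalClosure (schwartzTuples1 2 weightPlus)).completeSpace_coe

/-- `L_Q` from the third order space of index `0` to the second order space of index `1`. -/
theorem exists_linL_extension₃ :
    ∃ T : adaptedH3_0 →L[ℝ] adaptedH2_1,
      (∀ f ∈ equivSchwartz 0, ∃ v : adaptedH3_0, Represents3 v (profile f) ∧
        Represents2 (T v) (opL Q (profile f))) ∧
      (∃ C : ℝ, 0 < C ∧ ∀ v : adaptedH3_0, ‖T v‖ ≤ C * ‖v‖) ∧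
      ∃ e₁ e₂ : adaptedH3_0, Represents3 e₁ LambdaQ ∧ Represents3 e₂ (fun r => I * Q r) ∧
        ∀ ψ₁ ψ₂ : adaptedH3_0 →L[ℝ] ℝ, Matrix.det !![ψ₁ e₁, ψ₁ e₂; ψ₂ e₁, ψ₂ e₂] ≠ 0 →
          ∃ C : ℝ, 0 < C ∧ ∀ v : adaptedH3_0, ψ₁ v = 0 → ψ₂ v = 0 → ‖v‖ ≤ C * ‖T v‖ := by
  obtain ⟨T, hT, hb⟩ := exists_extension (schwartzTuples3 0)
    (fun (x : Ambient3) (y : adaptedH2_1) => ∃ f Y, ProfileData f Y ∧ Represents3 x f ∧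
      Represents2 y (lin f Y)) (12 * √90000)
    (by rintro x y ⟨f, Y, h, hx, hy⟩; exact h.norm_lin_le₃ hx hy)
    (by
      rintro x y x' y' ⟨f, Y, h, hx, hy⟩ ⟨f', Y', h', hx', hy'⟩
      refine ⟨f + f', Y + Y', h.add h', hx.add hx' h.smooth.smoothPos h'.smooth.smoothPos, ?_⟩
      rw [lin_add h h']
      exact hy.add hy' h.smoothPos_lin h'.smoothPos_lin)
    (by
      rintro c x y ⟨f, Y, h, hx, hy⟩
      refine ⟨c • f, c • Y, h.smul c, hx.smul c, ?_⟩
      rw [lin_smul]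
      exact hy.smul c)
    (by
      rintro x ⟨f, hf, hx⟩
      obtain ⟨y, hy⟩ := exists_lin_profile hf
      exact ⟨y, _, _, profileData_nonlocInt (contDiff_profile f), hx, hy⟩)
  refine ⟨T, fun f hf => ?_, ⟨12 * √90000, by positivity, hb⟩, ?_⟩
  · obtain ⟨v, hv⟩ := exists_mem_three (equivSmooth_of_mem hf) (decay_profile f le_rfl)
    obtain ⟨y, hy⟩ := exists_lin_profile hf
    refine ⟨v, hv, (congrArg (fun z : adaptedH2_1 => Represents2 z (opL Q (profile f)))
      (hT v y ⟨f, hf, hv⟩ ⟨_, _, profileData_nonlocInt (contDiff_profile f), hv, hy⟩)).mpr ?_⟩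
    exact hy.congr fun r hr => (opL_eq _ hr).symm
  · obtain ⟨e₁, he₁⟩ := exists_ratL_three
    obtain ⟨e₂, he₂⟩ := exists_ratS_three
    refine ⟨e₁, e₂, he₁, he₂, coercive_of_mod_span (schwartzTuples3 0) T e₁ e₂
      (K := 12 * √(10 ^ 18)) (by positivity) ?_⟩
    rintro v ⟨f, hf, hv⟩
    have hp := profileData_nonlocInt (contDiff_profile f)
    obtain ⟨y, hy⟩ := exists_lin_profile hf
    rw [hT v y ⟨f, hf, hv⟩ ⟨_, _, hp, hv, hy⟩]
    obtain ⟨c₁, c₂, Z, hZ, hZ1, him, he⟩ := hp.exists_normalized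
    exact ⟨c₁, c₂, hZ.norm_le_lin₃ hZ1 him ((hv.add (he₁.smul c₁) hp.smooth.smoothPos
      (profileData_LambdaQ.smooth.smoothPos.smul c₁)).add (he₂.smul c₂)
      (hp.add (profileData_LambdaQ.smul c₁)).smooth.smoothPos
      (profileData_IQ.smooth.smoothPos.smul c₂)) (hy.congr fun r hr => (he r hr).symm)⟩

/-- `A_Q` from the second order space of index `1` to the first order space of index `2`. -/
theorem exists_opA_extension :
    ∃ T : adaptedH2_1 →L[ℝ] adaptedH1_2,
      (∀ f ∈ equivSchwartz 1, ∃ v : adaptedH2_1, Represents2 v (profile f) ∧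
        Represents1 weightPlus (T v) (opA Q (profile f))) ∧
      (∃ C : ℝ, 0 < C ∧ ∀ v : adaptedH2_1, ‖T v‖ ≤ C * ‖v‖) ∧
      ∃ e₁ e₂ : adaptedH2_1, Represents2 e₁ (fun r => r * Q r) ∧
        Represents2 e₂ (fun r => I * (r * Q r)) ∧
        ∀ ψ₁ ψ₂ : adaptedH2_1 →L[ℝ] ℝ, Matrix.det !![ψ₁ e₁, ψ₁ e₂; ψ₂ e₁, ψ₂ e₂] ≠ 0 →
          ∃ C : ℝ, 0 < C ∧ ∀ v : adaptedH2_1, ψ₁ v = 0 → ψ₂ v = 0 → ‖v‖ ≤ C * ‖T v‖ := by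
  obtain ⟨T, hT, hb⟩ := exists_extension (schwartzTuples2 1)
    (fun (x : Ambient2) (y : adaptedH1_2) => ∃ f, ContDiff ℝ (⊤ : ℕ∞) f ∧ f 0 = 0 ∧
      Represents2 x f ∧ Represents1 weightPlus y (linA f)) (12 * √54)
    (by rintro x y ⟨f, h, h0, hx, hy⟩; exact norm_linA_le h h0 hx hy)
    (by
      rintro x y x' y' ⟨f, h, h0, hx, hy⟩ ⟨f', h', h0', hx', hy'⟩
      refine ⟨f + f', h.add h', by rw [Pi.add_apply, h0, h0', add_zero],
        hx.add hx' h.smoothPos h'.smoothPos, ?_⟩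
      exact (hy.add hy' (smoothPos_linA h) (smoothPos_linA h')).congr fun r _ =>
        (linA_add h h' r).symm)
    (by
      rintro c x y ⟨f, h, h0, hx, hy⟩
      exact ⟨c • f, contDiff_const.smul h, by rw [Pi.smul_apply, h0, smul_zero], hx.smul c,
        (hy.smul c).congr fun r _ => (linA_smul c f r).symm⟩)
    (by
      rintro x ⟨f, hf, hx⟩
      obtain ⟨y, hy⟩ := exists_linA_profile hf
      exact ⟨y, _, contDiff_profile f, profile_zero_of_mem one_ne_zero hf, hx, hy⟩)
  refine ⟨T, fun f hf => ?_, ⟨12 * √54, by positivity, hb⟩, ?_⟩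
  · obtain ⟨v, hv⟩ := exists_mem_two (equivSmooth_of_mem hf) (decay_profile f (by norm_num))
    obtain ⟨y, hy⟩ := exists_linA_profile hf
    refine ⟨v, hv, (congrArg (fun z : adaptedH1_2 => Represents1 weightPlus z (opA Q (profile f)))
      (hT v y ⟨f, hf, hv⟩
        ⟨_, contDiff_profile f, profile_zero_of_mem one_ne_zero hf, hv, hy⟩)).mpr ?_⟩
    exact hy.congr fun r hr => (opA_eq _ hr).symm
  · obtain ⟨e₁, he₁⟩ := exists_mul_ratS_two 1
    obtain ⟨e₂, he₂⟩ := exists_mul_ratS_two I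
    have he₁' : Represents2 e₁ (kerA 1) := he₁
    have he₂' : Represents2 e₂ (kerA I) := he₂
    refine ⟨e₁, e₂, he₁.congr fun r _ => one_mul _, he₂,
      coercive_of_mod_span (schwartzTuples2 1) T e₁ e₂ (K := 12 * √10000) (by positivity) ?_⟩
    rintro v ⟨f, hf, hv⟩
    have h := contDiff_profile f
    have h0 := profile_zero_of_mem one_ne_zero hf
    obtain ⟨y, hy⟩ := exists_linA_profile hf
    rw [hT v y ⟨f, hf, hv⟩ ⟨_, h, h0, hv, hy⟩]
    -- the multiple of `r Q` that makes the profile vanish at `r = 1`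
    set c₁ : ℝ := -(profile f 1).re / (√8 / 2)
    set c₂ : ℝ := -(profile f 1).im / (√8 / 2)
    have k₁ : ContDiff ℝ (⊤ : ℕ∞) (c₁ • kerA 1) := contDiff_const.smul (contDiff_kerA 1)
    have k₂ : ContDiff ℝ (⊤ : ℕ∞) (c₂ • kerA I) := contDiff_const.smul (contDiff_kerA I)
    refine ⟨c₁, c₂, norm_le_linA (f := profile f + c₁ • kerA 1 + c₂ • kerA I) ((h.add k₁).add k₂) ?_ ?_ ((hv.add (he₁'.smul c₁) h.smoothPos
      k₁.smoothPos).add (he₂'.smul c₂) (h.add k₁).smoothPos k₂.smoothPos)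
      (hy.congr fun r hr => ?_)⟩
    · simp [h0, kerA]
    · have e : ((√8 : ℝ) : ℂ) ≠ 0 := by
        rw [Ne, ofReal_eq_zero]; positivity
      simp only [Pi.add_apply, Pi.smul_apply, kerA_eq, ratS_one, real_smul, c₁, c₂]
      push_cast
      field_simp
      linear_combination -re_add_im (profile f 1)
    · have k₁' := linA_smul c₁ (kerA 1) r
      have k₂' := linA_smul c₂ (kerA I) r
      rw [linA_kerA _ hr, smul_zero] at k₁' k₂'
      have h₁ : ContDiff ℝ (⊤ : ℕ∞) (profile f + c₁ • kerA 1) := h.add k₁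
      rw [linA_add h₁ k₂, linA_add h k₁, k₁', k₂', add_zero, add_zero]

/-- `A_Q^*` from the first order space of index `2` to `L²`: it has no kernel, so the bound on the dense
set of Schwartz functions extends to the whole space. -/
theorem exists_opAstar_extension :
    ∃ T : adaptedH1_2 →L[ℝ] L2 ℂ,
      (∀ f ∈ equivSchwartz 2, ∃ v : adaptedH1_2, Represents1 weightPlus v (profile f) ∧
        T v =ᵐ[radialMeasure] opAstar Q (profile f)) ∧
      ∃ c C : ℝ, 0 < c ∧ 0 < C ∧
        ∀ v : adaptedH1_2, c * ‖v‖ ≤ ‖T v‖ ∧ ‖T v‖ ≤ C * ‖v‖ := by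
  have hm : ∀ f : 𝓢(ℂ, ℂ), Measurable (linAstar (profile f)) := fun f =>
    (ContDiff.measurable_iteratedDeriv (contDiff_profile f) 1).neg.sub
      ((by unfold coefAstar; fun_prop : Measurable coefAstar).smul (contDiff_profile f).continuous.measurable)
  have hdom : ∀ f : 𝓢(ℂ, ℂ), ∀ x : Ambient1, Represents1 weightPlus x (profile f) →
      ∃ y : L2 ℂ, y =ᵐ[radialMeasure] linAstar (profile f) := fun f x hx =>
    exists_L2 (hm f).stronglyMeasurable (massLE_linAstar (contDiff_profile f) hx)
  obtain ⟨T, hT, hb⟩ := exists_extension (schwartzTuples1 2 weightPlus)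
    (fun (x : Ambient1) (y : L2 ℂ) => ∃ f, ContDiff ℝ (⊤ : ℕ∞) f ∧ Represents1 weightPlus x f ∧
      y =ᵐ[radialMeasure] linAstar f) (3 * √10)
    (by rintro x y ⟨f, h, hx, hy⟩; exact norm_linAstar_le h hx hy)
    (by
      rintro x y x' y' ⟨f, h, hx, hy⟩ ⟨f', h', hx', hy'⟩
      refine ⟨f + f', h.add h', hx.add hx' h.smoothPos h'.smoothPos, ?_⟩
      rw [show linAstar (f + f') = linAstar f + linAstar f' from funext (linAstar_add h h')]
      exact (Lp.coeFn_add y y').trans (hy.add hy'))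
    (by
      rintro c x y ⟨f, h, hx, hy⟩
      refine ⟨c • f, contDiff_const.smul h, hx.smul c, ?_⟩
      rw [show linAstar (c • f) = c • linAstar f from funext (linAstar_smul c f)]
      exact (Lp.coeFn_smul c y).trans (hy.const_smul c))
    (by
      rintro x ⟨f, hf, hx⟩
      obtain ⟨y, hy⟩ := hdom f x hx
      exact ⟨y, _, contDiff_profile f, hx, hy⟩)
  have low : ∀ v : adaptedH1_2, ‖v‖ ≤ 12 * √10 * ‖T v‖ := by
    intro v
    have hcl : IsClosed {v : adaptedH1_2 | ‖v‖ ≤ 12 * √10 * ‖T v‖} :=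
      isClosed_le continuous_norm (continuous_const.mul T.continuous.norm)
    refine closure_minimal (s := {v : adaptedH1_2 | (v : Ambient1) ∈ schwartzTuples1 2 weightPlus})
      ?_ hcl ?_
    · rintro w ⟨f, hf, hw⟩
      obtain ⟨y, hy⟩ := hdom f w hw
      rw [mem_ofPred_eq, hT w y ⟨f, hf, hw⟩ ⟨_, contDiff_profile f, hw, hy⟩]
      exact norm_le_linAstar (contDiff_profile f) (profile_zero_of_mem two_ne_zero hf) hw hy
    · rw [closure_subtype]
      refine closure_mono (fun x hx => ?_) v.2
      exact ⟨⟨x, (schwartzTuples1 2 weightPlus).le_topologicalClosure hx⟩, hx, rfl⟩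
  refine ⟨T, fun f hf => ?_, (12 * √10)⁻¹, 3 * √10, by positivity, by positivity, fun v =>
    ⟨(inv_mul_le_iff₀ (by positivity)).2 (low v), hb v⟩⟩
  obtain ⟨v, hv⟩ := exists_mem_plus (equivSmooth_of_mem hf) (decay_profile f (by norm_num))
  obtain ⟨y, hy⟩ := hdom f v hv
  refine ⟨v, hv, (congrArg (fun z : L2 ℂ => z =ᵐ[radialMeasure] opAstar Q (profile f))
    (hT v y ⟨f, hf, hv⟩ ⟨_, contDiff_profile f, hv, hy⟩)).mpr ?_⟩
  exact hy.trans (ae_radialMeasure_of_forall fun r hr => (opAstar_eq _ hr).symm)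

end CSS

end

theorem proposition3p5 :
    -- coercivity of `L_Q` from the first order space of index 0 to `L²`
    (∃ T : CSS.adaptedH1_0 →L[ℝ] CSS.L2 ℂ,
      (∀ f ∈ CSS.equivSchwartz 0, ∃ v : CSS.adaptedH1_0,
        CSS.Represents1 CSS.weightMinus v (CSS.profile f) ∧
        T v =ᵐ[CSS.radialMeasure] CSS.opL CSS.Q (CSS.profile f)) ∧
      (∃ C : ℝ, 0 < C ∧ ∀ v : CSS.adaptedH1_0, ‖T v‖ ≤ C * ‖v‖) ∧
      ∃ e₁ e₂ : CSS.adaptedH1_0,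
        CSS.Represents1 CSS.weightMinus e₁ CSS.LambdaQ ∧
        CSS.Represents1 CSS.weightMinus e₂ (fun r => Complex.I * CSS.Q r) ∧
        ∀ ψ₁ ψ₂ : CSS.adaptedH1_0 →L[ℝ] ℝ,
          Matrix.det !![ψ₁ e₁, ψ₁ e₂; ψ₂ e₁, ψ₂ e₂] ≠ 0 →
          ∃ C : ℝ, 0 < C ∧ ∀ v : CSS.adaptedH1_0, ψ₁ v = 0 → ψ₂ v = 0 → ‖v‖ ≤ C * ‖T v‖) ∧
    -- coercivity of `L_Q` from the third order space of index 0 to the second order space of index 1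
    (∃ T : CSS.adaptedH3_0 →L[ℝ] CSS.adaptedH2_1,
      (∀ f ∈ CSS.equivSchwartz 0, ∃ v : CSS.adaptedH3_0,
        CSS.Represents3 v (CSS.profile f) ∧
        CSS.Represents2 (T v) (CSS.opL CSS.Q (CSS.profile f))) ∧
      (∃ C : ℝ, 0 < C ∧ ∀ v : CSS.adaptedH3_0, ‖T v‖ ≤ C * ‖v‖) ∧
      ∃ e₁ e₂ : CSS.adaptedH3_0,
        CSS.Represents3 e₁ CSS.LambdaQ ∧
        CSS.Represents3 e₂ (fun r => Complex.I * CSS.Q r) ∧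
        ∀ ψ₁ ψ₂ : CSS.adaptedH3_0 →L[ℝ] ℝ,
          Matrix.det !![ψ₁ e₁, ψ₁ e₂; ψ₂ e₁, ψ₂ e₂] ≠ 0 →
          ∃ C : ℝ, 0 < C ∧ ∀ v : CSS.adaptedH3_0, ψ₁ v = 0 → ψ₂ v = 0 → ‖v‖ ≤ C * ‖T v‖) ∧
    -- coercivity of `A_Q` from the second order space of index 1 to the first order space of index 2
    (∃ T : CSS.adaptedH2_1 →L[ℝ] CSS.adaptedH1_2,
      (∀ f ∈ CSS.equivSchwartz 1, ∃ v : CSS.adaptedH2_1,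
        CSS.Represents2 v (CSS.profile f) ∧
        CSS.Represents1 CSS.weightPlus (T v) (CSS.opA CSS.Q (CSS.profile f))) ∧
      (∃ C : ℝ, 0 < C ∧ ∀ v : CSS.adaptedH2_1, ‖T v‖ ≤ C * ‖v‖) ∧
      ∃ e₁ e₂ : CSS.adaptedH2_1,
        CSS.Represents2 e₁ (fun r => r * CSS.Q r) ∧
        CSS.Represents2 e₂ (fun r => Complex.I * (r * CSS.Q r)) ∧
        ∀ ψ₁ ψ₂ : CSS.adaptedH2_1 →L[ℝ] ℝ,
          Matrix.det !![ψ₁ e₁, ψ₁ e₂; ψ₂ e₁, ψ₂ e₂] ≠ 0 →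
          ∃ C : ℝ, 0 < C ∧ ∀ v : CSS.adaptedH2_1, ψ₁ v = 0 → ψ₂ v = 0 → ‖v‖ ≤ C * ‖T v‖) ∧
    -- unconditional coercivity of the adjoint of `A_Q` on the first order space of index 2
    (∃ T : CSS.adaptedH1_2 →L[ℝ] CSS.L2 ℂ,
      (∀ f ∈ CSS.equivSchwartz 2, ∃ v : CSS.adaptedH1_2,
        CSS.Represents1 CSS.weightPlus v (CSS.profile f) ∧
        T v =ᵐ[CSS.radialMeasure] CSS.opAstar CSS.Q (CSS.profile f)) ∧
      ∃ c C : ℝ, 0 < c ∧ 0 < C ∧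
        ∀ v : CSS.adaptedH1_2, c * ‖v‖ ≤ ‖T v‖ ∧ ‖T v‖ ≤ C * ‖v‖) :=
  ⟨CSS.exists_linL_extension, CSS.exists_linL_extension₃, CSS.exists_opA_extension,
    CSS.exists_opAstar_extension⟩
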